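/- For each index $\kappa\in\mathbb N$ let $m_1,\dots,m_l\ge 1$ be integers, $K_i=\mathbb{Q}(\zeta_{m_i})$, $K=\bigotimes_{i=1}^{l}K_i$ (over $\mathbb Q$), $R=\bigotimes_{i=1}^{l}\mathcal{O}_{K_i}$ (over $\mathbb Z$) and $n=\prod_i\varphi(m_i)$, and let $q$ be a prime with $q\equiv 1\pmod{m_i}$ for all $i$ and $\alpha>0$ a real number; all these depend on $\kappa$. Suppose that $n\to\infty$ as $\kappa\to\infty$ and that $q$ is bounded by a polynomial in $n$. "Negligible" means eventually smaller than $n^{-c}$ for every $c$. The $n$ embeddings $\sigma_j:K\to\mathbb C$ are the tensor products of the embeddings of the $K_i$. They identify $K_{\mathbb R}=K\otimes_{\mathbb Q}\mathbb R$ with the Euclidean space $H=\{x\in\mathbb{C}^n: x_{\bar\jmath}=\overline{x_j}\}$. Put $\mathrm{Tr}=\sum_j\sigma_j$, $R^\vee=\{x\in K:\mathrm{Tr}(xR)\subseteq\mathbb Z\}$, $R_q=R/qR$, $R_q^\vee=R^\vee/qR^\vee$ and $\mathbb T=K_{\mathbb R}/R^\vee$. Let $D_\alpha$ be the spherical Gaussian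 on $H$ with density $\alpha^{-n}\exp(-\pi\|x\|^2/\alpha^2)$, and for $s\in R_q^\vee$ let $A_{s,D_\alpha}$ be the distribution on $R_q\times\mathbb T$ of $(a,\ (a\cdot s)/q+e \bmod R^\vee)$ with $a\in R_q$ uniform and $e\leftarrow D_\alpha$ independent. For a lattice $\Lambda\subset H$ with dual $\Lambda^*$, the smoothing parameter $\eta_\epsilon(\Lambda)$ is the smallest $r>0$ with $\sum_{x\in\Lambda^*\setminus\{0\}}\exp(-\pi r^2\|x\|^2)\le\epsilon$. Assume $\alpha q\ge\eta_\epsilon(R^\vee)$ for some negligible $\epsilon=\epsilon(\kappa)>0$. Then there is a randomized polynomial-time reduction from the search problem $m\text{-RLWE}_{q,D_\alpha}$ (given arbitrarily many independent samples from $A_{s,D_\alpha}$ for an arbitrary $s\in R_q^\vee$, find $s$) to the average-case decision problem $m\text{-R-DLWE}_{q,D_\alpha}$ (distinguish, with non-negligible advantage, independent samples from $A_{s,D_\alpha}$ for one uniformly random $s\in R_q^\vee$ from the same number of uniform samples of $R_q\times\mathbb T$). Precisely: there is one randomized program $M$, with access to samples from $A_{s,D_\alpha}$ and to an oracle, which is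 given $m_1,\dots,m_l$, $q$ and positive integers $k$ and $L$, such that 1. for all oracles and all random outcomes $M$ halts after a number of steps bounded by a polynomial in $n+l+k+L$ (real numbers modulo $1$ are stored exactly, and may only be added, multiplied by integers and shifted by rational numbers); 2. for all $k=k(\kappa)$ and $L=L(\kappa)$ bounded by polynomials in $n$ there is a negligible $\nu$ such that for every $\kappa$, every randomized distinguisher that reads $L$ samples and has advantage at least $1/k$ in the decision problem at $\kappa$, and every $s\in R_q^\vee$, the program $M$ with samples from $A_{s,D_\alpha}$ and with this distinguisher as its oracle outputs $s$ except with probability at most $\nu(\kappa)$. The error in both problems is the same fixed distribution $D_\alpha$, and the number $L$ of samples used by the distinguisher may be any polynomial in $n$. -/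

import Mathlib

open MeasureTheory ProbabilityTheory NumberField
open scoped TensorProduct Pointwise ENNReal

noncomputable section

namespace MRLWE

/-! ### Parameters, the tensor of cyclotomic fields, its ring and its embeddings -/

/-- The parameters of one instance: the conductors `m 0, …, m (l - 1)` of the cyclotomic fields,
the modulus `q` and the parameter `α` of the spherical Gaussian error. -/
structure Params where
  l : ℕ
  m : Fin l → ℕ
  m_pos : ∀ i, 0 < m i
  q : ℕ
  two_le_q : 2 ≤ q
  α : ℝ
  α_pos : 0 < α

variable (P : Params)

instance (i : Fin P.l) : NeZero (P.m i) := ⟨(P.m_pos i).ne'⟩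

instance : NeZero P.q := ⟨by have := P.two_le_q; omega⟩

/-- The degree `n = ∏ φ(mᵢ)`. -/
abbrev Params.n : ℕ := ∏ i, Nat.totient (P.m i)

/-- The `i`-th cyclotomic field `Kᵢ = ℚ(ζ_{mᵢ})`. -/
abbrev CycField (i : Fin P.l) : Type := CyclotomicField (P.m i) ℚ

instance (i : Fin P.l) : IsCyclotomicExtension {P.m i} ℚ (CycField P i) := by
  have h : (DivisionRing.toRatAlgebra : Algebra ℚ (CycField P i)) = CyclotomicField.algebra _ _ :=
    Subsingleton.elim _ _
  rw [h]
  infer_instance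

/-- The tensor of number fields `K = ⨂_ℚ Kᵢ`. -/
def KT : Type := ⨂[ℚ] i, CycField P i

instance : CommRing (KT P) := inferInstanceAs (CommRing (⨂[ℚ] i, CycField P i))

instance : Algebra ℚ (KT P) := inferInstanceAs (Algebra ℚ (⨂[ℚ] i, CycField P i))

/-- Pure tensors in `K`. -/
def KT.tprod : MultilinearMap ℚ (CycField P) (KT P) :=
  (PiTensorProduct.tprod ℚ : MultilinearMap ℚ (CycField P) (⨂[ℚ] i, CycField P i))

/-- The tensor of the rings of integers `R = ⨂_ℤ 𝓞(Kᵢ)`. -/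
def R : Type := ⨂[ℤ] i, 𝓞 (CycField P i)

instance : CommRing (R P) := inferInstanceAs (CommRing (⨂[ℤ] i, 𝓞 (CycField P i)))

/-- Pure tensors in `R`. -/
def R.tprod (x : ∀ i, 𝓞 (CycField P i)) : R P :=
  (PiTensorProduct.tprod ℤ x : ⨂[ℤ] i, 𝓞 (CycField P i))

theorem KT.one_eq : (1 : KT P) = KT.tprod P 1 := rfl

theorem KT.tprod_mul (x y : ∀ i, CycField P i) :
    KT.tprod P (x * y) = KT.tprod P x * KT.tprod P y :=
  (PiTensorProduct.tprod_mul_tprod x y).symm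

/-- The pure tensors of integers, as a `ℤ`-multilinear map into `K`. -/
def intTensor : MultilinearMap ℤ (fun i => 𝓞 (CycField P i)) (KT P) where
  toFun x := KT.tprod P fun i => (x i : CycField P i)
  map_update_add' := by
    intro inst x i a b
    have h (c : 𝓞 (CycField P i)) :
        (fun k => (Function.update x i c k : CycField P k)) =
          Function.update (fun k => (x k : CycField P k)) i (c : CycField P i) := by
      funext k
      by_cases hk : k = i
      · subst hk; simp
      · simp [hk]
    simp only [h, map_add]
    exact (KT.tprod P).map_update_add _ _ _ _
  map_update_smul' := by
    intro inst x i a b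
    have h (c : 𝓞 (CycField P i)) :
        (fun k => (Function.update x i c k : CycField P k)) =
          Function.update (fun k => (x k : CycField P k)) i (c : CycField P i) := by
      funext k
      by_cases hk : k = i
      · subst hk; simp
      · simp [hk]
    have h2 : ((a • b : 𝓞 (CycField P i)) : CycField P i) = a • (b : CycField P i) :=
      map_zsmul (algebraMap (𝓞 (CycField P i)) (CycField P i)) a b
    simp only [h, h2]
    exact map_zsmul ((KT.tprod P).toLinearMap (fun k => (x k : CycField P k)) i) a
      (b : CycField P i)

/-- The natural ring homomorphism `R → K`. -/
def toKT : R P →+* KT P :=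
  (PiTensorProduct.liftAlgHom (R := ℤ) (intTensor P)
    (by
      change KT.tprod P _ = _
      rw [KT.one_eq]
      congr 1)
    (by
      intro x y
      change KT.tprod P _ = KT.tprod P _ * KT.tprod P _
      rw [← KT.tprod_mul]
      congr 1)).toRingHom

instance : Algebra (R P) (KT P) := (toKT P).toAlgebra

/-- The index set of the `n` embeddings of `K`: tuples of embeddings of the fields `Kᵢ`. -/
abbrev Emb : Type := ∀ i, CycField P i →ₐ[ℚ] ℂ

/-- The embedding `σ_j : K → ℂ`, `⊗ aᵢ ↦ ∏ jᵢ(aᵢ)`. -/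
def σ (j : Emb P) : KT P →ₐ[ℚ] ℂ :=
  (PiTensorProduct.liftAlgHom
    ((MultilinearMap.mkPiAlgebra ℚ (Fin P.l) ℂ).compLinearMap fun i => (j i).toLinearMap)
    (by simp) (by intro x y; simp [Finset.prod_mul_distrib]) :
    (⨂[ℚ] i, CycField P i) →ₐ[ℚ] ℂ)

theorem σ_tprod (j : Emb P) (x : ∀ i, CycField P i) :
    σ P j (KT.tprod P x) = ∏ i, j i (x i) := by
  change PiTensorProduct.lift _ (PiTensorProduct.tprod ℚ x) = _
  simp

/-- The complex conjugate of an embedding. -/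
def conjEmb (j : Emb P) : Emb P := fun i =>
  (Complex.conjAe.toAlgHom.restrictScalars ℚ).comp (j i)

theorem σ_conjEmb (j : Emb P) (x : KT P) : σ P (conjEmb P j) x = star (σ P j x) := by
  have : σ P (conjEmb P j) = (Complex.conjAe.toAlgHom.restrictScalars ℚ).comp (σ P j) := by
    refine AlgHom.toLinearMap_injective (PiTensorProduct.ext (MultilinearMap.ext fun x => ?_))
    change σ P (conjEmb P j) (KT.tprod P x) = star (σ P j (KT.tprod P x))
    rw [σ_tprod, σ_tprod, star_prod]
    rfl
  rw [this]
  rfl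

/-- The trace `Tr(x) = ∑_j σ_j(x)`. -/
def Tr (x : KT P) : ℂ := ∑ j : Emb P, σ P j x

/-- The dual `R^∨ = {x ∈ K : Tr(x R) ⊆ ℤ}`. -/
def Rdual : Submodule (R P) (KT P) where
  carrier := {x | ∀ y : R P, ∃ z : ℤ, Tr P (x * algebraMap (R P) (KT P) y) = z}
  zero_mem' y := ⟨0, by simp [Tr]⟩
  add_mem' {a b} ha hb y := by
    obtain ⟨z, hz⟩ := ha y
    obtain ⟨w, hw⟩ := hb y
    refine ⟨z + w, ?_⟩
    push_cast
    rw [← hz, ← hw]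
    simp [Tr, add_mul, Finset.sum_add_distrib]
  smul_mem' c x hx y := by
    obtain ⟨z, hz⟩ := hx (c * y)
    refine ⟨z, ?_⟩
    rw [← hz, Algebra.smul_def, map_mul]
    congr 1
    ring

/-- `R_q = R / qR`. -/
abbrev Rq : Type := R P ⧸ Ideal.span {(P.q : R P)}

/-- `R_q^∨ = R^∨ / qR^∨`, a module over `R_q`. -/
abbrev RqDual : Type := Rdual P ⧸ ((P.q : R P) • (⊤ : Submodule (R P) (Rdual P)))

/-! ### The space `H ≅ K ⊗_ℚ ℝ` and the torus `𝕋 = H / R^∨` -/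

/-- The space `H = {x ∈ ℂ^n : x_{j̄} = conj x_j}` with the Euclidean norm of `ℂ^n`; the canonical
embedding identifies it with `K ⊗_ℚ ℝ`. -/
def H : Submodule ℝ (EuclideanSpace ℂ (Emb P)) where
  carrier := {x | ∀ j, x (conjEmb P j) = star (x j)}
  zero_mem' := by intro j; simp
  add_mem' {a b} ha hb j := by simp [ha j, hb j]
  smul_mem' c x hx j := by simp [hx j]

/-- The canonical embedding `K → H`, `x ↦ (σ_j(x))_j`. -/
def canEmb : KT P →+ H P where
  toFun x := ⟨WithLp.toLp 2 fun j => σ P j x, fun j => σ_conjEmb P j x⟩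
  map_zero' := by ext j; simp
  map_add' x y := by ext j; simp

/-- `R^∨` as a lattice in `H`. -/
def dualLattice : AddSubgroup (H P) := (Rdual P).toAddSubgroup.map (canEmb P)

/-- The torus `𝕋 = (K ⊗ ℝ) / R^∨`. -/
def Torus : Type := H P ⧸ dualLattice P

instance : AddCommGroup (Torus P) := inferInstanceAs (AddCommGroup (H P ⧸ dualLattice P))

instance : TopologicalSpace (Torus P) := inferInstanceAs (TopologicalSpace (H P ⧸ dualLattice P))

instance : IsTopologicalAddGroup (Torus P) :=
  inferInstanceAs (IsTopologicalAddGroup (H P ⧸ dualLattice P))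

instance : LocallyCompactSpace (Torus P) :=
  inferInstanceAs (LocallyCompactSpace (H P ⧸ dualLattice P))

instance : MeasurableSpace (Torus P) := borel _

instance : BorelSpace (Torus P) := ⟨rfl⟩

instance : MeasurableSpace (Rq P) := ⊤

instance : DiscreteMeasurableSpace (Rq P) := ⟨fun _ => trivial⟩

instance : MeasurableSpace (RqDual P) := ⊤

instance : DiscreteMeasurableSpace (RqDual P) := ⟨fun _ => trivial⟩

/-- Reduction modulo `R^∨`. -/
def Torus.mk : H P →+ Torus P := QuotientAddGroup.mk' (dualLattice P)

theorem Torus.continuous_mk : Continuous (Torus.mk P) :=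
  (QuotientAddGroup.continuous_mk : Continuous (QuotientAddGroup.mk : H P → H P ⧸ dualLattice P))

/-- Division by `q`, as the map `R^∨ / qR^∨ → 𝕋`, `t ↦ t / q`. -/
def divQ : RqDual P →+ Torus P :=
  QuotientAddGroup.lift _
    ((Torus.mk P).comp (((DistribSMul.toAddMonoidHom (H P) ((P.q : ℝ)⁻¹)).comp (canEmb P)).comp
      (Rdual P).toAddSubgroup.subtype))
    (by
      intro x hx
      obtain ⟨y, -, rfl⟩ := (Submodule.mem_smul_pointwise_iff_exists _ _ _).1 hx
      have hq : (P.q : ℝ) ≠ 0 := Nat.cast_ne_zero.2 (NeZero.ne P.q)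
      have h1 : (P.q : ℝ)⁻¹ • canEmb P (((P.q : R P) • y : Rdual P) : KT P) =
          canEmb P (y : KT P) := by
        have h2 : (((P.q : R P) • y : Rdual P) : KT P) = P.q • (y : KT P) := by
          simp [Algebra.smul_def]
        rw [h2, map_nsmul, ← Nat.cast_smul_eq_nsmul ℝ, smul_smul, inv_mul_cancel₀ hq, one_smul]
      change Torus.mk P ((P.q : ℝ)⁻¹ • canEmb P (((P.q : R P) • y : Rdual P) : KT P)) = 0
      rw [h1]
      exact (QuotientAddGroup.eq_zero_iff _).2 ⟨y, y.2, rfl⟩)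

/-! ### Gaussians and the smoothing parameter -/

section Gaussian

variable (E : Type) [NormedAddCommGroup E] [InnerProductSpace ℝ E] [FiniteDimensional ℝ E]
  [MeasurableSpace E] [BorelSpace E]

/-- The spherical Gaussian `D_r`, of density `r^{-n} exp(-π‖x‖²/r²)` with respect to the Lebesgue
measure of the `n`-dimensional Euclidean space `E`. -/
def sphericalGaussian (r : ℝ) : Measure E :=
  (volume : Measure E).withDensity fun x =>
    ENNReal.ofReal ((r ^ Module.finrank ℝ E)⁻¹ * Real.exp (-Real.pi * ‖x‖ ^ 2 / r ^ 2))

theorem isProbabilityMeasure_sphericalGaussian {r : ℝ} (hr : 0 < r) :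
    IsProbabilityMeasure (sphericalGaussian E r) := by
  constructor
  have hb : 0 < Real.pi / r ^ 2 := by positivity
  have hint : ∫ v : E, Real.exp (-(Real.pi / r ^ 2) * ‖v‖ ^ 2) = r ^ Module.finrank ℝ E := by
    rw [GaussianFourier.integral_rexp_neg_mul_sq_norm hb]
    rw [div_div_cancel₀ Real.pi_ne_zero, ← Real.rpow_natCast, ← Real.rpow_natCast,
      ← Real.rpow_mul hr.le]
    congr 1
    push_cast
    ring
  have hfun : (fun x : E => (r ^ Module.finrank ℝ E)⁻¹ * Real.exp (-Real.pi * ‖x‖ ^ 2 / r ^ 2)) =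
      fun x => (r ^ Module.finrank ℝ E)⁻¹ * Real.exp (-(Real.pi / r ^ 2) * ‖x‖ ^ 2) := by
    funext x
    congr 2
    ring
  have hI : Integrable (fun v : E => Real.exp (-(Real.pi / r ^ 2) * ‖v‖ ^ 2)) := by
    by_contra h
    rw [integral_undef h] at hint
    exact (pow_pos hr _).ne hint
  rw [sphericalGaussian, withDensity_apply _ MeasurableSet.univ, Measure.restrict_univ]
  simp only [congrFun hfun]
  rw [
    ← ofReal_integral_eq_lintegral_ofReal (hI.const_mul _)
      (Filter.Eventually.of_forall fun x => by positivity),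
    integral_const_mul, hint, inv_mul_cancel₀ (pow_pos hr _).ne', ENNReal.ofReal_one]

/-- The smoothing parameter `η_ε(Λ)` of a lattice `Λ`: the smallest `r > 0` with
`ρ_{1/r}(Λ* ∖ {0}) ≤ ε`, where `ρ_{1/r}(x) = exp(-π r² ‖x‖²)` and `Λ*` is the dual lattice. -/
def smoothing (Λ : Set E) (ε : ℝ) : ℝ :=
  sInf {r : ℝ | 0 < r ∧
    ∑' x : {x : E | (∀ y ∈ Λ, ∃ z : ℤ, inner ℝ y x = z) ∧ x ≠ 0},
      ENNReal.ofReal (Real.exp (-Real.pi * r ^ 2 * ‖(x : E)‖ ^ 2)) ≤ ENNReal.ofReal ε}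

end Gaussian

/-- The smoothing parameter `η_ε(R^∨)`. -/
def smoothingDual (ε : ℝ) : ℝ := smoothing (H P) (dualLattice P : Set (H P)) ε

/-! ### The `m`-RLWE distribution -/

/-- The `m`-RLWE distribution `A_{s,ψ}` on `R_q × 𝕋`: the law of `(a, (a · s)/q + e mod R^∨)` for
uniform `a ∈ R_q` and independent `e ← ψ`. -/
def mRLWE (s : RqDual P) (ψ : Measure (H P)) : Measure (Rq P × Torus P) :=
  ((uniformOn (Set.univ : Set (Rq P))).prod ψ).map
    fun p => (p.1, divQ P (p.1 • s) + Torus.mk P p.2)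

/-- `A_{s,D_α}`. -/
def lweLaw (s : RqDual P) : Measure (Rq P × Torus P) := mRLWE P s (sphericalGaussian (H P) P.α)

/-- The uniform distribution on `R_q × 𝕋` (on `𝕋`, normalized Haar measure). -/
def unifLaw : Measure (Rq P × Torus P) :=
  (uniformOn (Set.univ : Set (Rq P))).prod ((Measure.addHaar : Measure (Torus P))[|Set.univ])

/-! ### Representation of ring and torus elements -/

/-- The integer `ζ_{mᵢ}`. -/
def zetaInt (i : Fin P.l) : 𝓞 (CycField P i) :=
  (IsCyclotomicExtension.zeta_spec (P.m i) ℚ (CycField P i)).toInteger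

/-- The power basis `1, ζ, …, ζ^{φ(mᵢ)-1}` of `𝓞(Kᵢ)`. -/
def cycBasis (i : Fin P.l) : Module.Basis (Fin (Nat.totient (P.m i))) ℤ (𝓞 (CycField P i)) :=
  (IsCyclotomicExtension.zeta_spec (P.m i) ℚ (CycField P i)).integralPowerBasis.basis.reindex
    (finCongr (IsPrimitiveRoot.integralPowerBasis_dim _))

/-- The tensor basis of `R`, in mixed-radix order: position `∑ᵢ eᵢ ∏_{d<i} φ(m_d)` holds
`⊗ ζ_{mᵢ}^{eᵢ}`. -/
def tensorBasis : Module.Basis (Fin P.n) ℤ (⨂[ℤ] i, 𝓞 (CycField P i)) :=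
  (Basis.piTensorProduct (cycBasis P)).reindex finPiFinEquiv

/-- The basis element of `R` at position `k`. -/
def basisElt (k : Fin P.n) : R P :=
  R.tprod P fun i => zetaInt P i ^ (finPiFinEquiv.symm k i : ℕ)

/-- Coordinates on `R` with respect to the tensor basis. -/
def coordR : R P →+ (Fin P.n → ℤ) where
  toFun r k := (tensorBasis P).repr r k
  map_zero' := by
    funext k
    exact congrArg (fun v => v k) (map_zero (tensorBasis P).repr)
  map_add' x y := by
    funext k
    exact congrArg (fun v => v k) (map_add (tensorBasis P).repr x y)

/-- Coordinates on `R_q` with respect to the tensor basis. -/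
def coordRq : Rq P →+ (Fin P.n → ZMod P.q) :=
  QuotientAddGroup.lift _
    ((AddMonoidHom.pi fun k => (Int.castAddHom (ZMod P.q)).comp
      (Pi.evalAddMonoidHom (fun _ : Fin P.n => ℤ) k)).comp (coordR P))
    (by
      intro x hx
      obtain ⟨y, rfl⟩ := Ideal.mem_span_singleton'.1 hx
      funext k
      have : coordR P (y * (P.q : R P)) = P.q • coordR P y := by
        rw [← map_nsmul, nsmul_eq_mul, mul_comm]
      change ((coordR P (y * (P.q : R P)) k : ℤ) : ZMod P.q) = 0
      rw [this]
      simp)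

/-- Coordinates on `𝕋 ≅ (ℝ/ℤ)^n` with respect to the `ℤ`-basis of `R^∨` that is dual to the tensor
basis of `R`: the `k`-th coordinate of `b` is `Tr(b · basisElt k) mod 1`. -/
def coordT : Torus P →+ (Fin P.n → UnitAddCircle) :=
  QuotientAddGroup.lift _
    (AddMonoidHom.pi fun k : Fin P.n =>
      ({ toFun := fun x : H P =>
          (((∑ j, (x : EuclideanSpace ℂ (Emb P)) j *
            σ P j (algebraMap (R P) (KT P) (basisElt P k))).re : ℝ) : UnitAddCircle)
         map_zero' := by simp
         map_add' := fun x y => by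
          simp [add_mul, Finset.sum_add_distrib] } : H P →+ UnitAddCircle))
    (by
      rintro _ ⟨y, hy, rfl⟩
      funext k
      obtain ⟨z, hz⟩ := hy (basisElt P k)
      have h : (∑ j, σ P j y * σ P j (algebraMap (R P) (KT P) (basisElt P k))) = (z : ℂ) := by
        rw [← hz, Tr]
        simp
      change (((∑ j, σ P j y * σ P j (algebraMap (R P) (KT P) (basisElt P k))).re : ℝ) :
        UnitAddCircle) = 0
      rw [h, Complex.intCast_re, AddCircle.coe_eq_zero_iff]
      exact ⟨z, by simp⟩)

/-- The integer vector `c` represents `s ∈ R_q^∨`: it lists the coordinates `Tr(y · basisElt k)`,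
with respect to the basis of `R^∨` dual to the tensor basis of `R`, of a representative `y` of
`s`. -/
def Represents (c : Fin P.n → ℤ) (s : RqDual P) : Prop :=
  ∃ y : Rdual P, Submodule.Quotient.mk y = s ∧
    ∀ k, Tr P ((y : KT P) * algebraMap (R P) (KT P) (basisElt P k)) = c k

/-- A sample in coordinates. -/
abbrev Sample : Type := (Fin P.n → ZMod P.q) × (Fin P.n → UnitAddCircle)

/-- The coordinates of a sample `(a, b) ∈ R_q × 𝕋`. -/
def coord (x : Rq P × Torus P) : Sample P := (coordRq P x.1, coordT P x.2)

/-! ### The decision problem -/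

/-- A randomized distinguisher that reads `L` samples: the value of `accept` is the probability
(over its internal coins) that it accepts. -/
structure Distinguisher (L : ℕ) where
  accept : (Fin L → Sample P) → unitInterval
  measurable_accept : Measurable accept

variable {P} in
/-- The acceptance probability on `L` independent samples with law `μ`. -/
def Distinguisher.acceptProb {L : ℕ} (D : Distinguisher P L) (μ : Measure (Rq P × Torus P)) : ℝ :=
  ∫ x, (D.accept fun i => coord P (x i) : ℝ) ∂(Measure.pi fun _ : Fin L => μ)

variable {P} in
/-- The advantage of a distinguisher in the average-case decision problem with error `D_α`:
samples from `A_{s,D_α}` for one uniformly random `s ∈ R_q^∨`, against uniform samples. -/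
def Distinguisher.advantage {L : ℕ} (D : Distinguisher P L) : ℝ :=
  |(∫ s, D.acceptProb (lweLaw P s) ∂(uniformOn (Set.univ : Set (RqDual P)))) -
    D.acceptProb (unifLaw P)|

theorem coordR_injective : Function.Injective (coordR P) := fun _ _ h =>
  (tensorBasis P).repr.injective (Finsupp.ext fun k => congrFun h k)

theorem coordRq_injective : Function.Injective (coordRq P) := by
  rw [injective_iff_map_eq_zero]
  intro a ha
  obtain ⟨r, rfl⟩ := Ideal.Quotient.mk_surjective a
  have h (k : Fin P.n) : (P.q : ℤ) ∣ coordR P r k :=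
    (ZMod.intCast_zmod_eq_zero_iff_dvd _ _).1 (congrFun ha k)
  choose w hw using h
  let y : R P := (tensorBasis P).equivFun.symm w
  have hy : coordR P y = w := (tensorBasis P).equivFun.apply_symm_apply w
  have hr : r = y * (P.q : R P) := by
    apply coordR_injective P
    have : coordR P (y * (P.q : R P)) = P.q • coordR P y := by
      rw [← map_nsmul, nsmul_eq_mul, mul_comm]
    rw [this, hy]
    funext k
    simp [hw k]
  rw [Ideal.Quotient.eq_zero_iff_mem, hr]
  exact Ideal.mul_mem_left _ _ (Ideal.mem_span_singleton_self _)

instance : Finite (Rq P) := Finite.of_injective _ (coordRq_injective P)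

instance (s : RqDual P) : IsProbabilityMeasure (lweLaw P s) := by
  have := isProbabilityMeasure_sphericalGaussian (H P) P.α_pos
  have : IsProbabilityMeasure (uniformOn (Set.univ : Set (Rq P))) :=
    isProbabilityMeasure_uniformOn Set.finite_univ Set.univ_nonempty
  refine Measure.isProbabilityMeasure_map (Measurable.aemeasurable ?_)
  refine measurable_fst.prodMk (measurable_from_prod_countable_right fun a => ?_)
  have h : Continuous fun y : H P => divQ P (a • s) + Torus.mk P y :=
    continuous_const.add (Torus.continuous_mk P)
  exact h.measurable

/-! ### Randomized oracle programs with a step count -/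

/-- What a program interacts with in one run: `sample i` is the `i`-th drawn sample, `coin i` the
`i`-th coin, `answer i` the reply of the oracle to the `i`-th query as a function of the query
(a list of `L` samples). Samples have `n` integer and `n` torus coordinates. -/
structure Env where
  n : ℕ
  L : ℕ
  sample : ℕ → (Fin n → ℤ) × (Fin n → UnitAddCircle)
  coin : ℕ → Bool
  answer : ℕ → (Fin L → (Fin n → ℤ) × (Fin n → UnitAddCircle)) → Bool

/-- The memory: integer variables, integer arrays, arrays of elements of `ℝ/ℤ`, and the numbers of
samples, coins and oracle calls used so far. -/
structure State where
  var : ℕ → ℤ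
  arr : ℕ → ℤ → ℤ
  tarr : ℕ → ℤ → UnitAddCircle
  samples : ℕ
  coins : ℕ
  queries : ℕ

/-- Integer expressions. -/
inductive Expr where
  | const (c : ℤ)
  | var (x : ℕ)
  | get (A : ℕ) (i : Expr)
  | add (a b : Expr)
  | sub (a b : Expr)
  | mul (a b : Expr)
  | div (a b : Expr)
  | mod (a b : Expr)

/-- The number of binary digits of an integer. -/
def bits (z : ℤ) : ℕ := Nat.size z.natAbs

/-- The value of an integer expression (`div` and `mod` are Euclidean division). -/
def Expr.eval (st : State) : Expr → ℤ
  | const c => c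
  | var x => st.var x
  | get A i => st.arr A (i.eval st)
  | add a b => a.eval st + b.eval st
  | sub a b => a.eval st - b.eval st
  | mul a b => a.eval st * b.eval st
  | div a b => a.eval st / b.eval st
  | mod a b => a.eval st % b.eval st

/-- The cost of evaluating an expression: one step per operation, where a multiplication is
charged in addition the numbers of digits of its factors. (So the numbers of digits in the memory
grow at most linearly with the cost, and the cost is polynomially equivalent to Turing time.) -/
def Expr.cost (st : State) : Expr → ℕ
  | const _ => 1
  | var _ => 1
  | get _ i => 1 + i.cost st
  | add a b => 1 + a.cost st + b.cost st
  | sub a b => 1 + a.cost st + b.cost st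
  | mul a b => 1 + bits (a.eval st) + bits (b.eval st) + a.cost st + b.cost st
  | div a b => 1 + a.cost st + b.cost st
  | mod a b => 1 + a.cost st + b.cost st

/-- Expressions with values in `ℝ/ℤ`. Elements of `ℝ/ℤ` can be added and multiplied by integers,
and there are rational constants; a program cannot inspect them otherwise. -/
inductive TExpr where
  | frac (a b : Expr)
  | get (A : ℕ) (i : Expr)
  | add (s t : TExpr)
  | smul (c : Expr) (t : TExpr)

/-- The value of a torus expression; `frac a b` is the class of `a / b`. -/
def TExpr.eval (st : State) : TExpr → UnitAddCircle
  | frac a b => (((a.eval st : ℝ) / (b.eval st : ℝ) : ℝ) : UnitAddCircle)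
  | get A i => st.tarr A (i.eval st)
  | add s t => s.eval st + t.eval st
  | smul c t => c.eval st • t.eval st

/-- The cost of a torus expression; an integer multiple is charged the digits of the integer. -/
def TExpr.cost (st : State) : TExpr → ℕ
  | frac a b => 1 + a.cost st + b.cost st
  | get _ i => 1 + i.cost st
  | add s t => 1 + s.cost st + t.cost st
  | smul c t => 1 + bits (c.eval st) + c.cost st + t.cost st

/-- Programs. `sample A B` draws a fresh sample and writes its coordinates into the integer array
`A` and the torus array `B`; `query x A B` submits the `L` samples whose coordinates stand one
after the other in `A` and `B` to the oracle and stores its reply in the variable `x`; `cond` and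
`loop` test whether an expression is positive. -/
inductive Prog where
  | skip
  | assign (x : ℕ) (e : Expr)
  | set (A : ℕ) (i e : Expr)
  | tset (A : ℕ) (i : Expr) (t : TExpr)
  | coin (x : ℕ)
  | sample (A B : ℕ)
  | query (x A B : ℕ)
  | seq (p p' : Prog)
  | cond (e : Expr) (p p' : Prog)
  | loop (e : Expr) (p : Prog)

/-- An array with the entries at positions `0, …, n - 1` overwritten by `v`. -/
def overwrite {β : Type} {n : ℕ} (f : ℤ → β) (v : Fin n → β) (z : ℤ) : β :=
  if h : 0 ≤ z ∧ z < n then v ⟨z.toNat, by omega⟩ else f z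

/-- `Exec env p st t st'`: in the environment `env`, the program `p` started in the state `st`
halts in the state `st'` after `t` steps. -/
inductive Exec (env : Env) : Prog → State → ℕ → State → Prop
  | skip (st : State) : Exec env .skip st 1 st
  | assign (x : ℕ) (e : Expr) (st : State) :
      Exec env (.assign x e) st (1 + e.cost st)
        { st with var := Function.update st.var x (e.eval st) }
  | set (A : ℕ) (i e : Expr) (st : State) :
      Exec env (.set A i e) st (1 + i.cost st + e.cost st)
        { st with
          arr := Function.update st.arr A (Function.update (st.arr A) (i.eval st) (e.eval st)) }
  | tset (A : ℕ) (i : Expr) (t : TExpr) (st : State) :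
      Exec env (.tset A i t) st (1 + i.cost st + t.cost st)
        { st with
          tarr := Function.update st.tarr A (Function.update (st.tarr A) (i.eval st) (t.eval st)) }
  | coin (x : ℕ) (st : State) :
      Exec env (.coin x) st 1
        { st with
          var := Function.update st.var x (if env.coin st.coins then 1 else 0)
          coins := st.coins + 1 }
  | sample (A B : ℕ) (st : State) :
      Exec env (.sample A B) st (1 + env.n)
        { st with
          arr := Function.update st.arr A (overwrite (st.arr A) (env.sample st.samples).1)
          tarr := Function.update st.tarr B (overwrite (st.tarr B) (env.sample st.samples).2)
          samples := st.samples + 1 }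
  | query (x A B : ℕ) (st : State) :
      Exec env (.query x A B) st (1 + env.L * env.n)
        { st with
          var := Function.update st.var x
            (if env.answer st.queries (fun i =>
                (fun k => st.arr A ((i * env.n + k : ℕ) : ℤ),
                 fun k => st.tarr B ((i * env.n + k : ℕ) : ℤ)))
              then 1 else 0)
          queries := st.queries + 1 }
  | seq {p p' : Prog} {st st' st'' : State} {t t' : ℕ}
      (h : Exec env p st t st') (h' : Exec env p' st' t' st'') :
      Exec env (.seq p p') st (t + t') st''
  | cond_pos {e : Expr} {p p' : Prog} {st st' : State} {t : ℕ}
      (he : 0 < e.eval st) (h : Exec env p st t st') :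
      Exec env (.cond e p p') st (1 + e.cost st + t) st'
  | cond_neg {e : Expr} {p p' : Prog} {st st' : State} {t : ℕ}
      (he : ¬ 0 < e.eval st) (h : Exec env p' st t st') :
      Exec env (.cond e p p') st (1 + e.cost st + t) st'
  | loop_pos {e : Expr} {p : Prog} {st st' st'' : State} {t t' : ℕ}
      (he : 0 < e.eval st) (h : Exec env p st t st') (h' : Exec env (.loop e p) st' t' st'') :
      Exec env (.loop e p) st (1 + e.cost st + t + t') st''
  | loop_neg {e : Expr} {p : Prog} {st : State} (he : ¬ 0 < e.eval st) :
      Exec env (.loop e p) st (1 + e.cost st) st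

/-! ### Reductions from the search problem to the decision problem -/

/-- The randomness of a run: the stream of samples, the coins of the program, and for each oracle
call a uniform number in `[0, 1]` that decides whether the distinguisher accepts. -/
abbrev Randomness : Type := (ℕ → Rq P × Torus P) × (ℕ → Bool) × (ℕ → unitInterval)

/-- The law of the randomness when the samples come from `A_{s,D_α}`. -/
def runLaw (s : RqDual P) : Measure (Randomness P) :=
  (Measure.infinitePi fun _ : ℕ => lweLaw P s).prod
    ((Measure.infinitePi fun _ : ℕ => (PMF.uniformOfFintype Bool).toMeasure).prod
      (Measure.infinitePi fun _ : ℕ => (volume : Measure unitInterval)))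

variable {P} in
/-- The environment of a program that has sample access and oracle access to the distinguisher
`D`. The elements of `ℤ/q` are given to the program as integers in `[0, q)`. -/
def env {L : ℕ} (D : Distinguisher P L) (ω : Randomness P) : Env where
  n := P.n
  L := L
  sample i := (fun k => ((coord P (ω.1 i)).1 k).val, (coord P (ω.1 i)).2)
  coin := ω.2.1
  answer i x := decide (ω.2.2 i < D.accept fun r => (fun k => ((x r).1 k : ZMod P.q), (x r).2))

/-- The initial state: the variables `0, 1, 2, 3` hold `l`, `q`, an integer `k` (the reciprocal of
the advantage that the oracle is promised to have) and the number `L` of samples in an oracle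
call; the array `0` holds `m 0, …, m (l - 1)`. All else is zero. -/
def initState (k L : ℕ) : State where
  var x := if x = 0 then P.l else if x = 1 then P.q else if x = 2 then k else if x = 3 then L else 0
  arr A := if A = 0 then overwrite (fun _ => 0) (fun i : Fin P.l => (P.m i : ℤ)) else fun _ => 0
  tarr _ _ := 0
  samples := 0
  coins := 0
  queries := 0

/-- The output of a program: the first `n` entries of the array `1`. -/
def output (st : State) (k : Fin P.n) : ℤ := st.arr 1 ((k : ℕ) : ℤ)

variable {P} in
/-- The probability that `M`, with samples from `A_{s,D_α}` and oracle `D`, does not find `s`. -/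
def failProb (M : Prog) (k : ℕ) {L : ℕ} (D : Distinguisher P L) (s : RqDual P) : ℝ≥0∞ :=
  runLaw P s {ω | ¬ ∃ t st, Exec (env D ω) M (initState P k L) t st ∧
    Represents P (output P st) s}

/-- A function of the index of a sequence of instances is bounded by a polynomial in the degree. -/
def PolyBounded (F : ℕ → Params) (f : ℕ → ℕ) : Prop :=
  ∃ p : Polynomial ℕ, ∀ κ, f κ ≤ p.eval (F κ).n

/-- A function of the index of a sequence of instances is negligible in the degree. -/
def Negligible (F : ℕ → Params) (ε : ℕ → ℝ) : Prop :=
  ∀ c : ℕ, ∀ᶠ κ in Filter.atTop, |ε κ| * ((F κ).n : ℝ) ^ c ≤ 1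

/-- `M` runs in polynomial time: the number of steps, for all outcomes of the randomness and all
oracles, is bounded by a polynomial in the degree `n`, the number `l` of tensor factors, `k`, and
the number of samples in an oracle call. -/
def RunsInPolyTime (F : ℕ → Params) (M : Prog) : Prop :=
  ∃ p : Polynomial ℕ, ∀ (κ k L : ℕ) (D : Distinguisher (F κ) L) (ω : Randomness (F κ)),
    ∃ t st, Exec (env D ω) M (initState (F κ) k L) t st ∧
      t ≤ p.eval ((F κ).n + (F κ).l + k + L)

/-- `M` is a randomized polynomial-time reduction from the search problem with error `D_α` to the
average-case decision problem with the same error: with any oracle that has advantage at least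
`1 / k` (for polynomially bounded `k`, and polynomially many samples per call), at every index at
which the oracle has this advantage, `M` finds every secret with overwhelming probability. -/
def IsSearchToDecisionReduction (F : ℕ → Params) (M : Prog) : Prop :=
  RunsInPolyTime F M ∧
    ∀ k L : ℕ → ℕ, PolyBounded F k → PolyBounded F L →
      ∃ ν : ℕ → ℝ, Negligible F ν ∧
        ∀ (κ : ℕ) (D : Distinguisher (F κ) (L κ)), 1 ≤ (k κ : ℝ) * D.advantage →
          ∀ s : RqDual (F κ), failProb M (k κ) D s ≤ ENNReal.ofReal (ν κ)

end MRLWE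

end

/-! ### Digit counts, costs of expressions, and a program logic with step bounds. -/

namespace MRLWE

/-! ### Sizes of integers and costs of expressions -/

/-! Since `q` is prime and `q ≡ 1` modulo every conductor, each cyclotomic polynomial involved
splits modulo `q`. Hence `R_q` is a product of `n` copies of `ℤ/q`, through homomorphisms `χ_i`
whose values on the tensor basis are the rows of `crtV`. A secret becomes a vector `(s_j)` over
`ℤ/q` (`secretEquiv`), and `a · s` has components `χ_j(a) s_j` (`coordT_divQ`). So the components of
the secret decouple, and each one has only `q`, that is polynomially many, candidates.

In the hybrid law number `m` the first `m` components of `a · s` carry an additional uniform mask.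
Hybrid `0` is the law of the samples. In hybrid `n` the second entry is the error plus a uniform
point of `q⁻¹R^∨ / R^∨`, independent of `a`. The Fourier coefficients of that law vanish at
frequencies not divisible by `q`; at the others they are Gaussian weights of width `αq ≥ η_ε(R^∨)`
on the dual lattice, so the nontrivial ones sum to at most `ε`, and the law is at most `1 + ε` times
the uniform one (`smoothT_le`). For `L` samples the loss is `(1 + ε)^L - 1`
(`abs_hybridProb_sub_le`). An advantage `1/k` therefore forces a gap of at least `1/(2kn)` between
two neighbouring hybrids `i₀` and `i₀ + 1`, on average over the secret (`exists_hybrid_gap`).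

To test the guess `s_j = g` at position `i`, a Galois automorphism moves component `j` to position
`i`. It permutes the embeddings, hence preserves the norm on `H` and the error law, so the error
stays exactly `D_α` (`map_autTorus_gaussT`). A uniform `t` is added to the secret, the components
before `i` are masked, a multiple `h_i` of the `i`-th idempotent (scaled by `C = ∏ m_a`) is added to
`a`, and `C g h_i` is added to component `i`. What is left at position `i` is the mask `C h_i (g -
s_j)`. For `g = s_j` this is hybrid `i`; otherwise it is hybrid `i + 1`, because `q` is prime
(`map_transform`). As `t` is uniform, the oracle sees an average-case secret whatever `s` is
(`integral_replyFun`).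

Control calls always produce hybrid `i + 1`. The score, the difference of the numbers of positive
replies to test and control calls, has mean zero for a wrong guess, and the mean given by the gap
for the right guess at `i₀`. Neither `i₀` nor the sign of the gap is known, so the pair `(i, g)`
with the largest squared score is taken. Fresh samples in every call make the rounds independent,
and Hoeffding's inequality with `16 k² n³` rounds and a union bound leave the failure probability `4
n² q exp(-n/2)` (`failProb_le`).

The remaining work is to exhibit all this as one concrete program. Tables for the Möbius function,
cyclotomic polynomials, units and roots of unity modulo `q` are computed by loops of length at most
about `q`, which is polynomial in `n`. The triples `Ex` combine partial correctness, termination and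
a step bound `Z ^ e`, where `Z` dominates all parameters; `progReduction_spec` is the outcome. The
uniform masks and `t` are first components of further samples, so no coin is ever tossed. -/

theorem lt_two_pow_bits (z : ℤ) : z.natAbs < 2 ^ bits z := Nat.lt_size_self _

theorem bits_le {z : ℤ} {b : ℕ} (h : z.natAbs < 2 ^ b) : bits z ≤ b := Nat.size_le.2 h

theorem bits_le_natAbs (z : ℤ) : bits z ≤ z.natAbs := bits_le Nat.lt_two_pow_self

theorem bits_eq_zero {z : ℤ} : bits z = 0 ↔ z = 0 := by
  rw [bits, Nat.size_eq_zero, Int.natAbs_eq_zero]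

theorem bits_neg (z : ℤ) : bits (-z) = bits z := by rw [bits, bits, Int.natAbs_neg]

/-- For nonzero operands both powers of two are at least `2`, and then a sum is at most the product.
A zero operand has no digits and is treated apart. -/
theorem bits_add_le (a b : ℤ) : bits (a + b) ≤ bits a + bits b := by
  rcases Nat.eq_zero_or_pos (bits a) with ha | ha
  · rw [bits_eq_zero.1 ha]; simp
  rcases Nat.eq_zero_or_pos (bits b) with hb | hb
  · rw [bits_eq_zero.1 hb]; simp
  refine bits_le ((Int.natAbs_add_le a b).trans_lt ?_)
  have h1 := lt_two_pow_bits a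
  have h2 := lt_two_pow_bits b
  have h3 : 2 ≤ 2 ^ bits a := by simpa using Nat.pow_le_pow_right (n := 2) (by norm_num) ha
  have h4 : 2 ≤ 2 ^ bits b := by simpa using Nat.pow_le_pow_right (n := 2) (by norm_num) hb
  rw [pow_add]
  nlinarith

theorem bits_sub_le (a b : ℤ) : bits (a - b) ≤ bits a + bits b := by
  rw [sub_eq_add_neg, ← bits_neg b]; exact bits_add_le _ _

theorem bits_mul_le (a b : ℤ) : bits (a * b) ≤ bits a + bits b := by
  refine bits_le ?_
  rw [Int.natAbs_mul, pow_add]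
  exact Nat.mul_lt_mul'' (lt_two_pow_bits a) (lt_two_pow_bits b)

theorem bits_mono {a b : ℤ} (h : a.natAbs ≤ b.natAbs) : bits a ≤ bits b := Nat.size_le_size h

theorem bits_div_le (a b : ℤ) : bits (a / b) ≤ bits a + bits b :=
  (bits_mono (Int.natAbs_ediv_le_natAbs a b)).trans (Nat.le_add_right _ _)

/-- Both digit counts are needed because `a % 0 = a`. -/
theorem bits_mod_le (a b : ℤ) : bits (a % b) ≤ bits a + bits b := by
  by_cases hb : b = 0
  · subst hb; simp
  · refine (bits_mono (b := b) ?_).trans (Nat.le_add_left _ _)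
    have := Int.emod_nonneg a hb
    have := Int.emod_lt a hb
    omega

theorem bits_le_of_abs_le {z : ℤ} {e : ℕ} (h : |z| ≤ 2 ^ e) : bits z ≤ e + 1 := by
  refine bits_le ?_
  have h1 : ((z.natAbs : ℕ) : ℤ) ≤ 2 ^ e := by rwa [Int.natCast_natAbs]
  have h2 : z.natAbs ≤ 2 ^ e := by exact_mod_cast h1
  exact h2.trans_lt (Nat.pow_lt_pow_right (by norm_num) (Nat.lt_succ_self e))

theorem bits_natCast_le {n Z : ℕ} (h : n ≤ Z) : bits (n : ℤ) ≤ Z ^ 6 :=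
  (bits_le_natAbs _).trans ((Int.natAbs_natCast n).le.trans (h.trans (Nat.le_self_pow (by norm_num) Z)))

theorem bits_one_le {Z : ℕ} (h : 100 ≤ Z) : bits 1 ≤ Z ^ 6 :=
  bits_natCast_le (n := 1) (by omega)

theorem bits_two_le {Z : ℕ} (h : 100 ≤ Z) : bits 2 ≤ Z ^ 6 :=
  bits_natCast_le (n := 2) (by omega)

/-- The number of nodes of an expression. -/
def Expr.size : Expr → ℕ
  | const _ => 1
  | var _ => 1
  | get _ i => 1 + i.size
  | add a b => 1 + a.size + b.size
  | sub a b => 1 + a.size + b.size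
  | mul a b => 1 + a.size + b.size
  | div a b => 1 + a.size + b.size
  | mod a b => 1 + a.size + b.size

/-- All constants and memory cells read at the top level have at most `B` digits. -/
def Expr.LeafBits (st : State) (B : ℕ) : Expr → Prop
  | const c => bits c ≤ B
  | var x => bits (st.var x) ≤ B
  | get A i => bits (st.arr A (i.eval st)) ≤ B
  | add a b => a.LeafBits st B ∧ b.LeafBits st B
  | sub a b => a.LeafBits st B ∧ b.LeafBits st B
  | mul a b => a.LeafBits st B ∧ b.LeafBits st B
  | div a b => a.LeafBits st B ∧ b.LeafBits st B
  | mod a b => a.LeafBits st B ∧ b.LeafBits st B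

/-- All factors of products have leaves with at most `B` digits. -/
def Expr.MulBits (st : State) (B : ℕ) : Expr → Prop
  | const _ => True
  | var _ => True
  | get _ i => i.MulBits st B
  | add a b => a.MulBits st B ∧ b.MulBits st B
  | sub a b => a.MulBits st B ∧ b.MulBits st B
  | mul a b => (a.LeafBits st B ∧ b.LeafBits st B) ∧ a.MulBits st B ∧ b.MulBits st B
  | div a b => a.MulBits st B ∧ b.MulBits st B
  | mod a b => a.MulBits st B ∧ b.MulBits st B

theorem Expr.one_le_size (e : Expr) : 1 ≤ e.size := by cases e <;> simp only [Expr.size] <;> omega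

/-- No operation yields more digits than its operands have together, so the digits of the leaves add
up. An array access counts as a leaf: only the value read matters, not the index. -/
theorem Expr.bits_eval_le {st : State} {B : ℕ} (e : Expr) (h : e.LeafBits st B) :
    bits (e.eval st) ≤ e.size * B := by
  induction e with
  | const c => simpa [Expr.size, Expr.eval, Expr.LeafBits] using h
  | var x => simpa [Expr.size, Expr.eval, Expr.LeafBits] using h
  | get A i _ =>
    simp only [Expr.LeafBits] at h
    simp only [Expr.size, Expr.eval]
    nlinarith [i.one_le_size]
  | add a b iha ihb =>
    have := bits_add_le (a.eval st) (b.eval st)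
    have := iha h.1
    have := ihb h.2
    simp only [Expr.size, Expr.eval]
    nlinarith
  | sub a b iha ihb =>
    have := bits_sub_le (a.eval st) (b.eval st)
    have := iha h.1
    have := ihb h.2
    simp only [Expr.size, Expr.eval]
    nlinarith
  | mul a b iha ihb =>
    have := bits_mul_le (a.eval st) (b.eval st)
    have := iha h.1
    have := ihb h.2
    simp only [Expr.size, Expr.eval]
    nlinarith
  | div a b iha ihb =>
    have := bits_div_le (a.eval st) (b.eval st)
    have := iha h.1
    have := ihb h.2
    simp only [Expr.size, Expr.eval]
    nlinarith
  | mod a b iha ihb =>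
    have := bits_mod_le (a.eval st) (b.eval st)
    have := iha h.1
    have := ihb h.2
    simp only [Expr.size, Expr.eval]
    nlinarith

/-- The bound `S` stays fixed during the induction while the size shrinks. Each node is charged at
most `1 + S * B`, since the factors of a product have at most `S * B` digits together. -/
theorem Expr.cost_le_of_size_le {st : State} {B S : ℕ} (e : Expr) (h : e.MulBits st B)
    (hS : e.size ≤ S) : e.cost st ≤ e.size * (1 + S * B) := by
  induction e with
  | const c => simp [Expr.size, Expr.cost]
  | var x => simp [Expr.size, Expr.cost]
  | get A i ih =>
    simp only [Expr.size] at hS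
    have := ih h (by omega)
    simp only [Expr.size, Expr.cost]
    nlinarith
  | mul a b iha ihb =>
    simp only [Expr.size] at hS
    have h1 := iha h.2.1 (by omega)
    have h2 := ihb h.2.2 (by omega)
    have h3 := a.bits_eval_le h.1.1
    have h4 := b.bits_eval_le h.1.2
    have h5 : (a.size + b.size) * B ≤ S * B := Nat.mul_le_mul_right _ (by omega)
    simp only [Expr.size, Expr.cost]
    nlinarith
  | add a b iha ihb | sub a b iha ihb | div a b iha ihb | mod a b iha ihb =>
    simp only [Expr.size] at hS
    have h1 := iha h.1 (by omega)
    have h2 := ihb h.2 (by omega)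
    simp only [Expr.size, Expr.cost]
    nlinarith

/-- The program has no expression with more than `60` nodes, and no factor of a product exceeds `Z ^
6` digits per leaf. `Z ≥ 100` absorbs the constants, as `60 * (1 + 60 * Z ^ 6) ≤ 10000 * Z ^ 6 ≤ Z ^
8`. -/
theorem Expr.cost_le {st : State} {Z : ℕ} (hZ : 100 ≤ Z) (e : Expr) (h : e.MulBits st (Z ^ 6))
    (hs : e.size ≤ 60) : e.cost st ≤ Z ^ 8 := by
  have h1 := e.cost_le_of_size_le h hs
  have h2 : 1 ≤ Z ^ 6 := Nat.one_le_pow _ _ (by omega)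
  have h3 : Z ^ 8 = Z ^ 6 * (Z * Z) := by ring
  have h4 : 10000 ≤ Z * Z := by nlinarith
  rw [h3]
  calc e.cost st ≤ e.size * (1 + 60 * Z ^ 6) := h1
    _ ≤ 60 * (1 + 60 * Z ^ 6) := Nat.mul_le_mul_right _ hs
    _ ≤ Z ^ 6 * 10000 := by omega
    _ ≤ _ := Nat.mul_le_mul_left _ h4

/-- The number of nodes of a torus expression. -/
def TExpr.size : TExpr → ℕ
  | frac a b => 1 + a.size + b.size
  | get _ i => 1 + i.size
  | add s t => 1 + s.size + t.size
  | smul c t => 1 + c.size + t.size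

/-- All integer factors have leaves with at most `B` digits. -/
def TExpr.MulBits (st : State) (B : ℕ) : TExpr → Prop
  | frac a b => a.MulBits st B ∧ b.MulBits st B
  | get _ i => i.MulBits st B
  | add s t => s.MulBits st B ∧ t.MulBits st B
  | smul c t => c.LeafBits st B ∧ c.MulBits st B ∧ t.MulBits st B

theorem TExpr.cost_le_of_size_le {st : State} {B S : ℕ} (e : TExpr) (h : e.MulBits st B)
    (hS : e.size ≤ S) : e.cost st ≤ e.size * (1 + S * B) := by
  induction e with
  | frac a b =>
    simp only [TExpr.size] at hS
    have h1 := a.cost_le_of_size_le h.1 (S := S) (by omega)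
    have h2 := b.cost_le_of_size_le h.2 (S := S) (by omega)
    simp only [TExpr.size, TExpr.cost]
    nlinarith
  | get A i =>
    simp only [TExpr.size] at hS
    have h1 := i.cost_le_of_size_le h (S := S) (by omega)
    simp only [TExpr.size, TExpr.cost]
    nlinarith
  | add a b iha ihb =>
    simp only [TExpr.size] at hS
    have h1 := iha h.1 (by omega)
    have h2 := ihb h.2 (by omega)
    simp only [TExpr.size, TExpr.cost]
    nlinarith
  | smul c t ih =>
    simp only [TExpr.size] at hS
    have h1 := c.cost_le_of_size_le h.2.1 (S := S) (by omega)
    have h2 := ih h.2.2 (by omega)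
    have h3 := c.bits_eval_le h.1
    have h5 : c.size * B ≤ S * B := Nat.mul_le_mul_right _ (by omega)
    simp only [TExpr.size, TExpr.cost]
    nlinarith

theorem TExpr.cost_le {st : State} {Z : ℕ} (hZ : 100 ≤ Z) (e : TExpr) (h : e.MulBits st (Z ^ 6))
    (hs : e.size ≤ 60) : e.cost st ≤ Z ^ 8 := by
  have h1 := e.cost_le_of_size_le h hs
  have h2 : 1 ≤ Z ^ 6 := Nat.one_le_pow _ _ (by omega)
  have h3 : Z ^ 8 = Z ^ 6 * (Z * Z) := by ring
  have h4 : 10000 ≤ Z * Z := by nlinarith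
  rw [h3]
  calc e.cost st ≤ e.size * (1 + 60 * Z ^ 6) := h1
    _ ≤ 60 * (1 + 60 * Z ^ 6) := Nat.mul_le_mul_right _ hs
    _ ≤ Z ^ 6 * 10000 := by omega
    _ ≤ _ := Nat.mul_le_mul_left _ h4

/-! ### Arithmetic notation for expressions -/

instance : Add Expr := ⟨.add⟩
instance : Sub Expr := ⟨.sub⟩
instance : Mul Expr := ⟨.mul⟩
instance : Div Expr := ⟨.div⟩
instance : Mod Expr := ⟨.mod⟩
instance (n : ℕ) : OfNat Expr n := ⟨.const n⟩

section
variable (st : State) (a b : Expr) (B : ℕ)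
@[simp] theorem Expr.eval_add : (a + b).eval st = a.eval st + b.eval st := rfl
@[simp] theorem Expr.eval_sub : (a - b).eval st = a.eval st - b.eval st := rfl
@[simp] theorem Expr.eval_mul : (a * b).eval st = a.eval st * b.eval st := rfl
@[simp] theorem Expr.eval_div : (a / b).eval st = a.eval st / b.eval st := rfl
@[simp] theorem Expr.eval_mod : (a % b).eval st = a.eval st % b.eval st := rfl
@[simp] theorem Expr.eval_zero : (0 : Expr).eval st = 0 := rfl
@[simp] theorem Expr.eval_one : (1 : Expr).eval st = 1 := rfl
@[simp] theorem Expr.eval_two : (2 : Expr).eval st = 2 := rfl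
@[simp] theorem Expr.eval_sixteen : (16 : Expr).eval st = 16 := rfl
@[simp] theorem Expr.eval_var (x : ℕ) : (Expr.var x).eval st = st.var x := rfl
@[simp] theorem Expr.eval_get (A : ℕ) : (Expr.get A a).eval st = st.arr A (a.eval st) := rfl

@[simp] theorem Expr.mulBits_add : (a + b).MulBits st B ↔ a.MulBits st B ∧ b.MulBits st B := Iff.rfl
@[simp] theorem Expr.mulBits_sub : (a - b).MulBits st B ↔ a.MulBits st B ∧ b.MulBits st B := Iff.rfl
@[simp] theorem Expr.mulBits_mul : (a * b).MulBits st B ↔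
    (a.LeafBits st B ∧ b.LeafBits st B) ∧ a.MulBits st B ∧ b.MulBits st B := Iff.rfl
@[simp] theorem Expr.mulBits_div : (a / b).MulBits st B ↔ a.MulBits st B ∧ b.MulBits st B := Iff.rfl
@[simp] theorem Expr.mulBits_mod : (a % b).MulBits st B ↔ a.MulBits st B ∧ b.MulBits st B := Iff.rfl
@[simp] theorem Expr.mulBits_zero : (0 : Expr).MulBits st B ↔ True := Iff.rfl
@[simp] theorem Expr.mulBits_one : (1 : Expr).MulBits st B ↔ True := Iff.rfl
@[simp] theorem Expr.mulBits_two : (2 : Expr).MulBits st B ↔ True := Iff.rfl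
@[simp] theorem Expr.mulBits_sixteen : (16 : Expr).MulBits st B ↔ True := Iff.rfl
@[simp] theorem Expr.mulBits_var (x : ℕ) : (Expr.var x).MulBits st B ↔ True := Iff.rfl
@[simp] theorem Expr.mulBits_get (A : ℕ) : (Expr.get A a).MulBits st B ↔ a.MulBits st B := Iff.rfl

@[simp] theorem Expr.leafBits_add : (a + b).LeafBits st B ↔ a.LeafBits st B ∧ b.LeafBits st B := Iff.rfl
@[simp] theorem Expr.leafBits_sub : (a - b).LeafBits st B ↔ a.LeafBits st B ∧ b.LeafBits st B := Iff.rfl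
@[simp] theorem Expr.leafBits_mul : (a * b).LeafBits st B ↔ a.LeafBits st B ∧ b.LeafBits st B := Iff.rfl
@[simp] theorem Expr.leafBits_div : (a / b).LeafBits st B ↔ a.LeafBits st B ∧ b.LeafBits st B := Iff.rfl
@[simp] theorem Expr.leafBits_mod : (a % b).LeafBits st B ↔ a.LeafBits st B ∧ b.LeafBits st B := Iff.rfl
@[simp] theorem Expr.leafBits_zero : (0 : Expr).LeafBits st B ↔ bits 0 ≤ B := Iff.rfl
@[simp] theorem Expr.leafBits_one : (1 : Expr).LeafBits st B ↔ bits 1 ≤ B := Iff.rfl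
@[simp] theorem Expr.leafBits_two : (2 : Expr).LeafBits st B ↔ bits 2 ≤ B := Iff.rfl
@[simp] theorem Expr.leafBits_sixteen : (16 : Expr).LeafBits st B ↔ bits 16 ≤ B := Iff.rfl
@[simp] theorem Expr.leafBits_var (x : ℕ) : (Expr.var x).LeafBits st B ↔ bits (st.var x) ≤ B := Iff.rfl
@[simp] theorem Expr.leafBits_get (A : ℕ) :
    (Expr.get A a).LeafBits st B ↔ bits (st.arr A (a.eval st)) ≤ B := Iff.rfl
end

/-! ### Memory updates and frames -/

/-- The state with the variable `x` set to `v`. -/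
def State.setVar (st : State) (x : ℕ) (v : ℤ) : State :=
  { st with var := Function.update st.var x v }

/-- The state with entry `i` of the integer array `A` set to `v`. -/
def State.setArr (st : State) (A : ℕ) (i v : ℤ) : State :=
  { st with arr := Function.update st.arr A (Function.update (st.arr A) i v) }

/-- The state with entry `i` of the torus array `A` set to `v`. -/
def State.setTarr (st : State) (A : ℕ) (i : ℤ) (v : UnitAddCircle) : State :=
  { st with tarr := Function.update st.tarr A (Function.update (st.tarr A) i v) }

section
variable (st : State) (x y A A' : ℕ) (i i' v : ℤ) (w : UnitAddCircle)
@[simp] theorem State.setVar_var : (st.setVar x v).var y = if y = x then v else st.var y := by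
  simp [State.setVar, Function.update_apply]
@[simp] theorem State.setVar_arr : (st.setVar x v).arr = st.arr := rfl
@[simp] theorem State.setVar_tarr : (st.setVar x v).tarr = st.tarr := rfl
@[simp] theorem State.setVar_samples : (st.setVar x v).samples = st.samples := rfl
@[simp] theorem State.setVar_queries : (st.setVar x v).queries = st.queries := rfl
@[simp] theorem State.setArr_var : (st.setArr A i v).var = st.var := rfl
@[simp] theorem State.setArr_tarr : (st.setArr A i v).tarr = st.tarr := rfl
@[simp] theorem State.setArr_samples : (st.setArr A i v).samples = st.samples := rfl
@[simp] theorem State.setArr_queries : (st.setArr A i v).queries = st.queries := rfl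
@[simp] theorem State.setArr_arr : (st.setArr A i v).arr A' i' =
    if A' = A ∧ i' = i then v else st.arr A' i' := by
  by_cases h : A' = A
  · subst h; simp [State.setArr, Function.update_apply]
  · simp [State.setArr, h]
@[simp] theorem State.setTarr_var : (st.setTarr A i w).var = st.var := rfl
@[simp] theorem State.setTarr_arr : (st.setTarr A i w).arr = st.arr := rfl
@[simp] theorem State.setTarr_samples : (st.setTarr A i w).samples = st.samples := rfl
@[simp] theorem State.setTarr_queries : (st.setTarr A i w).queries = st.queries := rfl
@[simp] theorem State.setTarr_tarr : (st.setTarr A i w).tarr A' i' =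
    if A' = A ∧ i' = i then w else st.tarr A' i' := by
  by_cases h : A' = A
  · subst h; simp [State.setTarr, Function.update_apply]
  · simp [State.setTarr, h]
end

/-- Whether a program may write the variable `y`. -/
def Prog.writesVar (y : ℕ) : Prog → Bool
  | skip => false
  | assign x _ => y == x
  | set _ _ _ => false
  | tset _ _ _ => false
  | coin x => y == x
  | sample _ _ => false
  | query x _ _ => y == x
  | seq p p' => p.writesVar y || p'.writesVar y
  | cond _ p p' => p.writesVar y || p'.writesVar y
  | loop _ p => p.writesVar y

/-- Whether a program may write the integer array `B`. -/
def Prog.writesArr (B : ℕ) : Prog → Bool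
  | set A _ _ => B == A
  | sample A _ => B == A
  | seq p p' => p.writesArr B || p'.writesArr B
  | cond _ p p' => p.writesArr B || p'.writesArr B
  | loop _ p => p.writesArr B
  | _ => false

/-- Whether a program may write the torus array `B`. -/
def Prog.writesTarr (B : ℕ) : Prog → Bool
  | tset A _ _ => B == A
  | sample _ A => B == A
  | seq p p' => p.writesTarr B || p'.writesTarr B
  | cond _ p p' => p.writesTarr B || p'.writesTarr B
  | loop _ p => p.writesTarr B
  | _ => false

/-- Whether a program may draw samples. -/
def Prog.draws : Prog → Bool
  | sample _ _ => true
  | seq p p' => p.draws || p'.draws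
  | cond _ p p' => p.draws || p'.draws
  | loop _ p => p.draws
  | _ => false

/-- Whether a program may call the oracle. -/
def Prog.asks : Prog → Bool
  | query _ _ _ => true
  | seq p p' => p.asks || p'.asks
  | cond _ p p' => p.asks || p'.asks
  | loop _ p => p.asks
  | _ => false

/-- The state `st'` agrees with `st` outside the footprint of the program `p`. -/
structure Agree (p : Prog) (st st' : State) : Prop where
  var : ∀ x, p.writesVar x = false → st'.var x = st.var x
  arr : ∀ A, p.writesArr A = false → st'.arr A = st.arr A
  tarr : ∀ A, p.writesTarr A = false → st'.tarr A = st.tarr A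
  samples : p.draws = false → st'.samples = st.samples
  queries : p.asks = false → st'.queries = st.queries

theorem Agree.refl (p : Prog) (st : State) : Agree p st st :=
  ⟨fun _ _ => rfl, fun _ _ => rfl, fun _ _ => rfl, fun _ => rfl, fun _ => rfl⟩

theorem Agree.trans {p : Prog} {st st' st'' : State} (h : Agree p st st') (h' : Agree p st' st'') :
    Agree p st st'' :=
  ⟨fun x hx => (h'.var x hx).trans (h.var x hx), fun x hx => (h'.arr x hx).trans (h.arr x hx),
    fun x hx => (h'.tarr x hx).trans (h.tarr x hx), fun hx => (h'.samples hx).trans (h.samples hx),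
    fun hx => (h'.queries hx).trans (h.queries hx)⟩

/-- The footprint of `p` is contained in that of `p'`. -/
structure Prog.Sub (p p' : Prog) : Prop where
  var : ∀ x, p'.writesVar x = false → p.writesVar x = false
  arr : ∀ x, p'.writesArr x = false → p.writesArr x = false
  tarr : ∀ x, p'.writesTarr x = false → p.writesTarr x = false
  draws : p'.draws = false → p.draws = false
  asks : p'.asks = false → p.asks = false

theorem Agree.mono {p p' : Prog} {st st' : State} (h : Agree p st st') (hp : p.Sub p') :
    Agree p' st st' :=
  ⟨fun x hx => h.var x (hp.var x hx), fun x hx => h.arr x (hp.arr x hx),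
    fun x hx => h.tarr x (hp.tarr x hx), fun hx => h.samples (hp.draws hx),
    fun hx => h.queries (hp.asks hx)⟩

theorem Prog.sub_seq_left (p p' : Prog) : p.Sub (p.seq p') := by
  constructor <;> simp +contextual [Prog.writesVar, Prog.writesArr, Prog.writesTarr, Prog.draws,
    Prog.asks]

theorem Prog.sub_seq_right (p p' : Prog) : p'.Sub (p.seq p') := by
  constructor <;> simp +contextual [Prog.writesVar, Prog.writesArr, Prog.writesTarr, Prog.draws,
    Prog.asks]

theorem Prog.sub_cond_left (e : Expr) (p p' : Prog) : p.Sub (.cond e p p') := by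
  constructor <;> simp +contextual [Prog.writesVar, Prog.writesArr, Prog.writesTarr, Prog.draws,
    Prog.asks]

theorem Prog.sub_cond_right (e : Expr) (p p' : Prog) : p'.Sub (.cond e p p') := by
  constructor <;> simp +contextual [Prog.writesVar, Prog.writesArr, Prog.writesTarr, Prog.draws,
    Prog.asks]

theorem Prog.sub_loop (e : Expr) (p : Prog) : p.Sub (.loop e p) := by
  constructor <;> simp [Prog.writesVar, Prog.writesArr, Prog.writesTarr, Prog.draws, Prog.asks]

theorem Prog.Sub.trans {p p' p'' : Prog} (h : p.Sub p') (h' : p'.Sub p'') : p.Sub p'' :=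
  ⟨fun x hx => h.var x (h'.var x hx), fun x hx => h.arr x (h'.arr x hx),
    fun x hx => h.tarr x (h'.tarr x hx), fun hx => h.draws (h'.draws hx),
    fun hx => h.asks (h'.asks hx)⟩

/-- The frame rule. Footprints are Boolean functions of the program text, so on a concrete program
the condition that a cell is untouched is closed by `rfl`. -/
theorem Exec.agree {env : Env} {p : Prog} {st st' : State} {t : ℕ} (h : Exec env p st t st') :
    Agree p st st' := by
  induction h with
  | skip st => exact Agree.refl _ _
  | assign x e st | coin x st | query x A B st =>
    refine ⟨fun y hy => ?_, fun _ _ => rfl, fun _ _ => rfl, fun h => ?_, fun h => ?_⟩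
    · simp only [Prog.writesVar, beq_eq_false_iff_ne] at hy
      simp [hy]
    · rfl
    · first | rfl | simp [Prog.asks] at h
  | set A i e st =>
    refine ⟨fun _ _ => rfl, fun y hy => ?_, fun _ _ => rfl, fun _ => rfl, fun _ => rfl⟩
    simp only [Prog.writesArr, beq_eq_false_iff_ne] at hy
    simp [hy]
  | tset A i e st =>
    refine ⟨fun _ _ => rfl, fun _ _ => rfl, fun y hy => ?_, fun _ => rfl, fun _ => rfl⟩
    simp only [Prog.writesTarr, beq_eq_false_iff_ne] at hy
    simp [hy]
  | sample A B st =>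
    refine ⟨fun _ _ => rfl, fun y hy => ?_, fun y hy => ?_, fun h => ?_, fun _ => rfl⟩
    · simp only [Prog.writesArr, beq_eq_false_iff_ne] at hy
      simp [hy]
    · simp only [Prog.writesTarr, beq_eq_false_iff_ne] at hy
      simp [hy]
    · simp [Prog.draws] at h
  | seq _ _ ih ih' =>
    exact (ih.mono (Prog.sub_seq_left _ _)).trans (ih'.mono (Prog.sub_seq_right _ _))
  | cond_pos _ _ ih => exact ih.mono (Prog.sub_cond_left _ _ _)
  | cond_neg _ _ ih => exact ih.mono (Prog.sub_cond_right _ _ _)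
  | loop_pos _ _ _ ih ih' => exact (ih.mono (Prog.sub_loop _ _)).trans ih'
  | loop_neg _ => exact Agree.refl _ _

/-! ### Total correctness with a step bound -/

/-- The program `p` started in `st` halts after at most `Z ^ e` steps in a state satisfying `Q`. -/
def Ex (env : Env) (Z e : ℕ) (p : Prog) (st : State) (Q : State → Prop) : Prop :=
  ∃ t st', Exec env p st t st' ∧ t ≤ Z ^ e ∧ Q st'

section Rules

variable {env : Env} {Z : ℕ}

theorem Ex.conseq {e : ℕ} {p : Prog} {st : State} {Q Q' : State → Prop} (h : Ex env Z e p st Q)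
    (hQ : ∀ st', Agree p st st' → Q st' → Q' st') : Ex env Z e p st Q' := by
  obtain ⟨t, st', h1, h2, h3⟩ := h
  exact ⟨t, st', h1, h2, hQ _ h1.agree h3⟩

theorem Ex.le (hZ : 100 ≤ Z) {e e' : ℕ} {p : Prog} {st : State} {Q : State → Prop}
    (h : Ex env Z e p st Q) (he : e ≤ e') : Ex env Z e' p st Q := by
  obtain ⟨t, st', h1, h2, h3⟩ := h
  exact ⟨t, st', h1, h2.trans (Nat.pow_le_pow_right (by omega) he), h3⟩

/-- Two runs of `Z ^ e` steps fit into `Z ^ (e + 1)`, so the exponent grows by one per composition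
and constants never have to be tracked. The frame of the first run is handed to the second. -/
theorem Ex.seq (hZ : 100 ≤ Z) {e : ℕ} {p p' : Prog} {st : State} {Q R : State → Prop}
    (h : Ex env Z e p st Q)
    (h' : ∀ st', Agree p st st' → Q st' → Ex env Z e p' st' R) :
    Ex env Z (e + 1) (.seq p p') st R := by
  obtain ⟨t, st', h1, h2, h3⟩ := h
  obtain ⟨t', st'', h1', h2', h3'⟩ := h' st' h1.agree h3
  refine ⟨_, _, Exec.seq h1 h1', ?_, h3'⟩
  rw [pow_succ]
  nlinarith

theorem Ex.skip (hZ : 100 ≤ Z) {st : State} {Q : State → Prop} (h : Q st) : Ex env Z 9 .skip st Q :=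
  ⟨_, _, Exec.skip st, Nat.one_le_pow _ _ (by omega), h⟩

/-- All elementary statements receive the exponent `9`, one more than the exponent for evaluating an
expression. -/
theorem Ex.assign {x : ℕ} {e : Expr} {st : State} {Q : State → Prop} (hZ : 100 ≤ Z)
    (hs : e.size ≤ 60) (he : e.MulBits st (Z ^ 6)) (hQ : Q (st.setVar x (e.eval st))) :
    Ex env Z 9 (.assign x e) st Q := by
  refine ⟨_, _, Exec.assign x e st, ?_, hQ⟩
  have := e.cost_le hZ he hs
  have h2 : 1 ≤ Z ^ 8 := Nat.one_le_pow _ _ (by omega)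
  rw [pow_succ Z 8]
  nlinarith

theorem Ex.set {A : ℕ} {i e : Expr} {st : State} {Q : State → Prop} (hZ : 100 ≤ Z)
    (hs : i.size ≤ 60 ∧ e.size ≤ 60) (hi : i.MulBits st (Z ^ 6)) (he : e.MulBits st (Z ^ 6))
    (hQ : Q (st.setArr A (i.eval st) (e.eval st))) :
    Ex env Z 9 (.set A i e) st Q := by
  refine ⟨_, _, Exec.set A i e st, ?_, hQ⟩
  have := e.cost_le hZ he hs.2
  have := i.cost_le hZ hi hs.1
  have h2 : 1 ≤ Z ^ 8 := Nat.one_le_pow _ _ (by omega)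
  rw [pow_succ Z 8]
  nlinarith

theorem Ex.tset {A : ℕ} {i : Expr} {e : TExpr} {st : State} {Q : State → Prop} (hZ : 100 ≤ Z)
    (hs : i.size ≤ 60 ∧ e.size ≤ 60) (hi : i.MulBits st (Z ^ 6)) (he : e.MulBits st (Z ^ 6))
    (hQ : Q (st.setTarr A (i.eval st) (e.eval st))) :
    Ex env Z 9 (.tset A i e) st Q := by
  refine ⟨_, _, Exec.tset A i e st, ?_, hQ⟩
  have := e.cost_le hZ he hs.2
  have := i.cost_le hZ hi hs.1
  have h2 : 1 ≤ Z ^ 8 := Nat.one_le_pow _ _ (by omega)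
  rw [pow_succ Z 8]
  nlinarith

theorem Ex.cond (hZ : 100 ≤ Z) {a : ℕ} {e : Expr} {p p' : Prog} {st : State} {Q : State → Prop}
    (hs : e.size ≤ 60) (he : e.MulBits st (Z ^ 6)) (ha : 9 ≤ a)
    (h : 0 < e.eval st → Ex env Z a p st Q) (h' : ¬ 0 < e.eval st → Ex env Z a p' st Q) :
    Ex env Z (a + 1) (.cond e p p') st Q := by
  have h1 := e.cost_le hZ he hs
  have h2 : 1 ≤ Z ^ 8 := Nat.one_le_pow _ _ (by omega)
  have h3 : Z ^ 8 ≤ Z ^ a := Nat.pow_le_pow_right (by omega) (by omega)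
  by_cases hp : 0 < e.eval st
  · obtain ⟨t, st', k1, k2, k3⟩ := h hp
    refine ⟨_, _, Exec.cond_pos hp k1, ?_, k3⟩
    rw [pow_succ]
    nlinarith
  · obtain ⟨t, st', k1, k2, k3⟩ := h' hp
    refine ⟨_, _, Exec.cond_neg hp k1, ?_, k3⟩
    rw [pow_succ]
    nlinarith

/-- `for x < N do body`. -/
def Prog.for (x : ℕ) (N : Expr) (body : Prog) : Prog :=
  .seq (.assign x 0) (.loop (N - .var x) (.seq body (.assign x (.var x + 1))))

theorem Prog.body_sub_for (x : ℕ) (N : Expr) (body : Prog) : body.Sub (.for x N body) :=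
  (Prog.sub_seq_left _ _).trans ((Prog.sub_loop _ _).trans (Prog.sub_seq_right _ _))

theorem Agree.for_setVar {x : ℕ} {N : Expr} {body : Prog} {st st' : State} {v : ℤ}
    (h : Agree (.for x N body) st st') : Agree (.for x N body) st (st'.setVar x v) := by
  refine ⟨fun y hy => ?_, h.arr, h.tarr, h.samples, h.queries⟩
  have : y ≠ x := by
    rintro rfl
    simp [Prog.for, Prog.writesVar] at hy
  rw [State.setVar_var, if_neg this, h.var y hy]

/-- The invariant `I i` speaks of states whose counter already holds `i`. The increment is not part
of the body, which is why the body must establish `I (i + 1)` for the state with the counter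
overwritten. The bound `N` is evaluated anew in every round, so it has to keep its value `n`. Of the
exponent, `b` pays for the rounds and `2` for the overhead. -/
theorem Ex.for (hZ : 100 ≤ Z) {x a b a' : ℕ} {N : Expr} {body : Prog} {st : State} (n : ℕ)
    (hn : n ≤ Z ^ b)
    (ha : 9 ≤ a) (ha' : a + b + 2 ≤ a') (hx : body.writesVar x = false) (hNs : N.size ≤ 60)
    (hN : ∀ st', Agree (.for x N body) st st' → N.eval st' = n ∧ N.MulBits st' (Z ^ 6))
    (I : ℕ → State → Prop) (h0 : I 0 (st.setVar x 0))
    (hb : ∀ i < n, ∀ st', Agree (.for x N body) st st' → st'.var x = i → I i st' →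
      Ex env Z a body st' fun st'' => I (i + 1) (st''.setVar x (i + 1 : ℕ))) :
    Ex env Z a' (.for x N body) st (I n) := by
  -- Induction on the number `d` of remaining rounds, for an arbitrary value `i` of the counter.
  have key : ∀ (d i : ℕ) (st' : State), i + d = n → Agree (.for x N body) st st' →
      st'.var x = i → I i st' → ∃ t st'', Exec env (.loop (N - .var x)
        (.seq body (.assign x (.var x + 1)))) st' t st'' ∧
        t ≤ (Z ^ 8 + 3) + d * (Z ^ 8 + 7 + Z ^ a) ∧ I n st'' := by
    intro d
    induction d with
    | zero =>
      intro i st' hi hA hv hI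
      obtain ⟨hN1, hN2⟩ := hN st' hA
      have hle : ¬ 0 < (N - .var x).eval st' := by
        rw [Expr.eval_sub, hN1, Expr.eval_var, hv]
        omega
      refine ⟨_, _, Exec.loop_neg hle, ?_, ?_⟩
      · have := N.cost_le hZ hN2 hNs
        change 1 + (1 + N.cost st' + 1) ≤ _
        omega
      · have : i = n := by omega
        rwa [← this]
    | succ d ih =>
      intro i st' hi hA hv hI
      obtain ⟨hN1, hN2⟩ := hN st' hA
      have hlt : 0 < (N - .var x).eval st' := by
        rw [Expr.eval_sub, hN1, Expr.eval_var, hv]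
        omega
      obtain ⟨t, st1, h1, h2, h3⟩ := hb i (by omega) st' hA hv hI
      have hv1 : st1.var x = i := (h1.agree.var x hx).trans hv
      have hexec := Exec.assign (env := env) x (.var x + 1) st1
      have hst : (st1.setVar x (i + 1 : ℕ)) =
          { st1 with var := Function.update st1.var x ((Expr.var x + 1).eval st1) } := by
        rw [State.setVar, Expr.eval_add, Expr.eval_var, hv1]
        push_cast
        rfl
      have hA1 : Agree (.for x N body) st (st1.setVar x (i + 1 : ℕ)) :=
        (hA.trans (h1.agree.mono (Prog.body_sub_for _ _ _))).for_setVar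
      obtain ⟨t', st2, h1', h2', h3'⟩ := ih (i + 1) (st1.setVar x (i + 1 : ℕ)) (by omega) hA1
        (by rw [State.setVar_var, if_pos rfl]) h3
      rw [hst] at h1'
      refine ⟨_, _, Exec.loop_pos hlt (Exec.seq h1 hexec) h1', ?_, h3'⟩
      have := N.cost_le hZ hN2 hNs
      change 1 + (1 + N.cost st' + 1) + (t + (1 + (1 + 1 + 1))) + t' ≤ _
      rw [Nat.succ_mul]
      omega
  obtain ⟨t, st', h1, h2, h3⟩ := key n 0 (st.setVar x 0) (by omega) (Agree.refl _ _).for_setVar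
    (by rw [State.setVar_var, if_pos rfl]; rfl) h0
  refine ⟨_, _, Exec.seq (Exec.assign x 0 st) h1, ?_, h3⟩
  change (1 + 1) + t ≤ _
  have e1 : 1 ≤ Z ^ 8 := Nat.one_le_pow _ _ (by omega)
  have e2 : Z ^ 9 ≤ Z ^ a := Nat.pow_le_pow_right (by omega) ha
  have e3 : 100 * Z ^ 8 ≤ Z ^ 9 := by rw [pow_succ Z 8]; nlinarith
  have e4 : 1 ≤ Z ^ b := Nat.one_le_pow _ _ (by omega)
  have e5 : Z ^ (a + b + 2) ≤ Z ^ a' := Nat.pow_le_pow_right (by omega) ha'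
  have e6 : Z ^ (a + b + 2) = Z ^ a * Z ^ b * (Z * Z) := by ring
  have e7 : n * (Z ^ 8 + 7 + Z ^ a) ≤ Z ^ b * (2 * Z ^ a) := Nat.mul_le_mul hn (by omega)
  have e8 : Z ^ a ≤ Z ^ a * Z ^ b := Nat.le_mul_of_pos_right _ e4
  have e9 : Z ^ a * Z ^ b * 10000 ≤ Z ^ a * Z ^ b * (Z * Z) := Nat.mul_le_mul_left _ (by nlinarith)
  have e10 : Z ^ b * (2 * Z ^ a) = 2 * (Z ^ a * Z ^ b) := by ring
  omega

/-- `acc := ∑_{x < N} e`. -/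
def Prog.sum (x acc : ℕ) (N e : Expr) : Prog :=
  .seq (.assign acc 0) (.for x N (.assign acc (.var acc + e)))

theorem Ex.sum (hZ : 100 ≤ Z) {x acc b a' : ℕ} {N e : Expr} {st : State} (n : ℕ) (hn : n ≤ Z ^ b)
    (ha' : b + 12 ≤ a') (hx : x ≠ acc) (hs : N.size ≤ 50 ∧ e.size ≤ 50)
    (hN : ∀ st', Agree (.sum x acc N e) st st' → N.eval st' = n ∧ N.MulBits st' (Z ^ 6))
    (f : ℕ → ℤ)
    (hf : ∀ i < n, ∀ st', Agree (.sum x acc N e) st st' → st'.var x = i →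
      e.eval st' = f i ∧ e.MulBits st' (Z ^ 6)) :
    Ex env Z a' (.sum x acc N e) st fun st' => st'.var acc = ∑ i ∈ Finset.range n, f i := by
  refine Ex.le hZ (e := b + 11 + 1) (Ex.seq hZ (Q := fun st' => st'.var acc = 0)
    (Ex.le hZ (Ex.assign hZ (e := 0) (by decide) trivial ?_) (by omega)) fun st1 hA1 h1 => ?_) ha'
  · rw [State.setVar_var, if_pos rfl]; rfl
  have hA : ∀ st', Agree (.for x N (.assign acc (.var acc + e))) st1 st' →
      Agree (.sum x acc N e) st st' := fun st' h =>
    (hA1.mono (Prog.sub_seq_left _ _)).trans (h.mono (Prog.sub_seq_right _ _))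
  refine Ex.for hZ (a := 9) (b := b) n hn le_rfl (by omega) (by simpa [Prog.writesVar] using hx)
    (by omega) (fun st' h => hN st' (hA _ h))
    (fun i st' => st'.var acc = ∑ i ∈ Finset.range i, f i) ?_ ?_
  · rw [State.setVar_var, if_neg hx.symm, h1, Finset.sum_range_zero]
  · intro i hi st' hA' hv hI
    obtain ⟨k1, k2⟩ := hf i hi st' (hA _ hA') hv
    refine Ex.assign hZ (?_ : 1 + 1 + e.size ≤ 60) ⟨trivial, k2⟩ ?_
    · omega
    · rw [State.setVar_var, if_neg hx.symm, State.setVar_var, if_pos rfl, Finset.sum_range_succ,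
        ← hI, ← k1]
      rfl

end Rules

end MRLWE

/-! ### Cyclotomic polynomials, roots of unity modulo `q`, and the matrices of homomorphisms and
automorphisms. -/

namespace MRLWE

/-! ### Powers of a primitive root in the power basis -/

section Cyclotomic

open Polynomial ArithmeticFunction

/-- The coefficient of `ζ ^ e` in `ζ ^ t`, for a primitive `m`-th root of unity `ζ`. -/
noncomputable def powCoeff (m t e : ℕ) : ℤ := ((X ^ t : ℤ[X]) %ₘ cyclotomic m ℤ).coeff e

/-- Division of `X ^ t` by `Φ_m` leaves a remainder of degree below `φ(m)`, and `ρ` kills the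
multiple of `Φ_m`. An arbitrary ring is allowed because the expansion is used both in `ℤ/q` and in
`ℂ`. -/
theorem pow_eq_sum_powCoeff {A : Type*} [CommRing A] {m : ℕ} (hm : 0 < m) {ρ : A}
    (hρ : aeval ρ (cyclotomic m ℤ) = 0) (t : ℕ) :
    ρ ^ t = ∑ e ∈ Finset.range m.totient, (powCoeff m t e : A) * ρ ^ e := by
  have h1 : aeval ρ ((X ^ t : ℤ[X]) %ₘ cyclotomic m ℤ) = ρ ^ t := by
    have := congrArg (aeval ρ) (modByMonic_add_div (X ^ t : ℤ[X]) (cyclotomic m ℤ))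
    rw [map_add, map_mul, hρ, zero_mul, add_zero] at this
    simpa using this
  rw [← h1, aeval_eq_sum_range' (n := m.totient)]
  · simp [powCoeff]
  · rw [← natDegree_cyclotomic m ℤ]
    refine natDegree_modByMonic_lt _ (cyclotomic.monic m ℤ) fun h => ?_
    have := natDegree_cyclotomic m ℤ
    rw [h, natDegree_one] at this
    exact (Nat.totient_pos.2 hm).ne this

theorem powCoeff_of_lt {m t : ℕ} (ht : t < m.totient) (e : ℕ) :
    powCoeff m t e = if e = t then 1 else 0 := by
  rw [powCoeff, (modByMonic_eq_self_iff (cyclotomic.monic m ℤ)).2, coeff_X_pow]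
  rw [degree_X_pow, degree_cyclotomic]
  exact_mod_cast ht

/-- The multiple `X ^ (t - φ) * Φ_m` has remainder zero, which expresses `X ^ t` through the `φ`
preceding powers. The coefficients are listed from the top down, the order in which the program
stores the reversed polynomial. -/
theorem powCoeff_rec {m t : ℕ} (ht : m.totient ≤ t) (e : ℕ) :
    powCoeff m t e = -∑ f ∈ Finset.range m.totient,
      (cyclotomic m ℤ).coeff (m.totient - 1 - f) * powCoeff m (t - 1 - f) e := by
  set φ := m.totient with hφ
  have hmon := cyclotomic.monic m ℤ
  have h0 : (X ^ (t - φ) * cyclotomic m ℤ) %ₘ cyclotomic m ℤ = 0 :=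
    (modByMonic_eq_zero_iff_dvd hmon).2 (dvd_mul_left _ _)
  have hsum : cyclotomic m ℤ =
      ∑ i ∈ Finset.range φ, C ((cyclotomic m ℤ).coeff i) * X ^ i + X ^ φ := by
    conv_lhs => rw [hmon.as_sum, natDegree_cyclotomic, add_comm]
  have h1 : X ^ (t - φ) * cyclotomic m ℤ =
      ∑ i ∈ Finset.range φ, (cyclotomic m ℤ).coeff i • X ^ (t - φ + i) + X ^ t := by
    conv_lhs => rw [hsum]
    rw [mul_add, Finset.mul_sum, ← pow_add, Nat.sub_add_cancel ht]
    congr 1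
    refine Finset.sum_congr rfl fun i _ => ?_
    rw [smul_eq_C_mul, pow_add]
    ring
  rw [h1] at h0
  have h2 := congrArg (fun p => coeff p e) h0
  have h3 : ∀ p, p %ₘ cyclotomic m ℤ = modByMonicHom (cyclotomic m ℤ) p := fun _ => rfl
  simp only [h3, map_add, map_sum, map_smul, coeff_add, finsetSum_coeff, coeff_smul, coeff_zero,
    smul_eq_mul] at h2
  rw [← Finset.sum_range_reflect] at h2
  have h4 : ∑ f ∈ Finset.range φ, (cyclotomic m ℤ).coeff (φ - 1 - f) * powCoeff m (t - 1 - f) e =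
      ∑ j ∈ Finset.range φ, (cyclotomic m ℤ).coeff (φ - 1 - j) *
        (modByMonicHom (cyclotomic m ℤ) (X ^ (t - φ + (φ - 1 - j)))).coeff e := by
    refine Finset.sum_congr rfl fun f hf => ?_
    rw [Finset.mem_range] at hf
    rw [show t - φ + (φ - 1 - f) = t - 1 - f by omega]
    rfl
  rw [h4, eq_neg_iff_add_eq_zero, add_comm]
  exact h2

/-- All complex roots lie on the unit circle, so a coefficient is at most a binomial coefficient. -/
theorem abs_coeff_cyclotomic_le (m i : ℕ) : |(cyclotomic m ℤ).coeff i| ≤ 2 ^ m.totient := by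
  have hmon : (cyclotomic m ℤ).Monic := cyclotomic.monic m ℤ
  have h := coeff_le_of_roots_le (p := cyclotomic m ℚ) (f := algebraMap ℚ ℂ) (B := 1) i
    (cyclotomic.monic m ℚ) (IsAlgClosed.splits _) (by
      intro z hz
      rw [map_cyclotomic] at hz
      rcases Nat.eq_zero_or_pos m with rfl | hm
      · simp at hz
      have : NeZero m := ⟨hm.ne'⟩
      have : NeZero ((m : ℕ) : ℂ) := ⟨by exact_mod_cast hm.ne'⟩
      exact ((isRoot_cyclotomic_iff.1 (isRoot_of_mem_roots hz)).norm'_eq_one hm.ne').le)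
  rw [map_cyclotomic, ← map_cyclotomic_int, coeff_map, one_pow, one_mul, natDegree_cyclotomic] at h
  have h2 : ((m.totient.choose i : ℕ) : ℝ) ≤ 2 ^ m.totient := by
    exact_mod_cast Nat.choose_le_two_pow _ _
  have h3 : ‖(((cyclotomic m ℤ).coeff i : ℤ) : ℂ)‖ ≤ 2 ^ m.totient := h.trans h2
  rw [Complex.norm_intCast] at h3
  exact_mod_cast h3

/-- One step of the recurrence enlarges the entries at most by the factor `φ * 2 ^ φ ≤ 2 ^ (2 * φ)`.
The bound is crude, but the number of digits remains polynomial. -/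
theorem abs_powCoeff_le (m t e : ℕ) : |powCoeff m t e| ≤ 2 ^ (2 * m.totient * t) := by
  induction t using Nat.strong_induction_on with
  | _ t ih =>
    rcases lt_or_ge t m.totient with ht | ht
    · rw [powCoeff_of_lt ht]
      split_ifs
      · simp only [abs_one]; exact one_le_pow₀ (by norm_num)
      · simp only [abs_zero]; positivity
    · rw [powCoeff_rec ht, abs_neg]
      refine (Finset.abs_sum_le_sum_abs _ _).trans ?_
      rcases Nat.eq_zero_or_pos m.totient with h0 | h0
      · simp [h0]
      have hb : ∀ f ∈ Finset.range m.totient,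
          |(cyclotomic m ℤ).coeff (m.totient - 1 - f) * powCoeff m (t - 1 - f) e| ≤
          2 ^ m.totient * 2 ^ (2 * m.totient * (t - 1)) := by
        intro f hf
        rw [abs_mul]
        refine mul_le_mul (abs_coeff_cyclotomic_le _ _) ((ih _ (by omega)).trans ?_) (abs_nonneg _)
          (by positivity)
        exact pow_le_pow_right₀ (by norm_num) (Nat.mul_le_mul_left _ (by omega))
      refine (Finset.sum_le_card_nsmul _ _ _ hb).trans ?_
      rw [Finset.card_range, nsmul_eq_mul]
      have h1 : ((m.totient : ℕ) : ℤ) ≤ 2 ^ m.totient := by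
        exact_mod_cast (Nat.lt_two_pow_self).le
      have h2 : 2 * m.totient * t = m.totient + (m.totient + 2 * m.totient * (t - 1)) := by
        obtain ⟨s, rfl⟩ : ∃ s, t = s + 1 := ⟨t - 1, by omega⟩
        rw [Nat.add_sub_cancel]
        ring
      rw [h2, pow_add, pow_add]
      exact mul_le_mul_of_nonneg_right h1 (by positivity)

/-! ### The reversed cyclotomic polynomial as a product of power series -/

theorem isUnit_one_sub_X_pow {d : ℕ} (hd : 0 < d) :
    IsUnit (1 - PowerSeries.X ^ d : PowerSeries ℤ) := by
  rw [PowerSeries.isUnit_iff_constantCoeff]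
  simp [hd.ne']

/-- The unit `1 - X ^ d` of `ℤ⟦X⟧`, for `d > 0`. -/
noncomputable def oneSubXPow (d : ℕ) : (PowerSeries ℤ)ˣ :=
  if h : 0 < d then (isUnit_one_sub_X_pow h).unit else 1

theorem coe_oneSubXPow {d : ℕ} (hd : 0 < d) :
    ((oneSubXPow d : (PowerSeries ℤ)ˣ) : PowerSeries ℤ) = 1 - PowerSeries.X ^ d := by
  rw [oneSubXPow, dif_pos hd]; rfl

/-- The product of `(1 - X ^ d) ^ μ(m / d)` over the divisors `d ≤ D` of `m`. -/
noncomputable def partialCyc (m D : ℕ) : (PowerSeries ℤ)ˣ :=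
  ∏ d ∈ Finset.range D, if (d + 1) ∣ m then oneSubXPow (d + 1) ^ moebius (m / (d + 1)) else 1

theorem reverse_prod' {ι : Type*} (s : Finset ι) (f : ι → ℤ[X]) :
    (∏ i ∈ s, f i).reverse = ∏ i ∈ s, (f i).reverse := by
  classical
  induction s using Finset.induction_on with
  | empty => simpa using reverse_C (1 : ℤ)
  | insert a s ha ih => rw [Finset.prod_insert ha, Finset.prod_insert ha, reverse_mul_of_domain, ih]

theorem reverse_X_pow_sub_one {m : ℕ} (hm : 0 < m) : (X ^ m - 1 : ℤ[X]).reverse = 1 - X ^ m := by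
  have hd : (X ^ m - 1 : ℤ[X]).natDegree = m := by
    have := natDegree_X_pow_sub_C (R := ℤ) (n := m) (r := 1)
    simpa using this
  ext k
  rw [coeff_reverse, hd]
  simp only [coeff_sub, coeff_X_pow, coeff_one]
  rcases le_or_gt k m with hk | hk
  · rw [revAt_le hk]
    rcases eq_or_ne k 0 with rfl | h0
    · simp [hm.ne', hm.ne]
    · rcases eq_or_ne k m with rfl | h1
      · simp [h0, h0.symm]
      · have e1 : m - k ≠ m := by omega
        have e2 : m - k ≠ 0 := by omega
        simp [h0, h1, e1, e2]
  · rw [revAt_eq_self_of_lt hk]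
    have e1 : k ≠ 0 := by omega
    simp [hk.ne', e1]

/-- Reversal turns `X ^ n - 1 = ∏ Φ_d` into an identity between power series with constant
coefficient `1`. These are units of `ℤ⟦X⟧`, so Möbius inversion applies in the unit group. No
polynomial division is needed. -/
theorem coe_partialCyc {m : ℕ} (hm : 0 < m) :
    ((partialCyc m m : (PowerSeries ℤ)ˣ) : PowerSeries ℤ) =
      ((cyclotomic m ℤ).reverse : PowerSeries ℤ) := by
  have hunit : ∀ d, IsUnit (((cyclotomic d ℤ).reverse : ℤ[X]) : PowerSeries ℤ) := fun d => by
    rw [PowerSeries.isUnit_iff_constantCoeff]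
    simp [(cyclotomic.monic d ℤ).leadingCoeff]
  have key := (prod_eq_iff_prod_pow_moebius_eq (f := fun d => (hunit d).unit) (g := oneSubXPow)).1 ?_
    m hm
  · have h2 : partialCyc m m = ∏ x ∈ m.divisorsAntidiagonal, oneSubXPow x.snd ^ moebius x.fst := by
      rw [Nat.prod_divisorsAntidiagonal' (f := fun a b => oneSubXPow b ^ moebius a), partialCyc,
        ← Finset.prod_filter, Finset.prod_filter, Finset.prod_range (fun d => if (d + 1) ∣ m then
          oneSubXPow (d + 1) ^ moebius (m / (d + 1)) else 1),
        ← Finset.prod_range (fun d => if (d + 1) ∣ m then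
          oneSubXPow (d + 1) ^ moebius (m / (d + 1)) else 1)]
      rw [Nat.divisors, Finset.prod_filter, Finset.prod_Ico_eq_prod_range]
      refine Finset.prod_congr rfl fun d _ => ?_
      rw [add_comm 1 d]
    rw [h2, key]
    rfl
  · intro n hn
    ext1
    rw [Units.coe_prod, coe_oneSubXPow hn]
    have h3 := congrArg reverse (prod_cyclotomic_eq_X_pow_sub_one hn ℤ)
    rw [reverse_prod', reverse_X_pow_sub_one hn] at h3
    have h4 := congrArg (coeToPowerSeries.ringHom (R := ℤ)) h3
    rw [map_prod] at h4
    simpa using h4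

theorem coeff_partialCyc {m k : ℕ} (hm : 0 < m) (hk : k ≤ m.totient) :
    PowerSeries.coeff k (partialCyc m m : PowerSeries ℤ) =
      (cyclotomic m ℤ).coeff (m.totient - k) := by
  rw [coe_partialCyc hm, Polynomial.coeff_coe, coeff_reverse, natDegree_cyclotomic, revAt_le hk]

theorem coeff_mul_one_sub_X_pow (F : PowerSeries ℤ) (d k : ℕ) :
    PowerSeries.coeff k (F * (1 - PowerSeries.X ^ d)) =
      PowerSeries.coeff k F - if d ≤ k then PowerSeries.coeff (k - d) F else 0 := by
  rw [mul_sub, mul_one, map_sub, PowerSeries.coeff_mul_X_pow']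

/-- The identity `∑_{d ∣ n} μ(d) = [n = 1]`, solved for the largest divisor. It gives `μ`
recursively without factoring. -/
theorem moebius_eq_sub_sum {n : ℕ} (hn : 0 < n) :
    moebius n = (if n = 1 then 1 else 0) -
      ∑ d ∈ Finset.range n, if d ∣ n then moebius d else 0 := by
  have h : ∑ d ∈ n.divisors, moebius d = if n = 1 then 1 else 0 := by
    rw [← coe_mul_zeta_apply, moebius_mul_coe_zeta, one_apply]
  rw [← h, ← Nat.cons_self_properDivisors hn.ne', Finset.sum_cons, Nat.properDivisors,
    Finset.sum_filter]
  have : ∑ d ∈ Finset.range n, (if d ∣ n then moebius d else 0) =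
      ∑ d ∈ Finset.Ico 1 n, if d ∣ n then moebius d else 0 := by
    rw [Finset.range_eq_Ico, Finset.sum_eq_sum_Ico_succ_bot hn]
    simp [hn.ne']
  rw [this]
  ring

end Cyclotomic

/-! ### Units modulo `m` and a primitive root modulo `q` -/

/-- The `j`-th number that is coprime to `m`. -/
noncomputable def unitAt (m j : ℕ) : ℕ := Nat.nth (Nat.Coprime m) j

/-- Infinitude keeps `Nat.nth` free of default values. -/
theorem infinite_coprime {m : ℕ} (hm : 0 < m) : {w | Nat.Coprime m w}.Infinite :=
  Set.infinite_of_injective_forall_mem (f := fun k : ℕ => m * k + 1)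
    (fun a b h => Nat.eq_of_mul_eq_mul_left hm (Nat.succ_injective h)) fun k => by simp

theorem coprime_unitAt {m : ℕ} (hm : 0 < m) (j : ℕ) : Nat.Coprime m (unitAt m j) :=
  Nat.nth_mem_of_infinite (infinite_coprime hm) j

theorem unitAt_injective {m : ℕ} (hm : 0 < m) : Function.Injective (unitAt m) :=
  Nat.nth_injective (infinite_coprime hm)

theorem count_coprime (m : ℕ) : Nat.count (Nat.Coprime m) m = m.totient :=
  Nat.count_eq_card_filter_range _ _

theorem unitAt_lt {m j : ℕ} (hj : j < m.totient) : unitAt m j < m :=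
  Nat.nth_lt_of_lt_count (by rwa [count_coprime])

/-- The inverse modulo `m` of the `j`-th number coprime to `m`. -/
noncomputable def unitInv (m j : ℕ) : ℕ := ((unitAt m j : ZMod m)⁻¹).val

theorem unitInv_lt {m : ℕ} (hm : 0 < m) (j : ℕ) : unitInv m j < m := by
  have : NeZero m := ⟨hm.ne'⟩
  exact ZMod.val_lt _

theorem cast_unitInv {m : ℕ} (hm : 0 < m) (j : ℕ) :
    (unitInv m j : ZMod m) = (unitAt m j : ZMod m)⁻¹ := by
  have : NeZero m := ⟨hm.ne'⟩
  exact ZMod.natCast_zmod_val _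

theorem cast_unitAt_mul_unitInv {m : ℕ} (hm : 0 < m) (j : ℕ) :
    (unitAt m j : ZMod m) * (unitInv m j : ZMod m) = 1 := by
  rw [cast_unitInv hm]
  exact ZMod.coe_mul_inv_eq_one _ (coprime_unitAt hm j).symm

/-- The numbers coprime to `m` at the positions below `φ(m)` represent the units modulo `m`. -/
noncomputable def unitEquiv {m : ℕ} (hm : 0 < m) : Fin m.totient ≃ (ZMod m)ˣ :=
  have : NeZero m := ⟨hm.ne'⟩
  Equiv.ofBijective (fun j => ZMod.unitOfCoprime (unitAt m j) (coprime_unitAt hm j).symm) (by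
    refine (Fintype.bijective_iff_injective_and_card _).2 ⟨fun i j h => ?_, ?_⟩
    · have h1 := congrArg Units.val h
      rw [ZMod.coe_unitOfCoprime, ZMod.coe_unitOfCoprime, ZMod.natCast_eq_natCast_iff'] at h1
      rw [Nat.mod_eq_of_lt (unitAt_lt i.2), Nat.mod_eq_of_lt (unitAt_lt j.2)] at h1
      exact Fin.ext (unitAt_injective hm h1)
    · rw [Fintype.card_fin, ZMod.card_units_eq_totient])

theorem coe_unitEquiv {m : ℕ} (hm : 0 < m) (j : Fin m.totient) :
    ((unitEquiv hm j : (ZMod m)ˣ) : ZMod m) = (unitAt m j : ZMod m) := rfl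

theorem coe_unitEquiv_inv {m : ℕ} (hm : 0 < m) (j : Fin m.totient) :
    (((unitEquiv hm j)⁻¹ : (ZMod m)ˣ) : ZMod m) = (unitInv m j : ZMod m) := by
  rw [cast_unitInv hm, ← coe_unitEquiv hm, ZMod.inv_coe_unit]

/-- The largest `y < x` with `Φ_m(y) ≡ 0 (mod q)` (or `0`). -/
noncomputable def lastRoot (m q : ℕ) : ℕ → ℕ
  | 0 => 0
  | x + 1 => if (Polynomial.cyclotomic m ℤ).eval (x : ℤ) % q = 0 then x else lastRoot m q x

/-- A primitive `m`-th root of unity modulo `q`. -/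
noncomputable def rootMod (m q : ℕ) : ℕ := lastRoot m q q

theorem lastRoot_lt {m q x : ℕ} (hx : 0 < x) : lastRoot m q x < x := by
  induction x with
  | zero => omega
  | succ x ih =>
    rw [lastRoot]
    split_ifs
    · omega
    · rcases Nat.eq_zero_or_pos x with rfl | h
      · rw [lastRoot]; omega
      · have := ih h; omega

theorem eval_lastRoot {m q x y : ℕ} (hy : y < x)
    (h : (Polynomial.cyclotomic m ℤ).eval (y : ℤ) % q = 0) :
    (Polynomial.cyclotomic m ℤ).eval (lastRoot m q x : ℤ) % q = 0 := by
  induction x with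
  | zero => omega
  | succ x ih =>
    rw [lastRoot]
    split_ifs with hx
    · exact hx
    · refine ih ?_
      rcases Nat.lt_succ_iff_lt_or_eq.1 hy with h1 | rfl
      · exact h1
      · exact absurd h hx

theorem rootMod_lt {m q : ℕ} (hq : 0 < q) : rootMod m q < q := lastRoot_lt hq

theorem aeval_cyclotomic {A : Type*} [CommRing A] [IsDomain A] {m : ℕ} (hm : 0 < m) {ρ : A}
    (h : IsPrimitiveRoot ρ m) : Polynomial.aeval ρ (Polynomial.cyclotomic m ℤ) = 0 := by
  rw [← Polynomial.eval_map_algebraMap, Polynomial.map_cyclotomic]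
  exact h.isRoot_cyclotomic hm

theorem pow_eq_one_of_aeval_cyclotomic {A : Type*} [CommRing A] {m : ℕ} {ρ : A}
    (h : Polynomial.aeval ρ (Polynomial.cyclotomic m ℤ) = 0) : ρ ^ m = 1 := by
  obtain ⟨p, hp⟩ := Polynomial.cyclotomic.dvd_X_pow_sub_one m ℤ
  have := congrArg (Polynomial.aeval ρ) hp
  rw [map_mul, h, zero_mul] at this
  simpa [sub_eq_zero] using this

/-- Otherwise `q ∣ m ∣ q - 1`. -/
theorem cast_ne_zero_of_modEq_one {m q : ℕ} [Fact q.Prime] (hmod : q ≡ 1 [MOD m]) :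
    (m : ZMod q) ≠ 0 := by
  have hq : 1 < q := (Fact.out : q.Prime).one_lt
  intro h
  rw [ZMod.natCast_eq_zero_iff] at h
  have h2 : m ∣ q - 1 := (Nat.modEq_iff_dvd' hq.le).1 hmod.symm
  have := Nat.le_of_dvd (by omega) (h.trans h2)
  omega

/-- As `m` is nonzero in `ℤ/q`, the zeros of `Φ_m` modulo `q` are exactly the primitive `m`-th roots
of unity. The exhaustive search finds one, because the cyclic group of units has order `q - 1`, a
multiple of `m`. -/
theorem isPrimitiveRoot_rootMod {m q : ℕ} [Fact q.Prime] (hmod : q ≡ 1 [MOD m]) :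
    IsPrimitiveRoot (rootMod m q : ZMod q) m := by
  have hq : 1 < q := (Fact.out : q.Prime).one_lt
  have h2 : m ∣ q - 1 := (Nat.modEq_iff_dvd' hq.le).1 hmod.symm
  have hne : NeZero (m : ZMod q) := ⟨cast_ne_zero_of_modEq_one hmod⟩
  have hroot (y : ℕ) : (Polynomial.cyclotomic m ℤ).eval (y : ℤ) % q = 0 ↔
      IsPrimitiveRoot (y : ZMod q) m := by
    rw [← Polynomial.isRoot_cyclotomic_iff, Polynomial.IsRoot,
      ← Polynomial.map_cyclotomic_int m (ZMod q), Polynomial.eval_natCast_map,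
      ← Int.dvd_iff_emod_eq_zero, ← ZMod.intCast_zmod_eq_zero_iff_dvd]
    rfl
  obtain ⟨g, hg⟩ := IsCyclic.exists_generator (α := (ZMod q)ˣ)
  have ho : orderOf g = q - 1 := by
    rw [orderOf_eq_card_of_forall_mem_zpowers hg, Nat.card_eq_fintype_card, ZMod.card_units]
  have hp : IsPrimitiveRoot (g : ZMod q) (q - 1) := by
    rw [IsPrimitiveRoot.coe_units_iff, ← ho]
    exact IsPrimitiveRoot.orderOf g
  have hp2 := hp.pow (a := (q - 1) / m) (b := m) (by omega) (Nat.div_mul_cancel h2).symm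
  rw [← hroot]
  refine eval_lastRoot (y := ((g : ZMod q) ^ ((q - 1) / m)).val) (ZMod.val_lt _) ?_
  rw [hroot, ZMod.natCast_zmod_val]
  exact hp2

end MRLWE

noncomputable section

namespace MRLWE

/-! ### The matrices of the reduction -/

variable (P : Params)

theorem Params.n_pos : 0 < P.n := Finset.prod_pos fun i _ => Nat.totient_pos.2 (P.m_pos i)


/-- The digits of a position in the mixed-radix order of the tensor basis. -/
def Params.dig (k : Fin P.n) (a : Fin P.l) : Fin (P.m a).totient := finPiFinEquiv.symm k a

theorem Params.dig_val (k : Fin P.n) (a : Fin P.l) : (P.dig k a : ℕ) =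
    k / (∏ d : Fin a, (P.m (Fin.castLE a.is_lt.le d)).totient) % (P.m a).totient := rfl

variable {P} in
theorem Params.dig_injective {k k' : Fin P.n} (h : ∀ a, P.dig k a = P.dig k' a) : k = k' :=
  finPiFinEquiv.symm.injective (funext h)

/-- Positions are tuples of digits, so this is distributivity. It reduces identities between the `n
× n` matrices to one tensor factor at a time. -/
theorem Params.sum_prod_dig {A : Type*} [CommSemiring A] (f : ∀ a, Fin (P.m a).totient → A) :
    ∑ k, ∏ a, f a (P.dig k a) = ∏ a, ∑ e, f a e := by
  rw [Finset.prod_univ_sum, Fintype.piFinset_univ]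
  exact Equiv.sum_comp finPiFinEquiv.symm (fun x : ∀ a, Fin (P.m a).totient => ∏ a, f a (x a))

/-- A primitive `m_a`-th root of unity modulo `q`. -/
def Params.root (a : Fin P.l) : ZMod P.q := (rootMod (P.m a) P.q : ZMod P.q)

/-- The values of the `n` ring homomorphisms `R → ℤ/q` on the tensor basis of `R`. -/
def crtV (i k : Fin P.n) : ZMod P.q :=
  ∏ a, P.root a ^ (unitAt (P.m a) (P.dig i a) * P.dig k a)

/-- The coordinates of multiples of the `n` primitive idempotents of `R_q`. -/
def crtW (i k : Fin P.n) : ZMod P.q :=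
  ∏ a, ∑ t ∈ Finset.range (P.m a),
    P.root a ^ ((P.m a - 1) * (unitAt (P.m a) (P.dig i a) * t)) * powCoeff (P.m a) t (P.dig k a)

/-- The product of the conductors, modulo `q`. -/
def crtC : ZMod P.q := ∏ a, (P.m a : ZMod P.q)

/-- The matrix of the automorphism of `R` that moves the `j`-th homomorphism to the `i`-th. -/
def autT (i j k k' : Fin P.n) : ℤ :=
  ∏ a, powCoeff (P.m a) ((unitAt (P.m a) (P.dig j a) * unitInv (P.m a) (P.dig i a) *
    P.dig k a) % P.m a) (P.dig k' a)

/-- Row `k` of `autT P i j` expands the image of the `k`-th basis element under `ζ_a ↦ ζ_a ^ (u_j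
u_i⁻¹)`. The identity is that expansion, read at an arbitrary tuple of zeros of the cyclotomic
polynomials. -/
theorem sum_autT {A : Type*} [CommRing A] {ρ : Fin P.l → A}
    (hρ : ∀ a, Polynomial.aeval (ρ a) (Polynomial.cyclotomic (P.m a) ℤ) = 0) (i j k : Fin P.n) :
    ∑ k', (autT P i j k k' : A) * ∏ a, ρ a ^ (P.dig k' a : ℕ) =
      ∏ a, ρ a ^ (unitAt (P.m a) (P.dig j a) * unitInv (P.m a) (P.dig i a) * P.dig k a) := by
  have h1 := P.sum_prod_dig fun (a : Fin P.l) (e : Fin (P.m a).totient) =>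
    (powCoeff (P.m a) ((unitAt (P.m a) (P.dig j a) * unitInv (P.m a) (P.dig i a) *
      P.dig k a) % P.m a) e : A) * ρ a ^ (e : ℕ)
  refine Eq.trans (Finset.sum_congr rfl fun k' _ => ?_) (h1.trans ?_)
  · rw [autT, Int.cast_prod, ← Finset.prod_mul_distrib]
  refine Finset.prod_congr rfl fun a _ => ?_
  rw [Fin.sum_univ_eq_sum_range (fun e => (powCoeff (P.m a) ((unitAt (P.m a) (P.dig j a) *
    unitInv (P.m a) (P.dig i a) * P.dig k a) % P.m a) e : A) * ρ a ^ e),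
    ← pow_eq_sum_powCoeff (P.m_pos a) (hρ a)]
  exact (pow_eq_pow_mod _ (pow_eq_one_of_aeval_cyclotomic (hρ a))).symm

/-- The permutation of the homomorphisms `R → ℤ/q` by an automorphism of `R`. -/
def crtPerm (i j : Fin P.n) : Equiv.Perm (Fin P.n) :=
  finPiFinEquiv.symm.trans ((Equiv.piCongrRight fun a =>
    (unitEquiv (P.m_pos a)).trans ((Equiv.mulRight (unitEquiv (P.m_pos a) (P.dig j a) *
      (unitEquiv (P.m_pos a) (P.dig i a))⁻¹)).trans (unitEquiv (P.m_pos a)).symm)).trans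
    finPiFinEquiv)

theorem unitEquiv_dig_crtPerm (i j b : Fin P.n) (a : Fin P.l) :
    unitEquiv (P.m_pos a) (P.dig (crtPerm P i j b) a) = unitEquiv (P.m_pos a) (P.dig b a) *
      (unitEquiv (P.m_pos a) (P.dig j a) * (unitEquiv (P.m_pos a) (P.dig i a))⁻¹) := by
  simp [Params.dig, crtPerm]

theorem crtPerm_self (i j : Fin P.n) : crtPerm P i j i = j := by
  refine Params.dig_injective fun a => (unitEquiv (P.m_pos a)).injective ?_
  rw [unitEquiv_dig_crtPerm, mul_left_comm, mul_inv_cancel, mul_one]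

theorem crtPerm_symm (i j b : Fin P.n) : crtPerm P j i (crtPerm P i j b) = b := by
  refine Params.dig_injective fun a => (unitEquiv (P.m_pos a)).injective ?_
  rw [unitEquiv_dig_crtPerm, unitEquiv_dig_crtPerm]
  group

variable [Fact P.q.Prime]

theorem isPrimitiveRoot_root (hmod : ∀ i, P.q ≡ 1 [MOD P.m i]) (a : Fin P.l) :
    IsPrimitiveRoot (P.root a) (P.m a) :=
  isPrimitiveRoot_rootMod (hmod a)

theorem isPrimitiveRoot_root_pow (hmod : ∀ i, P.q ≡ 1 [MOD P.m i])
    (i : Fin P.n) (a : Fin P.l) :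
    IsPrimitiveRoot (P.root a ^ unitAt (P.m a) (P.dig i a)) (P.m a) :=
  (isPrimitiveRoot_root P hmod a).pow_of_coprime _ (coprime_unitAt (P.m_pos a) _).symm

theorem crtC_ne_zero (hmod : ∀ i, P.q ≡ 1 [MOD P.m i]) : crtC P ≠ 0 :=
  Finset.prod_ne_zero_iff.2 fun a _ => cast_ne_zero_of_modEq_one (hmod a)

/-- In each factor `crtW` describes `∑_t ρ^(-u' t) ζ^t`, the exponent `m - 1` playing the role of
`-1`. Its value at `ζ = ρ^u` is a geometric sum, equal to `m` if `u = u'` and to `0` otherwise.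
Hence `crtW` inverts `crtV` up to the constant `crtC`. -/
theorem sum_crtV_mul_crtW (hmod : ∀ i, P.q ≡ 1 [MOD P.m i]) (i i' : Fin P.n) :
    ∑ k, crtV P i k * crtW P i' k = if i = i' then crtC P else 0 := by
  have h1 := P.sum_prod_dig fun (a : Fin P.l) (e : Fin (P.m a).totient) =>
    P.root a ^ (unitAt (P.m a) (P.dig i a) * (e : ℕ)) * ∑ t ∈ Finset.range (P.m a),
      P.root a ^ ((P.m a - 1) * (unitAt (P.m a) (P.dig i' a) * t)) *
        (powCoeff (P.m a) t e : ZMod P.q)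
  refine Eq.trans (Finset.sum_congr rfl fun k _ => ?_) (h1.trans ?_)
  · rw [crtV, crtW, ← Finset.prod_mul_distrib]
  have h2 : ∀ a, (∑ e : Fin (P.m a).totient,
      P.root a ^ (unitAt (P.m a) (P.dig i a) * e) * ∑ t ∈ Finset.range (P.m a),
          P.root a ^ ((P.m a - 1) * (unitAt (P.m a) (P.dig i' a) * t)) *
            (powCoeff (P.m a) t e : ZMod P.q)) =
      if P.dig i a = P.dig i' a then (P.m a : ZMod P.q) else 0 := by
    intro a
    have hr := isPrimitiveRoot_root P hmod a
    set u := unitAt (P.m a) (P.dig i a) with hu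
    set u' := unitAt (P.m a) (P.dig i' a) with hu'
    have h3 : ∀ t, (P.root a ^ u) ^ t = ∑ e : Fin (P.m a).totient,
        (powCoeff (P.m a) t e : ZMod P.q) * (P.root a ^ u) ^ (e : ℕ) := fun t => by
      rw [Fin.sum_univ_eq_sum_range (fun e => (powCoeff (P.m a) t e : ZMod P.q) *
        (P.root a ^ u) ^ e)]
      exact pow_eq_sum_powCoeff (P.m_pos a)
        (aeval_cyclotomic (P.m_pos a) (isPrimitiveRoot_root_pow P hmod i a)) t
    -- After exchanging the sums, the inner sum over the power basis is `(ρ^u)^t`.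
    have h4 : (∑ e : Fin (P.m a).totient, P.root a ^ (u * e) * ∑ t ∈ Finset.range (P.m a),
        P.root a ^ ((P.m a - 1) * (u' * t)) * (powCoeff (P.m a) t e : ZMod P.q)) =
        ∑ t ∈ Finset.range (P.m a), (P.root a ^ (u + (P.m a - 1) * u')) ^ t := by
      simp only [Finset.mul_sum]
      rw [Finset.sum_comm]
      refine Finset.sum_congr rfl fun t _ => ?_
      have h5 : (P.root a ^ (u + (P.m a - 1) * u')) ^ t =
          P.root a ^ ((P.m a - 1) * (u' * t)) * (P.root a ^ u) ^ t := by
        rw [← pow_mul, ← pow_mul, ← pow_add]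
        congr 1
        ring
      rw [h5, h3, Finset.mul_sum]
      refine Finset.sum_congr rfl fun e _ => ?_
      rw [← pow_mul]
      ring
    rw [h4]
    have hm1 : P.m a - 1 + 1 = P.m a := Nat.sub_add_cancel (P.m_pos a)
    split_ifs with hd
    · have h6 : P.root a ^ (u + (P.m a - 1) * u') = 1 := by
        have : u + (P.m a - 1) * u' = P.m a * u := by
          rw [hu', ← hd, ← hu]
          nth_rewrite 2 [← hm1]
          ring
        rw [this, pow_mul, hr.pow_eq_one, one_pow]
      simp [h6]
    · have h6 : P.root a ^ (u + (P.m a - 1) * u') ≠ 1 := by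
        intro h7
        have h8 : P.root a ^ u = P.root a ^ u' := by
          have h9 : P.root a ^ (u + (P.m a - 1) * u') * P.root a ^ u' = P.root a ^ u := by
            rw [← pow_add, add_assoc, ← Nat.succ_mul, Nat.succ_eq_add_one, hm1, pow_add, pow_mul,
              hr.pow_eq_one, one_pow, mul_one]
          rw [← h9, h7, one_mul]
        exact hd (Fin.ext (unitAt_injective (P.m_pos a)
          (hr.pow_inj (unitAt_lt (P.dig i a).2) (unitAt_lt (P.dig i' a).2) h8)))
      have h7 : (P.root a ^ (u + (P.m a - 1) * u')) ^ P.m a = 1 := by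
        rw [← pow_mul, mul_comm, pow_mul, hr.pow_eq_one, one_pow]
      have h8 := geom_sum_mul (P.root a ^ (u + (P.m a - 1) * u')) (P.m a)
      rw [h7, sub_self] at h8
      exact (mul_eq_zero.1 h8).resolve_right (sub_ne_zero.2 h6)
  simp only [h2]
  split_ifs with hi
  · subst hi
    simp [crtC]
  · obtain ⟨a, ha⟩ : ∃ a, P.dig i a ≠ P.dig i' a := by
      by_contra! h
      exact hi (Params.dig_injective h)
    exact Finset.prod_eq_zero (Finset.mem_univ a) (if_neg ha)

/-- Composing the `b`-th homomorphism with the automorphism multiplies its exponents by `u_j u_i⁻¹`.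
Exponents matter only modulo the conductors, so the result is another homomorphism of the list. -/
theorem sum_autT_mul_crtV (hmod : ∀ i, P.q ≡ 1 [MOD P.m i]) (i j b k : Fin P.n) :
    ∑ k', (autT P i j k k' : ZMod P.q) * crtV P b k' = crtV P (crtPerm P i j b) k := by
  have h := sum_autT P (fun a => aeval_cyclotomic (P.m_pos a) (isPrimitiveRoot_root_pow P hmod b a))
    i j k
  simp only [← pow_mul] at h
  refine h.trans (Finset.prod_congr rfl fun a _ => ?_)
  have hu := congrArg Units.val (unitEquiv_dig_crtPerm P i j b a)
  rw [Units.val_mul, Units.val_mul, coe_unitEquiv_inv, coe_unitEquiv, coe_unitEquiv,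
    coe_unitEquiv] at hu
  have h2 : unitAt (P.m a) (P.dig b a) * (unitAt (P.m a) (P.dig j a) *
      unitInv (P.m a) (P.dig i a) * P.dig k a) ≡
      unitAt (P.m a) (P.dig (crtPerm P i j b) a) * P.dig k a [MOD P.m a] := by
    rw [← ZMod.natCast_eq_natCast_iff]
    push_cast
    rw [hu]
    ring
  have hr := (isPrimitiveRoot_root P hmod a).pow_eq_one
  rw [pow_eq_pow_mod _ hr, h2, ← pow_eq_pow_mod _ hr]

end MRLWE

end

/-! ### Programs for the number-theoretic tables and for the matrices, with proofs of correctness.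
-/

namespace MRLWE

/-! ### Programs for the tables of one cyclotomic factor

Variables: `0` the number `l` of factors, `1` the modulus `q`, `4` the index `a` of a factor,
`5` its conductor `m`, `6` the totient `φ(m)`. Arrays: `0` the conductors, `2` the totients,
`3` the units modulo `m` and `4` their inverses, `5` the Möbius function, `6` the coefficients of
the reversed cyclotomic polynomial, `7` the powers of `ζ_m` in the power basis, `8` the powers of a
primitive root modulo `q`. -/

/-- The indicator of equality. -/
def Expr.delta (a b : Expr) : Expr := 1 / (1 + (a - b) * (a - b))

theorem Expr.eval_delta (a b : Expr) (st : State) :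
    (Expr.delta a b).eval st = if a.eval st = b.eval st then 1 else 0 := by
  simp only [Expr.delta, Expr.eval_div, Expr.eval_add, Expr.eval_mul, Expr.eval_sub, Expr.eval_one]
  split_ifs with h
  · simp [h]
  · have h1 : 0 < (a.eval st - b.eval st) * (a.eval st - b.eval st) :=
      mul_self_pos.2 (sub_ne_zero.2 h)
    exact Int.ediv_eq_zero_of_lt (by norm_num) (by omega)

/-- Inside expressions there is no test; integer division provides the indicator of zero. -/
theorem one_ediv_one_add {z : ℤ} (hz : 0 ≤ z) : 1 / (1 + z) = if z = 0 then 1 else 0 := by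
  split_ifs with h
  · simp [h]
  · exact Int.ediv_eq_zero_of_lt (by norm_num) (by omega)

/-- The table of the Möbius function below `q`. -/
def progMu : Prog :=
  .for 7 (.var 1) (.seq (.sum 9 11 (.var 7) (1 / (1 + .var 7 % .var 9) * .get 5 (.var 9)))
    (.set 5 (.var 7) (.delta (.var 7) 1 - .var 11)))

/-- The table of the units modulo `m`. -/
def progUnits : Prog :=
  .seq (.assign 6 0) (.for 7 (.var 5) (.for 8 (.var 5)
    (.cond (1 - (.var 7 * .var 8 - 1) % .var 5)
      (.seq (.set 3 (.var 4 * .var 1 + .var 6) (.var 7))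
        (.seq (.set 4 (.var 4 * .var 1 + .var 6) (.var 8)) (.assign 6 (.var 6 + 1))))
      .skip)))

/-- Multiplication of a power series by `1 - X ^ d`. -/
def progMulSeries : Prog :=
  .for 10 (.var 5 - .var 9)
    (.set 6 (.var 5 - .var 10) (.get 6 (.var 5 - .var 10) - .get 6 (.var 5 - .var 10 - (.var 9 + 1))))

/-- Division of a power series by `1 - X ^ d`. -/
def progDivSeries : Prog :=
  .for 10 (.var 5 - .var 9)
    (.set 6 (.var 9 + 1 + .var 10) (.get 6 (.var 9 + 1 + .var 10) + .get 6 (.var 10)))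

/-- The coefficients of the reversed cyclotomic polynomial. -/
def progCyc : Prog :=
  .seq (.for 10 (.var 5 + 1) (.set 6 (.var 10) (1 / (1 + .var 10))))
    (.for 9 (.var 5) (.cond (1 - .var 5 % (.var 9 + 1))
      (.cond (.get 5 (.var 5 / (.var 9 + 1))) progMulSeries
        (.cond (0 - .get 5 (.var 5 / (.var 9 + 1))) progDivSeries .skip)) .skip))

/-- The coordinates of the powers of `ζ_m`. -/
def progPowers : Prog :=
  .for 7 (.var 5) (.for 12 (.var 6) (.cond (.var 6 - .var 7)
    (.set 7 ((.var 4 * .var 1 + .var 7) * .var 1 + .var 12) (.delta (.var 7) (.var 12)))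
    (.seq (.sum 10 11 (.var 6) (.get 6 (.var 10 + 1) *
        .get 7 ((.var 4 * .var 1 + (.var 7 - 1 - .var 10)) * .var 1 + .var 12)))
      (.set 7 ((.var 4 * .var 1 + .var 7) * .var 1 + .var 12) (0 - .var 11)))))

/-- A primitive `m`-th root of unity modulo `q` and its powers. -/
def progRoot : Prog :=
  .seq (.assign 15 0) (.seq
    (.for 13 (.var 1) (.seq (.assign 14 1) (.seq (.assign 11 0) (.seq
      (.for 12 (.var 6 + 1) (.seq
        (.assign 11 ((.var 11 + .get 6 (.var 6 - .var 12) * .var 14) % .var 1))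
        (.assign 14 (.var 14 * .var 13 % .var 1))))
      (.cond (1 - .var 11) (.assign 15 (.var 13)) .skip)))))
    (.seq (.assign 14 1) (.for 7 (.var 5) (.seq
      (.set 8 (.var 4 * .var 1 + .var 7) (.var 14))
      (.assign 14 (.var 14 * .var 15 % .var 1))))))

variable {env : Env} {Z : ℕ}

open ArithmeticFunction in
theorem progMu_spec (hZ : 100 ≤ Z) {q : ℕ} (hq : q ≤ Z) {st : State} (h1 : st.var 1 = q) :
    Ex env Z 17 progMu st fun st' => ∀ d < q, st'.arr 5 d = moebius d := by
  refine Ex.for hZ (a := 14) (b := 1) q (by simpa using hq) (by norm_num) (by norm_num) rfl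
    (by decide) (by intro st' hA; exact ⟨(hA.var 1 rfl).trans h1, trivial⟩)
    (fun i st' => ∀ d < i, st'.arr 5 d = moebius d) (by simp) ?_
  intro i hi st' hA hv hI
  refine Ex.seq hZ (Ex.sum hZ (b := 1) i (by simpa using hi.le.trans hq) (by norm_num) (by norm_num)
    (by decide) (by intro st2 hA2; exact ⟨(hA2.var 7 rfl).trans hv, trivial⟩)
    (fun d => if d ∣ i then moebius d else 0) ?_) ?_
  · intro d hd st2 hA2 hv2
    have e1 : st2.var 7 = i := (hA2.var 7 rfl).trans hv
    have e2 : st2.arr 5 d = moebius d := by rw [hA2.arr 5 rfl, hI d hd]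
    refine ⟨?_, ?_⟩
    · simp only [Expr.eval_mul, Expr.eval_div, Expr.eval_one, Expr.eval_add, Expr.eval_mod,
        Expr.eval_var, Expr.eval_get, e1, hv2, e2]
      -- The index `d = 0` is harmless: `i % 0 = i` is nonzero because `d < i`, and `0` does not
      -- divide `i`.
      rw [one_ediv_one_add (by exact_mod_cast Nat.zero_le (i % d))]
      by_cases h : d ∣ i
      · have : (i : ℤ) % d = 0 := Int.emod_eq_zero_of_dvd (by exact_mod_cast h)
        simp [h, this]
      · have : ¬ (i : ℤ) % d = 0 := fun h' => h (by exact_mod_cast Int.dvd_of_emod_eq_zero h')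
        simp [h, this]
    · have : bits (moebius d) ≤ Z ^ 6 := by
        refine (bits_le_natAbs _).trans ?_
        have := abs_le.1 (abs_moebius_le_one (n := d))
        have h6 : 1 ≤ Z ^ 6 := Nat.one_le_pow _ _ (by omega)
        omega
      simp [e1, e2, hv2, bits_one_le hZ, this, bits_natCast_le (hi.le.trans hq),
        bits_natCast_le (hd.le.trans (hi.le.trans hq))]
  · intro st2 hA2 h2
    have e1 : st2.var 7 = i := (hA2.var 7 rfl).trans hv
    refine Ex.le hZ (Ex.set hZ (by decide) trivial ?_ ?_) (by norm_num)
    · simp [Expr.delta, e1, bits_one_le hZ, bits_natCast_le (hi.le.trans hq)]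
    · intro d hd
      simp only [State.setVar_arr, State.setArr_arr, Expr.eval_var, e1, Expr.eval_sub,
        Expr.eval_delta, Expr.eval_one, h2, true_and, Nat.cast_inj, Nat.cast_eq_one]
      split_ifs with hdi hi1
      · rw [hdi, moebius_eq_sub_sum (by omega), if_pos hi1]
      · rcases Nat.eq_zero_or_pos i with rfl | h0
        · simp [hdi]
        · rw [hdi, moebius_eq_sub_sum h0, if_neg hi1]
      · rw [hA2.arr 5 rfl, hI d (by omega)]

theorem mul_sub_one_emod_eq_zero_iff {m w w' : ℕ} (hm : 0 < m) (hw' : w' < m) :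
    (((w : ℤ) * w' - 1) % m = 0) ↔ Nat.Coprime m w ∧ w' = ((w : ZMod m)⁻¹).val := by
  have : NeZero m := ⟨hm.ne'⟩
  have h1 : (((w : ℤ) * w' - 1) % m = 0) ↔ (w : ZMod m) * w' = 1 := by
    rw [← Int.dvd_iff_emod_eq_zero, ← ZMod.intCast_zmod_eq_zero_iff_dvd, ← sub_eq_zero (b := (1 : ZMod m))]
    push_cast
    rfl
  rw [h1]
  constructor
  · intro h
    have hc : Nat.Coprime w m := (ZMod.isUnit_iff_coprime w m).1 (IsUnit.of_mul_eq_one _ h)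
    refine ⟨hc.symm, ?_⟩
    have h2 : (w' : ZMod m) = (w : ZMod m)⁻¹ := by
      have h3 := ZMod.coe_mul_inv_eq_one w hc
      calc (w' : ZMod m) = (w : ZMod m) * w' * (w : ZMod m)⁻¹ := by rw [mul_right_comm, h3, one_mul]
        _ = _ := by rw [h, one_mul]
    rw [← h2, ZMod.val_natCast, Nat.mod_eq_of_lt hw']
  · rintro ⟨hc, h⟩
    rw [h, ZMod.natCast_zmod_val]
    exact ZMod.coe_mul_inv_eq_one w hc.symm

/-- All pairs `(w, w')` below `m` are tested for `w * w' ≡ 1`. A unit has exactly one partner, so it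
is recorded once, together with its inverse, and the counter ends at `φ(m)`. Entries below `a * q`
belong to earlier factors and survive. -/
theorem progUnits_spec (hZ : 100 ≤ Z) {a m q : ℕ} (ha : a ≤ Z) (hm : 0 < m) (hmq : m < q)
    (hq : q ≤ Z) {st : State} (h1 : st.var 1 = q) (h4 : st.var 4 = a) (h5 : st.var 5 = m) :
    Ex env Z 20 progUnits st fun st' => st'.var 6 = m.totient ∧
      (∀ z < (a : ℤ) * q, st'.arr 3 z = st.arr 3 z ∧ st'.arr 4 z = st.arr 4 z) ∧
      ∀ j < m.totient, st'.arr 3 ((a : ℤ) * q + j) = unitAt m j ∧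
        st'.arr 4 ((a : ℤ) * q + j) = unitInv m j := by
  let J : ℕ → State → Prop := fun c st' => st'.var 6 = c ∧
      (∀ z < (a : ℤ) * q, st'.arr 3 z = st.arr 3 z ∧ st'.arr 4 z = st.arr 4 z) ∧
      ∀ j < c, st'.arr 3 ((a : ℤ) * q + j) = unitAt m j ∧ st'.arr 4 ((a : ℤ) * q + j) = unitInv m j
  refine Ex.seq hZ (Q := J 0) (Ex.le hZ (Ex.assign hZ (by decide) trivial ?_) (by norm_num)) ?_
  · exact ⟨by simp, fun z _ => ⟨rfl, rfl⟩, by simp⟩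
  intro st1 hA1 hJ1
  have hfin : Nat.count (Nat.Coprime m) m = m.totient := count_coprime m
  refine Ex.conseq (Ex.for hZ (a := 16) (b := 1) m (by simpa using hmq.le.trans hq) (by norm_num)
    (by norm_num) rfl (by decide) ?_ (fun w => J (Nat.count (Nat.Coprime m) w)) ?_ ?_)
    (fun st' _ h => hfin ▸ h)
  · intro st' hA
    exact ⟨by rw [Expr.eval_var, hA.var 5 rfl, hA1.var 5 rfl, h5], trivial⟩
  · exact ⟨by simpa using hJ1.1, hJ1.2.1, by simp⟩
  intro w hw st2 hA2 hv2 hJ2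
  set inv := ((w : ZMod m)⁻¹).val with hinv
  have : NeZero m := ⟨hm.ne'⟩
  have hinvlt : inv < m := ZMod.val_lt _
  -- The number of units recorded when partners below `i` have been tried: `w` counts as soon as its
  -- inverse has been passed.
  let cnt : ℕ → ℕ := fun i =>
    Nat.count (Nat.Coprime m) w + if Nat.Coprime m w ∧ inv < i then 1 else 0
  have e15 : ∀ st', Agree (.for 7 (.var 5) (.for 8 (.var 5)
    (.cond (1 - (.var 7 * .var 8 - 1) % .var 5)
      (.seq (.set 3 (.var 4 * .var 1 + .var 6) (.var 7))
        (.seq (.set 4 (.var 4 * .var 1 + .var 6) (.var 8)) (.assign 6 (.var 6 + 1))))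
      .skip))) st1 st' → st'.var 1 = q ∧ st'.var 4 = a ∧ st'.var 5 = m := fun st' hA =>
    ⟨by rw [hA.var 1 rfl, hA1.var 1 rfl, h1], by rw [hA.var 4 rfl, hA1.var 4 rfl, h4],
      by rw [hA.var 5 rfl, hA1.var 5 rfl, h5]⟩
  refine Ex.conseq (Ex.for hZ (a := 13) (b := 1) m (by simpa using hmq.le.trans hq) (by norm_num)
    (by norm_num) rfl (by decide) ?_ (fun i => J (cnt i)) ?_ ?_) ?_
  · intro st' hA
    exact ⟨by rw [Expr.eval_var, hA.var 5 rfl, (e15 _ hA2).2.2], trivial⟩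
  · have : cnt 0 = Nat.count (Nat.Coprime m) w := by simp [cnt]
    rw [this]
    exact ⟨by simpa using hJ2.1, hJ2.2.1, hJ2.2.2⟩
  · intro i hi st3 hA3 hv3 hJ3
    obtain ⟨f1, f4, f5⟩ := e15 _ hA2
    have g1 : st3.var 1 = q := by rw [hA3.var 1 rfl, f1]
    have g4 : st3.var 4 = a := by rw [hA3.var 4 rfl, f4]
    have g5 : st3.var 5 = m := by rw [hA3.var 5 rfl, f5]
    have g7 : st3.var 7 = w := by rw [hA3.var 7 rfl, hv2]
    have g6 : st3.var 6 = cnt i := hJ3.1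
    have bq := bits_natCast_le hq
    have ba := bits_natCast_le ha
    have bw := bits_natCast_le (hw.le.trans (hmq.le.trans hq))
    have bi := bits_natCast_le (hi.le.trans (hmq.le.trans hq))
    have htest : (0 < (1 - ((w : ℤ) * i - 1) % m)) ↔ Nat.Coprime m w ∧ i = inv := by
      rw [hinv, ← mul_sub_one_emod_eq_zero_iff hm hi]
      have := Int.emod_nonneg ((w : ℤ) * i - 1) (by exact_mod_cast hm.ne' : (m : ℤ) ≠ 0)
      omega
    refine Ex.cond hZ (by decide) (by simp [g7, hv3, bw, bi]) (by norm_num) ?_ ?_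
    · intro ht
      simp only [Expr.eval_sub, Expr.eval_one, Expr.eval_mod, Expr.eval_mul, Expr.eval_var, g7, hv3,
        g5] at ht
      obtain ⟨hc, rfl⟩ := htest.1 ht
      have hci : cnt inv = Nat.count (Nat.Coprime m) w := by simp [cnt]
      have hci1 : cnt (inv + 1) = Nat.count (Nat.Coprime m) w + 1 := by simp [cnt, hc]
      have hu : unitAt m (cnt inv) = w := by rw [hci]; exact Nat.nth_count hc
      have hui : unitInv m (cnt inv) = inv := by rw [unitInv, hu]
      refine Ex.seq hZ (Q := fun s => s = st3.setArr 3 ((a : ℤ) * q + cnt inv) w)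
        (Ex.le hZ (Ex.set hZ (by decide) (by simp [g4, g1, ba, bq]) trivial (by simp [g4, g1, g6, g7]))
          (by norm_num)) ?_
      rintro _ _ rfl
      refine Ex.seq hZ (Q := fun s => s = (st3.setArr 3 ((a : ℤ) * q + cnt inv) w).setArr 4
        ((a : ℤ) * q + cnt inv) inv)
        (Ex.le hZ (Ex.set hZ (by decide) (by simp [g4, g1, ba, bq]) trivial (by simp [g4, g1, g6, hv3]))
          (by norm_num)) ?_
      rintro _ _ rfl
      refine Ex.le hZ (Ex.assign hZ (by decide) (by simp) ?_) (by norm_num)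
      refine ⟨by simp [g6, hci, hci1], fun z hz => ?_, fun j hj => ?_⟩
      · have hz' : z ≠ (a : ℤ) * q + cnt inv := by omega
        simpa [hz'] using hJ3.2.1 z hz
      · rw [hci1, ← hci] at hj
        rcases Nat.lt_succ_iff_lt_or_eq.1 hj with hj | rfl
        · simpa [hj.ne] using hJ3.2.2 j hj
        · simp [hu, hui]
    · intro ht
      simp only [Expr.eval_sub, Expr.eval_one, Expr.eval_mod, Expr.eval_mul, Expr.eval_var, g7, hv3,
        g5] at ht
      rw [htest] at ht
      have hci1 : cnt (i + 1) = cnt i := by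
        simp only [cnt]
        congr 1
        by_cases hc : Nat.Coprime m w
        · have : i ≠ inv := fun h => ht ⟨hc, h⟩
          have h2 : inv < i + 1 ↔ inv < i := by omega
          simp [h2]
        · simp [hc]
      refine Ex.le hZ (Ex.skip hZ ?_) (by norm_num)
      rw [hci1]
      exact ⟨by simp [g6], hJ3.2.1, hJ3.2.2⟩
  · intro st3 _ hJ3
    have : cnt m = Nat.count (Nat.Coprime m) (w + 1) := by
      rw [Nat.count_succ]
      simp [cnt, hinvlt]
    rw [this] at hJ3
    exact ⟨by simpa using hJ3.1, hJ3.2.1, hJ3.2.2⟩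

/-- The update is done in place from the top degree downwards, so the lower coefficient that is read
is still the old one. -/
theorem progMulSeries_spec (hZ : 100 ≤ Z) {m d : ℕ} (hm : m ≤ Z) (hd : d < m) (F : PowerSeries ℤ)
    {st : State} (h5 : st.var 5 = m) (h9 : st.var 9 = d)
    (hF : ∀ k ≤ m, st.arr 6 k = PowerSeries.coeff k F) :
    Ex env Z 12 progMulSeries st fun st' => ∀ k ≤ m, st'.arr 6 k =
      PowerSeries.coeff k (F * (1 - PowerSeries.X ^ (d + 1))) := by
  refine Ex.conseq (Ex.for hZ (a := 9) (b := 1) (m - d) (by simp; omega) (by norm_num) (by norm_num)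
    rfl (by decide) ?_ (fun x st' => ∀ k ≤ m, st'.arr 6 k = if m < k + x then
      PowerSeries.coeff k (F * (1 - PowerSeries.X ^ (d + 1))) else PowerSeries.coeff k F) ?_ ?_) ?_
  · intro st' hA
    refine ⟨?_, by simp⟩
    simp only [Expr.eval_sub, Expr.eval_var, hA.var 5 rfl, hA.var 9 rfl, h5, h9]
    omega
  · intro k hk
    simp [hF k hk, hk]
  · intro x hx st' hA hv hI
    have g5 : st'.var 5 = m := (hA.var 5 rfl).trans h5
    have g9 : st'.var 9 = d := (hA.var 9 rfl).trans h9
    refine Ex.set hZ (by decide) (by simp) (by simp) ?_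
    intro k hk
    have e1 : (m : ℤ) - x = ((m - x : ℕ) : ℤ) := by omega
    have e2 : ((m - x : ℕ) : ℤ) - (d + 1) = ((m - x - (d + 1) : ℕ) : ℤ) := by omega
    simp only [State.setVar_arr, State.setArr_arr, Expr.eval_sub, Expr.eval_add, Expr.eval_var,
      Expr.eval_one, Expr.eval_get, g5, g9, hv, true_and, e1, e2, Nat.cast_inj]
    split_ifs with hkx hlt hlt
    · rw [hI _ (by omega), hI _ (by omega), if_neg (by omega), if_neg (by omega),
        coeff_mul_one_sub_X_pow, if_pos (by omega), hkx]
    · omega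
    · rw [hI _ hk, if_pos (by omega)]
    · rw [hI _ hk, if_neg (by omega)]
  · intro st' _ h k hk
    rw [h k hk]
    split_ifs with hlt
    · rfl
    · rw [coeff_mul_one_sub_X_pow, if_neg (by omega), sub_zero]

/-- The update is done in place from low degrees upwards, so the coefficient that is read already
belongs to the quotient. Naming the quotient `G` instead of the dividend makes an inverse series
unnecessary. -/
theorem progDivSeries_spec (hZ : 100 ≤ Z) {m d : ℕ} (hm : m ≤ Z) (hd : d < m)
    (G : PowerSeries ℤ) {st : State} (h5 : st.var 5 = m) (h9 : st.var 9 = d)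
    (hF : ∀ k ≤ m, st.arr 6 k =
      PowerSeries.coeff k (G * (1 - PowerSeries.X ^ (d + 1)))) :
    Ex env Z 12 progDivSeries st fun st' => ∀ k ≤ m, st'.arr 6 k = PowerSeries.coeff k G := by
  refine Ex.conseq (Ex.for hZ (a := 9) (b := 1) (m - d) (by simp; omega) (by norm_num) (by norm_num)
    rfl (by decide) ?_ (fun x st' => ∀ k ≤ m, st'.arr 6 k = if k < d + 1 + x then
      PowerSeries.coeff k G else PowerSeries.coeff k (G * (1 - PowerSeries.X ^ (d + 1)))) ?_ ?_) ?_
  · intro st' hA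
    refine ⟨?_, by simp⟩
    simp only [Expr.eval_sub, Expr.eval_var, hA.var 5 rfl, hA.var 9 rfl, h5, h9]
    omega
  · intro k hk
    rw [State.setVar_arr, hF k hk]
    split_ifs with hlt
    · rw [coeff_mul_one_sub_X_pow, if_neg (by omega), sub_zero]
    · rfl
  · intro x hx st' hA hv hI
    have g5 : st'.var 5 = m := (hA.var 5 rfl).trans h5
    have g9 : st'.var 9 = d := (hA.var 9 rfl).trans h9
    refine Ex.set hZ (by decide) (by simp) (by simp) ?_
    intro k hk
    have e1 : (d : ℤ) + 1 + x = ((d + 1 + x : ℕ) : ℤ) := by push_cast; ring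
    simp only [State.setVar_arr, State.setArr_arr, Expr.eval_add, Expr.eval_var,
      Expr.eval_one, Expr.eval_get, g9, hv, true_and, e1, Nat.cast_inj]
    split_ifs with hkx hlt hlt
    · rw [hI _ (by omega), hI _ (by omega), if_neg (by omega), if_pos (by omega),
        coeff_mul_one_sub_X_pow, if_pos (by omega), hkx, show d + 1 + x - (d + 1) = x by omega]
      ring
    · omega
    · rw [hI _ hk, if_pos (by omega)]
    · rw [hI _ hk, if_neg (by omega)]
  · intro st' _ h k hk
    rw [h k hk, if_pos (by omega)]

open ArithmeticFunction in
-- Starting from `1`, one multiplies or divides by `1 - X ^ d` according to the sign of `μ(m / d)`.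
-- Cutting off above degree `m` is exact, since each new coefficient depends only on coefficients of
-- at most the same degree.
theorem progCyc_spec (hZ : 100 ≤ Z) {m q : ℕ} (hm : 0 < m) (hmq : m < q) (hq : q ≤ Z)
    {st : State} (h5 : st.var 5 = m) (hmu : ∀ d < q, st.arr 5 d = moebius d) :
    Ex env Z 19 progCyc st fun st' => ∀ k ≤ m.totient, st'.arr 6 k =
      (Polynomial.cyclotomic m ℤ).coeff (m.totient - k) := by
  have hmZ : m ≤ Z := hmq.le.trans hq
  refine Ex.seq hZ (Q := fun st' => ∀ k ≤ m, st'.arr 6 k = PowerSeries.coeff k (1 : PowerSeries ℤ))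
    ?_ ?_
  · refine Ex.conseq (Ex.for hZ (a := 9) (b := 1) (m + 1) (by simp; omega) (by norm_num)
      (by norm_num) rfl (by decide) ?_
      (fun i st' => ∀ k < i, st'.arr 6 k = PowerSeries.coeff k (1 : PowerSeries ℤ)) (by simp) ?_)
      (fun st' _ h k hk => h k (by omega))
    · intro st' hA
      exact ⟨by simp [hA.var 5 rfl, h5], by simp⟩
    · intro i hi st' hA hv hI
      refine Ex.set hZ (by decide) (by simp) (by simp) ?_
      intro k hk
      simp only [State.setVar_arr, State.setArr_arr, Expr.eval_var, Expr.eval_div, Expr.eval_one,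
        Expr.eval_add, hv, true_and, Nat.cast_inj]
      split_ifs with hki
      · rw [one_ediv_one_add (by positivity), PowerSeries.coeff_one, hki]
        simp
      · exact hI k (by omega)
  intro st1 hA1 hJ1
  have k5 : st1.var 5 = m := (hA1.var 5 rfl).trans h5
  have kmu : ∀ d < q, st1.arr 5 d = moebius d := fun d hd => by rw [hA1.arr 5 rfl, hmu d hd]
  refine Ex.conseq (Ex.for hZ (a := 15) (b := 1) m (by simpa using hmZ) (by norm_num) (by norm_num)
    rfl (by decide) ?_
    (fun d st' => ∀ k ≤ m, st'.arr 6 k = PowerSeries.coeff k (partialCyc m d : PowerSeries ℤ)) ?_ ?_)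
    ?_
  · intro st' hA
    exact ⟨(hA.var 5 rfl).trans k5, trivial⟩
  · simpa [partialCyc] using hJ1
  · intro d hd st2 hA2 hv2 hI
    have g5 : st2.var 5 = m := (hA2.var 5 rfl).trans k5
    have gmu : ∀ d < q, st2.arr 5 d = moebius d := fun d hd => by rw [hA2.arr 5 rfl, kmu d hd]
    have hdiv : (m : ℤ) / (d + 1) = ((m / (d + 1) : ℕ) : ℤ) := by push_cast; rfl
    have hget : st2.arr 5 ((m : ℤ) / (d + 1)) = moebius (m / (d + 1)) := by
      rw [hdiv]
      exact gmu _ ((Nat.div_le_self _ _).trans_lt hmq)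
    have hstep : partialCyc m (d + 1) = partialCyc m d *
        if (d + 1) ∣ m then oneSubXPow (d + 1) ^ moebius (m / (d + 1)) else 1 := by
      rw [partialCyc, Finset.prod_range_succ]; rfl
    have hone := coe_oneSubXPow (Nat.succ_pos d)
    -- The loop variable is one less than the divisor it stands for.
    have htest : 0 < 1 - (m : ℤ) % (d + 1) ↔ (d + 1) ∣ m := by
      have h1 : (m : ℤ) % (d + 1) = ((m % (d + 1) : ℕ) : ℤ) := by push_cast; rfl
      rw [h1, Nat.dvd_iff_mod_eq_zero]
      omega
    refine Ex.cond hZ (by decide) (by simp) (by norm_num) ?_ ?_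
    · intro ht
      simp only [Expr.eval_sub, Expr.eval_one, Expr.eval_mod, Expr.eval_add, Expr.eval_var, g5,
        hv2] at ht
      rw [if_pos (htest.1 ht)] at hstep
      refine Ex.cond hZ (by decide) (by simp) (by norm_num) ?_ ?_
      · intro hp
        simp only [Expr.eval_get, Expr.eval_div, Expr.eval_add, Expr.eval_var, g5, hv2,
          Expr.eval_one, hget] at hp
        have h1 : moebius (m / (d + 1)) = 1 := by
          rcases moebius_ne_zero_iff_eq_or.1 hp.ne' with h | h <;> omega
        refine Ex.conseq (Ex.le hZ (progMulSeries_spec hZ hmZ hd _ g5 hv2 hI) (by norm_num)) ?_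
        intro st3 _ h3 k hk
        rw [State.setVar_arr, h3 k hk, hstep, h1, zpow_one, Units.val_mul, hone]
      · intro hp
        simp only [Expr.eval_get, Expr.eval_div, Expr.eval_add, Expr.eval_var, g5, hv2,
          Expr.eval_one, hget] at hp
        refine Ex.cond hZ (by decide) (by simp) (by norm_num) ?_ ?_
        · intro hn
          simp only [Expr.eval_get, Expr.eval_div, Expr.eval_add, Expr.eval_var, g5, hv2,
            Expr.eval_one, hget, Expr.eval_sub, Expr.eval_zero] at hn
          have h1 : moebius (m / (d + 1)) = -1 := by
            rcases moebius_ne_zero_iff_eq_or.1 (show moebius (m / (d + 1)) ≠ 0 by omega) with h | h <;>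
              omega
          rw [h1, zpow_neg_one] at hstep
          have h2 : ((partialCyc m (d + 1) : (PowerSeries ℤ)ˣ) : PowerSeries ℤ) *
              (1 - PowerSeries.X ^ (d + 1)) = ((partialCyc m d : (PowerSeries ℤ)ˣ) : PowerSeries ℤ) := by
            rw [← hone, ← Units.val_mul, hstep, inv_mul_cancel_right]
          refine Ex.conseq (Ex.le hZ (progDivSeries_spec hZ hmZ hd (partialCyc m (d + 1)) g5 hv2
            fun k hk => ?_) (by norm_num)) ?_
          · rw [h2, hI k hk]
          · intro st3 _ h3 k hk
            rw [State.setVar_arr, h3 k hk]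
        · intro hn
          simp only [Expr.eval_get, Expr.eval_div, Expr.eval_add, Expr.eval_var, g5, hv2,
            Expr.eval_one, hget, Expr.eval_sub, Expr.eval_zero] at hn
          have h1 : moebius (m / (d + 1)) = 0 := by omega
          rw [h1, zpow_zero, mul_one] at hstep
          refine Ex.le hZ (Ex.skip hZ ?_) (by norm_num)
          rw [hstep]
          exact hI
    · intro ht
      simp only [Expr.eval_sub, Expr.eval_one, Expr.eval_mod, Expr.eval_add, Expr.eval_var, g5,
        hv2] at ht
      rw [if_neg (fun h => ht (htest.2 h)), mul_one] at hstep
      refine Ex.le hZ (Ex.skip hZ ?_) (by norm_num)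
      rw [hstep]
      exact hI
  · intro st' _ h k hk
    rw [h k (hk.trans (Nat.totient_le m)), coeff_partialCyc hm hk]

/-- Uniqueness of digits in base `q`: distinct table entries occupy distinct cells. For the matrices
the same is used in base `n`. -/
theorem mul_add_inj {q x y e f : ℤ} (he : 0 ≤ e ∧ e < q) (hf : 0 ≤ f ∧ f < q) :
    x * q + e = y * q + f ↔ x = y ∧ e = f := by
  refine ⟨fun h => ?_, fun h => by rw [h.1, h.2]⟩
  have h1 : x = y := by
    rcases lt_trichotomy x y with h1 | h1 | h1
    · nlinarith
    · exact h1
    · nlinarith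
  subst h1
  exact ⟨rfl, by linarith⟩

theorem bits_coeff_cyclotomic_le (hZ : 100 ≤ Z) {m : ℕ} (hm : m ≤ Z) (i : ℕ) :
    bits ((Polynomial.cyclotomic m ℤ).coeff i) ≤ Z ^ 6 := by
  refine (bits_le_of_abs_le (abs_coeff_cyclotomic_le m i)).trans ?_
  have h1 := Nat.totient_le m
  have h2 : Z ^ 2 ≤ Z ^ 6 := Nat.pow_le_pow_right (by omega) (by norm_num)
  nlinarith

theorem bits_powCoeff_le (hZ : 100 ≤ Z) {m t : ℕ} (hm : m ≤ Z) (ht : t ≤ Z) (i : ℕ) :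
    bits (powCoeff m t i) ≤ Z ^ 3 := by
  refine (bits_le_of_abs_le (abs_powCoeff_le m t i)).trans ?_
  have h1 := (Nat.totient_le m).trans hm
  have h2 : m.totient * t ≤ Z * Z := Nat.mul_le_mul h1 ht
  have h3 : Z ^ 3 = Z * (Z * Z) := by ring
  nlinarith

theorem progPowers_spec (hZ : 100 ≤ Z) {a m q : ℕ} (ha : a ≤ Z) (hmq : m < q) (hq : q ≤ Z)
    {st : State} (h1 : st.var 1 = q) (h4 : st.var 4 = a) (h5 : st.var 5 = m)
    (h6 : st.var 6 = m.totient) (hc : ∀ k ≤ m.totient, st.arr 6 k =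
      (Polynomial.cyclotomic m ℤ).coeff (m.totient - k)) :
    Ex env Z 21 progPowers st fun st' =>
      (∀ z < (a : ℤ) * q * q, st'.arr 7 z = st.arr 7 z) ∧
      ∀ t < m, ∀ e < m.totient, st'.arr 7 (((a : ℤ) * q + t) * q + e) = powCoeff m t e := by
  have hφ := Nat.totient_le m
  have hmZ : m ≤ Z := hmq.le.trans hq
  have bq := bits_natCast_le hq
  have ba := bits_natCast_le ha
  -- The table is filled in lexicographic order, so all rows used by the recurrence for row `t` are
  -- complete.
  let J : ℕ → ℕ → State → Prop := fun t e st' =>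
    (∀ z < (a : ℤ) * q * q, st'.arr 7 z = st.arr 7 z) ∧
      ∀ t' e', e' < m.totient → (t' < t ∨ t' = t ∧ e' < e) →
        st'.arr 7 (((a : ℤ) * q + t') * q + e') = powCoeff m t' e'
  refine Ex.conseq (Ex.for hZ (a := 18) (b := 1) m (by simpa using hmZ) (by norm_num) (by norm_num)
    rfl (by decide) ?_ (fun t => J t 0) ⟨fun _ _ => rfl, by simp⟩ ?_)
    (fun st' _ h => ⟨h.1, fun t ht e he => h.2 t e he (Or.inl ht)⟩)
  · intro st' hA
    exact ⟨(hA.var 5 rfl).trans h5, trivial⟩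
  intro t ht st1 hA1 hv1 hJ1
  refine Ex.conseq (Ex.for hZ (a := 15) (b := 1) m.totient (by simpa using hφ.trans hmZ)
    (by norm_num) (by norm_num) rfl (by decide) ?_ (fun e => J t e) hJ1 ?_) ?_
  · intro st' hA
    exact ⟨by rw [Expr.eval_var, hA.var 6 rfl, hA1.var 6 rfl, h6], trivial⟩
  · intro e he st2 hA2 hv2 hJ2
    have g1 : st2.var 1 = q := by rw [hA2.var 1 rfl, hA1.var 1 rfl, h1]
    have g4 : st2.var 4 = a := by rw [hA2.var 4 rfl, hA1.var 4 rfl, h4]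
    have g6 : st2.var 6 = m.totient := by rw [hA2.var 6 rfl, hA1.var 6 rfl, h6]
    have g7 : st2.var 7 = t := by rw [hA2.var 7 rfl, hv1]
    have gc : st2.arr 6 = st.arr 6 := by rw [hA2.arr 6 rfl, hA1.arr 6 rfl]
    have bt := bits_natCast_le (ht.le.trans hmZ)
    have be := bits_natCast_le (he.le.trans (hφ.trans hmZ))
    have hset : ∀ st3 : State, st3.arr 7 = st2.arr 7 → ∀ v : ℤ, v = powCoeff m t e →
        J t (e + 1) ((st3.setArr 7 (((a : ℤ) * q + t) * q + e) v).setVar 12 (e + 1 : ℕ)) := by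
      intro st3 h3 v hv
      refine ⟨fun z hz => ?_, fun t' e' he' h => ?_⟩
      · have : z ≠ ((a : ℤ) * q + t) * q + e := by
          have : (0 : ℤ) ≤ t * q + e := by positivity
          intro h
          rw [h] at hz
          linarith
        simp [this, h3, hJ2.1 z hz]
      · have h4 : ((a : ℤ) * q + t') * q + e' = (a * q + t) * q + e ↔ t' = t ∧ e' = e := by
          rw [mul_add_inj (by omega) (by omega), add_right_inj, Nat.cast_inj, Nat.cast_inj]
        rw [State.setVar_arr, State.setArr_arr, h3, hv]
        by_cases h5 : t' = t ∧ e' = e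
        · rw [if_pos ⟨rfl, h4.2 h5⟩, h5.1, h5.2]
        · rw [if_neg (fun h => h5 (h4.1 h.2))]
          exact hJ2.2 t' e' he' (by omega)
    refine Ex.cond hZ (by decide) (by simp) (by norm_num) ?_ ?_
    · intro hp
      simp only [Expr.eval_sub, Expr.eval_var, g6, g7] at hp
      refine Ex.le hZ (Ex.set hZ (by decide) (by simp [g1, g4, g7, bq, ba, bt])
        (by simp [Expr.delta, g7, hv2, bt, be]) ?_) (by norm_num)
      have := hset st2 rfl (if (t : ℤ) = e then 1 else 0) (by
        rw [powCoeff_of_lt (by omega)]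
        simp [eq_comm])
      simpa [Expr.eval_delta, g1, g4, g7, hv2] using this
    · intro hp
      simp only [Expr.eval_sub, Expr.eval_var, g6, g7] at hp
      refine Ex.seq hZ (Ex.le hZ (Ex.sum hZ (b := 1) (a' := 13) m.totient
        (by simpa using hφ.trans hmZ) (by norm_num) (by norm_num) (by decide) ?_
        (fun f => (Polynomial.cyclotomic m ℤ).coeff (m.totient - 1 - f) *
          powCoeff m (t - 1 - f) e) ?_) (by norm_num)) ?_
      · intro st3 hA3
        exact ⟨by rw [Expr.eval_var, hA3.var 6 rfl, g6], trivial⟩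
      · intro f hf st3 hA3 hv3
        have e1 : (t : ℤ) - 1 - f = ((t - 1 - f : ℕ) : ℤ) := by omega
        have e2 : (f : ℤ) + 1 = ((f + 1 : ℕ) : ℤ) := by push_cast; ring
        have k6 : st3.arr 6 (f + 1) = (Polynomial.cyclotomic m ℤ).coeff (m.totient - 1 - f) := by
          rw [hA3.arr 6 rfl, gc, e2, hc _ (by omega)]
          congr 1
          omega
        have k7 : st3.arr 7 (((a : ℤ) * q + (t - 1 - f)) * q + e) = powCoeff m (t - 1 - f) e := by
          rw [hA3.arr 7 rfl, e1]
          exact hJ2.2 _ _ he (Or.inl (by omega))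
        have k1 : st3.var 1 = q := by rw [hA3.var 1 rfl, g1]
        have k4 : st3.var 4 = a := by rw [hA3.var 4 rfl, g4]
        have kt : st3.var 7 = t := by rw [hA3.var 7 rfl, g7]
        have k12 : st3.var 12 = e := by rw [hA3.var 12 rfl, hv2]
        have b1 := bits_coeff_cyclotomic_le hZ hmZ (m.totient - 1 - f)
        have b2 := (bits_powCoeff_le hZ hmZ (t := t - 1 - f) (by omega) e).trans
          (Nat.pow_le_pow_right (by omega) (by norm_num : 3 ≤ 6))
        have bf := bits_natCast_le (hf.le.trans (hφ.trans hmZ))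
        refine ⟨by simp [hv3, k1, k4, kt, k12, k6, k7], ?_⟩
        simp [hv3, k1, k4, kt, k12, k6, k7, b1, b2, bf, ba, bq, bt, bits_one_le hZ]
      · intro st3 hA3 h3
        have k1 : st3.var 1 = q := by rw [hA3.var 1 rfl, g1]
        have k4 : st3.var 4 = a := by rw [hA3.var 4 rfl, g4]
        have kt : st3.var 7 = t := by rw [hA3.var 7 rfl, g7]
        have k12 : st3.var 12 = e := by rw [hA3.var 12 rfl, hv2]
        refine Ex.le hZ (Ex.set hZ (by decide) (by simp [k1, k4, kt, bq, ba, bt]) (by simp) ?_)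
          (by norm_num)
        have := hset st3 (hA3.arr 7 rfl) (0 - st3.var 11) (by
          rw [powCoeff_rec (by omega), h3]
          ring)
        simpa [k1, k4, kt, k12] using this
  · intro st' _ h
    refine ⟨h.1, fun t' e' he' h' => h.2 t' e' he' ?_⟩
    omega

theorem bits_emod_le {q : ℕ} (hq0 : 0 < q) (hq : q ≤ Z) (z : ℤ) : bits (z % q) ≤ Z ^ 6 := by
  have h0 : (q : ℤ) ≠ 0 := by exact_mod_cast hq0.ne'
  have h1 := Int.emod_nonneg z h0
  have h2 := Int.emod_lt_of_pos z (by exact_mod_cast hq0 : (0 : ℤ) < q)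
  refine (bits_le_natAbs _).trans ?_
  have h3 : Z ≤ Z ^ 6 := Nat.le_self_pow (by norm_num) Z
  omega

theorem emod_eq_emod_of_cast_eq {q : ℕ} {x y : ℤ} (h : (x : ZMod q) = y) : x % q = y % q :=
  (ZMod.intCast_eq_intCast_iff' x y q).1 h

/-- Each `x < q` is tried in turn and the last zero of `Φ_m` is kept, which matches the recursion
for `lastRoot`. Afterwards the powers of that root are tabulated. -/
theorem progRoot_spec (hZ : 100 ≤ Z) {a m q : ℕ} (ha : a ≤ Z) (hm : 0 < m) (hmq : m < q) (hq : q ≤ Z)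
    {st : State} (h1 : st.var 1 = q) (h4 : st.var 4 = a) (h5 : st.var 5 = m)
    (h6 : st.var 6 = m.totient) (hc : ∀ k ≤ m.totient, st.arr 6 k =
      (Polynomial.cyclotomic m ℤ).coeff (m.totient - k)) :
    Ex env Z 22 progRoot st fun st' =>
      (∀ z < (a : ℤ) * q, st'.arr 8 z = st.arr 8 z) ∧
      ∀ t < m, st'.arr 8 ((a : ℤ) * q + t) = (rootMod m q : ℤ) ^ t % q := by
  have hφ := Nat.totient_le m
  have hmZ : m ≤ Z := hmq.le.trans hq
  have hq0 : 0 < q := by omega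
  have hq1 : (1 : ℤ) % q = 1 := Int.emod_eq_of_lt (by norm_num) (by omega)
  have bq := bits_natCast_le hq
  have ba := bits_natCast_le ha
  refine Ex.seq hZ (Q := fun s => s = st.setVar 15 0)
    (Ex.le hZ (Ex.assign hZ (by decide) trivial (by simp)) (by norm_num)) ?_
  rintro _ - rfl
  refine Ex.seq hZ (Q := fun s => s.var 15 = rootMod m q) (Ex.for hZ (a := 17) (b := 1) q
    (by simpa using hq) (by norm_num) (by norm_num) rfl (by decide) ?_
    (fun x s => s.var 15 = lastRoot m q x) (by simp [lastRoot]) ?_) ?_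
  · intro s hA
    exact ⟨by rw [Expr.eval_var, hA.var 1 rfl, State.setVar_var, if_neg (by norm_num), h1], trivial⟩
  · intro x hx s1 hA1 hv1 hI1
    have g1 : s1.var 1 = q := by rw [hA1.var 1 rfl]; simpa using h1
    have g6 : s1.var 6 = m.totient := by rw [hA1.var 6 rfl]; simpa using h6
    have gc : s1.arr 6 = st.arr 6 := hA1.arr 6 rfl
    have bx := bits_natCast_le (hx.le.trans hq)
    refine Ex.seq hZ (Q := fun s => s = s1.setVar 14 1)
      (Ex.le hZ (Ex.assign hZ (by decide) trivial (by simp)) (by norm_num)) ?_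
    rintro _ - rfl
    refine Ex.seq hZ (Q := fun s => s = (s1.setVar 14 1).setVar 11 0)
      (Ex.le hZ (Ex.assign hZ (by decide) trivial (by simp)) (by norm_num)) ?_
    rintro _ - rfl
    -- Partial sum and power of `x` are both reduced modulo `q` in every round, which keeps the
    -- numbers short.
    refine Ex.seq hZ (Ex.le hZ (Ex.for hZ (a := 10) (b := 1) (a' := 13) (m.totient + 1)
      (by simp; omega) (by norm_num) (by norm_num) rfl (by decide) ?_
      (fun e s => s.var 11 = (∑ e' ∈ Finset.range e,
        (Polynomial.cyclotomic m ℤ).coeff e' * (x : ℤ) ^ e') % q ∧ s.var 14 = (x : ℤ) ^ e % q)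
      ?_ ?_) (by norm_num)) ?_
    · intro s hA
      refine ⟨?_, by simp⟩
      rw [Expr.eval_add, Expr.eval_var, hA.var 6 rfl]
      simp [g6]
    · simp [hq1]
    · intro e he s2 hA2 hv2 hI2
      have k1 : s2.var 1 = q := by rw [hA2.var 1 rfl]; simpa using g1
      have k6 : s2.var 6 = m.totient := by rw [hA2.var 6 rfl]; simpa using g6
      have k13 : s2.var 13 = x := by rw [hA2.var 13 rfl]; simpa using hv1
      have e1 : (m.totient : ℤ) - e = ((m.totient - e : ℕ) : ℤ) := by omega
      have kc : s2.arr 6 ((m.totient : ℤ) - e) = (Polynomial.cyclotomic m ℤ).coeff e := by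
        rw [hA2.arr 6 rfl, State.setVar_arr, State.setVar_arr, gc, e1, hc _ (by omega)]
        congr 1
        omega
      have b1 := bits_coeff_cyclotomic_le hZ hmZ e
      have b2 := bits_emod_le hq0 hq ((x : ℤ) ^ e)
      refine Ex.seq hZ (Q := fun s => s = s2.setVar 11 ((∑ e' ∈ Finset.range (e + 1),
        (Polynomial.cyclotomic m ℤ).coeff e' * (x : ℤ) ^ e') % q))
        (Ex.assign hZ (by decide) (by simp [k6, hv2, kc, hI2.2, b1, b2]) ?_) ?_
      · simp only [Expr.eval_mod, Expr.eval_add, Expr.eval_var, Expr.eval_mul, Expr.eval_get,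
          Expr.eval_sub, k6, hv2, kc, hI2.1, hI2.2, k1]
        congr 1
        refine emod_eq_emod_of_cast_eq ?_
        rw [Finset.sum_range_succ]
        push_cast [ZMod.intCast_mod]
        rfl
      rintro _ - rfl
      refine Ex.assign hZ (by decide) (by simp [k13, hI2.2, b2, bx]) ?_
      refine ⟨by simp, ?_⟩
      simp only [State.setVar_var, Expr.eval_mod, Expr.eval_mul, Expr.eval_var]
      norm_num
      rw [hI2.2, k13, k1]
      refine emod_eq_emod_of_cast_eq ?_
      push_cast [ZMod.intCast_mod]
      ring
    · intro s2 hA2 hI2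
      have heval : ∑ e' ∈ Finset.range (m.totient + 1),
          (Polynomial.cyclotomic m ℤ).coeff e' * (x : ℤ) ^ e' =
          (Polynomial.cyclotomic m ℤ).eval (x : ℤ) := by
        rw [Polynomial.eval_eq_sum_range, Polynomial.natDegree_cyclotomic]
      rw [heval] at hI2
      have k15 : s2.var 15 = lastRoot m q x := by rw [hA2.var 15 rfl]; simpa using hI1
      have k13 : s2.var 13 = x := by rw [hA2.var 13 rfl]; simpa using hv1
      have hnn := Int.emod_nonneg ((Polynomial.cyclotomic m ℤ).eval (x : ℤ))
        (by exact_mod_cast hq0.ne' : (q : ℤ) ≠ 0)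
      refine Ex.cond hZ (by decide) (by simp) (by norm_num) ?_ ?_
      · intro ht
        simp only [Expr.eval_sub, Expr.eval_one, Expr.eval_var, hI2.1] at ht
        refine Ex.le hZ (Ex.assign hZ (by decide) trivial ?_) (by norm_num)
        simp [lastRoot, show (Polynomial.cyclotomic m ℤ).eval (x : ℤ) % q = 0 by omega, k13]
      · intro ht
        simp only [Expr.eval_sub, Expr.eval_one, Expr.eval_var, hI2.1] at ht
        refine Ex.le hZ (Ex.skip hZ ?_) (by norm_num)
        simp [lastRoot, show ¬ (Polynomial.cyclotomic m ℤ).eval (x : ℤ) % q = 0 by omega, k15]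
  · intro s1 hA1 h15
    have g1 : s1.var 1 = q := by rw [hA1.var 1 rfl]; simpa using h1
    have g4 : s1.var 4 = a := by rw [hA1.var 4 rfl]; simpa using h4
    have g5 : s1.var 5 = m := by rw [hA1.var 5 rfl]; simpa using h5
    have g8 : s1.arr 8 = st.arr 8 := hA1.arr 8 rfl
    have bo := bits_natCast_le ((rootMod_lt (m := m) hq0).le.trans hq)
    refine Ex.seq hZ (Q := fun s => s = s1.setVar 14 1)
      (Ex.le hZ (Ex.assign hZ (by decide) trivial (by simp)) (by norm_num)) ?_
    rintro _ - rfl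
    refine Ex.conseq (Ex.le hZ (Ex.for hZ (a := 10) (b := 1) (a' := 13) m (by simpa using hmZ)
      (by norm_num) (by norm_num) rfl (by decide) ?_
      (fun t s => s.var 14 = (rootMod m q : ℤ) ^ t % q ∧
        (∀ z < (a : ℤ) * q, s.arr 8 z = st.arr 8 z) ∧
        ∀ t' < t, s.arr 8 ((a : ℤ) * q + t') = (rootMod m q : ℤ) ^ t' % q) ?_ ?_) (by norm_num))
      (fun s _ h => h.2)
    · intro s hA
      refine ⟨?_, by simp⟩
      rw [Expr.eval_var, hA.var 5 rfl]
      simpa using g5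
    · refine ⟨?_, fun z _ => by rw [State.setVar_arr, State.setVar_arr, g8], by simp⟩
      simp [hq1]
    · intro t ht s2 hA2 hv2 hI2
      have k1 : s2.var 1 = q := by rw [hA2.var 1 rfl]; simpa using g1
      have k4 : s2.var 4 = a := by rw [hA2.var 4 rfl]; simpa using g4
      have k15 : s2.var 15 = rootMod m q := by rw [hA2.var 15 rfl]; simpa using h15
      have b2 := bits_emod_le hq0 hq ((rootMod m q : ℤ) ^ t)
      refine Ex.seq hZ (Q := fun s => s = s2.setArr 8 ((a : ℤ) * q + t)
        ((rootMod m q : ℤ) ^ t % q)) (Ex.set hZ (by decide) (by simp [k1, k4, ba, bq]) trivial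
          (by simp [k1, k4, hv2, hI2.1])) ?_
      rintro _ - rfl
      refine Ex.assign hZ (by decide) (by simp [k15, hI2.1, b2, bo]) ?_
      refine ⟨?_, fun z hz => ?_, fun t' ht' => ?_⟩
      · simp only [State.setVar_var, Expr.eval_mod, Expr.eval_mul, Expr.eval_var, State.setArr_var]
        norm_num
        rw [hI2.1, k15, k1]
        refine emod_eq_emod_of_cast_eq ?_
        push_cast [ZMod.intCast_mod]
        ring
      · have : z ≠ (a : ℤ) * q + t := by omega
        simpa [this] using hI2.2.1 z hz
      · rcases Nat.lt_succ_iff_lt_or_eq.1 ht' with h | rfl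
        · simpa [h.ne] using hI2.2.2 t' h
        · simp

end MRLWE

noncomputable section

namespace MRLWE

/-! ### Programs for the matrices of the reduction

Variables: `16` the degree `n`, `17` the product of the conductors modulo `q`, `18` and `27` the
indices `i` and `j` of homomorphisms. Arrays: `9` and `10` the matrices `crtV` and `crtW`, `11` and
`12` the matrices `autT i j` and `autT j i`. -/

section Rules

variable {env : Env} {Z : ℕ}

theorem Ex.assign_seq (hZ : 100 ≤ Z) {x c : ℕ} {e : Expr} {v : ℤ} {p : Prog} {st : State}
    {R : State → Prop} (hs : e.size ≤ 60) (he : e.MulBits st (Z ^ 6)) (hv : e.eval st = v)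
    (hc : 9 ≤ c) (h : Ex env Z c p (st.setVar x v) R) :
    Ex env Z (c + 1) (.seq (.assign x e) p) st R :=
  Ex.seq hZ (Q := fun s => s = st.setVar x v) (Ex.le hZ (Ex.assign hZ hs he (by rw [hv])) hc)
    (by rintro _ - rfl; exact h)

/-- Two `n × n` matrices are filled with the entries computed by `p` in the variables `u`, `v`. -/
def Prog.fill (x y A B u v : ℕ) (p : Prog) : Prog :=
  .for x (.var 16) (.for y (.var 16) (.seq p (.seq
    (.set A (.var x * .var 16 + .var y) (.var u)) (.set B (.var x * .var 16 + .var y) (.var v)))))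

/-- The exponent `e + 8` consists of `2` for the two compositions in the body and `3` for each of
the two loops. The invariant is again lexicographic. -/
theorem Ex.fill (hZ : 100 ≤ Z) {x y A B u v e : ℕ} {p : Prog} {st : State} {n : ℕ} (hn : n ≤ Z)
    (h16 : st.var 16 = n) (hAB : A ≠ B) (hxy : x ≠ y) (hx : x ≠ 16) (hy : y ≠ 16) (he : 9 ≤ e)
    (hpx : p.writesVar x = false) (hpy : p.writesVar y = false) (hp16 : p.writesVar 16 = false)
    (hpA : p.writesArr A = false) (hpB : p.writesArr B = false) (f g : ℕ → ℕ → ℤ)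
    (hp : ∀ i < n, ∀ k < n, ∀ st', Agree (.fill x y A B u v p) st st' → st'.var x = i →
      st'.var y = k → Ex env Z e p st' fun s => s.var u = f i k ∧ s.var v = g i k) :
    Ex env Z (e + 8) (.fill x y A B u v p) st fun s => ∀ i < n, ∀ k < n,
      s.arr A ((i : ℤ) * n + k) = f i k ∧ s.arr B ((i : ℤ) * n + k) = g i k := by
  let J : ℕ → ℕ → State → Prop := fun i k s => ∀ i' k', k' < n → (i' < i ∨ i' = i ∧ k' < k) →
    s.arr A ((i' : ℤ) * n + k') = f i' k' ∧ s.arr B ((i' : ℤ) * n + k') = g i' k'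
  have hw16 : (Prog.fill x y A B u v p).writesVar 16 = false := by
    simp [Prog.fill, Prog.for, Prog.writesVar, hp16, hx.symm, hy.symm]
  refine Ex.conseq (Ex.for hZ (a := e + 5) (b := 1) n (by simpa using hn) (by omega) (by omega)
    ?_ (by decide) ?_ (fun i => J i 0) (by simp [J]) ?_)
    (fun s _ h i hi k hk => h i k hk (Or.inl hi))
  · simp [Prog.for, Prog.writesVar, hpx, hxy]
  · intro s hA
    exact ⟨(hA.var 16 hw16).trans h16, trivial⟩
  intro i hi s1 hA1 hv1 hJ1
  refine Ex.conseq (Ex.for hZ (a := e + 2) (b := 1) n (by simpa using hn) (by omega) (by omega)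
    ?_ (by decide) ?_ (fun k => J i k) hJ1 ?_) (fun s _ h i' k' hk' h' => h i' k' hk' (by omega))
  · simp [Prog.writesVar, hpy]
  · intro s hA
    refine ⟨(hA.var 16 ?_).trans ((hA1.var 16 hw16).trans h16), trivial⟩
    simp [Prog.for, Prog.writesVar, hp16, hy.symm]
  intro k hk s2 hA2 hv2 hJ2
  have hsub : Agree (.fill x y A B u v p) st s2 := hA1.trans (hA2.mono (Prog.body_sub_for _ _ _))
  have k16 : s2.var 16 = n := (hsub.var 16 hw16).trans h16
  have kx : s2.var x = i := by
    rw [hA2.var x (by simp [Prog.for, Prog.writesVar, hpx, hxy]), hv1]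
  refine Ex.seq hZ (Ex.le hZ (hp i hi k hk s2 hsub kx hv2) (by omega)) fun s3 hA3 h3 => ?_
  have g16 : s3.var 16 = n := (hA3.var 16 hp16).trans k16
  have gx : s3.var x = i := (hA3.var x hpx).trans kx
  have gy : s3.var y = k := (hA3.var y hpy).trans hv2
  have bn := bits_natCast_le hn
  have bi := bits_natCast_le (hi.le.trans hn)
  refine Ex.seq hZ (Q := fun s => s = s3.setArr A ((i : ℤ) * n + k) (f i k))
    (Ex.le hZ (Ex.set hZ ⟨show 5 ≤ 60 by norm_num, show 1 ≤ 60 by norm_num⟩ (by simp [gx, g16, bn, bi]) trivial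
      (by simp [gx, gy, g16, h3.1])) (by omega)) ?_
  rintro _ - rfl
  refine Ex.le hZ (Ex.set hZ ⟨show 5 ≤ 60 by norm_num, show 1 ≤ 60 by norm_num⟩ (by simp [gx, g16, bn, bi]) trivial ?_) (by omega)
  intro i' k' hk' h
  have hidx : (i' : ℤ) * n + k' = i * n + k ↔ i' = i ∧ k' = k := by
    rw [mul_add_inj (by omega) (by omega), Nat.cast_inj, Nat.cast_inj]
  simp only [State.setVar_arr, State.setArr_arr, Expr.eval_add, Expr.eval_mul, Expr.eval_var,
    State.setArr_var, gx, gy, g16, h3.2, hidx, hAB, hAB.symm, false_and, if_false, true_and]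
  by_cases h5 : i' = i ∧ k' = k
  · rw [if_pos h5, if_pos h5, h5.1, h5.2]
    exact ⟨rfl, rfl⟩
  · rw [if_neg h5, if_neg h5, hA3.arr A hpA, hA3.arr B hpB]
    exact hJ2 i' k' hk' (by omega)

end Rules

/-- All tables of one factor. -/
def progAxis : Prog :=
  .seq (.assign 5 (.get 0 (.var 4))) (.seq progUnits (.seq (.set 2 (.var 4) (.var 6))
    (.seq progCyc (.seq progPowers progRoot))))

/-- All tables of all factors. -/
def progTables : Prog := .seq progMu (.for 4 (.var 0) progAxis)

/-- The degree and the product of the conductors. -/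
def progDim : Prog :=
  .seq (.assign 16 1) (.seq (.assign 17 1) (.for 4 (.var 0) (.seq
    (.assign 16 (.var 16 * .get 2 (.var 4)))
    (.assign 17 (.var 17 * .get 0 (.var 4) % .var 1)))))

/-- One entry of the matrices `crtV` and `crtW`. -/
def progCrtEntry : Prog :=
  .seq (.assign 21 (.var 18)) (.seq (.assign 22 (.var 19)) (.seq (.assign 23 1) (.seq (.assign 24 1)
    (.for 4 (.var 0)
      (.seq (.assign 6 (.get 2 (.var 4))) (.seq (.assign 5 (.get 0 (.var 4)))
      (.seq (.assign 36 (.get 3 (.var 4 * .var 1 + .var 21 % .var 6)))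
      (.seq (.assign 37 (.var 22 % .var 6))
      (.seq (.sum 25 26 (.var 5) (.get 8 (.var 4 * .var 1 +
          ((.var 5 - 1) * (.var 36 * .var 25)) % .var 5) *
          .get 7 ((.var 4 * .var 1 + .var 25) * .var 1 + .var 37)))
      (.seq (.assign 26 (.var 26 % .var 1))
      (.seq (.assign 23 (.var 23 * .get 8 (.var 4 * .var 1 + (.var 36 * .var 37) % .var 5) % .var 1))
      (.seq (.assign 24 (.var 24 * .var 26 % .var 1))
      (.seq (.assign 21 (.var 21 / .var 6)) (.assign 22 (.var 22 / .var 6)))))))))))))))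

/-- The matrices `crtV` and `crtW`. -/
def progCrt : Prog := .fill 18 19 9 10 23 24 progCrtEntry

/-- The position in the tables of a coordinate of a power of `ζ`. -/
def autIndex (x y : ℕ) : Expr :=
  (.var 4 * .var 1 + (.get 3 (.var 4 * .var 1 + .var x % .var 6) *
    .get 4 (.var 4 * .var 1 + .var y % .var 6) * (.var 22 % .var 6)) % .var 5) * .var 1 +
    .var 37 % .var 6

/-- One entry of the matrices of an automorphism and its inverse. -/
def progAutEntry : Prog :=
  .seq (.assign 21 (.var 18)) (.seq (.assign 36 (.var 27)) (.seq (.assign 22 (.var 19))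
    (.seq (.assign 37 (.var 20)) (.seq (.assign 23 1) (.seq (.assign 24 1)
    (.for 4 (.var 0)
      (.seq (.assign 6 (.get 2 (.var 4))) (.seq (.assign 5 (.get 0 (.var 4)))
      (.seq (.assign 23 (.var 23 * .get 7 (autIndex 36 21)))
      (.seq (.assign 24 (.var 24 * .get 7 (autIndex 21 36)))
      (.seq (.assign 21 (.var 21 / .var 6)) (.seq (.assign 36 (.var 36 / .var 6))
      (.seq (.assign 22 (.var 22 / .var 6)) (.assign 37 (.var 37 / .var 6)))))))))))))))

/-- The matrices of an automorphism and its inverse. -/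
def progAut : Prog := .fill 19 20 11 12 23 24 progAutEntry

/-! ### Their specifications -/

variable (P : Params)

/-- The conductors, as a function on `ℕ`. -/
def Params.mN (a : ℕ) : ℕ := if h : a < P.l then P.m ⟨a, h⟩ else 1

theorem Params.mN_pos (a : ℕ) : 0 < P.mN a := by
  unfold Params.mN
  split_ifs
  · exact P.m_pos _
  · exact one_pos

theorem Params.mN_val (a : Fin P.l) : P.mN a = P.m a := by simp [Params.mN]

/-- The place values of the mixed-radix order. -/
def Params.stride (a : ℕ) : ℕ := ∏ d ∈ Finset.range a, (P.mN d).totient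

theorem Params.stride_succ (a : ℕ) : P.stride (a + 1) = P.stride a * (P.mN a).totient :=
  Finset.prod_range_succ _ _

theorem Params.stride_l : P.stride P.l = P.n := by
  rw [Params.stride, Finset.prod_range]
  simp [Params.mN_val]

theorem Params.stride_pos (a : ℕ) : 0 < P.stride a := by
  unfold Params.stride
  exact Finset.prod_pos fun d _ => Nat.totient_pos.2 (P.mN_pos d)

/-- Place values increase because totients are positive, and the last one is `n`. -/
theorem Params.stride_le {a : ℕ} (ha : a ≤ P.l) : P.stride a ≤ P.n := by
  rw [← P.stride_l]
  exact monotone_nat_of_le_succ (f := P.stride) (fun b => by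
    rw [P.stride_succ]; exact Nat.le_mul_of_pos_right _ (Nat.totient_pos.2 (P.mN_pos b))) ha

theorem Params.totient_le {a : ℕ} (ha : a < P.l) : (P.mN a).totient ≤ P.n := by
  refine le_trans ?_ (P.stride_le (a := a + 1) ha)
  rw [P.stride_succ]
  exact Nat.le_mul_of_pos_left _ (P.stride_pos a)

/-- The digits in the mixed-radix order. -/
def Params.digN (k a : ℕ) : ℕ := k / P.stride a % (P.mN a).totient

theorem Params.digN_lt (k a : ℕ) : P.digN k a < (P.mN a).totient :=
  Nat.mod_lt _ (Nat.totient_pos.2 (P.mN_pos a))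

theorem Params.dig_eq_digN (k : Fin P.n) (a : Fin P.l) : (P.dig k a : ℕ) = P.digN k a := by
  have h : P.stride a = ∏ d : Fin (a : ℕ), (P.m (Fin.castLE a.2.le d)).totient := by
    rw [Params.stride, Finset.prod_range]
    refine Finset.prod_congr rfl fun d _ => ?_
    rw [Params.mN, dif_pos (d.2.trans a.2)]
    rfl
  rw [P.dig_val, Params.digN, P.mN_val, h]

/-- A factor of an entry of `crtV`. -/
def crtVFactor (i k a : ℕ) : ZMod P.q :=
  (rootMod (P.mN a) P.q : ZMod P.q) ^ (unitAt (P.mN a) (P.digN i a) * P.digN k a)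

/-- A factor of an entry of `crtW`. -/
def crtWFactor (i k a : ℕ) : ZMod P.q :=
  ∑ t ∈ Finset.range (P.mN a), (rootMod (P.mN a) P.q : ZMod P.q) ^
    ((P.mN a - 1) * (unitAt (P.mN a) (P.digN i a) * t)) * powCoeff (P.mN a) t (P.digN k a)

/-- A factor of an entry of `autT`. -/
def autTFactor (i j k k' a : ℕ) : ℤ :=
  powCoeff (P.mN a) ((unitAt (P.mN a) (P.digN j a) * unitInv (P.mN a) (P.digN i a) *
    P.digN k a) % P.mN a) (P.digN k' a)

theorem crtV_eq_prod (i k : Fin P.n) :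
    crtV P i k = ∏ a ∈ Finset.range P.l, crtVFactor P i k a := by
  rw [Finset.prod_range, crtV]
  simp [crtVFactor, Params.mN_val, Params.dig_eq_digN, Params.root]

theorem crtW_eq_prod (i k : Fin P.n) :
    crtW P i k = ∏ a ∈ Finset.range P.l, crtWFactor P i k a := by
  rw [Finset.prod_range, crtW]
  simp [crtWFactor, Params.mN_val, Params.dig_eq_digN, Params.root]

theorem autT_eq_prod (i j k k' : Fin P.n) :
    autT P i j k k' = ∏ a ∈ Finset.range P.l, autTFactor P i j k k' a := by
  rw [Finset.prod_range, autT]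
  simp [autTFactor, Params.mN_val, Params.dig_eq_digN]

/-- The tables of the first `A` factors are in the memory. -/
structure HasTables (A : ℕ) (st : State) : Prop where
  phi : ∀ a < A, st.arr 2 a = (P.mN a).totient
  unit : ∀ a < A, ∀ j < (P.mN a).totient, st.arr 3 ((a : ℤ) * P.q + j) = unitAt (P.mN a) j
  inv : ∀ a < A, ∀ j < (P.mN a).totient, st.arr 4 ((a : ℤ) * P.q + j) = unitInv (P.mN a) j
  pow : ∀ a < A, ∀ t < P.mN a, ∀ e < (P.mN a).totient,
    st.arr 7 (((a : ℤ) * P.q + t) * P.q + e) = powCoeff (P.mN a) t e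
  root : ∀ a < A, ∀ t < P.mN a,
    st.arr 8 ((a : ℤ) * P.q + t) = (rootMod (P.mN a) P.q : ℤ) ^ t % P.q

/-- The inputs that the programs only read. -/
structure HasInput (st : State) : Prop where
  l : st.var 0 = P.l
  q : st.var 1 = P.q
  m : ∀ a < P.l, st.arr 0 a = P.mN a

/-- The size parameter dominates the parameters of the instance. -/
structure Sized (Z : ℕ) : Prop where
  large : 100 ≤ Z
  l : P.l ≤ Z
  q : P.q ≤ Z
  n : P.n ≤ Z
  m : ∀ a, P.mN a < P.q
  root : ∀ a, (rootMod (P.mN a) P.q : ZMod P.q) ^ P.mN a = 1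

variable {P}

theorem HasTables.agree {A : ℕ} {st st' : State} {p : Prog} (h : HasTables P A st)
    (hA : Agree p st st') (h2 : p.writesArr 2 = false) (h3 : p.writesArr 3 = false)
    (h4 : p.writesArr 4 = false) (h7 : p.writesArr 7 = false) (h8 : p.writesArr 8 = false) :
    HasTables P A st' :=
  ⟨by rw [hA.arr 2 h2]; exact h.phi, by rw [hA.arr 3 h3]; exact h.unit,
    by rw [hA.arr 4 h4]; exact h.inv, by rw [hA.arr 7 h7]; exact h.pow,
    by rw [hA.arr 8 h8]; exact h.root⟩

theorem HasInput.agree {st st' : State} {p : Prog} (h : HasInput P st) (hA : Agree p st st')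
    (h0 : p.writesVar 0 = false) (h1 : p.writesVar 1 = false) (ha : p.writesArr 0 = false) :
    HasInput P st' :=
  ⟨by rw [hA.var 0 h0, h.l], by rw [hA.var 1 h1, h.q], by rw [hA.arr 0 ha]; exact h.m⟩

variable {env : Env} {Z : ℕ}

theorem Sized.mN_le (hS : Sized P Z) (a : ℕ) : P.mN a ≤ Z := (hS.m a).le.trans hS.q

theorem progAxis_spec (hS : Sized P Z) {a : ℕ} (ha : a < P.l) {st : State} (hI : HasInput P st)
    (h4 : st.var 4 = a) (hT : HasTables P a st)
    (hmu : ∀ d < P.q, st.arr 5 d = ArithmeticFunction.moebius d) :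
    Ex env Z 30 progAxis st (HasTables P (a + 1)) := by
  have hZ := hS.large
  have haZ : a ≤ Z := ha.le.trans hS.l
  have hm := P.mN_pos a
  have hmq := hS.m a
  have hφ := Nat.totient_le (P.mN a)
  refine Ex.assign_seq hZ (v := P.mN a) (by decide) (by simp) (by simp [h4, hI.m a ha])
    (by norm_num) ?_
  refine Ex.seq hZ (Ex.le hZ (progUnits_spec hZ haZ hm hmq hS.q (by simp [hI.q]) (by simp [h4])
    (by simp)) (by norm_num)) ?_
  intro s1 hA1 ⟨k6, kfr, kun⟩
  have k1 : s1.var 1 = P.q := by rw [hA1.var 1 rfl]; simp [hI.q]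
  have k4 : s1.var 4 = a := by rw [hA1.var 4 rfl]; simp [h4]
  have k5 : s1.var 5 = P.mN a := by rw [hA1.var 5 rfl]; simp
  have kmu : ∀ d < P.q, s1.arr 5 d = ArithmeticFunction.moebius d := by
    rw [hA1.arr 5 rfl]; exact hmu
  refine Ex.seq hZ (Q := fun s => s = s1.setArr 2 a (P.mN a).totient)
    (Ex.le hZ (Ex.set hZ (by decide) (by simp) (by simp) (by simp [k4, k6])) (by norm_num)) ?_
  rintro _ - rfl
  refine Ex.seq hZ (Ex.le hZ (progCyc_spec hZ hm hmq hS.q (by simp [k5]) (by simpa using kmu))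
    (by norm_num)) ?_
  intro s2 hA2 hc
  have v1 : s2.var 1 = P.q := by rw [hA2.var 1 rfl]; simp [k1]
  have v4 : s2.var 4 = a := by rw [hA2.var 4 rfl]; simp [k4]
  have v5 : s2.var 5 = P.mN a := by rw [hA2.var 5 rfl]; simp [k5]
  have v6 : s2.var 6 = (P.mN a).totient := by rw [hA2.var 6 rfl]; simp [k6]
  refine Ex.seq hZ (Ex.le hZ (progPowers_spec hZ haZ hmq hS.q v1 v4 v5 v6 hc) (by norm_num)) ?_
  intro s3 hA3 ⟨pfr, ppw⟩
  refine Ex.conseq (Ex.le hZ (progRoot_spec hZ haZ hm hmq hS.q (by rw [hA3.var 1 rfl, v1])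
    (by rw [hA3.var 4 rfl, v4]) (by rw [hA3.var 5 rfl, v5]) (by rw [hA3.var 6 rfl, v6])
    (by rw [hA3.arr 6 rfl]; exact hc)) (by norm_num)) ?_
  intro s4 hA4 ⟨rfr, rpw⟩
  have e2 : s4.arr 2 = (s1.setArr 2 a (P.mN a).totient).arr 2 := by
    rw [hA4.arr 2 rfl, hA3.arr 2 rfl, hA2.arr 2 rfl]
  have e2' : s1.arr 2 = st.arr 2 := by rw [hA1.arr 2 rfl]; rfl
  have e3 : s4.arr 3 = s1.arr 3 := by
    rw [hA4.arr 3 rfl, hA3.arr 3 rfl, hA2.arr 3 rfl]; funext z; simp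
  have e4 : s4.arr 4 = s1.arr 4 := by
    rw [hA4.arr 4 rfl, hA3.arr 4 rfl, hA2.arr 4 rfl]; funext z; simp
  have e7 : s4.arr 7 = s3.arr 7 := hA4.arr 7 rfl
  have e7' : s2.arr 7 = st.arr 7 := by
    rw [hA2.arr 7 rfl]; funext z; simp [hA1.arr 7 rfl]
  have e8' : s3.arr 8 = st.arr 8 := by
    rw [hA3.arr 8 rfl, hA2.arr 8 rfl]; funext z; simp [hA1.arr 8 rfl]
  -- Cells of earlier factors lie below the offset `a * q`, the region that the programs for factor
  -- `a` leave alone.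
  have hlow : ∀ b < a, ∀ j < P.q, (b : ℤ) * P.q + j < a * P.q := by
    intro b hb j hj
    have : ((b + 1 : ℕ) : ℤ) * P.q ≤ a * P.q :=
      mul_le_mul_of_nonneg_right (by exact_mod_cast hb) (by positivity)
    push_cast at this
    have : (j : ℤ) < P.q := by exact_mod_cast hj
    linarith
  refine ⟨fun b hb => ?_, fun b hb j hj => ?_, fun b hb j hj => ?_, fun b hb t ht e he => ?_,
    fun b hb t ht => ?_⟩ <;> rcases Nat.lt_succ_iff_lt_or_eq.1 hb with hb | rfl
  · rw [e2]
    simp [hb.ne, e2', hT.phi b hb]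
  · rw [e2]
    simp
  · have := Nat.totient_le (P.mN b)
    have := hS.m b
    rw [e3, (kfr _ (hlow b hb j (by omega))).1]
    simpa using hT.unit b hb j hj
  · rw [e3, (kun j hj).1]
  · have := Nat.totient_le (P.mN b)
    have := hS.m b
    rw [e4, (kfr _ (hlow b hb j (by omega))).2]
    simpa using hT.inv b hb j hj
  · rw [e4, (kun j hj).2]
  · have := Nat.totient_le (P.mN b)
    have := hS.m b
    have h1 := hlow b hb t (by omega)
    have h2 : ((b : ℤ) * P.q + t) * P.q + e < a * P.q * P.q := by
      have h3 : ((b : ℤ) * P.q + t + 1) * P.q ≤ a * P.q * P.q :=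
        mul_le_mul_of_nonneg_right (by omega) (by positivity)
      have : (e : ℤ) < P.q := by omega
      linarith
    rw [e7, pfr _ h2, e7', hT.pow b hb t ht e he]
  · rw [e7, ppw t ht e he]
  · have := hS.m b
    rw [rfr _ (hlow b hb t (by omega)), e8', hT.root b hb t ht]
  · rw [rpw t ht]

theorem progTables_spec (hS : Sized P Z) {st : State} (hI : HasInput P st) :
    Ex env Z 34 progTables st (HasTables P P.l) := by
  have hZ := hS.large
  refine Ex.seq hZ (Ex.le hZ (progMu_spec hZ hS.q hI.q) (by norm_num)) ?_
  intro s1 hA1 hmu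
  have hI1 := hI.agree hA1 rfl rfl rfl
  refine Ex.for hZ (a := 30) (b := 1) P.l (by simpa using hS.l) (by norm_num) (by norm_num) rfl
    (by decide) ?_ (HasTables P) ⟨by simp, by simp, by simp, by simp, by simp⟩ ?_
  · intro s hA
    exact ⟨(hA.var 0 rfl).trans hI1.l, trivial⟩
  · intro a ha s hA hv hT
    refine Ex.conseq (progAxis_spec hS ha (hI1.agree hA rfl rfl rfl) hv hT ?_) ?_
    · rw [hA.arr 5 rfl]; exact hmu
    · exact fun s' _ h => ⟨h.phi, h.unit, h.inv, h.pow, h.root⟩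

end MRLWE

end

namespace MRLWE

/-! ### The matrices of the reduction are computed correctly -/

/-- The representative in `[0, q)`. -/
def rep {q : ℕ} (x : ZMod q) : ℤ := x.val

theorem cast_rep {q : ℕ} [NeZero q] (x : ZMod q) : ((rep x : ℤ) : ZMod q) = x := by
  rw [rep, Int.cast_natCast, ZMod.natCast_zmod_val]

theorem emod_eq_rep {q : ℕ} [NeZero q] {z : ℤ} {x : ZMod q} (h : (z : ZMod q) = x) :
    z % q = rep x := by
  rw [← h, rep, ZMod.val_intCast]

theorem rep_one {q : ℕ} (hq : 2 ≤ q) : rep (1 : ZMod q) = 1 := by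
  have : Fact (1 < q) := ⟨hq⟩
  rw [rep, ZMod.val_one, Nat.cast_one]

theorem bits_rep_le {q Z : ℕ} [NeZero q] (hq : q ≤ Z) (x : ZMod q) : bits (rep x) ≤ Z ^ 6 :=
  bits_natCast_le ((ZMod.val_lt x).le.trans hq)

theorem bits_prod_le {ι : Type*} (s : Finset ι) (f : ι → ℤ) {B : ℕ} (h : ∀ i ∈ s, bits (f i) ≤ B) :
    bits (∏ i ∈ s, f i) ≤ 1 + s.card * B := by
  classical
  induction s using Finset.induction_on with
  | empty => simp [bits]
  | insert i s hi ih =>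
    rw [Finset.prod_insert hi, Finset.card_insert_of_notMem hi]
    have h1 := bits_mul_le (f i) (∏ i ∈ s, f i)
    have h2 := h i (Finset.mem_insert_self _ _)
    have h3 := ih fun j hj => h j (Finset.mem_insert_of_mem hj)
    nlinarith

theorem unitAt_le {m j : ℕ} (h : j < m.totient) : unitAt m j ≤ m := (unitAt_lt h).le

variable {P : Params} {env : Env} {Z : ℕ}

theorem HasInput.setVar {st : State} (h : HasInput P st) {x : ℕ} (v : ℤ) (h0 : x ≠ 0)
    (h1 : x ≠ 1) : HasInput P (st.setVar x v) :=
  ⟨by simp [h0.symm, h.l], by simp [h1.symm, h.q], h.m⟩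

theorem HasTables.setVar {A : ℕ} {st : State} (h : HasTables P A st) (x : ℕ) (v : ℤ) :
    HasTables P A (st.setVar x v) :=
  ⟨h.phi, h.unit, h.inv, h.pow, h.root⟩

theorem Params.intCast_ediv_emod (k a : ℕ) :
    (k : ℤ) / (P.stride a : ℤ) % ((P.mN a).totient : ℤ) = P.digN k a := by
  rw [Params.digN, Int.natCast_mod, Int.natCast_div]

theorem Params.intCast_ediv_ediv (k a : ℕ) :
    (k : ℤ) / (P.stride a : ℤ) / ((P.mN a).totient : ℤ) = k / (P.stride (a + 1) : ℤ) := by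
  rw [P.stride_succ, Int.ediv_ediv_of_nonneg (by positivity), Int.natCast_mul]

theorem progDim_spec (hS : Sized P Z) {st : State} (hI : HasInput P st) (hT : HasTables P P.l st) :
    Ex env Z 15 progDim st fun s => s.var 16 = P.n ∧ s.var 17 = rep (crtC P) := by
  have hZ := hS.large
  refine Ex.assign_seq hZ (v := 1) (by decide) trivial rfl (by norm_num) ?_
  refine Ex.assign_seq hZ (v := 1) (by decide) trivial rfl (by norm_num) ?_
  refine Ex.conseq (Ex.for hZ (a := 10) (b := 1) P.l (by simpa using hS.l) (by norm_num)
    (by norm_num) rfl (by decide) ?_ (fun A s => s.var 16 = P.stride A ∧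
      s.var 17 = rep (∏ a ∈ Finset.range A, (P.mN a : ZMod P.q))) ?_ ?_) ?_
  · intro s hA
    exact ⟨(hA.var 0 rfl).trans (by simp [hI.l]), trivial⟩
  · simp [Params.stride, rep_one P.two_le_q]
  · intro a ha s hA hv ⟨h16, h17⟩
    have h1 : s.var 1 = P.q := by rw [hA.var 1 rfl]; simp [hI.q]
    have h0 : s.arr 0 a = P.mN a := by rw [hA.arr 0 rfl]; simp [hI.m a ha]
    have h2 : s.arr 2 a = (P.mN a).totient := by rw [hA.arr 2 rfl]; simp [hT.phi a ha]
    have b1 := bits_natCast_le ((P.stride_le ha.le).trans hS.n)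
    have b2 := bits_natCast_le ((P.totient_le ha).trans hS.n)
    have b3 := bits_natCast_le (hS.mN_le a)
    have b4 := bits_rep_le hS.q (∏ a ∈ Finset.range a, (P.mN a : ZMod P.q))
    refine Ex.assign_seq hZ (v := P.stride (a + 1)) (by decide) (by simp [hv, h16, h2, b1, b2])
      (by simp [hv, h16, h2, P.stride_succ]) (by norm_num) ?_
    refine Ex.assign hZ (by decide) (by simp [hv, h17, h0, b3, b4]) ⟨by simp, ?_⟩
    simp only [State.setVar_var, Expr.eval_mod, Expr.eval_mul, Expr.eval_var, Expr.eval_get, hv,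
      h17, h1, State.setVar_arr]
    norm_num
    rw [h0]
    refine emod_eq_rep ?_
    rw [Finset.prod_range_succ]
    push_cast
    rw [cast_rep]
  · rintro s - ⟨h1, h2⟩
    refine ⟨by rw [h1, P.stride_l], ?_⟩
    rw [h2, Finset.prod_range, crtC]
    simp [Params.mN_val]

/-- The table holds exponents below the conductor only; larger ones are reduced by `ρ ^ m = 1`. -/
theorem HasTables.root_mod {A : ℕ} {st : State} (hT : HasTables P A st) (hS : Sized P Z) {a : ℕ}
    (ha : a < A) (t : ℕ) : st.arr 8 ((a : ℤ) * P.q + (t : ℤ) % (P.mN a : ℕ)) =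
      rep ((rootMod (P.mN a) P.q : ZMod P.q) ^ t) := by
  rw [← Int.natCast_mod, hT.root a ha _ (Nat.mod_lt _ (P.mN_pos a))]
  refine emod_eq_rep ?_
  push_cast
  conv_rhs => rw [← Nat.mod_add_div t (P.mN a), pow_add, pow_mul, hS.root, one_pow, mul_one]

/-- The digits of `i` and `k` are peeled off in the course of the loop: after `A` factors the
variables hold the quotients by the place value, and the next digit is a remainder. -/
theorem progCrtEntry_spec (hS : Sized P Z) {st : State} (hI : HasInput P st)
    (hT : HasTables P P.l st) {i k : ℕ} (h18 : st.var 18 = i)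
    (h19 : st.var 19 = k) :
    Ex env Z 30 progCrtEntry st fun s =>
      s.var 23 = rep (∏ a ∈ Finset.range P.l, crtVFactor P i k a) ∧
      s.var 24 = rep (∏ a ∈ Finset.range P.l, crtWFactor P i k a) := by
  have hZ := hS.large
  refine Ex.assign_seq hZ (v := i) (by decide) trivial (by simp [h18]) (by norm_num) ?_
  refine Ex.assign_seq hZ (v := k) (by decide) trivial (by simp [h19]) (by norm_num) ?_
  refine Ex.assign_seq hZ (v := 1) (by decide) trivial rfl (by norm_num) ?_
  refine Ex.assign_seq hZ (v := 1) (by decide) trivial rfl (by norm_num) ?_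
  refine Ex.conseq (Ex.for hZ (a := 23) (b := 1) P.l (by simpa using hS.l) (by norm_num)
    (by norm_num) rfl (by decide) ?_ (fun A s => s.var 21 = (i : ℤ) / P.stride A ∧
      s.var 22 = (k : ℤ) / P.stride A ∧
      s.var 23 = rep (∏ a ∈ Finset.range A, crtVFactor P i k a) ∧
      s.var 24 = rep (∏ a ∈ Finset.range A, crtWFactor P i k a)) ?_ ?_)
      fun s _ h => h.2.2
  · intro s hA
    exact ⟨(hA.var 0 rfl).trans (by simp [hI.l]), trivial⟩
  · simp [Params.stride, rep_one P.two_le_q]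
  intro a ha s hA hv ⟨h21, h22, h23, h24⟩
  have hI' : HasInput P s := ((((hI.setVar _ (by decide) (by decide)).setVar _ (by decide)
    (by decide)).setVar _ (by decide) (by decide)).setVar _ (by decide) (by decide)).agree hA
    rfl rfl rfl
  have hT' : HasTables P P.l s := ((((hT.setVar _ _).setVar _ _).setVar _ _).setVar _ _).agree hA
    rfl rfl rfl rfl rfl
  have hm := P.mN_pos a
  have bq := bits_natCast_le hS.q
  have ba := bits_natCast_le (ha.le.trans hS.l)
  have bm := bits_natCast_le (hS.mN_le a)
  have hdi := P.digN_lt i a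
  have hdk := P.digN_lt k a
  have bd := bits_natCast_le (hdk.le.trans ((Nat.totient_le _).trans (hS.mN_le a)))
  have bu := bits_natCast_le ((unitAt_le hdi).trans (hS.mN_le a))
  have b1 := bits_one_le hZ
  have hmc : (P.mN a : ℤ) - 1 = ((P.mN a - 1 : ℕ) : ℤ) := by omega
  refine Ex.assign_seq hZ (v := (P.mN a).totient) (by decide) trivial (by simp [hv, hT'.phi a ha])
    (by norm_num) ?_
  refine Ex.assign_seq hZ (v := P.mN a) (by decide) trivial (by simp [hv, hI'.m a ha])
    (by norm_num) ?_
  refine Ex.assign_seq hZ (v := unitAt (P.mN a) (P.digN i a)) (by decide)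
    (by simp [hv, hI'.q, bq, ba])
    (by simp only [State.setVar_var, State.setVar_arr, Expr.eval_mod, Expr.eval_mul, Expr.eval_var,
          Expr.eval_get, Expr.eval_add, hv, h21, hI'.q]
        norm_num
        rw [P.intCast_ediv_emod, hT'.unit a ha _ hdi]) (by norm_num) ?_
  refine Ex.assign_seq hZ (v := P.digN k a) (by decide) (by simp)
    (by simp [h22, P.intCast_ediv_emod]) (by norm_num) ?_
  refine Ex.seq hZ (Ex.sum hZ (b := 1) (P.mN a) (by simpa using hS.mN_le a) (by norm_num)
    (by decide) (by decide) ?_ (fun t => rep ((rootMod (P.mN a) P.q : ZMod P.q) ^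
      ((P.mN a - 1) * (unitAt (P.mN a) (P.digN i a) * t))) * powCoeff (P.mN a) t (P.digN k a)) ?_) ?_
  · intro s1 hA1
    exact ⟨(hA1.var 5 rfl).trans (by simp), trivial⟩
  · intro t ht s1 hA1 hv1
    have g4 : s1.var 4 = a := by rw [hA1.var 4 rfl]; simp [hv]
    have g1 : s1.var 1 = P.q := by rw [hA1.var 1 rfl]; simp [hI'.q]
    have g5 : s1.var 5 = P.mN a := by rw [hA1.var 5 rfl]; simp
    have g36 : s1.var 36 = unitAt (P.mN a) (P.digN i a) := by rw [hA1.var 36 rfl]; simp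
    have g37 : s1.var 37 = P.digN k a := by rw [hA1.var 37 rfl]; simp
    have g8 : s1.arr 8 = s.arr 8 := by rw [hA1.arr 8 rfl]; rfl
    have g7 : s1.arr 7 = s.arr 7 := by rw [hA1.arr 7 rfl]; rfl
    have bt := bits_natCast_le (ht.le.trans (hS.mN_le a))
    have r1 := hT'.root_mod hS ha ((P.mN a - 1) * (unitAt (P.mN a) (P.digN i a) * t))
    push_cast at r1
    have r2 := hT'.pow a ha t ht _ hdk
    have b2 := bits_rep_le hS.q ((rootMod (P.mN a) P.q : ZMod P.q) ^
      ((P.mN a - 1) * (unitAt (P.mN a) (P.digN i a) * t)))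
    have b3 : bits (powCoeff (P.mN a) t (P.digN k a)) ≤ Z ^ 6 :=
      (bits_powCoeff_le hZ (hS.mN_le a) (ht.le.trans (hS.mN_le a)) _).trans
        (Nat.pow_le_pow_right (by omega) (by norm_num))
    constructor
    · simp only [Expr.eval_mod, Expr.eval_mul, Expr.eval_var, Expr.eval_get, Expr.eval_add,
        Expr.eval_sub, Expr.eval_one, g4, g1, g5, g36, g37, g8, g7, hv1, hmc, r1, r2]
    · simp only [Expr.mulBits_mod, Expr.mulBits_mul, Expr.mulBits_var, Expr.mulBits_get,
        Expr.mulBits_add, Expr.mulBits_sub, Expr.mulBits_one, Expr.leafBits_get, Expr.leafBits_var,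
        Expr.leafBits_sub, Expr.leafBits_one, Expr.leafBits_mul, Expr.leafBits_add,
        Expr.eval_mod, Expr.eval_mul, Expr.eval_var, Expr.eval_add,
        Expr.eval_sub, Expr.eval_one, g4, g1, g5, g36, g37, g8, g7, hv1, hmc, r1, r2]
      simp only [b2, b3, ba, bq, bm, bu, bt, b1, and_self]
  intro s1 hA1 hsum
  have g4 : s1.var 4 = a := by rw [hA1.var 4 rfl]; simp [hv]
  have g1 : s1.var 1 = P.q := by rw [hA1.var 1 rfl]; simp [hI'.q]
  have g5 : s1.var 5 = P.mN a := by rw [hA1.var 5 rfl]; simp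
  have g6 : s1.var 6 = (P.mN a).totient := by rw [hA1.var 6 rfl]; simp
  have g36 : s1.var 36 = unitAt (P.mN a) (P.digN i a) := by rw [hA1.var 36 rfl]; simp
  have g37 : s1.var 37 = P.digN k a := by rw [hA1.var 37 rfl]; simp
  have g21 : s1.var 21 = (i : ℤ) / P.stride a := by rw [hA1.var 21 rfl]; simp [h21]
  have g22 : s1.var 22 = (k : ℤ) / P.stride a := by rw [hA1.var 22 rfl]; simp [h22]
  have g23 : s1.var 23 = rep (∏ a ∈ Finset.range a, crtVFactor P i k a) := by
    rw [hA1.var 23 rfl]; simp [h23]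
  have g24 : s1.var 24 = rep (∏ a ∈ Finset.range a, crtWFactor P i k a) := by
    rw [hA1.var 24 rfl]; simp [h24]
  have g8 : s1.arr 8 = s.arr 8 := by rw [hA1.arr 8 rfl]; rfl
  have r1 := hT'.root_mod hS ha (unitAt (P.mN a) (P.digN i a) * P.digN k a)
  push_cast at r1
  have bv := bits_rep_le hS.q (∏ a ∈ Finset.range a, crtVFactor P i k a)
  have bw := bits_rep_le hS.q (∏ a ∈ Finset.range a, crtWFactor P i k a)
  have bw' := bits_rep_le hS.q (crtWFactor P i k a)
  have br := bits_rep_le hS.q ((rootMod (P.mN a) P.q : ZMod P.q) ^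
    (unitAt (P.mN a) (P.digN i a) * P.digN k a))
  refine Ex.assign_seq hZ (v := rep (crtWFactor P i k a)) (by decide) (by simp) ?_ (by norm_num) ?_
  · simp only [Expr.eval_mod, Expr.eval_var, hsum, g1]
    refine emod_eq_rep ?_
    push_cast
    simp only [cast_rep]
    rfl
  refine Ex.assign_seq hZ (v := rep (∏ a ∈ Finset.range (a + 1), crtVFactor P i k a)) (by decide)
    (by simp [g4, g1, g36, g37, g5, g23, g8, ba, bq, bu, bd, r1, bv, br]) ?_ (by norm_num) ?_
  · simp [g4, g1, g36, g37, g5, g23, g8, r1]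
    refine emod_eq_rep ?_
    rw [Finset.prod_range_succ]
    push_cast
    rw [cast_rep, cast_rep]
    rfl
  refine Ex.assign_seq hZ (v := rep (∏ a ∈ Finset.range (a + 1), crtWFactor P i k a)) (by decide)
    (by simp [g24, bw, bw']) ?_ (by norm_num) ?_
  · simp [g24, g1]
    refine emod_eq_rep ?_
    rw [Finset.prod_range_succ]
    push_cast
    rw [cast_rep, cast_rep]
  refine Ex.assign_seq hZ (v := (i : ℤ) / P.stride (a + 1)) (by decide) (by simp)
    (by simp [g21, g6, P.intCast_ediv_ediv]) (by norm_num) ?_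
  refine Ex.le hZ (Ex.assign hZ (by decide) (by simp) ?_) (by norm_num)
  simp [g22, g6, P.intCast_ediv_ediv]

theorem progCrt_spec (hS : Sized P Z) {st : State} (hI : HasInput P st) (hT : HasTables P P.l st)
    (h16 : st.var 16 = P.n) :
    Ex env Z 38 progCrt st fun s => ∀ i k : Fin P.n, s.arr 9 ((i : ℤ) * P.n + k) = rep (crtV P i k) ∧
      s.arr 10 ((i : ℤ) * P.n + k) = rep (crtW P i k) := by
  refine Ex.conseq (Ex.fill hS.large hS.n h16 (by decide) (by decide) (by decide) (by decide)
    (by norm_num) rfl rfl rfl rfl rfl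
    (fun i k => rep (∏ a ∈ Finset.range P.l, crtVFactor P i k a))
    (fun i k => rep (∏ a ∈ Finset.range P.l, crtWFactor P i k a)) ?_) ?_
  · intro i _ k _ s hA hx hy
    exact progCrtEntry_spec hS (hI.agree hA rfl rfl rfl) (hT.agree hA rfl rfl rfl rfl rfl) hx hy
  · intro s _ h i k
    rw [crtV_eq_prod, crtW_eq_prod]
    exact h i i.2 k k.2

theorem bits_autTFactor_le (hS : Sized P Z) (i j k k' a : ℕ) : bits (autTFactor P i j k k' a) ≤ Z ^ 3 :=
  bits_powCoeff_le hS.large (hS.mN_le a)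
    ((Nat.mod_lt _ (P.mN_pos a)).le.trans (hS.mN_le a)) _

/-- The entries of `autT` cannot be reduced modulo `q`, because the matrix also acts on `ℝ/ℤ`. So
their digits need a bound: at most `l` factors with at most `Z ^ 3` digits each. -/
theorem bits_prod_autTFactor_le (hS : Sized P Z) (i j k k' : ℕ) {A : ℕ} (hA : A ≤ P.l) :
    bits (∏ a ∈ Finset.range A, autTFactor P i j k k' a) ≤ Z ^ 6 := by
  have hZ := hS.large
  refine (bits_prod_le _ _ fun a _ => bits_autTFactor_le hS i j k k' a).trans ?_
  rw [Finset.card_range]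
  have h1 : A * Z ^ 3 ≤ Z * Z ^ 3 := Nat.mul_le_mul_right _ (hA.trans hS.l)
  have h2 : Z ^ 6 = Z * Z ^ 3 * (Z * Z) := by ring
  have h3 : 1 ≤ Z * Z ^ 3 := Nat.mul_pos (by omega) (Nat.pow_pos (by omega))
  have h4 : 2 ≤ Z * Z := by nlinarith
  rw [h2]
  nlinarith

theorem HasTables.autIndex {A : ℕ} {st : State} (hT : HasTables P A st) {a i j k k' x y : ℕ}
    (ha : a < A) (h1 : st.var 1 = P.q) (h4 : st.var 4 = a) (h5 : st.var 5 = P.mN a)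
    (h6 : st.var 6 = (P.mN a).totient) (hx : st.var x = (j : ℤ) / P.stride a)
    (hy : st.var y = (i : ℤ) / P.stride a) (h22 : st.var 22 = (k : ℤ) / P.stride a)
    (h37 : st.var 37 = (k' : ℤ) / P.stride a) :
    st.arr 7 ((autIndex x y).eval st) = autTFactor P i j k k' a := by
  simp only [MRLWE.autIndex, Expr.eval_mod, Expr.eval_mul, Expr.eval_var, Expr.eval_get,
    Expr.eval_add, h1, h4, h5, h6, hx, hy, h22, h37, P.intCast_ediv_emod,
    hT.unit a ha _ (P.digN_lt _ _), hT.inv a ha _ (P.digN_lt _ _)]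
  rw [autTFactor, ← hT.pow a ha _ (Nat.mod_lt _ (P.mN_pos a)) _ (P.digN_lt k' a)]
  push_cast
  rfl

theorem HasTables.mulBits_autIndex {A : ℕ} {st : State} (hS : Sized P Z) (hT : HasTables P A st)
    {a i j k x y : ℕ} (ha : a < A) (haZ : a ≤ Z) (h1 : st.var 1 = P.q) (h4 : st.var 4 = a)
    (h5 : st.var 5 = P.mN a) (hk : k ≤ Z)
    (h6 : st.var 6 = (P.mN a).totient) (hx : st.var x = (j : ℤ) / P.stride a)
    (hy : st.var y = (i : ℤ) / P.stride a) (h22 : st.var 22 = (k : ℤ) / P.stride a) :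
    (MRLWE.autIndex x y).MulBits st (Z ^ 6) := by
  have bq := bits_natCast_le hS.q
  have ba := bits_natCast_le haZ
  have bm := bits_natCast_le (hS.mN_le a)
  have bt := bits_natCast_le ((Nat.totient_le _).trans (hS.mN_le a))
  have bu := bits_natCast_le ((unitAt_le (P.digN_lt j a)).trans (hS.mN_le a))
  have bi := bits_natCast_le ((unitInv_lt (P.mN_pos a) (P.digN i a)).le.trans (hS.mN_le a))
  have bk := bits_natCast_le ((Nat.div_le_self k (P.stride a)).trans hk)
  push_cast at bk
  simp only [MRLWE.autIndex, Expr.mulBits_mod, Expr.mulBits_mul, Expr.mulBits_var, Expr.mulBits_get,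
        Expr.mulBits_add, Expr.leafBits_get, Expr.leafBits_var, Expr.leafBits_mod,
        Expr.leafBits_mul, Expr.leafBits_add, Expr.eval_mod, Expr.eval_mul, Expr.eval_var,
        Expr.eval_add, h1, h4, h5, h6, hx, hy, h22, P.intCast_ediv_emod,
    hT.unit a ha _ (P.digN_lt _ _), hT.inv a ha _ (P.digN_lt _ _), bq, ba, bm, bt, bu, bi, bk,
    and_self]

theorem progAutEntry_spec (hS : Sized P Z) {st : State} (hI : HasInput P st)
    (hT : HasTables P P.l st) {i j k k' : ℕ} (hk : k < P.n) (h18 : st.var 18 = i)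
    (h27 : st.var 27 = j) (h19 : st.var 19 = k) (h20 : st.var 20 = k') :
    Ex env Z 30 progAutEntry st fun s =>
      s.var 23 = ∏ a ∈ Finset.range P.l, autTFactor P i j k k' a ∧
      s.var 24 = ∏ a ∈ Finset.range P.l, autTFactor P j i k k' a := by
  have hZ := hS.large
  refine Ex.assign_seq hZ (v := i) (by decide) trivial (by simp [h18]) (by norm_num) ?_
  refine Ex.assign_seq hZ (v := j) (by decide) trivial (by simp [h27]) (by norm_num) ?_
  refine Ex.assign_seq hZ (v := k) (by decide) trivial (by simp [h19]) (by norm_num) ?_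
  refine Ex.assign_seq hZ (v := k') (by decide) trivial (by simp [h20]) (by norm_num) ?_
  refine Ex.assign_seq hZ (v := 1) (by decide) trivial rfl (by norm_num) ?_
  refine Ex.assign_seq hZ (v := 1) (by decide) trivial rfl (by norm_num) ?_
  refine Ex.conseq (Ex.for hZ (a := 21) (b := 1) P.l (by simpa using hS.l) (by norm_num)
    (by norm_num) rfl (by decide) ?_ (fun A s => s.var 21 = (i : ℤ) / P.stride A ∧
      s.var 36 = (j : ℤ) / P.stride A ∧ s.var 22 = (k : ℤ) / P.stride A ∧
      s.var 37 = (k' : ℤ) / P.stride A ∧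
      s.var 23 = ∏ a ∈ Finset.range A, autTFactor P i j k k' a ∧
      s.var 24 = ∏ a ∈ Finset.range A, autTFactor P j i k k' a) ?_ ?_)
      fun s _ h => h.2.2.2.2
  · intro s hA
    exact ⟨(hA.var 0 rfl).trans (by simp [hI.l]), trivial⟩
  · simp [Params.stride]
  intro a ha s hA hv ⟨h21, h36, h22, h37, h23, h24⟩
  have hI' : HasInput P s := ((((((hI.setVar _ (by decide) (by decide)).setVar _ (by decide)
    (by decide)).setVar _ (by decide) (by decide)).setVar _ (by decide) (by decide)).setVar _
    (by decide) (by decide)).setVar _ (by decide) (by decide)).agree hA rfl rfl rfl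
  have hT' : HasTables P P.l s := ((((((hT.setVar _ _).setVar _ _).setVar _ _).setVar _ _).setVar
    _ _).setVar _ _).agree hA rfl rfl rfl rfl rfl
  have b1 := bits_prod_autTFactor_le hS i j k k' ha.le
  have b2 := bits_prod_autTFactor_le hS j i k k' ha.le
  have b3 : ∀ i j, bits (autTFactor P i j k k' a) ≤ Z ^ 6 := fun i j =>
    (bits_autTFactor_le hS i j k k' a).trans (Nat.pow_le_pow_right (by omega) (by norm_num))
  have haZ := ha.le.trans hS.l
  refine Ex.assign_seq hZ (v := (P.mN a).totient) (by decide) trivial (by simp [hv, hT'.phi a ha])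
    (by norm_num) ?_
  refine Ex.assign_seq hZ (v := P.mN a) (by decide) trivial (by simp [hv, hI'.m a ha])
    (by norm_num) ?_
  have hT2 : HasTables P P.l ((s.setVar 6 (P.mN a).totient).setVar 5 (P.mN a)) :=
    (hT'.setVar _ _).setVar _ _
  have e1 : _ = autTFactor P i j k k' a := hT2.autIndex (x := 36) (y := 21) ha (by simp [hI'.q])
    (by simp [hv]) (by simp) (by simp) (by simp [h36]) (by simp [h21]) (by simp [h22])
    (by simp [h37])
  have m1 : (autIndex 36 21).MulBits _ (Z ^ 6) := HasTables.mulBits_autIndex hS hT2 (i := i) (j := j) ha haZ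
    (by simp [hI'.q])
    (by simp [hv]) (by simp) (hk.le.trans hS.n) (by simp) (by simp [h36]) (by simp [h21]) (by simp [h22])
  refine Ex.assign_seq hZ (v := ∏ a ∈ Finset.range (a + 1), autTFactor P i j k k' a) (by decide)
    ⟨⟨?_, ?_⟩, trivial, m1⟩ ?_ (by norm_num) ?_
  · simp [h23, b1]
  · rw [Expr.leafBits_get, e1]; exact b3 i j
  · rw [Expr.eval_mul, Expr.eval_get, e1, Finset.prod_range_succ]
    simp [h23]
  have hT3 := hT2.setVar 23 (∏ a ∈ Finset.range (a + 1), autTFactor P i j k k' a)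
  have e2 : _ = autTFactor P j i k k' a := hT3.autIndex (x := 21) (y := 36) ha (by simp [hI'.q])
    (by simp [hv]) (by simp) (by simp) (by simp [h21]) (by simp [h36]) (by simp [h22])
    (by simp [h37])
  have m2 : (autIndex 21 36).MulBits _ (Z ^ 6) := HasTables.mulBits_autIndex hS hT3 (i := j) (j := i) ha haZ
    (by simp [hI'.q])
    (by simp [hv]) (by simp) (hk.le.trans hS.n) (by simp) (by simp [h21]) (by simp [h36]) (by simp [h22])
  refine Ex.assign_seq hZ (v := ∏ a ∈ Finset.range (a + 1), autTFactor P j i k k' a) (by decide)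
    ⟨⟨?_, ?_⟩, trivial, m2⟩ ?_ (by norm_num) ?_
  · simp [h24, b2]
  · rw [Expr.leafBits_get, e2]; exact b3 j i
  · rw [Expr.eval_mul, Expr.eval_get, e2, Finset.prod_range_succ (fun a => autTFactor P j i k k' a)]
    simp [h24]
  refine Ex.assign_seq hZ (v := (i : ℤ) / P.stride (a + 1)) (by decide) (by simp)
    (by simp [h21, P.intCast_ediv_ediv]) (by norm_num) ?_
  refine Ex.assign_seq hZ (v := (j : ℤ) / P.stride (a + 1)) (by decide) (by simp)
    (by simp [h36, P.intCast_ediv_ediv]) (by norm_num) ?_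
  refine Ex.assign_seq hZ (v := (k : ℤ) / P.stride (a + 1)) (by decide) (by simp)
    (by simp [h22, P.intCast_ediv_ediv]) (by norm_num) ?_
  refine Ex.le hZ (Ex.assign hZ (by decide) (by simp) ?_) (by norm_num)
  simp [h37, P.intCast_ediv_ediv]

theorem progAut_spec (hS : Sized P Z) {st : State} (hI : HasInput P st) (hT : HasTables P P.l st)
    (h16 : st.var 16 = P.n) {i j : Fin P.n} (h18 : st.var 18 = (i : ℕ)) (h27 : st.var 27 = (j : ℕ)) :
    Ex env Z 38 progAut st fun s => ∀ k k' : Fin P.n,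
      s.arr 11 ((k : ℤ) * P.n + k') = autT P i j k k' ∧
      s.arr 12 ((k : ℤ) * P.n + k') = autT P j i k k' := by
  refine Ex.conseq (Ex.fill hS.large hS.n h16 (by decide) (by decide) (by decide) (by decide)
    (by norm_num) rfl rfl rfl rfl rfl
    (fun k k' => ∏ a ∈ Finset.range P.l, autTFactor P i j k k' a)
    (fun k k' => ∏ a ∈ Finset.range P.l, autTFactor P j i k k' a) ?_) ?_
  · intro k hk k' hk' s hA hx hy
    exact progAutEntry_spec hS (hI.agree hA rfl rfl rfl) (hT.agree hA rfl rfl rfl rfl rfl) hk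
      ((hA.var 18 rfl).trans h18) ((hA.var 27 rfl).trans h27) hx hy
  · intro s _ h k k'
    rw [autT_eq_prod, autT_eq_prod]
    exact h k k.2 k' k'.2

theorem bits_autT_le (hS : Sized P Z) (i j k k' : Fin P.n) : bits (autT P i j k k') ≤ Z ^ 6 := by
  rw [autT_eq_prod]
  exact bits_prod_autTFactor_le hS i j k k' le_rfl

end MRLWE

/-! ### The transformation of samples, the reduction program, and its correctness as a program. -/

noncomputable section

namespace MRLWE

/-! ### Samples and oracle calls -/

theorem overwrite_natCast {β : Type} {n : ℕ} (f : ℤ → β) (v : Fin n → β) (k : Fin n) :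
    overwrite f v ((k : ℕ) : ℤ) = v k := by
  have h : (0 : ℤ) ≤ ((k : ℕ) : ℤ) ∧ ((k : ℕ) : ℤ) < n := by have := k.2; omega
  rw [overwrite, dif_pos h]
  congr 1

section Rules

variable {env : Env} {Z : ℕ}

theorem Ex.sample (hZ : 100 ≤ Z) (hn : env.n ≤ Z) {A B : ℕ} {st : State} :
    Ex env Z 9 (.sample A B) st fun s =>
      (∀ k : Fin env.n, s.arr A ((k : ℕ) : ℤ) = (env.sample st.samples).1 k) ∧
      (∀ k : Fin env.n, s.tarr B ((k : ℕ) : ℤ) = (env.sample st.samples).2 k) ∧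
      s.samples = st.samples + 1 := by
  refine ⟨_, _, Exec.sample A B st, ?_, ?_, ?_, rfl⟩
  · calc 1 + env.n ≤ Z * Z := by nlinarith
      _ = Z ^ 2 := by ring
      _ ≤ Z ^ 9 := Nat.pow_le_pow_right (by omega) (by norm_num)
  · intro k
    simp [overwrite_natCast]
  · intro k
    simp [overwrite_natCast]

theorem Ex.query (hZ : 100 ≤ Z) (hn : env.n ≤ Z) (hL : env.L ≤ Z) {x A B : ℕ} {st : State} :
    Ex env Z 9 (.query x A B) st fun s =>
      s.var x = (if env.answer st.queries (fun i =>
          (fun k => st.arr A ((i * env.n + k : ℕ) : ℤ),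
            fun k => st.tarr B ((i * env.n + k : ℕ) : ℤ))) then 1 else 0) ∧
      s.queries = st.queries + 1 := by
  refine ⟨_, _, Exec.query x A B st, ?_, by simp, rfl⟩
  calc 1 + env.L * env.n ≤ 1 + Z * Z := Nat.add_le_add_left (Nat.mul_le_mul hL hn) _
    _ ≤ Z ^ 3 := by nlinarith [show Z ^ 3 = Z * Z * Z by ring]
    _ ≤ Z ^ 9 := Nat.pow_le_pow_right (by omega) (by norm_num)

end Rules

/-- `1` if `a < b`, else `0`, for `0 ≤ a` and `0 ≤ b`. -/
def Expr.lt (a b : Expr) : Expr := 1 - 1 / (1 + b / (a + 1))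

/-- The quotient of `b` by `a + 1` is positive exactly for `a < b`, and `1 / (1 + z)` is the
indicator of zero. -/
theorem Expr.eval_lt {st : State} {a b : Expr} {x y : ℕ} (ha : a.eval st = x) (hb : b.eval st = y) :
    (Expr.lt a b).eval st = if x < y then 1 else 0 := by
  have h : (Expr.lt a b).eval st = 1 - 1 / (1 + ((y / (x + 1) : ℕ) : ℤ)) := by
    simp [Expr.lt, ha, hb]
  rw [h]
  split_ifs with hxy
  · have : 1 ≤ y / (x + 1) := (Nat.one_le_div_iff (by omega)).2 hxy
    rw [Int.ediv_eq_zero_of_lt (by omega) (by omega)]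
    rfl
  · rw [Nat.div_eq_of_lt (by omega)]
    rfl

/-! ### The transformed samples -/

section Transform

variable (P : Params)

/-- Vectors modulo `q` as elements of order dividing `q` of the torus. -/
def embT (v : Fin P.n → ZMod P.q) : Fin P.n → UnitAddCircle := fun k => ZMod.toAddCircle (v k)

/-- The value of the `i`-th homomorphism `R_q → ℤ/q`. -/
def evalV (a : Fin P.n → ZMod P.q) (i : Fin P.n) : ZMod P.q := ∑ k, crtV P i k * a k

/-- The coordinates of a combination of the homomorphisms. -/
def combV (w : Fin P.n → ZMod P.q) (k : Fin P.n) : ZMod P.q := ∑ j, w j * crtV P j k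

/-- The first component of a transformed sample. -/
def transformA (i j : Fin P.n) (md : ℕ) (a h : Fin P.n → ZMod P.q) (k : Fin P.n) : ZMod P.q :=
  ∑ k', a k' * autT P i j k' k + (1 - md) * h i * crtW P i k

/-- What is added to the second component of a transformed sample. -/
def transformW (i : Fin P.n) (lam : ZMod P.q) (t a h : Fin P.n → ZMod P.q) (j : Fin P.n) : ZMod P.q :=
  evalV P a j * t j + (if j < i then h j else 0) + (if j = i then lam * h j else 0)

/-- An integer matrix acting on the torus. -/
def autTorus (i j : Fin P.n) (b : Fin P.n → UnitAddCircle) (k : Fin P.n) : UnitAddCircle :=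
  ∑ k', autT P i j k k' • b k'

/-- The multiple of `h_i` that is added at position `i`. -/
def guess (g : ZMod P.q) (md : ℕ) : ZMod P.q := (1 - md) * (crtC P * g) + md

/-- The transformed sample. -/
def transform (i j : Fin P.n) (g : ZMod P.q) (md : ℕ) (t : Fin P.n → ZMod P.q) (x : Sample P)
    (h : Fin P.n → ZMod P.q) : Sample P :=
  (transformA P i j md x.1 h,
    embT P (combV P (transformW P i (guess P g md) t (transformA P i j md x.1 h) h)) +
      autTorus P j i x.2)

variable {P}

/-- The reply to the `Q`-th oracle call. -/
def reply {L : ℕ} (D : Distinguisher P L) (ω : Randomness P) (i j : Fin P.n) (g : ZMod P.q)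
    (md Q : ℕ) : ℤ :=
  if ω.2.2 Q < D.accept (fun y : Fin L => transform P i j g md (coord P (ω.1 (Q * (1 + 2 * L)))).1
      (coord P (ω.1 (Q * (1 + 2 * L) + 1 + 2 * y)))
      (coord P (ω.1 (Q * (1 + 2 * L) + 2 + 2 * y))).1) then 1 else 0

/-- The number of the oracle call. -/
def callIndex (P : Params) (N j i g r md : ℕ) : ℕ := (((j * P.n + i) * P.q + g) * N + r) * 2 + md

/-- The difference of the numbers of positive replies to the two kinds of oracle calls. -/
def score {L : ℕ} (D : Distinguisher P L) (ω : Randomness P) (N : ℕ) (j i : Fin P.n) (g : ℕ) : ℤ :=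
  ∑ r ∈ Finset.range N, (reply D ω i j g 0 (callIndex P N j i g r 0) -
    reply D ω i j g 1 (callIndex P N j i g r 1))

end Transform

/-! ### The program -/

/-- The first component of one transformed sample. -/
def progTransformA : Prog :=
  .for 19 (.var 16) (.seq
    (.sum 20 21 (.var 16) (.get 13 (.var 20) * .get 11 (.var 20 * .var 16 + .var 19)))
    (.set 16 (.var 34 * .var 16 + .var 19)
      ((.var 21 + (1 - .var 33) * .get 15 (.var 18) * .get 10 (.var 18 * .var 16 + .var 19)) % .var 1)))

/-- The coefficients of what is added to the second component. -/
def progTransformW : Prog :=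
  .for 19 (.var 16) (.seq
    (.sum 20 21 (.var 16) (.get 9 (.var 19 * .var 16 + .var 20) *
      .get 16 (.var 34 * .var 16 + .var 20)))
    (.seq (.assign 21 (.var 21 % .var 1))
    (.set 17 (.var 19) ((.var 21 * .get 14 (.var 19) + .lt (.var 19) (.var 18) * .get 15 (.var 19) +
      .delta (.var 19) (.var 18) * (.var 40 * .get 15 (.var 19))) % .var 1))))

/-- The second component of one transformed sample. -/
def progTransformB : Prog :=
  .for 19 (.var 16) (.seq
    (.sum 20 21 (.var 16) (.get 17 (.var 20) * .get 9 (.var 20 * .var 16 + .var 19)))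
    (.seq (.tset 2 (.var 34 * .var 16 + .var 19) (.frac (.var 21) (.var 1)))
    (.for 20 (.var 16) (.tset 2 (.var 34 * .var 16 + .var 19)
      (.add (.get 2 (.var 34 * .var 16 + .var 19))
        (.smul (.get 12 (.var 19 * .var 16 + .var 20)) (.get 1 (.var 20))))))))

/-- One oracle call. -/
def progQuery : Prog :=
  .seq (.sample 14 0) (.seq (.for 34 (.var 3) (.seq (.sample 13 1) (.seq (.sample 15 0)
    (.seq progTransformA (.seq progTransformW progTransformB))))) (.query 35 16 2))

/-- The score of one guess. -/
def progScore : Prog :=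
  .seq (.assign 31 0) (.for 32 (.var 38) (.for 33 2 (.seq
    (.assign 40 ((1 - .var 33) * (.var 17 * .var 30 % .var 1) + .var 33))
    (.seq progQuery (.assign 31 (.var 31 + (1 - 2 * .var 33) * .var 35))))))

/-- The search for the best guess for one component of the secret. -/
def progSearch : Prog :=
  .seq (.assign 28 (0 - 1)) (.seq (.assign 29 0) (.for 18 (.var 16) (.seq progAut
    (.for 30 (.var 1) (.seq progScore (.cond (.var 31 * .var 31 - .var 28)
      (.seq (.assign 28 (.var 31 * .var 31)) (.assign 29 (.var 30))) .skip))))))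

/-- The search-to-decision reduction. -/
def progReduction : Prog :=
  .seq progTables (.seq progDim (.seq progCrt (.seq
    (.assign 38 (16 * (.var 2 * .var 2) * (.var 16 * (.var 16 * .var 16))))
    (.for 27 (.var 16) (.seq progSearch (.for 19 (.var 16)
      (.set 1 (.var 19) ((.get 1 (.var 19) + .var 29 * .get 9 (.var 27 * .var 16 + .var 19)) % .var 1))))))))

end MRLWE

end

namespace MRLWE

/-! ### An oracle call is made as intended -/

theorem Ex.sumFin {env : Env} {Z : ℕ} (hZ : 100 ≤ Z) {x acc : ℕ} {N e : Expr} {st : State}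
    {n : ℕ} (hn : n ≤ Z) (hx : x ≠ acc) (hs : N.size ≤ 50 ∧ e.size ≤ 50)
    (hN : ∀ st', Agree (.sum x acc N e) st st' → N.eval st' = n ∧ N.MulBits st' (Z ^ 6))
    (f : Fin n → ℤ)
    (hf : ∀ i : Fin n, ∀ st', Agree (.sum x acc N e) st st' → st'.var x = (i : ℕ) →
      e.eval st' = f i ∧ e.MulBits st' (Z ^ 6)) :
    Ex env Z 13 (.sum x acc N e) st fun st' => st'.var acc = ∑ i, f i := by
  refine Ex.conseq (Ex.sum hZ (b := 1) n (by simpa using hn) (by norm_num) hx hs hN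
    (fun i => if h : i < n then f ⟨i, h⟩ else 0) ?_) fun s _ h => ?_
  · intro i hi s hA hv
    simpa [hi] using hf ⟨i, hi⟩ s hA hv
  · rw [h, Finset.sum_range]
    simp

variable {P : Params} {Z : ℕ}

/-- The matrices of an automorphism and the degree are in the memory. -/
structure Ready (i j : Fin P.n) (st : State) : Prop where
  q : st.var 1 = P.q
  n : st.var 16 = P.n
  idx : st.var 18 = (i : ℕ)
  V : ∀ i k : Fin P.n, st.arr 9 ((i : ℤ) * P.n + k) = rep (crtV P i k)
  W : ∀ i k : Fin P.n, st.arr 10 ((i : ℤ) * P.n + k) = rep (crtW P i k)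
  T : ∀ k k' : Fin P.n, st.arr 11 ((k : ℤ) * P.n + k') = autT P i j k k'
  T' : ∀ k k' : Fin P.n, st.arr 12 ((k : ℤ) * P.n + k') = autT P j i k k'

theorem Ready.agree {i j : Fin P.n} {st st' : State} {p : Prog} (h : Ready i j st)
    (hA : Agree p st st') (h1 : p.writesVar 1 = false) (h2 : p.writesVar 16 = false)
    (h3 : p.writesVar 18 = false) (h9 : p.writesArr 9 = false) (h10 : p.writesArr 10 = false)
    (h11 : p.writesArr 11 = false) (h12 : p.writesArr 12 = false) : Ready i j st' :=
  ⟨by rw [hA.var 1 h1, h.q], by rw [hA.var 16 h2, h.n], by rw [hA.var 18 h3, h.idx],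
    by rw [hA.arr 9 h9]; exact h.V, by rw [hA.arr 10 h10]; exact h.W,
    by rw [hA.arr 11 h11]; exact h.T, by rw [hA.arr 12 h12]; exact h.T'⟩

theorem Ready.setVar {i j : Fin P.n} {st : State} (h : Ready i j st) (x : ℕ) (v : ℤ) (h1 : x ≠ 1)
    (h2 : x ≠ 16) (h3 : x ≠ 18) : Ready i j (st.setVar x v) :=
  ⟨by simp [-Nat.cast_prod, h1.symm, h.q], by simp [-Nat.cast_prod, h2.symm, h.n], by simp [-Nat.cast_prod, h3.symm, h.idx], h.V, h.W, h.T, h.T'⟩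

section Parts

variable {env : Env} {i j : Fin P.n} {st : State} {y : ℕ}

/-- Array `16` collects the first components of all `L` samples of a query, the `y`-th one at offset
`y * n`. That earlier blocks are untouched is part of the claim, since the frame rule only sees
whole arrays. -/
theorem progTransformA_spec (hS : Sized P Z) (hR : Ready i j st) (hy : y ≤ Z)
    (h34 : st.var 34 = y) {md : ℕ} (hmd : md ≤ 1) (h33 : st.var 33 = md)
    {a h : Fin P.n → ZMod P.q} (h13 : ∀ k : Fin P.n, st.arr 13 (k : ℕ) = rep (a k))
    (h15 : ∀ k : Fin P.n, st.arr 15 (k : ℕ) = rep (h k)) :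
    Ex env Z 17 progTransformA st fun s =>
      (∀ k : Fin P.n, s.arr 16 ((y : ℤ) * P.n + k) = rep (transformA P i j md a h k)) ∧
      ∀ z < (y : ℤ) * P.n, s.arr 16 z = st.arr 16 z := by
  have hZ := hS.large
  have bn := bits_natCast_le hS.n
  have bi := bits_natCast_le (i.2.le.trans hS.n)
  have by' := bits_natCast_le hy
  have b1 := bits_one_le hZ
  have bmd := bits_natCast_le (hmd.trans (by omega : 1 ≤ Z))
  refine Ex.conseq (Ex.for hZ (a := 14) (b := 1) P.n (by simpa using hS.n) (by norm_num)
    (by norm_num) rfl (by decide) ?_ (fun K s =>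
      (∀ k : Fin P.n, k < K → s.arr 16 ((y : ℤ) * P.n + k) = rep (transformA P i j md a h k)) ∧
      ∀ z < (y : ℤ) * P.n, s.arr 16 z = st.arr 16 z) ?_ ?_)
      fun s _ h => ⟨fun k => h.1 k k.2, h.2⟩
  · intro s hA
    exact ⟨(hA.var 16 rfl).trans hR.n, trivial⟩
  · simp
  intro k hk s hA hv ⟨hI1, hI2⟩
  have hR1 : Ready i j s := hR.agree hA rfl rfl rfl rfl rfl rfl rfl
  refine Ex.seq hZ (Ex.sumFin hZ hS.n (by decide) (by decide) ?_
    (fun k' => rep (a k') * autT P i j k' ⟨k, hk⟩) ?_) ?_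
  · intro s1 hA1
    exact ⟨(hA1.var 16 rfl).trans hR1.n, trivial⟩
  · intro k' s1 hA1 hv1
    have hR2 : Ready i j s1 := hR1.agree hA1 rfl rfl rfl rfl rfl rfl rfl
    have g19 : s1.var 19 = k := (hA1.var 19 rfl).trans hv
    have g13 : s1.arr 13 (k' : ℕ) = rep (a k') := by rw [hA1.arr 13 rfl, hA.arr 13 rfl, h13]
    have gT : s1.arr 11 (((k' : ℕ) : ℤ) * P.n + k) = autT P i j k' ⟨k, hk⟩ := hR2.T k' ⟨k, hk⟩
    have bk := bits_natCast_le (k'.2.le.trans hS.n)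
    have bT := bits_autT_le hS i j k' ⟨k, hk⟩
    have ba := bits_rep_le hS.q (a k')
    exact ⟨by simp only [Expr.eval_mul, Expr.eval_get, Expr.eval_add, Expr.eval_var, hv1, g13,
      hR2.n, g19, gT], by simp [-Nat.cast_prod, hv1, g13, hR2.n, g19, gT, bk, bT, ba, bn]⟩
  intro s1 hA1 hsum
  have hR2 : Ready i j s1 := hR1.agree hA1 rfl rfl rfl rfl rfl rfl rfl
  have g19 : s1.var 19 = k := (hA1.var 19 rfl).trans hv
  have g33 : s1.var 33 = md := by rw [hA1.var 33 rfl, hA.var 33 rfl, h33]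
  have g34 : s1.var 34 = y := by rw [hA1.var 34 rfl, hA.var 34 rfl, h34]
  have g15 : s1.arr 15 (i : ℕ) = rep (h i) := by rw [hA1.arr 15 rfl, hA.arr 15 rfl, h15]
  have gW : s1.arr 10 (((i : ℕ) : ℤ) * P.n + k) = rep (crtW P i ⟨k, hk⟩) := hR2.W i ⟨k, hk⟩
  have g16 : s1.arr 16 = s.arr 16 := hA1.arr 16 rfl
  have bW := bits_rep_le hS.q (crtW P i ⟨k, hk⟩)
  have bh := bits_rep_le hS.q (h i)
  have hval : ((Expr.var 21 + (1 - .var 33) * .get 15 (.var 18) *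
      .get 10 (.var 18 * .var 16 + .var 19)) % .var 1).eval s1 =
      rep (transformA P i j md a h ⟨k, hk⟩) := by
    simp only [Expr.eval_mod, Expr.eval_mul, Expr.eval_get, Expr.eval_add, Expr.eval_sub,
      Expr.eval_one, Expr.eval_var, g19, g33, g15, gW, hR2.n, hR2.q, hR2.idx, hsum]
    refine emod_eq_rep ?_
    push_cast
    simp only [cast_rep]
    rfl
  refine Ex.le hZ (Ex.set hZ (by decide) (by simp [-Nat.cast_prod, g34, hR2.n, by', bn])
    (by simp [-Nat.cast_prod, g33, g15, gW, hR2.idx, hR2.n, g19, bi, bn, bW, bh, b1, bmd]) ⟨?_, ?_⟩) (by norm_num)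
  · intro k' hk'
    rw [hval]
    simp only [State.setVar_arr, State.setArr_arr, Expr.eval_mul, Expr.eval_add, Expr.eval_var,
      g34, hR2.n, g19, true_and, add_right_inj, Nat.cast_inj]
    split_ifs with h5
    · congr
      exact h5.symm
    · rw [g16]
      exact hI1 k' (by omega)
  · intro z hz
    have : z ≠ (y : ℤ) * P.n + k := by omega
    simp [-Nat.cast_prod, g34, hR2.n, g19, this, g16, hI2 z hz]

theorem progTransformW_spec (hS : Sized P Z) (hR : Ready i j st) (hy : y ≤ Z)
    (h34 : st.var 34 = y) {lam : ZMod P.q} (h40 : st.var 40 = rep lam)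
    {t a h : Fin P.n → ZMod P.q} (h14 : ∀ k : Fin P.n, st.arr 14 (k : ℕ) = rep (t k))
    (h16 : ∀ k : Fin P.n, st.arr 16 ((y : ℤ) * P.n + k) = rep (a k))
    (h15 : ∀ k : Fin P.n, st.arr 15 (k : ℕ) = rep (h k)) :
    Ex env Z 18 progTransformW st fun s =>
      ∀ k : Fin P.n, s.arr 17 (k : ℕ) = rep (transformW P i lam t a h k) := by
  have hZ := hS.large
  have bn := bits_natCast_le hS.n
  have bi := bits_natCast_le (i.2.le.trans hS.n)
  have by' := bits_natCast_le hy
  have b1 := bits_one_le hZ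
  have bl := bits_rep_le hS.q lam
  refine Ex.conseq (Ex.for hZ (a := 15) (b := 1) P.n (by simpa using hS.n) (by norm_num)
    (by norm_num) rfl (by decide) ?_ (fun K s =>
      ∀ k : Fin P.n, k < K → s.arr 17 (k : ℕ) = rep (transformW P i lam t a h k)) ?_ ?_)
      fun s _ h k => h k k.2
  · intro s hA
    exact ⟨(hA.var 16 rfl).trans hR.n, trivial⟩
  · simp
  intro k hk s hA hv hI
  have hR1 : Ready i j s := hR.agree hA rfl rfl rfl rfl rfl rfl rfl
  refine Ex.seq hZ (Ex.le hZ (Ex.sumFin hZ hS.n (by decide) (by decide) ?_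
    (fun k' => rep (crtV P ⟨k, hk⟩ k') * rep (a k')) ?_) (by norm_num)) ?_
  · intro s1 hA1
    exact ⟨(hA1.var 16 rfl).trans hR1.n, trivial⟩
  · intro k' s1 hA1 hv1
    have hR2 : Ready i j s1 := hR1.agree hA1 rfl rfl rfl rfl rfl rfl rfl
    have g19 : s1.var 19 = k := (hA1.var 19 rfl).trans hv
    have g34 : s1.var 34 = y := by rw [hA1.var 34 rfl, hA.var 34 rfl, h34]
    have g16 : s1.arr 16 ((y : ℤ) * P.n + k') = rep (a k') := by
      rw [hA1.arr 16 rfl, hA.arr 16 rfl, h16]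
    have gV : s1.arr 9 ((k : ℤ) * P.n + k') = rep (crtV P ⟨k, hk⟩ k') := hR2.V ⟨k, hk⟩ k'
    have bk := bits_natCast_le (hk.le.trans hS.n)
    have bV := bits_rep_le hS.q (crtV P ⟨k, hk⟩ k')
    have ba := bits_rep_le hS.q (a k')
    exact ⟨by simp only [Expr.eval_mul, Expr.eval_get, Expr.eval_add, Expr.eval_var, hv1, g16, g34,
      hR2.n, g19, gV], by simp [-Nat.cast_prod, hv1, g16, hR2.n, g19, g34, gV, bk, bV, ba, bn, by']⟩
  intro s1 hA1 hsum
  have hR2 : Ready i j s1 := hR1.agree hA1 rfl rfl rfl rfl rfl rfl rfl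
  have g19 : s1.var 19 = k := (hA1.var 19 rfl).trans hv
  have g40 : s1.var 40 = rep lam := by rw [hA1.var 40 rfl, hA.var 40 rfl, h40]
  have g14 : s1.arr 14 (k : ℕ) = rep (t ⟨k, hk⟩) := by
    rw [hA1.arr 14 rfl, hA.arr 14 rfl]; exact h14 ⟨k, hk⟩
  have g15 : s1.arr 15 (k : ℕ) = rep (h ⟨k, hk⟩) := by
    rw [hA1.arr 15 rfl, hA.arr 15 rfl]; exact h15 ⟨k, hk⟩
  have g17 : s1.arr 17 = s.arr 17 := hA1.arr 17 rfl
  have bk := bits_natCast_le (hk.le.trans hS.n)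
  have bt := bits_rep_le hS.q (t ⟨k, hk⟩)
  have bh := bits_rep_le hS.q (h ⟨k, hk⟩)
  have be := bits_rep_le hS.q (evalV P a ⟨k, hk⟩)
  refine Ex.assign_seq hZ (v := rep (evalV P a ⟨k, hk⟩)) (by decide) (by simp) ?_ (by norm_num) ?_
  · simp only [Expr.eval_mod, Expr.eval_var, hsum, hR2.q]
    refine emod_eq_rep ?_
    push_cast
    simp only [cast_rep]
    rfl
  have hval : ((Expr.var 21 * .get 14 (.var 19) + .lt (.var 19) (.var 18) * .get 15 (.var 19) +
      .delta (.var 19) (.var 18) * (.var 40 * .get 15 (.var 19))) % .var 1).eval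
      (s1.setVar 21 (rep (evalV P a ⟨k, hk⟩))) = rep (transformW P i lam t a h ⟨k, hk⟩) := by
    have hlt := Expr.eval_lt (st := s1.setVar 21 (rep (evalV P a ⟨k, hk⟩))) (a := .var 19)
      (b := .var 18) (x := k) (y := i) (by simp [-Nat.cast_prod, g19]) (by simp [-Nat.cast_prod, hR2.idx])
    simp only [Expr.eval_mod, Expr.eval_mul, Expr.eval_get, Expr.eval_add, Expr.eval_delta, hlt,
      Expr.eval_var, State.setVar_var, State.setVar_arr]
    simp only [show (19 : ℕ) ≠ 21 by norm_num, show (18 : ℕ) ≠ 21 by norm_num,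
      show (40 : ℕ) ≠ 21 by norm_num, show (1 : ℕ) ≠ 21 by norm_num, if_true, if_false,
      g19, g14, g15, hR2.q, hR2.idx, g40, Nat.cast_inj]
    refine emod_eq_rep ?_
    push_cast
    simp only [cast_rep, transformW, Fin.lt_def, Fin.ext_iff]
    split_ifs <;> simp
  refine Ex.le hZ (Ex.set hZ (by decide) (by simp)
    (by simp [-Nat.cast_prod, Expr.lt, Expr.delta, g14, g15, hR2.idx, g19, g40, bi, bk, bh, b1, bt, be, bl]) ?_)
    (by norm_num)
  intro k' hk'
  rw [hval]
  simp only [State.setVar_arr, State.setArr_arr, Expr.eval_var,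
    State.setVar_var, show (19 : ℕ) ≠ 21 by norm_num, if_false, g19, true_and, Nat.cast_inj]
  split_ifs with h5
  · congr
    exact h5.symm
  · rw [g17]
    exact hI k' (by omega)

theorem progTransformB_spec (hS : Sized P Z) (hR : Ready i j st) (hy : y ≤ Z)
    (h34 : st.var 34 = y) {w : Fin P.n → ZMod P.q} {b : Fin P.n → UnitAddCircle}
    (h17 : ∀ k : Fin P.n, st.arr 17 (k : ℕ) = rep (w k))
    (h1 : ∀ k : Fin P.n, st.tarr 1 (k : ℕ) = b k) :
    Ex env Z 18 progTransformB st fun s =>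
      (∀ k : Fin P.n, s.tarr 2 ((y : ℤ) * P.n + k) = embT P (combV P w) k + autTorus P j i b k) ∧
      ∀ z < (y : ℤ) * P.n, s.tarr 2 z = st.tarr 2 z := by
  have hZ := hS.large
  have bn := bits_natCast_le hS.n
  have by' := bits_natCast_le hy
  refine Ex.conseq (Ex.for hZ (a := 15) (b := 1) P.n (by simpa using hS.n) (by norm_num)
    (by norm_num) rfl (by decide) ?_ (fun K s =>
      (∀ k : Fin P.n, k < K → s.tarr 2 ((y : ℤ) * P.n + k) =
        embT P (combV P w) k + autTorus P j i b k) ∧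
      ∀ z < (y : ℤ) * P.n, s.tarr 2 z = st.tarr 2 z) ?_ ?_)
      fun s _ h => ⟨fun k => h.1 k k.2, h.2⟩
  · intro s hA
    exact ⟨(hA.var 16 rfl).trans hR.n, trivial⟩
  · simp
  intro k hk s hA hv ⟨hI1, hI2⟩
  have hR1 : Ready i j s := hR.agree hA rfl rfl rfl rfl rfl rfl rfl
  have bk := bits_natCast_le (hk.le.trans hS.n)
  refine Ex.seq hZ (Ex.le hZ (Ex.sumFin hZ hS.n (by decide) (by decide) ?_
    (fun k' => rep (w k') * rep (crtV P k' ⟨k, hk⟩)) ?_) (by norm_num)) ?_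
  · intro s1 hA1
    exact ⟨(hA1.var 16 rfl).trans hR1.n, trivial⟩
  · intro k' s1 hA1 hv1
    have hR2 : Ready i j s1 := hR1.agree hA1 rfl rfl rfl rfl rfl rfl rfl
    have g19 : s1.var 19 = k := (hA1.var 19 rfl).trans hv
    have g17 : s1.arr 17 (k' : ℕ) = rep (w k') := by rw [hA1.arr 17 rfl, hA.arr 17 rfl, h17]
    have gV : s1.arr 9 (((k' : ℕ) : ℤ) * P.n + k) = rep (crtV P k' ⟨k, hk⟩) := hR2.V k' ⟨k, hk⟩
    have bk' := bits_natCast_le (k'.2.le.trans hS.n)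
    have bV := bits_rep_le hS.q (crtV P k' ⟨k, hk⟩)
    have bw := bits_rep_le hS.q (w k')
    exact ⟨by simp only [Expr.eval_mul, Expr.eval_get, Expr.eval_add, Expr.eval_var, hv1, g17,
      hR2.n, g19, gV], by simp [-Nat.cast_prod, hv1, g17, hR2.n, g19, gV, bk', bV, bw, bn]⟩
  intro s1 hA1 hsum
  have hR2 : Ready i j s1 := hR1.agree hA1 rfl rfl rfl rfl rfl rfl rfl
  have g19 : s1.var 19 = k := (hA1.var 19 rfl).trans hv
  have g34 : s1.var 34 = y := by rw [hA1.var 34 rfl, hA.var 34 rfl, h34]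
  have g2 : s1.tarr 2 = s.tarr 2 := hA1.tarr 2 rfl
  have gb : ∀ k : Fin P.n, s1.tarr 1 (k : ℕ) = b k := by
    rw [hA1.tarr 1 rfl, hA.tarr 1 rfl]; exact h1
  have hval : (TExpr.frac (.var 21) (.var 1)).eval s1 = embT P (combV P w) ⟨k, hk⟩ := by
    have hz : ((∑ k', rep (w k') * rep (crtV P k' ⟨k, hk⟩) : ℤ) : ZMod P.q) =
        combV P w ⟨k, hk⟩ := by
      push_cast
      simp only [cast_rep]
      rfl
    rw [TExpr.eval, Expr.eval_var, Expr.eval_var, hsum, hR2.q, embT, ← hz, ZMod.toAddCircle_intCast]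
    push_cast
    rfl
  refine Ex.seq hZ (Q := fun s => s = s1.setTarr 2 ((y : ℤ) * P.n + k)
    (embT P (combV P w) ⟨k, hk⟩)) (Ex.le hZ (Ex.tset hZ (by decide)
      (by simp [-Nat.cast_prod, g34, hR2.n, by', bn]) ⟨trivial, trivial⟩ ?_) (by norm_num)) ?_
  · rw [hval]
    simp [-Nat.cast_prod, g34, hR2.n, g19]
  rintro _ - rfl
  -- Elements of `ℝ/ℤ` live in arrays only, so the sum is accumulated in its final cell, on top of
  -- the fraction that is already there.
  refine Ex.conseq (Ex.for hZ (a := 9) (b := 1) P.n (by simpa using hS.n) (by norm_num)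
    (by norm_num) rfl (by decide) ?_ (fun K s' =>
      s'.tarr 2 ((y : ℤ) * P.n + k) = embT P (combV P w) ⟨k, hk⟩ +
        ∑ k' ∈ Finset.univ.filter (fun k' : Fin P.n => (k' : ℕ) < K),
          autT P j i ⟨k, hk⟩ k' • b k' ∧
      ∀ z, z ≠ (y : ℤ) * P.n + k → s'.tarr 2 z = s.tarr 2 z) ?_ ?_) ?_
  · intro s hA
    exact ⟨(hA.var 16 rfl).trans hR2.n, trivial⟩
  · refine ⟨by simp, fun z hz => by simp [-Nat.cast_prod, hz, g2]⟩
  · intro k' hk' s2 hA2 hv2 ⟨hJ1, hJ2⟩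
    have k34 : s2.var 34 = y := (hA2.var 34 rfl).trans g34
    have k19 : s2.var 19 = k := (hA2.var 19 rfl).trans g19
    have k16 : s2.var 16 = P.n := (hA2.var 16 rfl).trans hR2.n
    have kT : s2.arr 12 ((k : ℤ) * P.n + k') = autT P j i ⟨k, hk⟩ ⟨k', hk'⟩ := by
      rw [hA2.arr 12 rfl]; exact hR2.T' ⟨k, hk⟩ ⟨k', hk'⟩
    have kb : s2.tarr 1 k' = b ⟨k', hk'⟩ := by
      rw [hA2.tarr 1 rfl]
      exact (by simp [-Nat.cast_prod, State.setTarr_tarr] : _ = s1.tarr 1 k').trans (gb ⟨k', hk'⟩)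
    have bT := bits_autT_le hS j i ⟨k, hk⟩ ⟨k', hk'⟩
    refine Ex.tset hZ (by decide) (by simp [-Nat.cast_prod, k34, k16, by', bn])
      (by simp [-Nat.cast_prod, TExpr.MulBits, k34, k16, k19, hv2, kT, bT, by', bn, bk]) ⟨?_, ?_⟩
    · have hfil : Finset.univ.filter (fun x : Fin P.n => (x : ℕ) < k' + 1) =
          insert ⟨k', hk'⟩ (Finset.univ.filter (fun x : Fin P.n => (x : ℕ) < k')) := by
        ext x; simp [-Nat.cast_prod, Fin.ext_iff]; omega
      rw [hfil, Finset.sum_insert (by simp)]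
      simp only [State.setVar_tarr, State.setTarr_tarr, TExpr.eval, Expr.eval_add, Expr.eval_mul,
        Expr.eval_var, Expr.eval_get, k34, k16, k19, hv2, kT, kb, hJ1, and_self, if_true]
      abel
    · intro z hz
      simp [-Nat.cast_prod, k34, k16, k19, hz, hJ2 z hz]
  · rintro s2 - ⟨hJ1, hJ2⟩
    refine ⟨fun k' hk' => ?_, fun z hz => ?_⟩
    · rcases Nat.lt_succ_iff_lt_or_eq.1 hk' with h | h
      · rw [State.setVar_tarr, hJ2 _ (by omega)]
        exact hI1 k' h
      · obtain rfl : k' = ⟨k, hk⟩ := Fin.ext h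
        rw [State.setVar_tarr, hJ1]
        simp [-Nat.cast_prod, autTorus]
    · rw [State.setVar_tarr, hJ2 _ (by omega)]
      exact hI2 z hz

end Parts

end MRLWE

noncomputable section

namespace MRLWE

/-! ### Correctness of the reduction program -/

variable {P : Params} {Z L : ℕ} {D : Distinguisher P L} {ω : Randomness P} {i j : Fin P.n}
  {st : State}

/-- A call consumes `1 + 2 * L` samples: one for the shift `t` of the secret, then alternately a
sample to transform and one whose first component is the mask `h`. The sample counter at the start
of call `Q` fixes which ones these are. -/
theorem progQuery_spec (hS : Sized P Z) (hL : L ≤ Z) (hR : Ready i j st) (h3 : st.var 3 = L)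
    {g : ZMod P.q} {md Q : ℕ} (hmd : md ≤ 1) (h33 : st.var 33 = md)
    (h40 : st.var 40 = rep (guess P g md)) (hs : st.samples = Q * (1 + 2 * L))
    (hq : st.queries = Q) :
    Ex (env D ω) Z 30 progQuery st fun s => s.var 35 = reply D ω i j g md Q ∧
      s.samples = (Q + 1) * (1 + 2 * L) ∧ s.queries = Q + 1 := by
  have hZ := hS.large
  have hn : (env D ω).n ≤ Z := hS.n
  let S : ℕ → Sample P := fun r => coord P (ω.1 r)
  let t := (S (Q * (1 + 2 * L))).1
  let x : ℕ → Sample P := fun y => transform P i j g md t (S (Q * (1 + 2 * L) + 1 + 2 * y))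
    (S (Q * (1 + 2 * L) + 2 + 2 * y)).1
  refine Ex.seq hZ (Ex.le hZ (Ex.sample hZ hn) (by norm_num)) ?_
  intro s0 hA0 ⟨f1, _, f3⟩
  have hR0 : Ready i j s0 := hR.agree hA0 rfl rfl rfl rfl rfl rfl rfl
  have f14 : ∀ k : Fin P.n, s0.arr 14 (k : ℕ) = rep (t k) := by
    intro k
    rw [f1 k, hs]
    rfl
  refine Ex.seq hZ (Ex.le hZ (Ex.for hZ (a := 23) (b := 1) (a' := 26) L (by simpa using hL)
    (by norm_num) (by norm_num) rfl (by decide) ?_ (fun y s =>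
      (∀ y' < y, ∀ k : Fin P.n, s.arr 16 ((y' : ℤ) * P.n + k) = rep ((x y').1 k) ∧
        s.tarr 2 ((y' : ℤ) * P.n + k) = (x y').2 k) ∧
      s.samples = Q * (1 + 2 * L) + 1 + 2 * y) ?_ ?_) (by norm_num)) ?_
  · intro s hA
    exact ⟨(hA.var 3 rfl).trans ((hA0.var 3 rfl).trans h3), trivial⟩
  · simp [f3, hs]
  · intro y hy s1 hA1 hv1 ⟨hI1, hI2⟩
    have hR1 : Ready i j s1 := hR0.agree hA1 rfl rfl rfl rfl rfl rfl rfl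
    refine Ex.seq hZ (Ex.le hZ (Ex.sample hZ hn) (by norm_num)) ?_
    intro s2 hA2 ⟨a1, a2, a3⟩
    have hR2 : Ready i j s2 := hR1.agree hA2 rfl rfl rfl rfl rfl rfl rfl
    refine Ex.seq hZ (Ex.le hZ (Ex.sample hZ hn) (by norm_num)) ?_
    intro s3 hA3 ⟨b1, _, b3⟩
    have hR3 : Ready i j s3 := hR2.agree hA3 rfl rfl rfl rfl rfl rfl rfl
    have c13 : ∀ k : Fin P.n, s3.arr 13 (k : ℕ) = rep ((S (Q * (1 + 2 * L) + 1 + 2 * y)).1 k) := by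
      intro k
      rw [hA3.arr 13 rfl, a1 k, hI2]
      rfl
    have c1 : ∀ k : Fin P.n, s3.tarr 1 (k : ℕ) = (S (Q * (1 + 2 * L) + 1 + 2 * y)).2 k := by
      intro k
      rw [hA3.tarr 1 rfl, a2 k, hI2]
      rfl
    have c15 : ∀ k : Fin P.n, s3.arr 15 (k : ℕ) = rep ((S (Q * (1 + 2 * L) + 2 + 2 * y)).1 k) := by
      intro k
      rw [b1 k, a3, hI2, show Q * (1 + 2 * L) + 1 + 2 * y + 1 = Q * (1 + 2 * L) + 2 + 2 * y by ring]
      rfl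
    have v34 : s3.var 34 = y := by rw [hA3.var 34 rfl, hA2.var 34 rfl, hv1]
    have v33 : s3.var 33 = md := by
      rw [hA3.var 33 rfl, hA2.var 33 rfl, hA1.var 33 rfl, hA0.var 33 rfl, h33]
    have v40 : s3.var 40 = rep (guess P g md) := by
      rw [hA3.var 40 rfl, hA2.var 40 rfl, hA1.var 40 rfl, hA0.var 40 rfl, h40]
    have c14 : ∀ k : Fin P.n, s3.arr 14 (k : ℕ) = rep (t k) := by
      rw [hA3.arr 14 rfl, hA2.arr 14 rfl, hA1.arr 14 rfl]
      exact f14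
    have hyZ : y ≤ Z := hy.le.trans hL
    refine Ex.seq hZ (Ex.le hZ (progTransformA_spec hS hR3 hyZ v34 hmd v33 c13 c15)
      (by norm_num)) ?_
    intro s4 hA4 ⟨d1, d2⟩
    have hR4 : Ready i j s4 := hR3.agree hA4 rfl rfl rfl rfl rfl rfl rfl
    refine Ex.seq hZ (Ex.le hZ (progTransformW_spec hS hR4 hyZ ((hA4.var 34 rfl).trans v34)
      ((hA4.var 40 rfl).trans v40) (by rw [hA4.arr 14 rfl]; exact c14) d1
      (by rw [hA4.arr 15 rfl]; exact c15)) (by norm_num)) ?_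
    intro s5 hA5 e1
    have hR5 : Ready i j s5 := hR4.agree hA5 rfl rfl rfl rfl rfl rfl rfl
    refine Ex.conseq (Ex.le hZ (progTransformB_spec hS hR5 hyZ
      (by rw [hA5.var 34 rfl, hA4.var 34 rfl, v34]) e1
      (by rw [hA5.tarr 1 rfl, hA4.tarr 1 rfl]; exact c1)) (by norm_num)) ?_
    intro s6 hA6 ⟨k1, k2⟩
    have g16 : s6.arr 16 = s4.arr 16 := by rw [hA6.arr 16 rfl, hA5.arr 16 rfl]
    have g2 : s5.tarr 2 = s1.tarr 2 := by
      rw [hA5.tarr 2 rfl, hA4.tarr 2 rfl, hA3.tarr 2 rfl, hA2.tarr 2 rfl]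
    have g16' : s3.arr 16 = s1.arr 16 := by rw [hA3.arr 16 rfl, hA2.arr 16 rfl]
    refine ⟨fun y' hy' k => ?_, ?_⟩
    · rw [State.setVar_arr, State.setVar_tarr]
      rcases Nat.lt_succ_iff_lt_or_eq.1 hy' with h | rfl
      · have hlt : (y' : ℤ) * P.n + k < y * P.n := by
          have h1 : ((y' + 1 : ℕ) : ℤ) * P.n ≤ y * P.n :=
            mul_le_mul_of_nonneg_right (by exact_mod_cast h) (by positivity)
          have h2 := k.2
          rw [Nat.cast_add, Nat.cast_one, add_mul, one_mul] at h1
          omega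
        rw [g16, d2 _ hlt, g16', k2 _ hlt, g2]
        exact hI1 y' h k
      · exact ⟨by rw [g16]; exact d1 k, k1 k⟩
    · rw [State.setVar_samples, hA6.samples rfl, hA5.samples rfl, hA4.samples rfl, b3, a3, hI2]
      ring
  · intro s1 hA1 ⟨hI1, hI2⟩
    have hq1 : s1.queries = Q := by rw [hA1.queries rfl, hA0.queries rfl, hq]
    refine Ex.conseq (Ex.le hZ (Ex.query hZ hn hL) (by norm_num)) ?_
    intro s2 hA2 ⟨k1, k2⟩
    refine ⟨?_, by rw [hA2.samples rfl, hI2]; ring, by rw [k2, hq1]⟩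
    rw [k1, hq1, reply]
    have harg : (fun r : Fin L => ((fun k : Fin P.n => ((s1.arr 16 ((r * P.n + k : ℕ) : ℤ) : ℤ) :
        ZMod P.q), fun k : Fin P.n => s1.tarr 2 ((r * P.n + k : ℕ) : ℤ)) : Sample P)) =
        fun r : Fin L => x r := by
      funext r
      refine Prod.ext (funext fun k => ?_) (funext fun k => ?_)
      · have := (hI1 r r.2 k).1
        dsimp only
        rw [Nat.cast_add, Nat.cast_mul]
        exact (congrArg _ this).trans (cast_rep _)
      · have := (hI1 r r.2 k).2
        dsimp only
        rw [Nat.cast_add, Nat.cast_mul]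
        exact this
    change (if decide (ω.2.2 Q < D.accept (fun r : Fin L => ((fun k : Fin P.n =>
      ((s1.arr 16 ((r * P.n + k : ℕ) : ℤ) : ℤ) : ZMod P.q), fun k : Fin P.n =>
        s1.tarr 2 ((r * P.n + k : ℕ) : ℤ)) : Sample P))) = true then (1 : ℤ) else 0) = _
    rw [harg]
    simp only [decide_eq_true_eq]
    rfl

theorem reply_nonneg (g : ZMod P.q) (md Q : ℕ) : 0 ≤ reply D ω i j g md Q := by
  unfold reply; split_ifs <;> norm_num

theorem reply_le_one (g : ZMod P.q) (md Q : ℕ) : reply D ω i j g md Q ≤ 1 := by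
  unfold reply; split_ifs <;> norm_num

/-- The score after `r` rounds. -/
def partialScore (D : Distinguisher P L) (ω : Randomness P) (N : ℕ) (j i : Fin P.n) (g r : ℕ) : ℤ :=
  ∑ r ∈ Finset.range r, (reply D ω i j g 0 (callIndex P N j i g r 0) -
    reply D ω i j g 1 (callIndex P N j i g r 1))

/-- Replies are `0` or `1`, so each round contributes at most `1`. This bounds the digits of the
score. -/
theorem abs_score_le (N : ℕ) (j i : Fin P.n) (g : ℕ) : |score D ω N j i g| ≤ N := by
  refine (Finset.abs_sum_le_sum_abs _ _).trans ?_
  refine (Finset.sum_le_sum (g := fun _ => (1 : ℤ)) fun r _ => ?_).trans (by simp)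
  have h1 := reply_nonneg (D := D) (ω := ω) (i := i) (j := j) g 0 (callIndex P N j i g r 0)
  have h2 := reply_nonneg (D := D) (ω := ω) (i := i) (j := j) g 1 (callIndex P N j i g r 1)
  have h3 := reply_le_one (D := D) (ω := ω) (i := i) (j := j) g 0 (callIndex P N j i g r 0)
  have h4 := reply_le_one (D := D) (ω := ω) (i := i) (j := j) g 1 (callIndex P N j i g r 1)
  rw [abs_le]
  constructor <;> linarith

/-- The counters of samples and queries are carried through the loops because they identify every
reply with the part of the randomness that it uses; independence of the rounds rests on this. Test
calls enter with sign `+1` and control calls with `-1`, both written as `1 - 2 * md`. -/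
theorem progScore_spec (hS : Sized P Z) (hL : L ≤ Z) (hR : Ready i j st) (h3 : st.var 3 = L)
    (h17 : st.var 17 = rep (crtC P)) {N g : ℕ} (hN : N ≤ Z ^ 6) (h38 : st.var 38 = N)
    (hg : g < P.q) (h30 : st.var 30 = g)
    (hs : st.samples = ((j * P.n + i) * P.q + g) * N * 2 * (1 + 2 * L))
    (hq : st.queries = ((j * P.n + i) * P.q + g) * N * 2) :
    Ex (env D ω) Z 50 progScore st fun s => s.var 31 = score D ω N j i g ∧
      s.samples = ((j * P.n + i) * P.q + (g + 1)) * N * 2 * (1 + 2 * L) ∧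
      s.queries = ((j * P.n + i) * P.q + (g + 1)) * N * 2 := by
  have hZ := hS.large
  have b1 := bits_one_le hZ
  have b2 := bits_two_le hZ
  have bg := bits_natCast_le (hg.le.trans hS.q)
  have bc := bits_rep_le hS.q (crtC P)
  refine Ex.assign_seq hZ (v := 0) (by decide) trivial rfl (by norm_num) ?_
  refine Ex.conseq (Ex.for hZ (a := 36) (b := 6) N hN (by norm_num) (by norm_num) rfl (by decide) ?_
    (fun r s => s.var 31 = partialScore D ω N j i g r ∧
      s.samples = (((j * P.n + i) * P.q + g) * N + r) * 2 * (1 + 2 * L) ∧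
      s.queries = (((j * P.n + i) * P.q + g) * N + r) * 2) ?_ ?_) ?_
  · intro s hA
    exact ⟨(hA.var 38 rfl).trans (by simp [h38]), trivial⟩
  · simp [partialScore, hs, hq, -Nat.cast_prod]
  · intro r hr s1 hA1 hv1 ⟨hI1, hI2, hI3⟩
    have hR1 : Ready i j s1 := (hR.setVar 31 0 (by decide) (by decide) (by decide)).agree hA1
      rfl rfl rfl rfl rfl rfl rfl
    refine Ex.conseq (Ex.for hZ (a := 32) (b := 1) 2 (by simp; omega) (by norm_num) (by norm_num)
      rfl (by decide) (by intro s _; exact ⟨rfl, trivial⟩)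
      (fun md s => s.var 31 = partialScore D ω N j i g r + ∑ d ∈ Finset.range md,
        (1 - 2 * (d : ℤ)) * reply D ω i j g d (callIndex P N j i g r d) ∧
        s.samples = callIndex P N j i g r md * (1 + 2 * L) ∧
        s.queries = callIndex P N j i g r md) ?_ ?_) ?_
    · simp [hI1, hI2, hI3, callIndex, -Nat.cast_prod]
    · intro md hmd s2 hA2 hv2 ⟨hJ1, hJ2, hJ3⟩
      have hR2 : Ready i j s2 := hR1.agree hA2 rfl rfl rfl rfl rfl rfl rfl
      have v17 : s2.var 17 = rep (crtC P) := by
        rw [hA2.var 17 rfl, hA1.var 17 rfl]; simp [h17]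
      have v30 : s2.var 30 = g := by rw [hA2.var 30 rfl, hA1.var 30 rfl]; simp [h30]
      have v3 : s2.var 3 = L := by rw [hA2.var 3 rfl, hA1.var 3 rfl]; simp [h3]
      have bmd := bits_natCast_le (show md ≤ Z by omega)
      have bm := bits_emod_le (by have := P.two_le_q; omega) hS.q (rep (crtC P) * g)
      refine Ex.assign_seq hZ (v := rep (guess P g md)) (by decide)
        (by simp [v17, v30, hv2, hR2.q, bmd, b1, bc, bg, bits_natCast_le hS.q]) ?_ (by norm_num) ?_
      · have e1 : rep (crtC P) * (g : ℤ) % P.q = rep (crtC P * (g : ZMod P.q)) := by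
          refine emod_eq_rep ?_
          push_cast
          rw [cast_rep]
        simp only [Expr.eval_add, Expr.eval_mul, Expr.eval_sub, Expr.eval_one, Expr.eval_var,
          Expr.eval_mod, v17, v30, hv2, hR2.q, e1, guess]
        rcases (by omega : md = 0 ∨ md = 1) with rfl | rfl
        · simp
        · simp [rep_one P.two_le_q]
      refine Ex.seq hZ (Ex.le hZ (progQuery_spec (g := (g : ZMod P.q)) (md := md)
        (Q := callIndex P N j i g r md) hS hL
        (hR2.setVar 40 _ (by decide) (by decide) (by decide)) (by simp [v3]) (by omega)
        (by simp [hv2]) (by simp) hJ2 hJ3) (by norm_num)) ?_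
      intro s3 hA3 ⟨q1, q2, q3⟩
      have w33 : s3.var 33 = md := by rw [hA3.var 33 rfl]; simp [hv2]
      have w31 : s3.var 31 = s2.var 31 := by rw [hA3.var 31 rfl]; simp
      have br : bits (reply D ω i j g md (callIndex P N j i g r md)) ≤ Z ^ 6 := by
        unfold reply
        split_ifs
        · exact b1
        · simp [bits]
      refine Ex.le hZ (Ex.assign hZ (by decide) (by simp [w33, q1, b1, b2, bmd, br])
        ⟨?_, ?_, ?_⟩) (by norm_num)
      · simp [w33, q1, w31, hJ1, Finset.sum_range_succ]
        ring
      · rw [State.setVar_samples, State.setVar_samples, q2]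
        rfl
      · rw [State.setVar_queries, State.setVar_queries, q3]
        rfl
    · rintro s2 hA2 ⟨hJ1, hJ2, hJ3⟩
      refine ⟨?_, ?_, ?_⟩
      · rw [State.setVar_var, if_neg (by decide), hJ1, partialScore, partialScore,
          Finset.sum_range_succ _ r]
        simp [Finset.sum_range_succ]
        ring
      · rw [State.setVar_samples, hJ2, callIndex]
        ring
      · rw [State.setVar_queries, hJ3, callIndex]
        ring
  · rintro s - ⟨h1, h2, h3⟩
    refine ⟨h1, ?_, ?_⟩
    · rw [h2]; ring
    · rw [h3]; ring

/-- The best guess among those seen. -/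
structure BestSoFar (D : Distinguisher P L) (ω : Randomness P) (N : ℕ) (j : Fin P.n)
    (seen : Fin P.n → ℕ → Prop) (best bg : ℤ) : Prop where
  le : ∀ i g, seen i g → score D ω N j i g ^ 2 ≤ best
  eq : best = -1 ∧ bg = 0 ∨ ∃ i g, g < P.q ∧ bg = (g : ℕ) ∧ best = score D ω N j i g ^ 2

theorem progSearch_spec (hS : Sized P Z) (hL : L ≤ Z) (hI : HasInput P st) (hT : HasTables P P.l st)
    (h3 : st.var 3 = L) (h16 : st.var 16 = P.n)
    (h27 : st.var 27 = (j : ℕ)) (h17 : st.var 17 = rep (crtC P)) {N : ℕ} (hN : N ≤ Z ^ 6)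
    (h38 : st.var 38 = N)
    (hV : ∀ i k : Fin P.n, st.arr 9 ((i : ℤ) * P.n + k) = rep (crtV P i k))
    (hW : ∀ i k : Fin P.n, st.arr 10 ((i : ℤ) * P.n + k) = rep (crtW P i k))
    (hs : st.samples = j * P.n * P.q * N * 2 * (1 + 2 * L))
    (hq : st.queries = j * P.n * P.q * N * 2) :
    Ex (env D ω) Z 70 progSearch st fun s =>
      (∃ g i, g < P.q ∧ s.var 29 = (g : ℕ) ∧ ∀ i' g', g' < P.q →
        score D ω N j i' g' ^ 2 ≤ score D ω N j i g ^ 2) ∧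
      s.samples = (j + 1) * P.n * P.q * N * 2 * (1 + 2 * L) ∧
      s.queries = (j + 1) * P.n * P.q * N * 2 := by
  have hZ := hS.large
  -- The initial record `-1` is below every square, so the first score replaces it.
  refine Ex.assign_seq hZ (v := -1) (by decide) (by simp) rfl (by norm_num) ?_
  refine Ex.assign_seq hZ (v := 0) (by decide) trivial rfl (by norm_num) ?_
  refine Ex.conseq (Ex.for hZ (a := 60) (b := 1) P.n (by simpa using hS.n) (by norm_num)
    (by norm_num) rfl (by decide) ?_ (fun i s =>
      BestSoFar D ω N j (fun i' g => i' < i ∧ g < P.q) (s.var 28) (s.var 29) ∧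
      s.samples = (j * P.n + i) * P.q * N * 2 * (1 + 2 * L) ∧
      s.queries = (j * P.n + i) * P.q * N * 2) ?_ ?_) ?_
  · intro s hA
    exact ⟨(hA.var 16 rfl).trans (by simp [h16, -Nat.cast_prod]), trivial⟩
  · refine ⟨⟨by simp, Or.inl (by simp)⟩, ?_, ?_⟩
    · simp [hs]
    · simp [hq]
  · intro i hi s1 hA1 hv1 ⟨hB, hI2, hI3⟩
    have hI1 : HasInput P s1 := ((hI.setVar _ (by decide) (by decide)).setVar _ (by decide)
      (by decide)).agree hA1 rfl rfl rfl
    have hT1 : HasTables P P.l s1 := ((hT.setVar _ _).setVar _ _).agree hA1 rfl rfl rfl rfl rfl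
    have v16 : s1.var 16 = P.n := by rw [hA1.var 16 rfl]; simp [h16, -Nat.cast_prod]
    have v27 : s1.var 27 = (j : ℕ) := by rw [hA1.var 27 rfl]; simp [h27]
    refine Ex.seq hZ (Ex.le hZ (progAut_spec (i := ⟨i, hi⟩) (j := j) hS hI1 hT1 v16 hv1 v27)
      (by norm_num)) ?_
    intro s2 hA2 hTT
    have hR2 : Ready ⟨i, hi⟩ j s2 := by
      refine ⟨(hA2.var 1 rfl).trans hI1.q, (hA2.var 16 rfl).trans v16, (hA2.var 18 rfl).trans hv1,
        ?_, ?_, fun k k' => (hTT k k').1, fun k k' => (hTT k k').2⟩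
      · rw [hA2.arr 9 rfl, hA1.arr 9 rfl]; exact hV
      · rw [hA2.arr 10 rfl, hA1.arr 10 rfl]; exact hW
    refine Ex.conseq (Ex.for hZ (a := 56) (b := 1) P.q (by simpa using hS.q) (by norm_num)
      (by norm_num) rfl (by decide) ?_ (fun g s =>
        BestSoFar D ω N j (fun i' g' => g' < P.q ∧ (i' < i ∨ i' = i ∧ g' < g))
          (s.var 28) (s.var 29) ∧
        s.samples = ((j * P.n + i) * P.q + g) * N * 2 * (1 + 2 * L) ∧
        s.queries = ((j * P.n + i) * P.q + g) * N * 2) ?_ ?_) ?_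
    · intro s hA
      exact ⟨(hA.var 1 rfl).trans hR2.q, trivial⟩
    · have e28 : s2.var 28 = s1.var 28 := hA2.var 28 rfl
      have e29 : s2.var 29 = s1.var 29 := hA2.var 29 rfl
      refine ⟨?_, ?_, ?_⟩
      · simp only [State.setVar_var, show (28 : ℕ) ≠ 30 by norm_num, show (29 : ℕ) ≠ 30 by norm_num,
          if_false, e28, e29]
        exact ⟨fun i' g' h => hB.le i' g' ⟨by omega, h.1⟩, hB.eq⟩
      · rw [State.setVar_samples, hA2.samples rfl, hI2]; ring
      · rw [State.setVar_queries, hA2.queries rfl, hI3]; ring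
    · intro g hg s3 hA3 hv3 ⟨hB3, hJ2, hJ3⟩
      have hR3 : Ready ⟨i, hi⟩ j s3 := hR2.agree hA3 rfl rfl rfl rfl rfl rfl rfl
      have w3 : s3.var 3 = L := by rw [hA3.var 3 rfl, hA2.var 3 rfl, hA1.var 3 rfl]; simp [h3]
      have w17 : s3.var 17 = rep (crtC P) := by
        rw [hA3.var 17 rfl, hA2.var 17 rfl, hA1.var 17 rfl]; simp [h17]
      have w38 : s3.var 38 = N := by
        rw [hA3.var 38 rfl, hA2.var 38 rfl, hA1.var 38 rfl]; simp [h38]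
      refine Ex.seq hZ (Ex.le hZ (progScore_spec (D := D) (ω := ω) hS hL hR3 w3 w17 hN w38 hg hv3
        hJ2 hJ3) (by norm_num)) ?_
      intro s4 hA4 ⟨k1, k2, k3⟩
      have x28 : s4.var 28 = s3.var 28 := hA4.var 28 rfl
      have x29 : s4.var 29 = s3.var 29 := hA4.var 29 rfl
      have x30 : s4.var 30 = g := (hA4.var 30 rfl).trans hv3
      have bsc : bits (score D ω N j ⟨i, hi⟩ g) ≤ Z ^ 6 := by
        refine (bits_le_natAbs _).trans ?_
        have := abs_score_le (D := D) (ω := ω) N j ⟨i, hi⟩ g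
        rw [Int.abs_eq_natAbs] at this
        omega
      refine Ex.le hZ (e := 11) (Ex.cond hZ (by decide) (by simp [k1, bsc]) (by norm_num) ?_ ?_)
        (by norm_num)
      · intro hpos
        simp only [Expr.eval_sub, Expr.eval_mul, Expr.eval_var, k1, x28, ← pow_two] at hpos
        refine Ex.assign_seq hZ (v := score D ω N j ⟨i, hi⟩ g ^ 2) (by decide) (by simp [k1, bsc])
          (by simp [k1, pow_two]) (by norm_num) ?_
        refine Ex.assign hZ (by decide) (by simp) ⟨⟨?_, ?_⟩, ?_, ?_⟩
        · intro i' g' h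
          simp only [State.setVar_var]
          norm_num
          by_cases h' : (i' : ℕ) = i ∧ g' = g
          · obtain ⟨h1, rfl⟩ := h'
            obtain rfl : i' = ⟨i, hi⟩ := Fin.ext h1
            exact le_rfl
          · have := hB3.le i' g' ⟨h.1, by omega⟩
            linarith
        · refine Or.inr ⟨⟨i, hi⟩, g, hg, ?_, ?_⟩
          · simp [x30]
          · simp
        · simpa using k2
        · simpa using k3
      · intro hneg
        simp only [Expr.eval_sub, Expr.eval_mul, Expr.eval_var, k1, x28, ← pow_two] at hneg
        refine Ex.le hZ (Ex.skip hZ ⟨⟨?_, ?_⟩, ?_, ?_⟩) (by norm_num)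
        · intro i' g' h
          simp only [State.setVar_var, show (28 : ℕ) ≠ 30 by norm_num, if_false, x28]
          by_cases h' : (i' : ℕ) = i ∧ g' = g
          · obtain ⟨h1, rfl⟩ := h'
            obtain rfl : i' = ⟨i, hi⟩ := Fin.ext h1
            linarith
          · exact hB3.le i' g' ⟨h.1, by omega⟩
        · simp only [State.setVar_var, show (28 : ℕ) ≠ 30 by norm_num,
            show (29 : ℕ) ≠ 30 by norm_num, if_false, x28, x29]
          exact hB3.eq
        · simpa using k2
        · simpa using k3
    · rintro s3 hA3 ⟨hB3, hJ2, hJ3⟩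
      refine ⟨?_, ?_, ?_⟩
      · simp only [State.setVar_var, show (28 : ℕ) ≠ 18 by norm_num, show (29 : ℕ) ≠ 18 by norm_num,
          if_false]
        exact ⟨fun i' g' h => hB3.le i' g' ⟨h.2, by omega⟩, hB3.eq⟩
      · rw [State.setVar_samples, hJ2]; ring
      · rw [State.setVar_queries, hJ3]; ring
  · rintro s - ⟨hB, h2, h3⟩
    refine ⟨?_, by rw [h2]; ring, by rw [h3]; ring⟩
    -- At least the pair `(0, 0)` has been examined, so the record cannot be the initial `-1`.
    have hle := hB.le ⟨0, P.n_pos⟩ 0 ⟨P.n_pos, by have := P.two_le_q; omega⟩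
    rcases hB.eq with h | ⟨i, g, hg, h4, h5⟩
    · rw [h.1] at hle
      have := sq_nonneg (score D ω N j ⟨0, P.n_pos⟩ 0)
      omega
    · exact ⟨g, i, hg, h4, fun i' g' hg' => h5 ▸ hB.le i' g' ⟨i'.2, hg'⟩⟩

/-- The number of rounds for each guess. -/
def rounds (P : Params) (k : ℕ) : ℕ := 16 * (k * k) * (P.n * (P.n * P.n))

theorem progReduction_spec (hS : Sized P Z) (hL : L ≤ Z) {k : ℕ} (hk : k ≤ Z) :
    Ex (env D ω) Z 80 progReduction (initState P k L) fun s =>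
      ∃ bg : Fin P.n → ℕ, (∀ j, bg j < P.q ∧ ∃ i, ∀ i' g', g' < P.q →
        score D ω (rounds P k) j i' g' ^ 2 ≤ score D ω (rounds P k) j i (bg j) ^ 2) ∧
      ∀ k', output P s k' = rep (∑ j, (bg j : ZMod P.q) * crtV P j k') := by
  have hZ := hS.large
  have bn := bits_natCast_le hS.n
  have bk := bits_natCast_le hk
  have b16 : bits 16 ≤ Z ^ 6 := bits_natCast_le (n := 16) (by omega)
  have hI0 : HasInput P (initState P k L) := by
    refine ⟨rfl, rfl, fun a ha => ?_⟩
    have := overwrite_natCast (fun _ : ℤ => (0 : ℤ)) (fun i : Fin P.l => (P.m i : ℤ)) ⟨a, ha⟩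
    rw [Params.mN, dif_pos ha]
    exact this
  refine Ex.seq hZ (Ex.le hZ (progTables_spec hS hI0) (by norm_num)) ?_
  intro s1 hA1 hT1
  have hI1 := hI0.agree hA1 rfl rfl rfl
  refine Ex.seq hZ (Ex.le hZ (progDim_spec hS hI1 hT1) (by norm_num)) ?_
  intro s2 hA2 ⟨d16, d17⟩
  have hI2 := hI1.agree hA2 rfl rfl rfl
  have hT2 := hT1.agree hA2 rfl rfl rfl rfl rfl
  refine Ex.seq hZ (Ex.le hZ (progCrt_spec hS hI2 hT2 d16) (by norm_num)) ?_
  intro s3 hA3 hVW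
  have hI3 := hI2.agree hA3 rfl rfl rfl
  have hT3 := hT2.agree hA3 rfl rfl rfl rfl rfl
  have e2 : s3.var 2 = k := by rw [hA3.var 2 rfl, hA2.var 2 rfl, hA1.var 2 rfl]; rfl
  have e3 : s3.var 3 = L := by rw [hA3.var 3 rfl, hA2.var 3 rfl, hA1.var 3 rfl]; rfl
  have e16 : s3.var 16 = P.n := (hA3.var 16 rfl).trans d16
  have e17 : s3.var 17 = rep (crtC P) := (hA3.var 17 rfl).trans d17
  have eo : ∀ z, s3.arr 1 z = 0 := by
    intro z
    rw [hA3.arr 1 rfl, hA2.arr 1 rfl, hA1.arr 1 rfl]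
    rfl
  have es : s3.samples = 0 := by rw [hA3.samples rfl, hA2.samples rfl, hA1.samples rfl]; rfl
  have eq : s3.queries = 0 := by rw [hA3.queries rfl, hA2.queries rfl, hA1.queries rfl]; rfl
  -- Six factors, `16`, `k`, `k`, `n`, `n`, `n`, each at most `Z`.
  have hN : rounds P k ≤ Z ^ 6 := by
    have h1 : k * k ≤ Z * Z := Nat.mul_le_mul hk hk
    have h2 : P.n * (P.n * P.n) ≤ Z * (Z * Z) := Nat.mul_le_mul hS.n (Nat.mul_le_mul hS.n hS.n)
    calc rounds P k ≤ Z * (Z * Z) * (Z * (Z * Z)) :=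
          Nat.mul_le_mul (Nat.mul_le_mul (by omega) h1) h2
      _ = Z ^ 6 := by ring
  refine Ex.assign_seq hZ (v := rounds P k) (by decide)
    (by simp [-Nat.cast_prod, e2, e16, bn, bk, b16])
    (by simp [-Nat.cast_prod, e2, e16, rounds]) (by norm_num) ?_
  refine Ex.conseq (Ex.for hZ (a := 72) (b := 1) P.n (by simpa using hS.n) (by norm_num)
    (by norm_num) rfl (by decide) ?_ (fun J s =>
      (∃ bg : Fin P.n → ℕ, (∀ j : Fin P.n, j < J → bg j < P.q ∧ ∃ i, ∀ i' g', g' < P.q →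
        score D ω (rounds P k) j i' g' ^ 2 ≤ score D ω (rounds P k) j i (bg j) ^ 2) ∧
        (∀ j : Fin P.n, J ≤ j → bg j = 0) ∧
      ∀ k' : Fin P.n, s.arr 1 (k' : ℕ) = rep (∑ j, (bg j : ZMod P.q) * crtV P j k')) ∧
      s.samples = J * P.n * P.q * rounds P k * 2 * (1 + 2 * L) ∧
      s.queries = J * P.n * P.q * rounds P k * 2) ?_ ?_) ?_
  · intro s hA
    exact ⟨(hA.var 16 rfl).trans (by simp [e16, -Nat.cast_prod]), trivial⟩
  · refine ⟨⟨fun _ => 0, by simp, by simp, fun k' => ?_⟩, by simp [es], by simp [eq]⟩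
    simp [eo, rep]
  · intro j hj s4 hA4 hv4 ⟨⟨bg, hb1, hb2, hb3⟩, hJ2, hJ3⟩
    have hI4 : HasInput P s4 := (hI3.setVar _ (by decide) (by decide)).agree hA4 rfl rfl rfl
    have hT4 : HasTables P P.l s4 := (hT3.setVar _ _).agree hA4 rfl rfl rfl rfl rfl
    have f3 : s4.var 3 = L := by rw [hA4.var 3 rfl]; simp [e3]
    have f16 : s4.var 16 = P.n := by rw [hA4.var 16 rfl]; simp [e16, -Nat.cast_prod]
    have f17 : s4.var 17 = rep (crtC P) := by rw [hA4.var 17 rfl]; simp [e17]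
    have f38 : s4.var 38 = rounds P k := by rw [hA4.var 38 rfl]; simp
    have fV : ∀ i k : Fin P.n, s4.arr 9 ((i : ℤ) * P.n + k) = rep (crtV P i k) := by
      rw [hA4.arr 9 rfl]; exact fun i k => (hVW i k).1
    have fW : ∀ i k : Fin P.n, s4.arr 10 ((i : ℤ) * P.n + k) = rep (crtW P i k) := by
      rw [hA4.arr 10 rfl]; exact fun i k => (hVW i k).2
    refine Ex.seq hZ (Ex.le hZ (progSearch_spec (D := D) (ω := ω) (j := ⟨j, hj⟩) hS hL hI4 hT4 f3 f16
      hv4 f17 hN f38 fV fW hJ2 hJ3) (by norm_num)) ?_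
    intro s5 hA5 ⟨⟨g, i, hg, k29, kmax⟩, k2, k3⟩
    have m29 := bits_natCast_le (hg.le.trans hS.q)
    -- The output vector is updated in place: entries below the counter already contain the
    -- contribution of component `j`.
    refine Ex.conseq (Ex.le hZ (Ex.for hZ (a := 9) (b := 1) (a' := 12) P.n (by simpa using hS.n)
      (by norm_num) (by norm_num) rfl (by decide) ?_ (fun K s => ∀ k' : Fin P.n,
        s.arr 1 (k' : ℕ) = if (k' : ℕ) < K then rep (∑ j', (bg j' : ZMod P.q) * crtV P j' k' +
          (g : ZMod P.q) * crtV P ⟨j, hj⟩ k') else rep (∑ j', (bg j' : ZMod P.q) * crtV P j' k')) ?_ ?_)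
      (by norm_num)) ?_
    · intro s hA
      exact ⟨(hA.var 16 rfl).trans ((hA5.var 16 rfl).trans f16), trivial⟩
    · intro k'
      simp [hA5.arr 1 rfl, hb3]
    · intro k' hk' s6 hA6 hv6 hK
      have g1 : s6.var 1 = P.q := by rw [hA6.var 1 rfl, hA5.var 1 rfl, hI4.q]
      have g16 : s6.var 16 = P.n := by rw [hA6.var 16 rfl, hA5.var 16 rfl, f16]
      have g27 : s6.var 27 = j := by rw [hA6.var 27 rfl, hA5.var 27 rfl, hv4]
      have g29 : s6.var 29 = g := by rw [hA6.var 29 rfl, k29]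
      have gV : s6.arr 9 ((j : ℤ) * P.n + k') = rep (crtV P ⟨j, hj⟩ ⟨k', hk'⟩) := by
        rw [hA6.arr 9 rfl, hA5.arr 9 rfl]; exact fV ⟨j, hj⟩ ⟨k', hk'⟩
      have bV := bits_rep_le hS.q (crtV P ⟨j, hj⟩ ⟨k', hk'⟩)
      have bj := bits_natCast_le (hj.le.trans hS.n)
      have hK' := hK ⟨k', hk'⟩
      simp only [lt_irrefl, if_false] at hK'
      refine Ex.set hZ (by decide) (by simp)
        (by simp [-Nat.cast_prod, g16, g27, g29, gV, hv6, bV, bj, bn, m29]) ?_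
      intro k''
      simp only [State.setVar_arr, State.setArr_arr, Expr.eval_mod, Expr.eval_add, Expr.eval_mul,
        Expr.eval_get, Expr.eval_var, g1, g16, g27, g29, gV, hv6, true_and, Nat.cast_inj, hK']
      by_cases h5 : (k'' : ℕ) = k'
      · obtain rfl : k'' = ⟨k', hk'⟩ := Fin.ext h5
        simp only [if_true, Nat.lt_succ_self]
        refine emod_eq_rep ?_
        push_cast
        simp only [cast_rep]
      · rw [if_neg h5, hK k'']
        exact if_congr (by omega) rfl rfl
    · intro s6 hA6 hK
      refine ⟨⟨Function.update bg ⟨j, hj⟩ g, fun j' hj' => ?_, fun j' hj' => ?_, fun k' => ?_⟩, ?_, ?_⟩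
      · by_cases h5 : j' = ⟨j, hj⟩
        · subst h5
          simp only [Function.update_self]
          exact ⟨hg, i, kmax⟩
        · have h6 : (j' : ℕ) ≠ j := fun h => h5 (Fin.ext h)
          rw [Function.update_of_ne h5]
          exact hb1 j' (by omega)
      · have h5 : j' ≠ ⟨j, hj⟩ := by
          rintro rfl
          simp at hj'
        rw [Function.update_of_ne h5]
        exact hb2 j' (by omega)
      · rw [State.setVar_arr, hK k', if_pos k'.2]
        congr 1
        -- Components not yet determined count as zero, so recording one amounts to adding its row.
        have h0 : bg ⟨j, hj⟩ = 0 := hb2 _ le_rfl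
        have : ∀ j', ((Function.update bg ⟨j, hj⟩ g j' : ℕ) : ZMod P.q) * crtV P j' k' =
            (bg j' : ZMod P.q) * crtV P j' k' +
              if j' = ⟨j, hj⟩ then (g : ZMod P.q) * crtV P ⟨j, hj⟩ k' else 0 := by
          intro j'
          by_cases h5 : j' = ⟨j, hj⟩
          · subst h5
            simp [h0]
          · simp [h5]
        simp only [this, Finset.sum_add_distrib, Finset.sum_ite_eq', Finset.mem_univ, if_true]
      · rw [State.setVar_samples, hA6.samples rfl, k2]
      · rw [State.setVar_queries, hA6.queries rfl, k3]
  · rintro s - ⟨⟨bg, h1, -, h3⟩, -, -⟩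
    exact ⟨bg, fun j => h1 j j.2, h3⟩

end MRLWE

end

/-! ### Bases of `R` and `K`, the trace form, `R_q^∨`, and the splitting of `R_q` into `n` copies of
`ℤ/q`. -/

noncomputable section

namespace MRLWE

variable (P : Params)

/-! ### The tensor bases of `R` and `K` -/

theorem cycBasis_apply (a : Fin P.l) (e : Fin (P.m a).totient) :
    cycBasis P a e = zetaInt P a ^ (e : ℕ) := by
  simp [cycBasis, zetaInt]

theorem tensorBasis_apply (k : Fin P.n) : tensorBasis P k = basisElt P k := by
  rw [tensorBasis, Module.Basis.reindex_apply, Basis.piTensorProduct_apply, basisElt, R.tprod]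
  congr 1
  funext a
  exact cycBasis_apply P a _

theorem sum_coordR (r : R P) : ∑ k, coordR P r k • basisElt P k = r := by
  have h := (tensorBasis P).sum_repr r
  simp only [tensorBasis_apply] at h
  exact h

theorem coordR_basisElt (k k' : Fin P.n) : coordR P (basisElt P k) k' = if k = k' then 1 else 0 := by
  have h := (tensorBasis P).repr_self_apply k k'
  rw [tensorBasis_apply] at h
  exact h

theorem coordRq_mk (r : R P) (k : Fin P.n) :
    coordRq P (Ideal.Quotient.mk _ r) k = (coordR P r k : ZMod P.q) := rfl

theorem coordRq_surjective : Function.Surjective (coordRq P) := by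
  intro v
  refine ⟨Ideal.Quotient.mk _ (∑ k, rep (v k) • basisElt P k), ?_⟩
  funext k
  rw [coordRq_mk, map_sum, Finset.sum_apply]
  simp only [map_zsmul, Pi.smul_apply, coordR_basisElt]
  simp [cast_rep]

/-- The root of unity `ζ` in the `a`-th field. -/
def zetaK (a : Fin P.l) : CycField P a := IsCyclotomicExtension.zeta (P.m a) ℚ (CycField P a)

theorem isPrimitiveRoot_zetaK (a : Fin P.l) : IsPrimitiveRoot (zetaK P a) (P.m a) :=
  IsCyclotomicExtension.zeta_spec _ _ _

/-- The tensor basis elements, in `K`. -/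
def eltK (k : Fin P.n) : KT P := algebraMap (R P) (KT P) (basisElt P k)

theorem algebraMap_tprod (x : ∀ i, 𝓞 (CycField P i)) :
    algebraMap (R P) (KT P) (R.tprod P x) = KT.tprod P fun i => (x i : CycField P i) := by
  change PiTensorProduct.lift (intTensor P) (PiTensorProduct.tprod ℤ x) = _
  rw [PiTensorProduct.lift.tprod]
  rfl

theorem eltK_eq (k : Fin P.n) :
    eltK P k = KT.tprod P fun a => zetaK P a ^ (P.dig k a : ℕ) := by
  rw [eltK, basisElt, algebraMap_tprod]
  congr 1

theorem σ_eltK (j : Emb P) (k : Fin P.n) :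
    σ P j (eltK P k) = ∏ a, j a (zetaK P a) ^ (P.dig k a : ℕ) := by
  rw [eltK_eq, σ_tprod]
  simp

/-- The power basis of `K_a` over `ℚ`. -/
def cycBasisK (a : Fin P.l) : Module.Basis (Fin (P.m a).totient) ℚ (CycField P a) :=
  ((isPrimitiveRoot_zetaK P a).powerBasis ℚ).basis.reindex (finCongr (by
    rw [← PowerBasis.finrank, IsCyclotomicExtension.finrank (n := P.m a) (CycField P a)
      (Polynomial.cyclotomic.irreducible_rat (P.m_pos a))]))

/-- The tensor basis of `K` over `ℚ`. -/
def basisK : Module.Basis (Fin P.n) ℚ (KT P) :=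
  ((Basis.piTensorProduct (cycBasisK P)).reindex finPiFinEquiv :
    Module.Basis (Fin P.n) ℚ (⨂[ℚ] i, CycField P i))

theorem basisK_apply (k : Fin P.n) : basisK P k = eltK P k := by
  rw [eltK_eq]
  have h : (((Basis.piTensorProduct (cycBasisK P)).reindex finPiFinEquiv :
    Module.Basis (Fin P.n) ℚ (⨂[ℚ] i, CycField P i))) k = PiTensorProduct.tprod ℚ
      fun a => zetaK P a ^ (P.dig k a : ℕ) := by
    rw [Module.Basis.reindex_apply, Basis.piTensorProduct_apply]
    congr 1
    funext a
    simp [cycBasisK, Params.dig]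
  exact h

theorem card_emb : Fintype.card (Emb P) = P.n := by
  rw [Fintype.card_pi]
  refine Finset.prod_congr rfl fun a _ => ?_
  rw [AlgHom.card, IsCyclotomicExtension.finrank (n := P.m a) (CycField P a)
      (Polynomial.cyclotomic.irreducible_rat (P.m_pos a))]

/-- An embedding of `K` determines its factors: evaluate it at pure tensors equal to `1` outside one
place. -/
theorem σ_injective : Function.Injective (σ P) := by
  intro j j' h
  funext a
  refine AlgHom.ext fun x => ?_
  have h1 := DFunLike.congr_fun h (KT.tprod P (Function.update 1 a x))
  rw [σ_tprod, σ_tprod] at h1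
  have h2 (j : Emb P) : ∏ i, j i (Function.update (1 : ∀ i, CycField P i) a x i) = j a x := by
    rw [Finset.prod_eq_single a]
    · simp
    · intro b _ hb
      simp [hb]
    · simp
  rwa [h2, h2] at h1

/-- The matrix of the values of the embeddings has independent rows. -/
theorem eq_zero_of_sum_σ {x : Emb P → ℂ} (h : ∀ k, ∑ j, x j * σ P j (eltK P k) = 0) : x = 0 := by
  have hli : LinearIndependent ℂ (fun j : Emb P => (σ P j : KT P → ℂ)) := by
    have := linearIndependent_monoidHom (KT P) ℂ
    exact this.comp (fun j : Emb P => ((σ P j : KT P →+* ℂ) : KT P →* ℂ)) (by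
      intro j j' hj
      exact σ_injective P (AlgHom.ext fun y => DFunLike.congr_fun hj y))
  have h0 : ∑ j, x j • (σ P j : KT P → ℂ) = 0 := by
    funext y
    have hy := (basisK P).sum_repr y
    simp only [basisK_apply] at hy
    rw [← hy]
    simp only [Finset.sum_apply, Pi.smul_apply, smul_eq_mul, map_sum, map_smul, Finset.mul_sum,
      Pi.zero_apply]
    rw [Finset.sum_comm]
    refine Finset.sum_eq_zero fun k _ => ?_
    rw [← mul_zero (((basisK P).repr y k : ℚ) : ℂ), ← h k, Finset.mul_sum]
    refine Finset.sum_congr rfl fun j _ => ?_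
    rw [Algebra.smul_def, eq_ratCast]
    ring
  funext j
  exact Fintype.linearIndependent_iff.1 hli x h0 j

end MRLWE

end

noncomputable section

namespace MRLWE

variable (P : Params)

/-! ### The trace form -/

theorem Tr_add (x y : KT P) : Tr P (x + y) = Tr P x + Tr P y := by
  simp [Tr, Finset.sum_add_distrib]

theorem Tr_rat_smul (c : ℚ) (x : KT P) : Tr P (c • x) = c * Tr P x := by
  simp only [Tr, map_smul, Finset.mul_sum]
  refine Finset.sum_congr rfl fun j _ => ?_
  rw [Algebra.smul_def, eq_ratCast]

theorem Tr_sum {ι : Type*} (s : Finset ι) (f : ι → KT P) :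
    Tr P (∑ i ∈ s, f i) = ∑ i ∈ s, Tr P (f i) := by
  simp only [Tr, map_sum]
  exact Finset.sum_comm

theorem Tr_int_smul (c : ℤ) (x : KT P) : Tr P (c • x) = c * Tr P x := by
  rw [← Int.cast_smul_eq_zsmul ℚ, Tr_rat_smul]
  simp

/-- The trace of a pure tensor is the product of the traces in the factors, and each of these is a
rational algebraic integer. -/
theorem exists_int_Tr_tprod (x : ∀ i, 𝓞 (CycField P i)) :
    ∃ z : ℤ, Tr P (KT.tprod P fun i => (x i : CycField P i)) = z := by
  have h (a : Fin P.l) : ∃ z : ℤ, ∑ τ : CycField P a →ₐ[ℚ] ℂ, τ (x a) = z := by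
    have hi : IsIntegral ℤ (Algebra.trace ℚ (CycField P a) (x a)) :=
      Algebra.isIntegral_trace (x a).isIntegral_coe
    obtain ⟨z, hz⟩ := IsIntegrallyClosed.isIntegral_iff.1 hi
    refine ⟨z, ?_⟩
    rw [← trace_eq_sum_embeddings (K := ℚ) (E := ℂ), ← hz]
    simp
  choose z hz using h
  refine ⟨∏ a, z a, ?_⟩
  rw [Tr]
  simp only [σ_tprod]
  push_cast
  simp only [← hz]
  rw [Finset.prod_univ_sum, Fintype.piFinset_univ]

theorem exists_int_Tr (r : R P) : ∃ z : ℤ, Tr P (algebraMap (R P) (KT P) r) = z := by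
  have h (k : Fin P.n) : ∃ z : ℤ, Tr P (eltK P k) = z := by
    rw [eltK, basisElt, algebraMap_tprod]
    exact exists_int_Tr_tprod P _
  choose z hz using h
  refine ⟨∑ k, coordR P r k * z k, ?_⟩
  conv_lhs => rw [← sum_coordR P r]
  simp only [map_sum, map_zsmul, Tr_sum, Tr_int_smul]
  push_cast
  refine Finset.sum_congr rfl fun k _ => ?_
  rw [← hz]
  rfl

theorem Tr_mul_algebraMap (y : KT P) (r : R P) :
    Tr P (y * algebraMap (R P) (KT P) r) = ∑ k, (coordR P r k : ℂ) * Tr P (y * eltK P k) := by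
  conv_lhs => rw [← sum_coordR P r]
  simp only [map_sum, map_zsmul, Finset.mul_sum, mul_smul_comm, Tr_sum, Tr_int_smul]
  rfl

/-- The matrix of the embeddings on the tensor basis is square, by `card_emb`. Independent rows make
it invertible, so its columns are independent as well. -/
theorem eq_zero_of_σ {y : KT P} (h : ∀ j, σ P j y = 0) : y = 0 := by
  let e : Emb P ≃ Fin P.n := Fintype.equivFinOfCardEq (card_emb P)
  let M : Matrix (Fin P.n) (Fin P.n) ℂ := fun i k => σ P (e.symm i) (eltK P k)
  have hdet : M.det ≠ 0 := by
    intro h0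
    obtain ⟨v, hv, hv0⟩ := Matrix.exists_vecMul_eq_zero_iff.2 h0
    refine hv ?_
    have := eq_zero_of_sum_σ P (x := fun j => v (e j)) fun k => by
      have h1 : ∑ i, v i * σ P (e.symm i) (eltK P k) = 0 := congrFun hv0 k
      rw [← h1, ← Equiv.sum_comp e]
      simp
    funext i
    simpa using congrFun this (e.symm i)
  have hy := (basisK P).sum_repr y
  have hz : (fun k => (((basisK P).repr y k : ℚ) : ℂ)) = 0 := by
    by_contra hne
    refine hdet (Matrix.exists_mulVec_eq_zero_iff.1 ⟨_, hne, ?_⟩)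
    funext i
    have h1 := h (e.symm i)
    rw [← hy, map_sum] at h1
    rw [Matrix.mulVec, dotProduct, Pi.zero_apply, ← h1]
    refine Finset.sum_congr rfl fun k _ => ?_
    rw [map_smul, basisK_apply, Algebra.smul_def, eq_ratCast, mul_comm]
  rw [← hy]
  refine Finset.sum_eq_zero fun k _ => ?_
  have := congrFun hz k
  simp only [Pi.zero_apply, Rat.cast_eq_zero] at this
  rw [this, zero_smul]

theorem eq_zero_of_Tr {y : KT P} (h : ∀ k, Tr P (y * eltK P k) = 0) : y = 0 := by
  refine eq_zero_of_σ P fun j => congrFun (eq_zero_of_sum_σ P (x := fun j => σ P j y) fun k => ?_) j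
  rw [← h k, Tr]
  simp

/-- The Gram matrix of the trace form has integer entries, so it defines a `ℚ`-linear endomorphism.
Nondegeneracy makes it injective, hence surjective. -/
theorem exists_Tr_eq (c : Fin P.n → ℚ) : ∃ y : KT P, ∀ k, Tr P (y * eltK P k) = c k := by
  have h (k k' : Fin P.n) : ∃ z : ℤ, Tr P (eltK P k * eltK P k') = z := by
    rw [eltK, eltK, ← map_mul]
    exact exists_int_Tr P _
  choose G hG using h
  let T : (Fin P.n → ℚ) →ₗ[ℚ] (Fin P.n → ℚ) := Matrix.toLin' (fun k' k => (G k k' : ℚ))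
  have hT (v : Fin P.n → ℚ) (k' : Fin P.n) :
      Tr P ((∑ k, v k • eltK P k) * eltK P k') = (T v k' : ℚ) := by
    have h1 : T v k' = ∑ k, (G k k' : ℚ) * v k := rfl
    rw [Finset.sum_mul, Tr_sum, h1]
    push_cast
    refine Finset.sum_congr rfl fun k _ => ?_
    rw [smul_mul_assoc, Tr_rat_smul, hG, mul_comm]
  have hinj : Function.Injective T := by
    rw [injective_iff_map_eq_zero]
    intro v hv
    have h0 : ∑ k, v k • eltK P k = 0 := eq_zero_of_Tr P fun k' => by
      rw [hT, hv]
      simp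
    simp only [← basisK_apply] at h0
    funext k
    exact Fintype.linearIndependent_iff.1 (basisK P).linearIndependent v h0 k
  obtain ⟨v, hv⟩ := LinearMap.injective_iff_surjective.1 hinj c
  exact ⟨_, fun k => (hT v k).trans (by rw [hv])⟩

/-- Integrality of `Tr(y r)` need only be checked on the tensor basis. -/
theorem exists_Rdual (c : Fin P.n → ℤ) : ∃ y : Rdual P, ∀ k, Tr P ((y : KT P) * eltK P k) = c k := by
  obtain ⟨y, hy⟩ := exists_Tr_eq P fun k => (c k : ℚ)
  simp only [Rat.cast_intCast] at hy
  refine ⟨⟨y, fun r => ⟨∑ k, coordR P r k * c k, ?_⟩⟩, hy⟩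
  rw [Tr_mul_algebraMap]
  push_cast
  simp only [hy]

/-- The coordinates of an element of `R^∨` for the basis dual to the tensor basis. -/
def trZ (y : Rdual P) (k : Fin P.n) : ℤ := (y.2 (basisElt P k)).choose

theorem trZ_spec (y : Rdual P) (k : Fin P.n) : Tr P ((y : KT P) * eltK P k) = trZ P y k :=
  (y.2 (basisElt P k)).choose_spec

theorem trZ_eq {y : Rdual P} {k : Fin P.n} {z : ℤ} (h : Tr P ((y : KT P) * eltK P k) = z) :
    trZ P y k = z := by
  rw [trZ_spec] at h
  exact_mod_cast h

theorem trZ_add_smul (y w : Rdual P) (k : Fin P.n) :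
    trZ P (y + (P.q : R P) • w) k = trZ P y k + P.q * trZ P w k := by
  refine trZ_eq P ?_
  have h : ((y + (P.q : R P) • w : Rdual P) : KT P) = (y : KT P) + (P.q : ℤ) • (w : KT P) := by
    simp [Algebra.smul_def]
  rw [h, add_mul, Tr_add, smul_mul_assoc, Tr_int_smul, trZ_spec, trZ_spec]
  push_cast
  rfl

theorem trZ_injective : Function.Injective (trZ P) := by
  intro y y' h
  refine Subtype.ext (sub_eq_zero.1 (eq_zero_of_Tr P fun k => ?_))
  have h1 : ((y : KT P) - y') * eltK P k = y * eltK P k + (-1 : ℤ) • ((y' : KT P) * eltK P k) := by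
    rw [neg_one_smul]; ring
  rw [h1, Tr_add, Tr_int_smul, trZ_spec, trZ_spec, h]
  push_cast
  ring

theorem mk_eq_mk_iff (y y' : Rdual P) :
    (Submodule.Quotient.mk y : RqDual P) = Submodule.Quotient.mk y' ↔
      ∃ w : Rdual P, y = y' + (P.q : R P) • w := by
  rw [Submodule.Quotient.eq, Submodule.mem_smul_pointwise_iff_exists]
  constructor
  · rintro ⟨w, -, hw⟩
    exact ⟨w, by rw [hw]; abel⟩
  · rintro ⟨w, hw⟩
    exact ⟨w, trivial, by rw [hw]; abel⟩

/-- In the dual basis `qR^∨` consists of the vectors with all coordinates divisible by `q`; thus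
`R_q^∨` is identified with vectors modulo `q`. -/
theorem mk_eq_mk_iff_trZ (y y' : Rdual P) :
    (Submodule.Quotient.mk y : RqDual P) = Submodule.Quotient.mk y' ↔
      ∀ k, (trZ P y k : ZMod P.q) = trZ P y' k := by
  rw [mk_eq_mk_iff]
  constructor
  · rintro ⟨w, rfl⟩ k
    rw [trZ_add_smul]
    simp
  · intro h
    have h1 (k : Fin P.n) : ∃ w : ℤ, trZ P y k = trZ P y' k + P.q * w := by
      have := (ZMod.intCast_eq_intCast_iff_dvd_sub _ _ _).1 (h k).symm
      obtain ⟨w, hw⟩ := this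
      exact ⟨w, by rw [← hw]; ring⟩
    choose w hw using h1
    obtain ⟨x, hx⟩ := exists_Rdual P w
    refine ⟨x, trZ_injective P (funext fun k => ?_)⟩
    rw [trZ_add_smul, trZ_eq P (hx k), hw]

/-- The coordinates of an element of `R_q^∨`. -/
def dualVec (s : RqDual P) (k : Fin P.n) : ZMod P.q := trZ P (Quotient.out s) k

theorem dualVec_mk (y : Rdual P) (k : Fin P.n) :
    dualVec P (Submodule.Quotient.mk y) k = trZ P y k := by
  refine (mk_eq_mk_iff_trZ P _ _).1 ?_ k
  exact Quotient.out_eq (Submodule.Quotient.mk y : RqDual P)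

theorem dualVec_bijective : Function.Bijective (dualVec P) := by
  constructor
  · intro s s' h
    obtain ⟨y, rfl⟩ := Submodule.Quotient.mk_surjective _ s
    obtain ⟨y', rfl⟩ := Submodule.Quotient.mk_surjective _ s'
    refine (mk_eq_mk_iff_trZ P _ _).2 fun k => ?_
    rw [← dualVec_mk, ← dualVec_mk, h]
  · intro v
    obtain ⟨y, hy⟩ := exists_Rdual P fun k => rep (v k)
    refine ⟨Submodule.Quotient.mk y, funext fun k => ?_⟩
    rw [dualVec_mk, trZ_eq P (hy k), cast_rep]

theorem represents_of_dualVec {c : Fin P.n → ℤ} {s : RqDual P}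
    (h : ∀ k, (c k : ZMod P.q) = dualVec P s k) : Represents P c s := by
  obtain ⟨y, hy⟩ := exists_Rdual P c
  refine ⟨y, (dualVec_bijective P).1 (funext fun k => ?_), hy⟩
  rw [dualVec_mk, trZ_eq P (hy k), h]

theorem coordT_mk (x : H P) (k : Fin P.n) : coordT P (Torus.mk P x) k =
    (((∑ j, (x : EuclideanSpace ℂ (Emb P)) j * σ P j (eltK P k)).re : ℝ) : UnitAddCircle) := rfl

/-- By associativity `Tr((r y) b_k) = Tr(y (r b_k))`, and `r b_k` is expanded in the tensor basis.
-/
theorem coordT_divQ_smul (r : R P) (y : Rdual P) (k : Fin P.n) :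
    coordT P (divQ P ((Ideal.Quotient.mk _ r : Rq P) • (Submodule.Quotient.mk y : RqDual P))) k =
      ZMod.toAddCircle (∑ k', (coordR P (r * basisElt P k) k' : ZMod P.q) * (trZ P y k' : ZMod P.q)) := by
  have h1 : divQ P ((Ideal.Quotient.mk _ r : Rq P) • (Submodule.Quotient.mk y : RqDual P)) =
      Torus.mk P ((P.q : ℝ)⁻¹ • canEmb P ((r • y : Rdual P) : KT P)) := rfl
  have h2 : ∑ j, σ P j ((r • y : Rdual P) : KT P) * σ P j (eltK P k) =
      ((∑ k', coordR P (r * basisElt P k) k' * trZ P y k' : ℤ) : ℂ) := by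
    have h3 : ((r • y : Rdual P) : KT P) * eltK P k =
        (y : KT P) * algebraMap (R P) (KT P) (r * basisElt P k) := by
      rw [map_mul, Submodule.coe_smul, Algebra.smul_def, eltK]
      ring
    have h4 := Tr_mul_algebraMap P (y : KT P) (r * basisElt P k)
    rw [← h3] at h4
    rw [Tr] at h4
    simp only [map_mul] at h4
    rw [h4]
    push_cast
    simp only [trZ_spec]
  have h5 : ∑ j, (((P.q : ℝ)⁻¹ • canEmb P ((r • y : Rdual P) : KT P) : H P) :
      EuclideanSpace ℂ (Emb P)) j * σ P j (eltK P k) =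
      (((∑ k', coordR P (r * basisElt P k) k' * trZ P y k' : ℤ) / (P.q : ℝ) : ℝ) : ℂ) := by
    have h6 (j : Emb P) : (((P.q : ℝ)⁻¹ • canEmb P ((r • y : Rdual P) : KT P) : H P) :
        EuclideanSpace ℂ (Emb P)) j = ((P.q : ℝ)⁻¹ : ℂ) * σ P j ((r • y : Rdual P) : KT P) := by
      change ((P.q : ℝ)⁻¹ : ℝ) • σ P j _ = _
      rw [Complex.real_smul]
      push_cast
      rfl
    simp only [h6, mul_assoc, ← Finset.mul_sum, h2]
    push_cast
    rw [div_eq_inv_mul]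
  rw [h1, coordT_mk, h5, Complex.ofReal_re, ← ZMod.toAddCircle_intCast]
  push_cast
  rfl

end MRLWE

end

noncomputable section

namespace MRLWE

variable (P : Params)

/-! ### The homomorphisms `R → ℤ/q` and the components of a secret -/

/-- The matrix of the homomorphisms. -/
def matV : Matrix (Fin P.n) (Fin P.n) (ZMod P.q) := Matrix.of (crtV P)

theorem evalV_eq_mulVec (a : Fin P.n → ZMod P.q) : evalV P a = (matV P).mulVec a := rfl

theorem combV_eq_vecMul (w : Fin P.n → ZMod P.q) : combV P w = Matrix.vecMul w (matV P) := rfl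

section Chi

variable [Fact P.q.Prime]

/-- The homomorphisms `𝓞(K_a) → ℤ/q`. -/
def chiAxis (hmod : ∀ i, P.q ≡ 1 [MOD P.m i]) (i : Fin P.n) (a : Fin P.l) :
    𝓞 (CycField P a) →ₐ[ℤ] ZMod P.q :=
  (isPrimitiveRoot_zetaK P a).integralPowerBasis.lift
    (P.root a ^ unitAt (P.m a) (P.dig i a)) (by
      rw [IsPrimitiveRoot.integralPowerBasis_gen,
        ← minpoly.algebraMap_eq (B := 𝓞 (CycField P a)) (B' := CycField P a)
          RingOfIntegers.coe_injective]
      rw [show algebraMap (𝓞 (CycField P a)) (CycField P a) (isPrimitiveRoot_zetaK P a).toInteger =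
        zetaK P a from rfl]
      -- The minimal polynomial of `ζ` over `ℤ` is `Φ_m`, so the prescribed image only has to be a
      -- zero of `Φ_m`.
      convert aeval_cyclotomic (P.m_pos a) (isPrimitiveRoot_root_pow P hmod i a) using 2
      convert (Polynomial.cyclotomic_eq_minpoly (isPrimitiveRoot_zetaK P a) (P.m_pos a)).symm
      exact Subsingleton.elim _ _)

theorem chiAxis_zetaInt (hmod : ∀ i, P.q ≡ 1 [MOD P.m i]) (i : Fin P.n) (a : Fin P.l) :
    chiAxis P hmod i a (zetaInt P a) = P.root a ^ unitAt (P.m a) (P.dig i a) := by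
  have h : zetaInt P a = (isPrimitiveRoot_zetaK P a).integralPowerBasis.gen :=
    (IsPrimitiveRoot.integralPowerBasis_gen _).symm
  rw [h, chiAxis, PowerBasis.lift_gen]

/-- The `i`-th homomorphism `R → ℤ/q`. -/
def chi (hmod : ∀ i, P.q ≡ 1 [MOD P.m i]) (i : Fin P.n) : R P →+* ZMod P.q :=
  (PiTensorProduct.liftAlgHom
    ((MultilinearMap.mkPiAlgebra ℤ (Fin P.l) (ZMod P.q)).compLinearMap
      fun a => (chiAxis P hmod i a).toLinearMap)
    (by simp) (by intro x y; simp [Finset.prod_mul_distrib]) :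
    (⨂[ℤ] i, 𝓞 (CycField P i)) →ₐ[ℤ] ZMod P.q).toRingHom

theorem chi_basisElt (hmod : ∀ i, P.q ≡ 1 [MOD P.m i]) (i k : Fin P.n) :
    chi P hmod i (basisElt P k) = crtV P i k := by
  change PiTensorProduct.lift _ (PiTensorProduct.tprod ℤ _) = _
  rw [PiTensorProduct.lift.tprod]
  simp only [MultilinearMap.compLinearMap_apply, MultilinearMap.mkPiAlgebra_apply,
    AlgHom.toLinearMap_apply, map_pow, chiAxis_zetaInt, ← pow_mul]
  rfl

theorem chi_eq_evalV (hmod : ∀ i, P.q ≡ 1 [MOD P.m i]) (i : Fin P.n) (r : R P) :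
    chi P hmod i r = evalV P (coordRq P (Ideal.Quotient.mk _ r)) i := by
  conv_lhs => rw [← sum_coordR P r]
  simp only [map_sum, map_zsmul, chi_basisElt, evalV, coordRq_mk]
  refine Finset.sum_congr rfl fun k _ => ?_
  rw [zsmul_eq_mul, mul_comm]

/-- The inverse of the matrix of the homomorphisms. -/
def matVInv : Matrix (Fin P.n) (Fin P.n) (ZMod P.q) := (crtC P)⁻¹ • (Matrix.of (crtW P)).transpose

theorem matV_mul_matVInv (hmod : ∀ i, P.q ≡ 1 [MOD P.m i]) : matV P * matVInv P = 1 := by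
  ext i i'
  rw [matVInv, Matrix.mul_smul, Matrix.smul_apply, Matrix.mul_apply, Matrix.one_apply]
  have h := sum_crtV_mul_crtW P hmod i i'
  simp only [matV, Matrix.transpose_apply, Matrix.of_apply]
  rw [h]
  split_ifs
  · rw [smul_eq_mul, inv_mul_cancel₀ (crtC_ne_zero P hmod)]
  · simp

theorem evalV_bijective (hmod : ∀ i, P.q ≡ 1 [MOD P.m i]) : Function.Bijective (evalV P) := by
  have h1 := matV_mul_matVInv P hmod
  have h2 := mul_eq_one_comm.1 h1
  refine Function.bijective_iff_has_inverse.2 ⟨(matVInv P).mulVec, fun a => ?_, fun a => ?_⟩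
  · rw [evalV_eq_mulVec, Matrix.mulVec_mulVec, h2, Matrix.one_mulVec]
  · rw [evalV_eq_mulVec, Matrix.mulVec_mulVec, h1, Matrix.one_mulVec]

theorem combV_bijective (hmod : ∀ i, P.q ≡ 1 [MOD P.m i]) : Function.Bijective (combV P) := by
  have h1 := matV_mul_matVInv P hmod
  have h2 := mul_eq_one_comm.1 h1
  refine Function.bijective_iff_has_inverse.2
    ⟨fun v => Matrix.vecMul v (matVInv P), fun a => ?_, fun a => ?_⟩
  · change Matrix.vecMul (Matrix.vecMul a (matV P)) (matVInv P) = a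
    rw [Matrix.vecMul_vecMul, h1, Matrix.vecMul_one]
  · rw [combV_eq_vecMul, Matrix.vecMul_vecMul, h2, Matrix.vecMul_one]

/-- The components of a secret with respect to the basis of homomorphisms. -/
def secretEquiv (hmod : ∀ i, P.q ≡ 1 [MOD P.m i]) : RqDual P ≃ (Fin P.n → ZMod P.q) :=
  (Equiv.ofBijective _ (dualVec_bijective P)).trans (Equiv.ofBijective _ (combV_bijective P hmod)).symm

theorem combV_secretEquiv (hmod : ∀ i, P.q ≡ 1 [MOD P.m i]) (s : RqDual P) :
    combV P (secretEquiv P hmod s) = dualVec P s :=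
  (Equiv.ofBijective _ (combV_bijective P hmod)).apply_symm_apply _

/-- A secret is a functional `∑ s_j χ_j` on `R_q`. Multiplicativity, `χ_j(a b_k) = χ_j(a) χ_j(b_k)`,
makes multiplication by `a` diagonal on its components; this decouples the search. -/
theorem coordT_divQ (hmod : ∀ i, P.q ≡ 1 [MOD P.m i]) (a : Rq P) (s : RqDual P) :
    coordT P (divQ P (a • s)) = embT P (combV P fun j =>
      evalV P (coordRq P a) j * secretEquiv P hmod s j) := by
  obtain ⟨r, rfl⟩ := Ideal.Quotient.mk_surjective a
  obtain ⟨y, rfl⟩ := Submodule.Quotient.mk_surjective _ s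
  funext k
  rw [coordT_divQ_smul, embT]
  congr 1
  have h1 (k' : Fin P.n) : (trZ P y k' : ZMod P.q) =
      ∑ j, secretEquiv P hmod (Submodule.Quotient.mk y) j * crtV P j k' := by
    rw [← dualVec_mk, ← combV_secretEquiv P hmod]
    rfl
  simp only [h1, Finset.mul_sum, combV]
  rw [Finset.sum_comm]
  refine Finset.sum_congr rfl fun j _ => ?_
  have h2 := chi_eq_evalV P hmod j (r * basisElt P k)
  rw [map_mul, chi_basisElt, chi_eq_evalV] at h2
  rw [mul_right_comm, h2, evalV, Finset.sum_mul]
  refine Finset.sum_congr rfl fun k' _ => ?_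
  rw [coordRq_mk]
  ring

theorem represents_of_secret (hmod : ∀ i, P.q ≡ 1 [MOD P.m i]) {c : Fin P.n → ℤ} {s : RqDual P}
    (h : ∀ k, c k = rep (∑ j, secretEquiv P hmod s j * crtV P j k)) : Represents P c s := by
  refine represents_of_dualVec P fun k => ?_
  rw [h, cast_rep, ← combV_secretEquiv P hmod]
  rfl

end Chi

/-! ### The automorphisms -/

theorem evalV_transform [Fact P.q.Prime] (hmod : ∀ i, P.q ≡ 1 [MOD P.m i]) (i j : Fin P.n)
    (a : Fin P.n → ZMod P.q) (b : Fin P.n) :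
    evalV P (fun k => ∑ k', a k' * autT P i j k' k) b = evalV P a (crtPerm P i j b) := by
  simp only [evalV, Finset.mul_sum, ← sum_autT_mul_crtV P hmod, Finset.sum_mul]
  rw [Finset.sum_comm]
  refine Finset.sum_congr rfl fun k' _ => Finset.sum_congr rfl fun k _ => ?_
  ring

theorem autTorus_add (i j : Fin P.n) (b b' : Fin P.n → UnitAddCircle) :
    autTorus P i j (b + b') = autTorus P i j b + autTorus P i j b' := by
  funext k
  simp [autTorus, Finset.sum_add_distrib]

/-- The indices of the matrix are swapped compared with the first component of a sample. There the
automorphism `τ` acts on coordinates in the tensor basis; here it acts on trace coordinates, and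
`Tr(τ(x) b_k) = Tr(x τ⁻¹(b_k))` calls for the inverse. -/
theorem autTorus_embT [Fact P.q.Prime] (hmod : ∀ i, P.q ≡ 1 [MOD P.m i]) (i j : Fin P.n)
    (w : Fin P.n → ZMod P.q) :
    autTorus P j i (embT P (combV P w)) = embT P (combV P fun b => w (crtPerm P i j b)) := by
  funext k
  simp only [autTorus, embT, ← map_zsmul, ← map_sum]
  congr 1
  simp only [zsmul_eq_mul, combV, Finset.mul_sum]
  rw [Finset.sum_comm, ← Equiv.sum_comp (crtPerm P i j)]
  refine Finset.sum_congr rfl fun b _ => ?_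
  rw [← crtPerm_symm P i j b, ← sum_autT_mul_crtV P hmod, Finset.mul_sum]
  simp only [crtPerm_symm]
  refine Finset.sum_congr rfl fun k' _ => ?_
  ring

end MRLWE

end

/-! ### Real coordinates on `H`, the dual lattice, and the smoothing parameter. -/

noncomputable section

namespace MRLWE

variable (P : Params)

/-! ### Real coordinates on `H` -/

theorem conjEmb_conjEmb (j : Emb P) : conjEmb P (conjEmb P j) = j := by
  funext i
  ext x
  exact Complex.conj_conj _

/-- Complex conjugation of embeddings as a permutation. -/
def conjEquiv : Emb P ≃ Emb P where
  toFun := conjEmb P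
  invFun := conjEmb P
  left_inv := conjEmb_conjEmb P
  right_inv := conjEmb_conjEmb P

/-- The real coordinates `Tr(x · basisElt k)` of `x ∈ H`. -/
def coordH : H P →ₗ[ℝ] (Fin P.n → ℝ) where
  toFun x k := (∑ j, (x : EuclideanSpace ℂ (Emb P)) j * σ P j (eltK P k)).re
  map_add' x y := by
    funext k
    simp [add_mul, Finset.sum_add_distrib]
  map_smul' c x := by
    funext k
    simp only [RingHom.id_apply, Pi.smul_apply, smul_eq_mul, Complex.re_sum, Finset.mul_sum]
    refine Finset.sum_congr rfl fun j _ => ?_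
    rw [← Complex.re_ofReal_mul, ← mul_assoc, ← Complex.real_smul]
    rfl

theorem coordH_apply (x : H P) (k : Fin P.n) :
    coordH P x k = (∑ j, (x : EuclideanSpace ℂ (Emb P)) j * σ P j (eltK P k)).re := rfl

/-- Conjugation of embeddings permutes the summands into their conjugates, so the sum is real and
the real part in `coordT` loses nothing. -/
theorem ofReal_coordH (x : H P) (k : Fin P.n) : ((coordH P x k : ℝ) : ℂ) =
    ∑ j, (x : EuclideanSpace ℂ (Emb P)) j * σ P j (eltK P k) := by
  rw [coordH_apply]
  refine Complex.conj_eq_iff_re.1 ?_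
  rw [map_sum, ← Equiv.sum_comp (conjEquiv P)]
  refine Finset.sum_congr rfl fun j _ => ?_
  change star _ = _
  have h1 : (x : EuclideanSpace ℂ (Emb P)) (conjEmb P j) = star ((x : EuclideanSpace ℂ (Emb P)) j) :=
    x.2 j
  change star ((x : EuclideanSpace ℂ (Emb P)) (conjEmb P j) * σ P (conjEmb P j) (eltK P k)) = _
  rw [h1, σ_conjEmb, ← star_mul', star_star]

theorem coordH_injective : Function.Injective (coordH P) := by
  rw [injective_iff_map_eq_zero]
  intro x hx
  have h := eq_zero_of_sum_σ P (x := fun j => (x : EuclideanSpace ℂ (Emb P)) j) fun k => by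
    rw [← ofReal_coordH, hx]
    simp
  ext j
  exact congrFun h j

/-- A complex solution exists by a dimension count. The conjugate-symmetrized vector solves the same
system because the right-hand side is real, so uniqueness places the solution in `H`. -/
theorem coordH_surjective : Function.Surjective (coordH P) := by
  intro c
  let T : (Emb P → ℂ) →ₗ[ℂ] (Fin P.n → ℂ) :=
    { toFun := fun x k => ∑ j, x j * σ P j (eltK P k)
      map_add' := fun x y => by
        funext k
        simp [add_mul, Finset.sum_add_distrib]
      map_smul' := fun c x => by
        funext k
        simp [Finset.mul_sum, mul_assoc] }
  have hinj : Function.Injective T := by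
    rw [injective_iff_map_eq_zero]
    intro x hx
    exact eq_zero_of_sum_σ P fun k => congrFun hx k
  have hsurj : Function.Surjective T := by
    refine (LinearMap.injective_iff_surjective_of_finrank_eq_finrank ?_).1 hinj
    simp only [Module.finrank_fintype_fun_eq_card, card_emb, Fintype.card_fin]
  obtain ⟨x, hx⟩ := hsurj fun k => (c k : ℂ)
  have hx' (k : Fin P.n) : ∑ j, x j * σ P j (eltK P k) = c k := congrFun hx k
  have hsym : (fun j => star (x (conjEmb P j))) = x := by
    refine hinj (Eq.trans (funext fun k => ?_) hx.symm)
    change ∑ j, star (x (conjEmb P j)) * σ P j (eltK P k) = c k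
    rw [← Complex.conj_ofReal, ← hx', map_sum, ← Equiv.sum_comp (conjEquiv P)]
    refine Finset.sum_congr rfl fun j _ => ?_
    change star (x (conjEmb P (conjEmb P j))) * σ P (conjEmb P j) (eltK P k) = star (x j * _)
    rw [conjEmb_conjEmb, σ_conjEmb, ← star_mul']
  refine ⟨⟨WithLp.toLp 2 x, fun j => ?_⟩, funext fun k => ?_⟩
  · change x (conjEmb P j) = star (x j)
    rw [← congrFun hsym j, star_star]
  · rw [coordH_apply]
    change (∑ j, x j * σ P j (eltK P k)).re = c k
    rw [hx', Complex.ofReal_re]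

theorem coordT_mk_eq (x : H P) (k : Fin P.n) :
    coordT P (Torus.mk P x) k = ((coordH P x k : ℝ) : UnitAddCircle) := rfl

theorem mem_dualLattice_iff (x : H P) :
    x ∈ dualLattice P ↔ ∀ k, ∃ z : ℤ, coordH P x k = z := by
  constructor
  · rintro ⟨y, hy, rfl⟩ k
    obtain ⟨z, hz⟩ := hy (basisElt P k)
    refine ⟨z, Complex.ofReal_injective ?_⟩
    rw [ofReal_coordH, Complex.ofReal_intCast, ← hz, Tr]
    simp only [map_mul]
    rfl
  · intro h
    choose z hz using h
    obtain ⟨y, hy⟩ := exists_Rdual P z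
    refine ⟨y, y.2, coordH_injective P (funext fun k => ?_)⟩
    rw [hz]
    apply Complex.ofReal_injective
    rw [ofReal_coordH, Complex.ofReal_intCast, ← hy, Tr]
    simp only [map_mul]
    rfl

theorem coordT_injective : Function.Injective (coordT P) := by
  rw [injective_iff_map_eq_zero]
  intro b hb
  obtain ⟨x, rfl⟩ := QuotientAddGroup.mk'_surjective (dualLattice P) b
  refine (QuotientAddGroup.eq_zero_iff x).2 ((mem_dualLattice_iff P x).2 fun k => ?_)
  have h : ((coordH P x k : ℝ) : UnitAddCircle) = 0 := congrFun hb k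
  rw [AddCircle.coe_eq_zero_iff] at h
  obtain ⟨z, hz⟩ := h
  exact ⟨z, by simpa using hz.symm⟩

theorem coordT_surjective : Function.Surjective (coordT P) := by
  intro v
  have h (k : Fin P.n) : ∃ c : ℝ, (c : UnitAddCircle) = v k := QuotientAddGroup.mk_surjective (v k)
  choose c hc using h
  obtain ⟨x, rfl⟩ := coordH_surjective P c
  exact ⟨Torus.mk P x, funext hc⟩

theorem continuous_coordH : Continuous (coordH P) := LinearMap.continuous_of_finiteDimensional _

theorem continuous_coordT : Continuous (coordT P) := by
  have h : Topology.IsQuotientMap (QuotientAddGroup.mk : H P → H P ⧸ dualLattice P) :=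
    QuotientAddGroup.isQuotientMap_mk _
  refine h.continuous_iff.2 (continuous_pi fun k => ?_)
  exact (AddCircle.continuous_mk' 1).comp ((continuous_apply k).comp (continuous_coordH P))

/-- The torus is the continuous image of the unit cube in real coordinates. -/
instance : CompactSpace (Torus P) := by
  let e : H P ≃ₗ[ℝ] (Fin P.n → ℝ) :=
    LinearEquiv.ofBijective (coordH P) ⟨coordH_injective P, coordH_surjective P⟩
  have hc : Continuous fun c : Fin P.n → ℝ => Torus.mk P (e.symm c) :=
    (Torus.continuous_mk P).comp (LinearMap.continuous_of_finiteDimensional e.symm.toLinearMap)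
  refine ⟨?_⟩
  have hK : IsCompact (Set.Icc (0 : Fin P.n → ℝ) 1) := isCompact_Icc
  convert hK.image hc
  symm
  rw [Set.eq_univ_iff_forall]
  intro b
  have h (k : Fin P.n) : ∃ c : ℝ, c ∈ Set.Icc (0 : ℝ) 1 ∧ (c : UnitAddCircle) = coordT P b k := by
    obtain ⟨x, hx⟩ := QuotientAddGroup.mk_surjective (coordT P b k)
    refine ⟨Int.fract x, ⟨Int.fract_nonneg x, (Int.fract_lt_one x).le⟩, ?_⟩
    rw [← hx]
    refine sub_eq_zero.1 ?_
    rw [Int.fract]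
    change (((x - ⌊x⌋ : ℝ)) : UnitAddCircle) - (x : UnitAddCircle) = 0
    rw [← AddCircle.coe_sub, AddCircle.coe_eq_zero_iff]
    exact ⟨-⌊x⌋, by simp⟩
  choose c hc hcb using h
  refine ⟨c, ⟨fun k => (hc k).1, fun k => (hc k).2⟩, coordT_injective P (funext fun k => ?_)⟩
  rw [← hcb]
  change ((coordH P (e.symm c) k : ℝ) : UnitAddCircle) = _
  rw [show coordH P (e.symm c) = c from e.apply_symm_apply c]

/-! ### The dual lattice -/

/-- The vector of `H` whose inner products are the integer combinations of the coordinates. -/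
def freqVec (z : Fin P.n → ℤ) : H P :=
  ⟨WithLp.toLp 2 fun j => star (σ P j (∑ k, z k • eltK P k)), fun j => by
    change star _ = star (star _)
    rw [σ_conjEmb]⟩

/-- The conjugation in `freqVec` cancels the one in the Hermitian inner product. -/
theorem inner_freqVec (z : Fin P.n → ℤ) (v : H P) :
    inner ℝ (freqVec P z) v = ∑ k, (z k : ℝ) * coordH P v k := by
  rw [Submodule.coe_inner, PiLp.inner_apply]
  have h (j : Emb P) : inner ℝ ((freqVec P z : EuclideanSpace ℂ (Emb P)) j)
      ((v : EuclideanSpace ℂ (Emb P)) j) =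
      ∑ k, (z k : ℝ) * ((v : EuclideanSpace ℂ (Emb P)) j * σ P j (eltK P k)).re := by
    change inner ℝ (star (σ P j (∑ k, z k • eltK P k))) _ = _
    rw [Complex.inner]
    change (_ * star (star _) : ℂ).re = _
    rw [star_star, map_sum, Finset.mul_sum, Complex.re_sum]
    refine Finset.sum_congr rfl fun k _ => ?_
    rw [map_zsmul, zsmul_eq_mul, mul_left_comm, ← Complex.ofReal_intCast, Complex.re_ofReal_mul]
  simp only [h, coordH_apply, Complex.re_sum, Finset.mul_sum]
  exact Finset.sum_comm

theorem exists_coordH_single (k : Fin P.n) : ∃ y : H P, coordH P y = Pi.single k 1 :=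
  coordH_surjective P _

/-- The basis of `H` dual to the tensor basis. -/
def dualBasisH (k : Fin P.n) : H P := (exists_coordH_single P k).choose

theorem coordH_dualBasisH (k : Fin P.n) : coordH P (dualBasisH P k) = Pi.single k 1 :=
  (exists_coordH_single P k).choose_spec

theorem dualBasisH_mem (k : Fin P.n) : dualBasisH P k ∈ dualLattice P := by
  refine (mem_dualLattice_iff P _).2 fun k' => ?_
  rw [coordH_dualBasisH]
  by_cases h : k' = k
  · subst h
    exact ⟨1, by simp⟩
  · exact ⟨0, by simp [h]⟩

theorem sum_coordH (x : H P) : ∑ k, coordH P x k • dualBasisH P k = x := by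
  refine coordH_injective P (funext fun k => ?_)
  simp [map_sum, coordH_dualBasisH, Pi.single_apply]

theorem freqVec_injective : Function.Injective (freqVec P) := by
  intro z z' h
  funext k
  have h1 := inner_freqVec P z (dualBasisH P k)
  rw [h, inner_freqVec, coordH_dualBasisH] at h1
  simpa [Pi.single_apply] using h1.symm

theorem inner_freqVec_mem {y : H P} (hy : y ∈ dualLattice P) (z : Fin P.n → ℤ) :
    ∃ w : ℤ, inner ℝ y (freqVec P z) = w := by
  have h := (mem_dualLattice_iff P y).1 hy
  choose c hc using h
  refine ⟨∑ k, z k * c k, ?_⟩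
  rw [real_inner_comm, inner_freqVec]
  push_cast
  simp only [hc]

end MRLWE

end

noncomputable section

namespace MRLWE

/-! ### Gaussian sums over the dual lattice -/

theorem tsum_pi_prod {β : Type*} (f : β → ℝ≥0∞) (n : ℕ) :
    ∑' z : Fin n → β, ∏ k, f (z k) = (∑' x, f x) ^ n := by
  induction n with
  | zero => simp
  | succ n ih =>
    rw [← (Fin.consEquiv fun _ : Fin (n + 1) => β).tsum_eq, ENNReal.tsum_prod']
    simp only [Fin.consEquiv_apply, Fin.prod_univ_succ, Fin.cons_zero, Fin.cons_succ,
      ENNReal.tsum_mul_left, ih, ENNReal.tsum_mul_right]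
    rw [pow_succ, mul_comm]

theorem tsum_exp_neg_sq_ne_top : ∑' x : ℤ, ENNReal.ofReal (Real.exp (-(x : ℝ) ^ 2)) ≠ ⊤ := by
  have h : Summable fun x : ℤ => Real.exp (-(x : ℝ) ^ 2) := by
    have h1 : Summable fun x : ℕ => Real.exp (-(x : ℝ)) := Real.summable_exp_neg_nat
    have h2 : Summable fun x : ℕ => Real.exp (-(x : ℝ) ^ 2) := by
      refine Summable.of_nonneg_of_le (fun _ => by positivity) (fun x => ?_) h1
      refine Real.exp_le_exp.2 (neg_le_neg ?_)
      exact_mod_cast Nat.le_self_pow two_ne_zero x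
    refine Summable.of_nat_of_neg (by simpa using h2) (by simpa using h2)
  rw [← ENNReal.ofReal_tsum_of_nonneg (fun _ => by positivity) h]
  exact ENNReal.ofReal_ne_top

theorem tsum_exp_neg_sum_sq_ne_top (n : ℕ) :
    ∑' z : Fin n → ℤ, ENNReal.ofReal (Real.exp (-∑ k, (z k : ℝ) ^ 2)) ≠ ⊤ := by
  have h (z : Fin n → ℤ) : ENNReal.ofReal (Real.exp (-∑ k, (z k : ℝ) ^ 2)) =
      ∏ k, ENNReal.ofReal (Real.exp (-(z k : ℝ) ^ 2)) := by
    rw [← ENNReal.ofReal_prod_of_nonneg (fun _ _ => by positivity), ← Real.exp_sum]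
    simp
  simp only [h]
  rw [tsum_pi_prod fun x : ℤ => ENNReal.ofReal (Real.exp (-(x : ℝ) ^ 2))]
  exact ENNReal.pow_ne_top tsum_exp_neg_sq_ne_top

theorem eq_of_inner_eq {E ι : Type*} [NormedAddCommGroup E] [InnerProductSpace ℝ E] [Fintype ι]
    {b : ι → E} {c : E → ι → ℝ} (hb : ∀ v, ∑ k, c v k • b k = v) {x y : E}
    (h : ∀ k, inner ℝ (b k) x = inner ℝ (b k) y) : x = y := by
  refine ext_inner_left ℝ fun v => ?_
  rw [← hb v]
  simp only [sum_inner, real_inner_smul_left, h]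

variable (P : Params)

/-- The nonzero vectors of the lattice dual to `R^∨`. -/
def freqSet : Set (H P) :=
  {x : H P | (∀ y ∈ (dualLattice P : Set (H P)), ∃ z : ℤ, inner ℝ y x = z) ∧ x ≠ 0}

/-- The Gaussian sum over `freqSet`. -/
def gaussSum (r : ℝ) : ℝ≥0∞ :=
  ∑' x : freqSet P, ENNReal.ofReal (Real.exp (-Real.pi * r ^ 2 * ‖(x : H P)‖ ^ 2))

theorem exists_int_of_mem_freqSet (x : freqSet P) (k : Fin P.n) :
    ∃ z : ℤ, inner ℝ (dualBasisH P k) (x : H P) = z :=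
  x.2.1 _ (dualBasisH_mem P k)

/-- Integer coordinates on `freqSet`. -/
def freqCoord (x : freqSet P) (k : Fin P.n) : ℤ := (exists_int_of_mem_freqSet P x k).choose

theorem freqCoord_spec (x : freqSet P) (k : Fin P.n) :
    inner ℝ (dualBasisH P k) (x : H P) = freqCoord P x k :=
  (exists_int_of_mem_freqSet P x k).choose_spec

theorem eq_of_inner_dualBasisH {x y : H P}
    (h : ∀ k, inner ℝ (dualBasisH P k) x = inner ℝ (dualBasisH P k) y) : x = y :=
  eq_of_inner_eq (E := H P) (c := coordH P) (sum_coordH P) h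

theorem freqCoord_injective : Function.Injective (freqCoord P) := by
  intro x y h
  refine Subtype.ext (eq_of_inner_dualBasisH P fun k => ?_)
  rw [freqCoord_spec, freqCoord_spec, h]

theorem freqCoord_ne_zero (x : freqSet P) : freqCoord P x ≠ 0 := by
  intro h
  refine x.2.2 (eq_of_inner_dualBasisH P fun k => ?_)
  rw [freqCoord_spec, h]
  simp

/-- The coordinates are inner products with a fixed basis, so Cauchy–Schwarz applies. The summand
`1` makes the constant positive in every case. -/
theorem sum_sq_freqCoord_le (x : freqSet P) :
    ∑ k, (freqCoord P x k : ℝ) ^ 2 ≤ (1 + ∑ k, ‖dualBasisH P k‖ ^ 2) * ‖(x : H P)‖ ^ 2 := by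
  have h (k : Fin P.n) : (freqCoord P x k : ℝ) ^ 2 ≤ ‖dualBasisH P k‖ ^ 2 * ‖(x : H P)‖ ^ 2 := by
    rw [← freqCoord_spec, ← mul_pow, ← sq_abs]
    exact pow_le_pow_left₀ (abs_nonneg _) (abs_real_inner_le_norm _ _) 2
  calc _ ≤ ∑ k, ‖dualBasisH P k‖ ^ 2 * ‖(x : H P)‖ ^ 2 := Finset.sum_le_sum fun k _ => h k
    _ ≤ _ := by
      rw [← Finset.sum_mul]
      gcongr
      linarith

/-- The set defining the smoothing parameter must be nonempty, since an infimum over the empty set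
would be `0` and bound nothing. Nonzero dual vectors have integer coordinates with `∑ z_k² ≥ 1`. So
for `π r² = t C` a term is at most `exp(-(t - 1)) * exp(-∑ z_k²)`, with a convergent sum over `z`;
then `t → ∞`. -/
theorem exists_gaussSum_le {ε : ℝ} (hε : 0 < ε) :
    ∃ r : ℝ, 0 < r ∧ gaussSum P r ≤ ENNReal.ofReal ε := by
  set C := 1 + ∑ k, ‖dualBasisH P k‖ ^ 2 with hC
  have hC0 : 0 < C := by positivity
  set S := ∑' z : Fin P.n → ℤ, ENNReal.ofReal (Real.exp (-∑ k, (z k : ℝ) ^ 2)) with hS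
  have hStop : S ≠ ⊤ := tsum_exp_neg_sum_sq_ne_top P.n
  have hlim : Filter.Tendsto (fun t : ℝ => Real.exp (-(t - 1)) * S.toReal) Filter.atTop (nhds 0) := by
    have h1 : Filter.Tendsto (fun t : ℝ => Real.exp (-(t - 1))) Filter.atTop (nhds 0) :=
      Real.tendsto_exp_neg_atTop_nhds_zero.comp
        (Filter.tendsto_atTop_add_const_right _ (-1) Filter.tendsto_id)
    simpa using h1.mul_const S.toReal
  obtain ⟨t, ht, ht1⟩ := ((hlim.eventually (gt_mem_nhds hε)).and
    (Filter.eventually_ge_atTop (1 : ℝ))).exists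
  have hr : Real.pi * (Real.sqrt (t * C / Real.pi)) ^ 2 = t * C := by
    rw [Real.sq_sqrt (by positivity), mul_div_cancel₀ _ Real.pi_ne_zero]
  refine ⟨Real.sqrt (t * C / Real.pi), by positivity, ?_⟩
  have hterm (x : freqSet P) : ENNReal.ofReal
      (Real.exp (-Real.pi * (Real.sqrt (t * C / Real.pi)) ^ 2 * ‖(x : H P)‖ ^ 2)) ≤
      ENNReal.ofReal (Real.exp (-(t - 1))) *
        ENNReal.ofReal (Real.exp (-∑ k, (freqCoord P x k : ℝ) ^ 2)) := by
    rw [← ENNReal.ofReal_mul (by positivity), ← Real.exp_add]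
    refine ENNReal.ofReal_le_ofReal (Real.exp_le_exp.2 ?_)
    rw [neg_mul, hr]
    have h1 := sum_sq_freqCoord_le P x
    have h2 : (1 : ℝ) ≤ ∑ k, (freqCoord P x k : ℝ) ^ 2 := by
      obtain ⟨k, hk⟩ := Function.ne_iff.1 (freqCoord_ne_zero P x)
      have h3 : (1 : ℤ) ≤ freqCoord P x k ^ 2 := by
        have hk' : freqCoord P x k ≠ 0 := hk
        have : 0 < freqCoord P x k ^ 2 := by positivity
        omega
      calc (1 : ℝ) ≤ (freqCoord P x k : ℝ) ^ 2 := by exact_mod_cast h3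
        _ ≤ _ := Finset.single_le_sum (f := fun k => (freqCoord P x k : ℝ) ^ 2)
          (fun _ _ => by positivity) (Finset.mem_univ k)
    rw [← hC] at h1
    nlinarith
  calc gaussSum P _ ≤ ∑' x : freqSet P, ENNReal.ofReal (Real.exp (-(t - 1))) *
        ENNReal.ofReal (Real.exp (-∑ k, (freqCoord P x k : ℝ) ^ 2)) := ENNReal.tsum_le_tsum hterm
    _ = ENNReal.ofReal (Real.exp (-(t - 1))) *
        ∑' x : freqSet P, ENNReal.ofReal (Real.exp (-∑ k, (freqCoord P x k : ℝ) ^ 2)) :=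
      ENNReal.tsum_mul_left
    _ ≤ ENNReal.ofReal (Real.exp (-(t - 1))) * S := by
      gcongr
      exact ENNReal.tsum_comp_le_tsum_of_injective (freqCoord_injective P)
        (fun z => ENNReal.ofReal (Real.exp (-∑ k, (z k : ℝ) ^ 2)))
    _ = ENNReal.ofReal (Real.exp (-(t - 1)) * S.toReal) := by
      rw [ENNReal.ofReal_mul (by positivity), ENNReal.ofReal_toReal hStop]
    _ ≤ _ := ENNReal.ofReal_le_ofReal ht.le

theorem gaussSum_anti {r r' : ℝ} (hr : 0 ≤ r) (h : r ≤ r') : gaussSum P r' ≤ gaussSum P r := by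
  refine ENNReal.tsum_le_tsum fun x => ENNReal.ofReal_le_ofReal (Real.exp_le_exp.2 ?_)
  rw [neg_mul, neg_mul, neg_mul, neg_mul, neg_le_neg_iff]
  gcongr

/-- The infimum is attained. Above it the bound holds by monotonicity, and it passes to the limit
from the right because finite partial sums are continuous in the radius. -/
theorem gaussSum_le_of_smoothing_le {ε r : ℝ} (hε : 0 < ε)
    (h : smoothingDual P ε ≤ r) : gaussSum P r ≤ ENNReal.ofReal ε := by
  have hlt (r' : ℝ) (hr' : r < r') : gaussSum P r' ≤ ENNReal.ofReal ε := by
    have hne : {r : ℝ | 0 < r ∧ gaussSum P r ≤ ENNReal.ofReal ε}.Nonempty := exists_gaussSum_le P hε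
    have h1 : sInf {r : ℝ | 0 < r ∧ gaussSum P r ≤ ENNReal.ofReal ε} < r' := h.trans_lt hr'
    obtain ⟨u, ⟨hu0, hu⟩, hur⟩ := exists_lt_of_csInf_lt hne h1
    exact (gaussSum_anti P hu0.le hur.le).trans hu
  rw [gaussSum, ENNReal.tsum_eq_iSup_sum]
  refine iSup_le fun s => ?_
  have hc : Filter.Tendsto (fun r' : ℝ => ∑ x ∈ s,
      ENNReal.ofReal (Real.exp (-Real.pi * r' ^ 2 * ‖(x : H P)‖ ^ 2))) (nhdsWithin r (Set.Ioi r))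
      (nhds (∑ x ∈ s, ENNReal.ofReal (Real.exp (-Real.pi * r ^ 2 * ‖(x : H P)‖ ^ 2)))) := by
    have : Continuous fun r' : ℝ => ∑ x ∈ s,
        ENNReal.ofReal (Real.exp (-Real.pi * r' ^ 2 * ‖(x : H P)‖ ^ 2)) :=
      continuous_finsetSum _ fun x _ => ENNReal.continuous_ofReal.comp (by fun_prop)
    exact this.continuousWithinAt
  refine le_of_tendsto hc (Filter.eventually_of_mem self_mem_nhdsWithin fun r' hr' => ?_)
  exact (ENNReal.sum_le_tsum s).trans (hlt r' hr')

/-- The vectors `freqVec P z` form part of the dual lattice, injectively in `z`. That they exhaust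
it is not needed for an upper bound. -/
theorem tsum_freqVec_le {ε r : ℝ} (hε : 0 < ε) (h : smoothingDual P ε ≤ r) :
    ∑' z : {z : Fin P.n → ℤ // z ≠ 0},
      ENNReal.ofReal (Real.exp (-Real.pi * r ^ 2 * ‖freqVec P z‖ ^ 2)) ≤ ENNReal.ofReal ε := by
  refine le_trans ?_ (gaussSum_le_of_smoothing_le P hε h)
  have h0 : freqVec P 0 = 0 := by
    ext j
    change star (σ P j (∑ k, (0 : ℤ) • eltK P k)) = 0
    simp
  let f (z : {z : Fin P.n → ℤ // z ≠ 0}) : freqSet P :=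
    ⟨freqVec P z, fun y hy => inner_freqVec_mem P hy z, fun hz =>
      z.2 (freqVec_injective P (hz.trans h0.symm))⟩
  have hf : Function.Injective f := fun z z' hz =>
    Subtype.ext (freqVec_injective P (congrArg Subtype.val hz))
  exact ENNReal.tsum_comp_le_tsum_of_injective hf
    fun x : freqSet P => ENNReal.ofReal (Real.exp (-Real.pi * r ^ 2 * ‖(x : H P)‖ ^ 2))

end MRLWE

end

/-! ### Fourier coefficients on the torus: the error law, its invariance, and smoothing. -/

noncomputable section

namespace MRLWE

/-! ### Measures on the torus and their Fourier coefficients -/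

section Torus

variable {d : Type} [Fintype d]

theorem integrable_continuousMap (μ : Measure (d → UnitAddCircle)) [IsFiniteMeasure μ]
    (f : C(d → UnitAddCircle, ℂ)) : Integrable (fun x => f x) μ :=
  Integrable.of_bound f.continuous.aestronglyMeasurable ‖f‖
    (Filter.Eventually.of_forall fun x => f.norm_coe_le_norm x)

/-- Integration as a continuous functional on continuous functions. -/
def integralC (μ : Measure (d → UnitAddCircle)) [IsFiniteMeasure μ] :
    C(d → UnitAddCircle, ℂ) →L[ℂ] ℂ :=
  LinearMap.mkContinuous
    { toFun := fun f => ∫ x, f x ∂μ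
      map_add' := fun f g => integral_add (integrable_continuousMap μ f) (integrable_continuousMap μ g)
      map_smul' := fun c f => integral_const_mul c _ }
    (μ.real Set.univ) fun f => by
      rw [mul_comm]
      exact norm_integral_le_of_norm_le_const
        (Filter.Eventually.of_forall fun x => f.norm_coe_le_norm x)

theorem integralC_apply (μ : Measure (d → UnitAddCircle)) [IsFiniteMeasure μ]
    (f : C(d → UnitAddCircle, ℂ)) : integralC μ f = ∫ x, f x ∂μ := rfl

/-- Trigonometric polynomials are dense among continuous functions, and integration is continuous
for the uniform norm. -/
theorem measure_eq_of_mFourier {μ ν : Measure (d → UnitAddCircle)} [IsFiniteMeasure μ]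
    [IsFiniteMeasure ν]
    (h : ∀ z, ∫ x, UnitAddTorus.mFourier z x ∂μ = ∫ x, UnitAddTorus.mFourier z x ∂ν) : μ = ν := by
  have h1 : integralC μ = integralC ν := by
    refine ContinuousLinearMap.ext_on (s := Set.range UnitAddTorus.mFourier) ?_ ?_
    · have := UnitAddTorus.span_mFourier_closure_eq_top (d := d)
      rw [dense_iff_closure_eq, ← Submodule.topologicalClosure_coe, this]
      rfl
    · rintro _ ⟨z, rfl⟩
      exact h z
  refine ext_of_forall_integral_eq_of_IsFiniteMeasure fun f => ?_
  let g : C(d → UnitAddCircle, ℂ) :=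
    ⟨fun x => (f x : ℂ), Complex.continuous_ofReal.comp f.continuous⟩
  have h2 : ∫ x, (f x : ℂ) ∂μ = ∫ x, (f x : ℂ) ∂ν := DFunLike.congr_fun h1 g
  have h3 := congrArg Complex.re h2
  rwa [integral_complex_ofReal, integral_complex_ofReal] at h3

theorem mFourier_add_apply (z : d → ℤ) (x y : d → UnitAddCircle) :
    UnitAddTorus.mFourier z (x + y) = UnitAddTorus.mFourier z x * UnitAddTorus.mFourier z y := by
  simp only [UnitAddTorus.mFourier, ContinuousMap.coe_mk, Pi.add_apply, ← Finset.prod_mul_distrib]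
  refine Finset.prod_congr rfl fun k _ => ?_
  simp only [fourier_apply, smul_add, AddCircle.toCircle_add, Circle.coe_mul]

theorem norm_mFourier_apply (z : d → ℤ) (x : d → UnitAddCircle) :
    ‖UnitAddTorus.mFourier z x‖ = 1 := by
  simp only [UnitAddTorus.mFourier, ContinuousMap.coe_mk, fourier_apply, norm_prod, Circle.norm_coe,
    Finset.prod_const_one]

theorem integral_mFourier_of_invariant (U : Measure (d → UnitAddCircle)) [IsProbabilityMeasure U]
    [U.IsAddLeftInvariant] (z : d → ℤ) :
    ∫ x, UnitAddTorus.mFourier z x ∂U = if z = 0 then 1 else 0 := by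
  classical
  split_ifs with hz
  · subst hz
    simp [UnitAddTorus.mFourier_zero]
  · obtain ⟨k, hk⟩ := Function.ne_iff.1 hz
    have hk' : (z k : ℝ) ≠ 0 := Int.cast_ne_zero.2 hk
    -- At this point the character has the value `-1`, so invariance makes the integral equal to its
    -- own negative.
    let y : d → UnitAddCircle := Pi.single k (((1 / 2 / (z k : ℝ) : ℝ)) : UnitAddCircle)
    have hy : UnitAddTorus.mFourier z y = -1 := by
      simp only [UnitAddTorus.mFourier, ContinuousMap.coe_mk]
      rw [Finset.prod_eq_single k]
      · simp only [y, Pi.single_eq_same]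
        rw [fourier_coe_apply]
        have : (2 * Real.pi * Complex.I * (z k : ℂ) * ((1 / 2 / (z k : ℝ) : ℝ) : ℂ) / ((1 : ℝ) : ℂ)) =
            Real.pi * Complex.I := by
          have h0 : (z k : ℂ) ≠ 0 := Int.cast_ne_zero.2 hk
          push_cast
          field_simp
        rw [this, Complex.exp_pi_mul_I]
      · intro b _ hb
        simp [y, hb]
      · simp
    have h1 := integral_add_left_eq_self (μ := U) (fun x => UnitAddTorus.mFourier z x) y
    simp only [mFourier_add_apply, hy, integral_const_mul] at h1
    have h2 : (2 : ℂ) * ∫ x, UnitAddTorus.mFourier z x ∂U = 0 := by linear_combination -h1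
    simpa using h2

theorem summable_norm_of_tsum_ne_zero_le {ι : Type} [Zero ι] {c : ι → ℂ} (h0 : c 0 = 1) {ε : ℝ}
    (hε : 0 ≤ ε) (h : ∑' z : {z : ι // z ≠ 0}, ‖c z‖ₑ ≤ ENNReal.ofReal ε) :
    (Summable fun z => ‖c z‖) ∧ ∑' z, ‖c z‖ ≤ 1 + ε := by
  have hsum : ∑' z, ‖c z‖ₑ ≤ ENNReal.ofReal (1 + ε) := by
    have h1 : ∑' z, ‖c z‖ₑ = ‖c 0‖ₑ + ∑' z : {z : ι // z ≠ 0}, ‖c z‖ₑ := by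
      classical
      rw [ENNReal.tsum_eq_add_tsum_ite 0]
      congr 1
      have h2 : ∑' z : {z : ι // z ≠ 0}, ‖c z‖ₑ = ∑' z, Set.indicator {z : ι | z ≠ 0}
          (fun z => ‖c z‖ₑ) z := tsum_subtype {z : ι | z ≠ 0} fun z => ‖c z‖ₑ
      rw [h2]
      refine tsum_congr fun z => ?_
      by_cases hz : z = 0 <;> simp [hz]
    rw [h1, h0, ENNReal.ofReal_add zero_le_one hε]
    exact add_le_add (by simp) h
  have hne : ∑' z, ‖c z‖ₑ ≠ ⊤ := ne_top_of_le_ne_top ENNReal.ofReal_ne_top hsum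
  have hs : Summable fun z => ‖c z‖ := by
    have := ENNReal.summable_toReal hne
    simpa only [toReal_enorm] using this
  refine ⟨hs, ?_⟩
  have h2 : ∑' z, ‖c z‖ = (∑' z, ‖c z‖ₑ).toReal := by
    rw [ENNReal.tsum_toReal_eq fun z => by simp]
    simp only [toReal_enorm]
  rw [h2]
  exact ENNReal.toReal_le_of_le_ofReal (by linarith) hsum

/-- A probability measure on the torus whose nontrivial Fourier coefficients have sum at most `ε` is
at most `1 + ε` times the uniform measure. -/
theorem le_smul_of_fourier_le (U ν : Measure (d → UnitAddCircle)) [IsProbabilityMeasure U]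
    [U.IsAddLeftInvariant] [IsProbabilityMeasure ν] {ε : ℝ}
    {c : (d → ℤ) → ℂ} (hc : ∀ z, c z = ∫ x, UnitAddTorus.mFourier z x ∂ν)
    (hs : Summable fun z => ‖c z‖) (hle : ∑' z, ‖c z‖ ≤ 1 + ε) (hε : 0 ≤ ε) :
    ν ≤ ENNReal.ofReal (1 + ε) • U := by
  have hcneg (z : d → ℤ) : c (-z) = star (c z) := by
    simp only [hc, UnitAddTorus.mFourier_neg]
    exact integral_conj
  -- The candidate density of `ν` is `∑ c_z e_{-z}`, uniformly convergent and bounded in absolute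
  -- value by `1 + ε`.
  let F (z : d → ℤ) : C(d → UnitAddCircle, ℂ) := c z • UnitAddTorus.mFourier (-z)
  have hF (z : d → ℤ) : ‖F z‖ = ‖c z‖ := by
    rw [norm_smul, UnitAddTorus.mFourier_norm, mul_one]
  have hFs : Summable F := Summable.of_norm (by simpa only [hF] using hs)
  set f : C(d → UnitAddCircle, ℂ) := ∑' z, F z with hf
  have hfx (x : d → UnitAddCircle) : f x = ∑' z, c z * UnitAddTorus.mFourier (-z) x :=
    (ContinuousMap.tsum_apply hFs x).symm
  have hfn (x : d → UnitAddCircle) : ‖f x‖ ≤ 1 + ε := by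
    refine (f.norm_coe_le_norm x).trans ((norm_tsum_le_tsum_norm ?_).trans ?_)
    · simpa only [hF] using hs
    · simpa only [hF] using hle
  have hfr (x : d → UnitAddCircle) : ((f x).re : ℂ) = f x := by
    refine Complex.conj_eq_iff_re.1 ?_
    rw [hfx, Complex.conj_tsum, ← (Equiv.neg (d → ℤ)).tsum_eq]
    refine tsum_congr fun z => ?_
    rw [Equiv.neg_apply, map_mul, hcneg, UnitAddTorus.mFourier_neg, UnitAddTorus.mFourier_neg]
    simp
  have hfint (w : d → ℤ) : ∫ x, UnitAddTorus.mFourier w x * f x ∂U = c w := by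
    have h1 : integralC U (UnitAddTorus.mFourier w * f) =
        ∑' z, integralC U (UnitAddTorus.mFourier w * F z) := by
      rw [hf, ← ContinuousLinearMap.map_tsum, hFs.tsum_mul_left]
      exact hFs.mul_left _
    have h2 (z : d → ℤ) : integralC U (UnitAddTorus.mFourier w * F z) = if z = w then c w else 0 := by
      have h3 : UnitAddTorus.mFourier w * F z = c z • UnitAddTorus.mFourier (w - z) := by
        ext x
        simp only [F, ContinuousMap.mul_apply, ContinuousMap.smul_apply, smul_eq_mul, sub_eq_add_neg,
          UnitAddTorus.mFourier_add]
        ring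
      rw [h3, map_smul, integralC_apply, integral_mFourier_of_invariant]
      by_cases hzw : z = w
      · simp [hzw]
      · rw [if_neg hzw, if_neg (sub_ne_zero.2 (Ne.symm hzw)), smul_zero]
    rw [← tsum_ite_eq w (fun _ => c w)]
    simp only [← h2]
    exact h1
  -- The nonnegative defect of the density. The identity `ν + g U = (1 + ε) U` is checked on Fourier
  -- coefficients, and the domination is then immediate.
  let g (x : d → UnitAddCircle) : ℝ := 1 + ε - (f x).re
  have hg0 (x : d → UnitAddCircle) : 0 ≤ g x := by
    have := (Complex.re_le_norm (f x)).trans (hfn x)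
    simp only [g]
    linarith
  have hgc : Continuous g := by
    have := f.continuous
    fun_prop
  have hgi : Integrable g U := by
    refine Integrable.of_bound hgc.aestronglyMeasurable (1 + ε + (1 + ε))
      (Filter.Eventually.of_forall fun x => ?_)
    have h1 := Complex.abs_re_le_norm (f x)
    have h2 := hfn x
    rw [Real.norm_eq_abs, abs_of_nonneg (hg0 x)]
    have := neg_abs_le (f x).re
    simp only [g]
    linarith
  have hgm : Measurable fun x => ENNReal.ofReal (g x) := (ENNReal.continuous_ofReal.comp hgc).measurable
  have hfin : IsFiniteMeasure (U.withDensity fun x => ENNReal.ofReal (g x)) :=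
    isFiniteMeasure_withDensity_ofReal hgi.2
  have hfin' : IsFiniteMeasure (ENNReal.ofReal (1 + ε) • U) := by
    exact Measure.smul_finite _ ENNReal.ofReal_ne_top
  have heq : ν + U.withDensity (fun x => ENNReal.ofReal (g x)) = ENNReal.ofReal (1 + ε) • U := by
    refine measure_eq_of_mFourier fun w => ?_
    rw [integral_add_measure (integrable_continuousMap _ _) (integrable_continuousMap _ _),
      integral_smul_measure, ENNReal.toReal_ofReal (by linarith),
      integral_withDensity_eq_integral_toReal_smul hgm (by simp)]
    have h1 (x : d → UnitAddCircle) : (ENNReal.ofReal (g x)).toReal • UnitAddTorus.mFourier w x =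
        ((1 + ε : ℝ) : ℂ) * UnitAddTorus.mFourier w x - UnitAddTorus.mFourier w x * f x := by
      rw [ENNReal.toReal_ofReal (hg0 x), Complex.real_smul]
      simp only [g]
      rw [Complex.ofReal_sub, hfr]
      ring
    simp only [h1]
    have h2 : Integrable (fun x => UnitAddTorus.mFourier w x * f x) U :=
      integrable_continuousMap U (UnitAddTorus.mFourier w * f)
    rw [integral_sub ((integrable_continuousMap _ _).const_mul _) h2, hfint, integral_const_mul,
      Complex.real_smul]
    rw [← hc]
    ring
  rw [← heq]
  exact Measure.le_add_right le_rfl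

end Torus

end MRLWE

end

noncomputable section

namespace MRLWE

/-! ### The Gaussian modulo `R^∨` -/

theorem integral_cexp_sphericalGaussian (E : Type) [NormedAddCommGroup E] [InnerProductSpace ℝ E]
    [FiniteDimensional ℝ E] [MeasurableSpace E] [BorelSpace E] {r : ℝ} (hr : 0 < r) (w : E) :
    ∫ v, Complex.exp (2 * Real.pi * Complex.I * (inner ℝ w v : ℝ)) ∂(sphericalGaussian E r) =
      ((Real.exp (-Real.pi * r ^ 2 * ‖w‖ ^ 2) : ℝ) : ℂ) := by
  have hm : Measurable fun x : E =>
      ENNReal.ofReal ((r ^ Module.finrank ℝ E)⁻¹ * Real.exp (-Real.pi * ‖x‖ ^ 2 / r ^ 2)) := by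
    fun_prop
  rw [sphericalGaussian, integral_withDensity_eq_integral_toReal_smul hm (by simp)]
  have hr0 : (r : ℂ) ≠ 0 := by exact_mod_cast hr.ne'
  have h1 (x : E) : (ENNReal.ofReal ((r ^ Module.finrank ℝ E)⁻¹ *
      Real.exp (-Real.pi * ‖x‖ ^ 2 / r ^ 2))).toReal •
      Complex.exp (2 * Real.pi * Complex.I * (inner ℝ w x : ℝ)) =
      ((r : ℂ) ^ Module.finrank ℝ E)⁻¹ * Complex.exp (-((Real.pi / r ^ 2 : ℝ) : ℂ) * ‖x‖ ^ 2 +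
        2 * Real.pi * Complex.I * (inner ℝ w x : ℝ)) := by
    rw [ENNReal.toReal_ofReal (by positivity), Complex.real_smul, Complex.exp_add]
    push_cast
    rw [mul_assoc]
    congr 3
    ring
  simp only [h1]
  rw [integral_const_mul, GaussianFourier.integral_cexp_neg_mul_sq_norm_add (by
    rw [Complex.ofReal_re]; positivity)]
  have h2 : ((Real.pi : ℂ) / ((Real.pi / r ^ 2 : ℝ) : ℂ)) ^ ((Module.finrank ℝ E : ℂ) / 2) =
      (r : ℂ) ^ Module.finrank ℝ E := by
    have h3 : (Real.pi : ℂ) / ((Real.pi / r ^ 2 : ℝ) : ℂ) = ((r ^ 2 : ℝ) : ℂ) := by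
      rw [← Complex.ofReal_div, div_div_cancel₀ Real.pi_ne_zero]
    have h4 : ((Module.finrank ℝ E : ℂ) / 2) = (((Module.finrank ℝ E : ℝ) / 2 : ℝ) : ℂ) := by
      push_cast; rfl
    rw [h3, h4, ← Complex.ofReal_cpow (by positivity), ← Complex.ofReal_pow]
    congr 1
    rw [← Real.rpow_natCast, ← Real.rpow_natCast, ← Real.rpow_mul hr.le]
    congr 1
    push_cast
    ring
  rw [h2, inv_mul_cancel_left₀ (pow_ne_zero _ hr0), Complex.ofReal_exp]
  congr 1
  have hpi : (Real.pi : ℂ) ≠ 0 := by exact_mod_cast Real.pi_ne_zero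
  push_cast
  field_simp
  rw [Complex.I_sq]
  ring

variable (P : Params)

/-- The law of the coordinates of the error. -/
def gaussT : Measure (Fin P.n → UnitAddCircle) :=
  (sphericalGaussian (H P) P.α).map fun x => coordT P (Torus.mk P x)

theorem measurable_coordT_mk : Measurable fun x => coordT P (Torus.mk P x) :=
  ((continuous_coordT P).comp (Torus.continuous_mk P)).measurable

instance : IsProbabilityMeasure (gaussT P) := by
  have := isProbabilityMeasure_sphericalGaussian (H P) P.α_pos
  exact Measure.isProbabilityMeasure_map (measurable_coordT_mk P).aemeasurable

theorem mFourier_coordT_mk (z : Fin P.n → ℤ) (x : H P) :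
    UnitAddTorus.mFourier z (coordT P (Torus.mk P x)) =
      Complex.exp (2 * Real.pi * Complex.I * (inner ℝ (freqVec P z) x : ℝ)) := by
  rw [inner_freqVec]
  simp only [UnitAddTorus.mFourier, ContinuousMap.coe_mk, coordT_mk_eq, fourier_coe_apply]
  rw [← Complex.exp_sum]
  congr 1
  push_cast
  rw [Finset.mul_sum]
  refine Finset.sum_congr rfl fun k _ => ?_
  ring

/-- Characters of the torus pull back to characters of `H` at dual lattice vectors, so the
coefficients of the wrapped Gaussian are values of its Fourier transform. -/
theorem integral_mFourier_gaussT (z : Fin P.n → ℤ) :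
    ∫ x, UnitAddTorus.mFourier z x ∂(gaussT P) =
      ((Real.exp (-Real.pi * P.α ^ 2 * ‖freqVec P z‖ ^ 2) : ℝ) : ℂ) := by
  rw [gaussT, integral_map (measurable_coordT_mk P).aemeasurable
    (UnitAddTorus.mFourier z).continuous.aestronglyMeasurable]
  simp only [mFourier_coordT_mk]
  exact integral_cexp_sphericalGaussian (H P) P.α_pos _

/-! ### Invariance under the automorphisms -/

theorem norm_freqVec_sq (z : Fin P.n → ℤ) :
    ‖freqVec P z‖ ^ 2 = ∑ j, ‖σ P j (∑ k, z k • eltK P k)‖ ^ 2 := by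
  rw [Submodule.coe_norm, EuclideanSpace.norm_sq_eq]
  refine Finset.sum_congr rfl fun j _ => ?_
  change ‖star (σ P j _)‖ ^ 2 = _
  rw [norm_star]

theorem exists_algEquiv_zetaK (a : Fin P.l) {u : ℕ} (hu : u.Coprime (P.m a)) :
    ∃ τ : CycField P a ≃ₐ[ℚ] CycField P a, τ (zetaK P a) = zetaK P a ^ u := by
  have hμ := (isPrimitiveRoot_zetaK P a).pow_of_coprime u hu
  refine ⟨IsCyclotomicExtension.fromZetaAut hμ (Polynomial.cyclotomic.irreducible_rat (P.m_pos a)),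
    ?_⟩
  exact IsCyclotomicExtension.fromZetaAut_spec hμ _

/-- Precomposition with the automorphisms `ζ_a ↦ ζ_a ^ u_a` permutes the embeddings factor by
factor. -/
theorem exists_perm_emb {u : Fin P.l → ℕ} (hu : ∀ a, (u a).Coprime (P.m a)) :
    ∃ e : Equiv.Perm (Emb P), ∀ j a, e j a (zetaK P a) = j a (zetaK P a) ^ u a := by
  choose τ hτ using fun a => exists_algEquiv_zetaK P a (hu a)
  refine ⟨Equiv.piCongrRight fun a =>
    { toFun := fun f => f.comp (τ a : CycField P a →ₐ[ℚ] CycField P a)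
      invFun := fun f => f.comp ((τ a).symm : CycField P a →ₐ[ℚ] CycField P a)
      left_inv := fun f => by ext x; simp
      right_inv := fun f => by ext x; simp }, fun j a => ?_⟩
  change j a (τ a (zetaK P a)) = _
  rw [hτ, map_pow]

/-- The action of an automorphism on frequencies. -/
def autFreq (i j : Fin P.n) (z : Fin P.n → ℤ) (k' : Fin P.n) : ℤ := ∑ k, z k * autT P i j k k'

/-- The squared norm is the sum of `|σ_j|²` over all embeddings, and the automorphism only permutes
these. -/
theorem norm_freqVec_autFreq (i j : Fin P.n) (z : Fin P.n → ℤ) :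
    ‖freqVec P (autFreq P i j z)‖ ^ 2 = ‖freqVec P z‖ ^ 2 := by
  obtain ⟨e, he⟩ := exists_perm_emb P (u := fun a =>
    unitAt (P.m a) (P.dig j a) * unitInv (P.m a) (P.dig i a)) fun a => by
      refine Nat.Coprime.mul_left (coprime_unitAt (P.m_pos a) _).symm ?_
      rw [← ZMod.isUnit_iff_coprime]
      exact IsUnit.of_mul_eq_one _ ((mul_comm _ _).trans (cast_unitAt_mul_unitInv (P.m_pos a) _))
  rw [norm_freqVec_sq, norm_freqVec_sq, ← Equiv.sum_comp e (fun j => ‖σ P j (∑ k, z k • eltK P k)‖ ^ 2)]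
  refine Finset.sum_congr rfl fun f _ => ?_
  congr 2
  have hρ (a : Fin P.l) : Polynomial.aeval (f a (zetaK P a)) (Polynomial.cyclotomic (P.m a) ℤ) = 0 :=
    aeval_cyclotomic (P.m_pos a) ((isPrimitiveRoot_zetaK P a).map_of_injective (f a).toRingHom.injective)
  simp only [autFreq, zsmul_eq_mul, map_sum, map_mul, map_intCast, σ_eltK, he, ← pow_mul,
    Int.cast_sum, Int.cast_mul, Finset.sum_mul]
  rw [Finset.sum_comm]
  refine Finset.sum_congr rfl fun k _ => ?_
  rw [← sum_autT P hρ i j k, Finset.mul_sum]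
  refine Finset.sum_congr rfl fun k' _ => ?_
  ring

theorem mFourier_eq_toCircle {d : Type} [Fintype d] (z : d → ℤ) (b : d → UnitAddCircle) :
    UnitAddTorus.mFourier z b = (AddCircle.toCircle (∑ k, z k • b k) : ℂ) := by
  have h (s : Finset d) : ∏ k ∈ s, fourier (z k) (b k) =
      (AddCircle.toCircle (∑ k ∈ s, z k • b k) : ℂ) := by
    classical
    induction s using Finset.induction_on with
    | empty => simp
    | insert a s ha ih =>
      rw [Finset.prod_insert ha, Finset.sum_insert ha, ih, AddCircle.toCircle_add, Circle.coe_mul,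
        fourier_apply]
  exact h Finset.univ

theorem mFourier_autTorus (i j : Fin P.n) (z : Fin P.n → ℤ) (b : Fin P.n → UnitAddCircle) :
    UnitAddTorus.mFourier z (autTorus P i j b) = UnitAddTorus.mFourier (autFreq P i j z) b := by
  rw [mFourier_eq_toCircle, mFourier_eq_toCircle]
  congr 2
  simp only [autTorus, autFreq, Finset.smul_sum, Finset.sum_smul, mul_smul]
  exact Finset.sum_comm

theorem continuous_autTorus (i j : Fin P.n) : Continuous (autTorus P i j) :=
  continuous_pi fun _ => continuous_finsetSum _ fun k' _ => (continuous_apply k').zsmul _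

/-- Both laws have the same Fourier coefficients, since the coefficients of the spherical error
depend only on norms of frequencies. Thus automorphisms leave `D_α` modulo `R^∨` exactly unchanged.
-/
theorem map_autTorus_gaussT (i j : Fin P.n) : (gaussT P).map (autTorus P i j) = gaussT P := by
  have hm := (continuous_autTorus P i j).measurable
  have : IsProbabilityMeasure ((gaussT P).map (autTorus P i j)) :=
    Measure.isProbabilityMeasure_map hm.aemeasurable
  refine measure_eq_of_mFourier fun z => ?_
  rw [integral_map hm.aemeasurable (UnitAddTorus.mFourier z).continuous.aestronglyMeasurable]
  simp only [mFourier_autTorus, integral_mFourier_gaussT, norm_freqVec_autFreq]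

/-! ### Smoothing -/

theorem map_uniformOn_of_bijective {X Y : Type} [Finite X] [Finite Y] [MeasurableSpace X]
    [MeasurableSpace Y] [DiscreteMeasurableSpace X] [DiscreteMeasurableSpace Y] {f : X → Y}
    (hf : Function.Bijective f) :
    (uniformOn (Set.univ : Set X)).map f = uniformOn (Set.univ : Set Y) := by
  have := Fintype.ofFinite X
  have := Fintype.ofFinite Y
  refine Measure.ext_of_singleton fun y => ?_
  obtain ⟨x, rfl⟩ := hf.2 y
  rw [Measure.map_apply (measurable_of_countable f) (MeasurableSet.singleton _),
    Set.preimage_eq_iff_eq_image hf |>.2 (Set.image_singleton.symm), uniformOn_univ, uniformOn_univ,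
    Fintype.card_of_bijective hf]
  simp

/-- If `q` does not divide `z_k`, a translation by the `k`-th unit vector multiplies the integral by
a number different from `1` and also preserves it. -/
theorem integral_mFourier_embT_eq_zero {z : Fin P.n → ℤ} (hz : ¬ ∀ k, (P.q : ℤ) ∣ z k) :
    ∫ v, UnitAddTorus.mFourier z (embT P v) ∂(uniformOn (Set.univ : Set (Fin P.n → ZMod P.q))) =
      0 := by
  push Not at hz
  obtain ⟨k, hk⟩ := hz
  set u : Fin P.n → ZMod P.q := Pi.single k 1
  have hadd (v w : Fin P.n → ZMod P.q) : embT P (v + w) = embT P v + embT P w :=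
    funext fun k => map_add ZMod.toAddCircle _ _
  have h1 : ∫ v, UnitAddTorus.mFourier z (embT P v)
        ∂(uniformOn (Set.univ : Set (Fin P.n → ZMod P.q))) =
      UnitAddTorus.mFourier z (embT P u) * ∫ v, UnitAddTorus.mFourier z (embT P v)
        ∂(uniformOn (Set.univ : Set (Fin P.n → ZMod P.q))) := by
    conv_lhs => rw [← map_uniformOn_of_bijective (Equiv.addLeft u).bijective]
    rw [integral_map (measurable_of_countable _).aemeasurable
      (measurable_of_countable _).aestronglyMeasurable, ← integral_const_mul]
    simp only [Equiv.coe_addLeft, hadd, mFourier_add_apply]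
  have h2 : UnitAddTorus.mFourier z (embT P u) ≠ 1 := by
    rw [mFourier_eq_toCircle, Finset.sum_eq_single k]
    · have h3 : embT P u k = ((((1 : ℤ) / (P.q : ℝ) : ℝ)) : UnitAddCircle) := by
        simp only [embT, u, Pi.single_eq_same]
        rw [← ZMod.toAddCircle_intCast]
        simp
      rw [Ne, Circle.coe_eq_one, ← AddCircle.toCircle_zero, (AddCircle.injective_toCircle one_ne_zero).eq_iff,
        h3, ← AddCircle.coe_zsmul, AddCircle.coe_eq_zero_iff]
      rintro ⟨w, hw⟩
      refine hk ⟨w, ?_⟩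
      have hq : (P.q : ℝ) ≠ 0 := Nat.cast_ne_zero.2 (NeZero.ne P.q)
      simp only [zsmul_eq_mul, mul_one, Int.cast_one] at hw
      field_simp at hw
      have : (w * P.q : ℝ) = z k := hw
      exact_mod_cast (this.symm.trans (mul_comm _ _))
    · intro b _ hb
      simp [embT, u, hb]
    · simp
  have h4 : (UnitAddTorus.mFourier z (embT P u) - 1) * ∫ v, UnitAddTorus.mFourier z (embT P v)
        ∂(uniformOn (Set.univ : Set (Fin P.n → ZMod P.q))) = 0 := by linear_combination -h1
  exact (mul_eq_zero.1 h4).resolve_left (sub_ne_zero.2 h2)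

/-- The law of the error plus a uniform element of `q⁻¹R^∨ / R^∨`. -/
def smoothT : Measure (Fin P.n → UnitAddCircle) :=
  ((uniformOn (Set.univ : Set (Fin P.n → ZMod P.q))).prod (gaussT P)).map fun p => embT P p.1 + p.2

theorem measurable_embT_add : Measurable fun p : (Fin P.n → ZMod P.q) × (Fin P.n → UnitAddCircle) =>
    embT P p.1 + p.2 :=
  ((measurable_of_countable (embT P)).comp measurable_fst).add measurable_snd

instance : IsProbabilityMeasure (smoothT P) :=
  Measure.isProbabilityMeasure_map (measurable_embT_add P).aemeasurable

theorem integral_mFourier_smoothT (z : Fin P.n → ℤ) :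
    ∫ x, UnitAddTorus.mFourier z x ∂(smoothT P) =
      (∫ v, UnitAddTorus.mFourier z (embT P v)
        ∂(uniformOn (Set.univ : Set (Fin P.n → ZMod P.q)))) *
      ((Real.exp (-Real.pi * P.α ^ 2 * ‖freqVec P z‖ ^ 2) : ℝ) : ℂ) := by
  rw [smoothT, integral_map (measurable_embT_add P).aemeasurable
    (UnitAddTorus.mFourier z).continuous.aestronglyMeasurable]
  simp only [mFourier_add_apply]
  rw [integral_prod_mul (fun v => UnitAddTorus.mFourier z (embT P v))
    (fun x => UnitAddTorus.mFourier z x), integral_mFourier_gaussT]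

/-- The coefficients live on frequencies `q w`, and substituting these turns the width `α` into `α
q`. This is where the hypothesis on the smoothing parameter enters. -/
theorem tsum_smoothT_le {ε : ℝ} (hε : 0 < ε) (h : smoothingDual P ε ≤ P.α * P.q) :
    ∑' z : {z : Fin P.n → ℤ // z ≠ 0}, ‖∫ x, UnitAddTorus.mFourier (z : Fin P.n → ℤ) x ∂(smoothT P)‖ₑ ≤
      ENNReal.ofReal ε := by
  refine le_trans ?_ (tsum_freqVec_le P hε h)
  let f (z : {z : Fin P.n → ℤ // z ≠ 0}) : {z : Fin P.n → ℤ // z ≠ 0} :=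
    ⟨(P.q : ℤ) • (z : Fin P.n → ℤ), smul_ne_zero (by exact_mod_cast NeZero.ne P.q) z.2⟩
  have hf : Function.Injective f := fun z z' hz => Subtype.ext
    (smul_right_injective _ (by exact_mod_cast NeZero.ne P.q) (congrArg Subtype.val hz))
  rw [← hf.tsum_eq (f := fun z : {z : Fin P.n → ℤ // z ≠ 0} =>
    ‖∫ x, UnitAddTorus.mFourier (z : Fin P.n → ℤ) x ∂(smoothT P)‖ₑ)]
  · refine ENNReal.tsum_le_tsum fun z => ?_
    rw [integral_mFourier_smoothT, ← ofReal_norm, norm_mul, Complex.norm_real, Real.norm_eq_abs,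
      abs_of_pos (Real.exp_pos _)]
    refine ENNReal.ofReal_le_ofReal ?_
    have h1 : ‖∫ v, UnitAddTorus.mFourier (f z : Fin P.n → ℤ) (embT P v)
        ∂(uniformOn (Set.univ : Set (Fin P.n → ZMod P.q)))‖ ≤ 1 := by
      refine (norm_integral_le_of_norm_le_const (C := 1)
        (Filter.Eventually.of_forall fun v => (norm_mFourier_apply _ _).le)).trans ?_
      simp
    have h2 : ‖freqVec P (f z)‖ ^ 2 = (P.q : ℝ) ^ 2 * ‖freqVec P z‖ ^ 2 := by
      rw [norm_freqVec_sq, norm_freqVec_sq, Finset.mul_sum]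
      refine Finset.sum_congr rfl fun j _ => ?_
      have h3 : ∑ k, (f z : Fin P.n → ℤ) k • eltK P k =
          (P.q : ℤ) • ∑ k, (z : Fin P.n → ℤ) k • eltK P k := by
        simp only [f, Finset.smul_sum, Pi.smul_apply, smul_eq_mul, mul_smul]
      rw [h3, map_zsmul, zsmul_eq_mul, norm_mul, mul_pow]
      simp [-Nat.cast_prod]
    rw [h2]
    calc _ ≤ 1 * Real.exp (-Real.pi * P.α ^ 2 * (P.q ^ 2 * ‖freqVec P z‖ ^ 2)) := by gcongr
      _ = _ := by
        rw [one_mul]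
        congr 1
        ring
  · intro z hz
    rw [Function.mem_support] at hz
    by_contra hr
    refine hz ?_
    rw [integral_mFourier_smoothT, integral_mFourier_embT_eq_zero, zero_mul, enorm_zero]
    intro hd
    choose w hw using hd
    refine hr ⟨⟨w, fun h0 => z.2 (funext fun k => ?_)⟩, Subtype.ext (funext fun k => ?_)⟩
    · rw [hw, h0]
      simp
    · exact (hw k).symm

/-- The uniform law in coordinates. -/
def unifT : Measure (Fin P.n → UnitAddCircle) :=
  ((Measure.addHaar : Measure (Torus P))[|Set.univ]).map (coordT P)

instance : IsProbabilityMeasure ((Measure.addHaar : Measure (Torus P))[|Set.univ]) :=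
  cond_isProbabilityMeasure (by
    rw [Ne, Measure.measure_univ_eq_zero]
    exact NeZero.ne _)

instance : IsProbabilityMeasure (unifT P) :=
  Measure.isProbabilityMeasure_map (continuous_coordT P).measurable.aemeasurable

instance : ((Measure.addHaar : Measure (Torus P))[|Set.univ]).IsAddLeftInvariant := by
  rw [ProbabilityTheory.cond, Measure.restrict_univ]
  infer_instance

instance : (unifT P).IsAddLeftInvariant :=
  isAddLeftInvariant_map (μ := (Measure.addHaar : Measure (Torus P))[|Set.univ])
    (AddMonoidHom.toAddHom (coordT P)) (continuous_coordT P).measurable (coordT_surjective P)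

theorem smoothT_le {ε : ℝ} (hε : 0 < ε) (h : smoothingDual P ε ≤ P.α * P.q) :
    smoothT P ≤ ENNReal.ofReal (1 + ε) • unifT P := by
  have h0 : ∫ x, UnitAddTorus.mFourier (0 : Fin P.n → ℤ) x ∂(smoothT P) = 1 := by
    simp [UnitAddTorus.mFourier_zero]
  obtain ⟨h1, h2⟩ := summable_norm_of_tsum_ne_zero_le
    (c := fun z => ∫ x, UnitAddTorus.mFourier z x ∂(smoothT P)) h0 hε.le (tsum_smoothT_le P hε h)
  exact le_smul_of_fourier_le (unifT P) (smoothT P) (fun z => rfl) h1 h2 hε.le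

end MRLWE

end

/-! ### Hybrid laws and the exact law of transformed samples. -/

noncomputable section

namespace MRLWE

/-! ### Generalities on product measures -/

theorem uniformOn_prod_uniformOn (X Y : Type) [Finite X] [Finite Y] [Nonempty X] [Nonempty Y]
    [MeasurableSpace X]
    [MeasurableSpace Y] [DiscreteMeasurableSpace X] [DiscreteMeasurableSpace Y] :
    (uniformOn (Set.univ : Set X)).prod (uniformOn (Set.univ : Set Y)) =
      uniformOn (Set.univ : Set (X × Y)) := by
  have := Fintype.ofFinite X
  have := Fintype.ofFinite Y
  refine Measure.ext_of_singleton fun p => ?_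
  obtain ⟨x, y⟩ := p
  rw [← Set.singleton_prod_singleton, Measure.prod_prod, uniformOn_univ, uniformOn_univ, uniformOn_univ,
    Set.singleton_prod_singleton, Measure.count_singleton, Measure.count_singleton,
    Measure.count_singleton, Fintype.card_prod, Nat.cast_mul, one_div, one_div, one_div,
    ENNReal.mul_inv (by simp) (by simp)]

theorem map_prod_rotate {X Y Z : Type} [MeasurableSpace X] [MeasurableSpace Y] [MeasurableSpace Z]
    (μ : Measure X) (ν : Measure Y) (γ : Measure Z) [SFinite μ] [SFinite ν] [SFinite γ] :
    ((μ.prod ν).prod γ).map (fun p => ((p.1.1, p.2), p.1.2)) = (μ.prod γ).prod ν := by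
  have h1 := (measurePreserving_prodAssoc μ ν γ)
  have h2 : MeasurePreserving (Prod.map id Prod.swap) (μ.prod (ν.prod γ)) (μ.prod (γ.prod ν)) :=
    (MeasurePreserving.id μ).prod Measure.measurePreserving_swap
  have h3 := (measurePreserving_prodAssoc μ γ ν).symm
  exact (h3.comp (h2.comp h1)).map_eq

theorem pi_le_smul_pi {X : Type} [MeasurableSpace X] {μ ν : Measure X} [IsProbabilityMeasure μ]
    [IsProbabilityMeasure ν] {c : ℝ≥0∞} (h : ν ≤ c • μ) (hc : c ≠ ⊤) (L : ℕ) :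
    Measure.pi (fun _ : Fin L => ν) ≤ c ^ L • Measure.pi (fun _ : Fin L => μ) := by
  induction L with
  | zero =>
    rw [pow_zero, one_smul, Measure.pi_of_empty, Measure.pi_of_empty]
  | succ L ih =>
    have h1 (μ : Measure X) [IsProbabilityMeasure μ] : Measure.pi (fun _ : Fin (L + 1) => μ) =
        (μ.prod (Measure.pi fun _ : Fin L => μ)).map
          (MeasurableEquiv.piFinSuccAbove (fun _ => X) 0).symm :=
      (measurePreserving_piFinSuccAbove (fun _ : Fin (L + 1) => μ) 0).symm.map_eq.symm
    have hfin : IsFiniteMeasure (c ^ L • Measure.pi fun _ : Fin L => μ) :=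
      Measure.smul_finite _ (ENNReal.pow_ne_top hc)
    have h2 : (c • μ).prod (c ^ L • Measure.pi fun _ : Fin L => μ) =
        c ^ (L + 1) • μ.prod (Measure.pi fun _ : Fin L => μ) := by
      rw [Measure.prod_smul_left, Measure.prod_smul_right, smul_smul, pow_succ, mul_comm]
    rw [h1 ν, h1 μ, ← Measure.map_smul, ← h2]
    exact Measure.map_mono (Measure.prod_mono h ih) (MeasurableEquiv.measurable _)

variable (P : Params)

/-! ### The laws of samples in coordinates -/

/-- The uniform law on vectors modulo `q`. -/
abbrev unifV : Measure (Fin P.n → ZMod P.q) := uniformOn Set.univ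

/-- A sample in coordinates as a function of its first component and of the error. -/
def lweFun (s : Fin P.n → ZMod P.q) (p : (Fin P.n → ZMod P.q) × (Fin P.n → UnitAddCircle)) :
    Sample P :=
  (p.1, embT P (combV P fun j => evalV P p.1 j * s j) + p.2)

/-- The law of samples in coordinates, where the components of the secret are `s`. -/
def lweCoord (s : Fin P.n → ZMod P.q) : Measure (Sample P) :=
  ((unifV P).prod (gaussT P)).map (lweFun P s)

/-- A hybrid sample as a function of its first component, of the mask and of the error. -/
def hybridFun (m : ℕ) (s : Fin P.n → ZMod P.q)
    (p : ((Fin P.n → ZMod P.q) × (Fin P.n → ZMod P.q)) × (Fin P.n → UnitAddCircle)) : Sample P :=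
  (p.1.1, embT P (combV P fun j => evalV P p.1.1 j * s j + if (j : ℕ) < m then p.1.2 j else 0) + p.2)

/-- The hybrid laws: the first `m` components of the product are replaced by uniform ones. -/
def hybrid (m : ℕ) (s : Fin P.n → ZMod P.q) : Measure (Sample P) :=
  (((unifV P).prod (unifV P)).prod (gaussT P)).map (hybridFun P m s)

theorem measurable_prodMk_add {X : Type} [Countable X] [MeasurableSpace X]
    [DiscreteMeasurableSpace X] (g : X → Fin P.n → ZMod P.q) (f : X → Fin P.n → UnitAddCircle) :
    Measurable fun p : X × (Fin P.n → UnitAddCircle) => ((g p.1, f p.1 + p.2) : Sample P) :=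
  ((measurable_of_countable g).comp measurable_fst).prodMk
    (((measurable_of_countable f).comp measurable_fst).add measurable_snd)

theorem measurable_lweFun (s : Fin P.n → ZMod P.q) : Measurable (lweFun P s) :=
  measurable_prodMk_add P (fun a => a) fun a => embT P (combV P fun j => evalV P a j * s j)

theorem measurable_hybridFun (m : ℕ) (s : Fin P.n → ZMod P.q) : Measurable (hybridFun P m s) :=
  measurable_prodMk_add P (X := (Fin P.n → ZMod P.q) × (Fin P.n → ZMod P.q)) Prod.fst
    fun p => embT P (combV P fun j => evalV P p.1 j * s j + if (j : ℕ) < m then p.2 j else 0)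

instance (m : ℕ) (s : Fin P.n → ZMod P.q) : IsProbabilityMeasure (hybrid P m s) :=
  Measure.isProbabilityMeasure_map (measurable_hybridFun P m s).aemeasurable

theorem measurable_coord : Measurable (coord P) :=
  ((measurable_of_countable (coordRq P)).comp measurable_fst).prodMk
    ((continuous_coordT P).measurable.comp measurable_snd)

theorem map_coordRq : (uniformOn (Set.univ : Set (Rq P))).map (coordRq P) = unifV P :=
  map_uniformOn_of_bijective ⟨coordRq_injective P, coordRq_surjective P⟩

theorem map_coord_unifLaw : (unifLaw P).map (coord P) = (unifV P).prod (unifT P) := by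
  rw [← map_coordRq, unifT, Measure.map_prod_map _ _ (measurable_of_countable _)
    (continuous_coordT P).measurable]
  rfl

theorem map_coord_lweLaw [Fact P.q.Prime] (hmod : ∀ i, P.q ≡ 1 [MOD P.m i]) (s : RqDual P) :
    (lweLaw P s).map (coord P) = lweCoord P (secretEquiv P hmod s) := by
  have := isProbabilityMeasure_sphericalGaussian (H P) P.α_pos
  have hm : Measurable fun p : Rq P × H P => (p.1, divQ P (p.1 • s) + Torus.mk P p.2) := by
    refine measurable_fst.prodMk (measurable_from_prod_countable_right fun a => ?_)
    have h : Continuous fun y : H P => divQ P (a • s) + Torus.mk P y :=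
      continuous_const.add (Torus.continuous_mk P)
    exact h.measurable
  rw [lweCoord, gaussT, ← map_coordRq, Measure.map_prod_map _ _ (measurable_of_countable _)
    (measurable_coordT_mk P), Measure.map_map (measurable_lweFun P _)
    ((measurable_of_countable _).prodMap (measurable_coordT_mk P)), lweLaw, mRLWE,
    Measure.map_map (measurable_coord P) hm]
  congr 1
  funext p
  simp only [Function.comp_apply, coord, lweFun, map_add, coordT_divQ P hmod]
  rfl

theorem hybrid_zero (s : Fin P.n → ZMod P.q) : hybrid P 0 s = lweCoord P s := by
  have h := congrArg (Measure.map Prod.fst) (map_prod_rotate (unifV P) (unifV P) (gaussT P))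
  rw [Measure.map_fst_prod, measure_univ, one_smul, Measure.map_map measurable_fst (by fun_prop)] at h
  rw [lweCoord, ← h, Measure.map_map (measurable_lweFun P _) (by fun_prop), hybrid]
  congr 1
  funext p
  simp [hybridFun, lweFun, Function.comp_def]

/-- With every component masked, `(a, h) ↦ (a, ∑ (χ_j(a) s_j + h_j) χ_j)` is a bijection of a finite
set, so the second entry is uniform and independent of `a`. -/
theorem hybrid_top [Fact P.q.Prime] (hmod : ∀ i, P.q ≡ 1 [MOD P.m i]) (s : Fin P.n → ZMod P.q) :
    hybrid P P.n s = (unifV P).prod (smoothT P) := by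
  let Φ (p : (Fin P.n → ZMod P.q) × (Fin P.n → ZMod P.q)) :
      (Fin P.n → ZMod P.q) × (Fin P.n → ZMod P.q) :=
    (p.1, combV P fun j => evalV P p.1 j * s j + p.2 j)
  have hΦ : Function.Bijective Φ := by
    rw [← Finite.injective_iff_bijective]
    rintro ⟨a, h⟩ ⟨a', h'⟩ hp
    obtain ⟨rfl, h2⟩ := Prod.ext_iff.1 hp
    refine Prod.ext rfl (funext fun j => ?_)
    exact add_left_cancel (congrFun ((combV_bijective P hmod).1 h2) j)
  have h1 : ((unifV P).prod (unifV P)).map Φ = (unifV P).prod (unifV P) := by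
    rw [uniformOn_prod_uniformOn]
    exact map_uniformOn_of_bijective hΦ
  have h2 : (((unifV P).prod (unifV P)).prod (gaussT P)).map (Prod.map Φ id) =
      ((unifV P).prod (unifV P)).prod (gaussT P) := by
    rw [← Measure.map_prod_map _ _ (measurable_of_countable _) measurable_id, h1, Measure.map_id]
  have h3 := (measurePreserving_prodAssoc (unifV P) (unifV P) (gaussT P)).map_eq
  have h4 : (unifV P).prod (smoothT P) = (((unifV P).prod (unifV P)).prod (gaussT P)).map
      fun p => (p.1.1, embT P p.1.2 + p.2) := by
    conv_lhs => rw [← Measure.map_id (μ := unifV P)]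
    rw [smoothT, Measure.map_prod_map _ _ measurable_id (measurable_embT_add P), ← h3,
      Measure.map_map (measurable_id.prodMap (measurable_embT_add P)) (MeasurableEquiv.measurable _)]
    rfl
  have hm : Measurable fun p : ((Fin P.n → ZMod P.q) × (Fin P.n → ZMod P.q)) ×
      (Fin P.n → UnitAddCircle) => ((p.1.1, embT P p.1.2 + p.2) : Sample P) :=
    measurable_prodMk_add P Prod.fst fun p => embT P p.2
  rw [h4]
  conv_rhs => rw [← h2]
  rw [Measure.map_map hm ((measurable_of_countable _).prodMap measurable_id), hybrid]
  congr 1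
  funext p
  simp [Φ, hybridFun]

theorem hybrid_top_le [Fact P.q.Prime] (hmod : ∀ i, P.q ≡ 1 [MOD P.m i]) {ε : ℝ} (hε : 0 < ε)
    (h : smoothingDual P ε ≤ P.α * P.q) (s : Fin P.n → ZMod P.q) :
    hybrid P P.n s ≤ ENNReal.ofReal (1 + ε) • (unifV P).prod (unifT P) := by
  have hfin : IsFiniteMeasure (ENNReal.ofReal (1 + ε) • unifT P) :=
    Measure.smul_finite _ ENNReal.ofReal_ne_top
  rw [hybrid_top P hmod, ← Measure.prod_smul_right]
  exact Measure.prod_mono le_rfl (smoothT_le P hε h)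

/-! ### The law of transformed samples -/

theorem evalV_transformA [Fact P.q.Prime] (hmod : ∀ i, P.q ≡ 1 [MOD P.m i]) (i j : Fin P.n) (md : ℕ)
    (a h : Fin P.n → ZMod P.q) (b : Fin P.n) :
    evalV P (transformA P i j md a h) b =
      evalV P a (crtPerm P i j b) + if b = i then (1 - md) * h i * crtC P else 0 := by
  have h1 : evalV P (transformA P i j md a h) b =
      evalV P (fun k => ∑ k', a k' * autT P i j k' k) b +
        (1 - md) * h i * ∑ k, crtV P b k * crtW P i k := by
    simp only [evalV, transformA, mul_add, Finset.sum_add_distrib, Finset.mul_sum]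
    congr 1
    refine Finset.sum_congr rfl fun k _ => ?_
    ring
  rw [h1, evalV_transform P hmod, sum_crtV_mul_crtW P hmod, mul_ite, mul_zero]

/-- The coefficient of the `i`-th mask in a transformed sample. -/
def maskCoeff (g sj : ZMod P.q) (md : ℕ) : ZMod P.q := guess P g md - (1 - md) * crtC P * sj

/-- Component `i` is rewritten in terms of the new first entry. The idempotent has added `C h_i`
there, which should have contributed `C h_i s_j` but contributed the guess instead; `maskCoeff` is
the difference. -/
theorem transform_eq [Fact P.q.Prime] (hmod : ∀ i, P.q ≡ 1 [MOD P.m i]) (i j : Fin P.n)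
    (g : ZMod P.q) (md : ℕ) (t s a h : Fin P.n → ZMod P.q) (e : Fin P.n → UnitAddCircle) :
    transform P i j g md t (a, embT P (combV P fun b => evalV P a b * s b) + e) h =
      (transformA P i j md a h, embT P (combV P fun b =>
        evalV P (transformA P i j md a h) b * (s (crtPerm P i j b) + t b) +
          ((if b < i then h b else 0) + if b = i then maskCoeff P g (s j) md * h b else 0)) +
        autTorus P j i e) := by
  rw [transform]
  refine Prod.ext rfl ?_
  simp only
  rw [autTorus_add, autTorus_embT P hmod, ← add_assoc]
  congr 1
  have hadd (v w : Fin P.n → ZMod P.q) : embT P (combV P v) + embT P (combV P w) =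
      embT P (combV P (v + w)) := by
    funext k
    simp only [embT, Pi.add_apply, ← map_add]
    congr 1
    simp only [combV, Pi.add_apply, add_mul, Finset.sum_add_distrib]
  rw [hadd]
  congr 2
  funext b
  simp only [Pi.add_apply, transformW]
  have h1 := evalV_transformA P hmod i j md a h b
  by_cases hb : b = i
  · subst hb
    rw [if_pos rfl] at h1
    simp only [if_true, lt_irrefl, if_false]
    have h2 : evalV P a (crtPerm P b j b) = evalV P (transformA P b j md a h) b -
      (1 - md) * h b * crtC P := by rw [h1]; ring
    rw [h2, crtPerm_self, maskCoeff]
    ring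
  · rw [if_neg hb, add_zero] at h1
    rw [if_neg hb, if_neg hb, h1]
    ring

/-- For fixed `h` the new `a` is an automorphic image of the old one plus a constant, hence uniform,
and the error law is invariant. A nonzero mask coefficient is invertible as `q` is prime, so the
`i`-th mask is then fully uniform; otherwise it disappears. -/
theorem map_transform [Fact P.q.Prime] (hmod : ∀ i, P.q ≡ 1 [MOD P.m i]) (i j : Fin P.n)
    (g : ZMod P.q) (md : ℕ) (t s : Fin P.n → ZMod P.q) :
    ((lweCoord P s).prod (unifV P)).map (fun p => transform P i j g md t p.1 p.2) =
      hybrid P (if maskCoeff P g (s j) md = 0 then i else i + 1)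
        (fun b => s (crtPerm P i j b) + t b) := by
  set μ := maskCoeff P g (s j) md with hμ
  -- If the coefficient vanishes, `h_i` is kept as it is to preserve bijectivity; hybrid `i` does
  -- not use it.
  let Φ (p : (Fin P.n → ZMod P.q) × (Fin P.n → ZMod P.q)) :
      (Fin P.n → ZMod P.q) × (Fin P.n → ZMod P.q) :=
    (transformA P i j md p.1 p.2, fun b => if b = i ∧ μ ≠ 0 then μ * p.2 b else p.2 b)
  have hΦ : Function.Bijective Φ := by
    rw [← Finite.injective_iff_bijective]
    rintro ⟨a, h⟩ ⟨a', h'⟩ hp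
    obtain ⟨h1, h2⟩ := Prod.ext_iff.1 hp
    have hh : h = h' := by
      funext b
      have h3 := congrFun h2 b
      simp only [Φ] at h3
      split_ifs at h3 with hc
      · exact mul_left_cancel₀ hc.2 h3
      · exact h3
    subst hh
    refine Prod.ext ((evalV_bijective P hmod).1 (funext fun b => ?_)) rfl
    have h4 := congrArg (fun v => evalV P v ((crtPerm P i j).symm b)) h1
    simp only [Φ, evalV_transformA P hmod, Equiv.apply_symm_apply] at h4
    exact add_right_cancel h4
  have h1 : ((unifV P).prod (unifV P)).map Φ = (unifV P).prod (unifV P) := by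
    rw [uniformOn_prod_uniformOn]
    exact map_uniformOn_of_bijective hΦ
  have hA := (continuous_autTorus P j i).measurable
  have h2 : (((unifV P).prod (unifV P)).prod (gaussT P)).map (Prod.map Φ (autTorus P j i)) =
      ((unifV P).prod (unifV P)).prod (gaussT P) := by
    rw [← Measure.map_prod_map _ _ (measurable_of_countable _) hA, h1, map_autTorus_gaussT]
  have hT : Measurable fun p : Sample P × (Fin P.n → ZMod P.q) => transform P i j g md t p.1 p.2 := by
    have hd : Measurable fun p : Sample P × (Fin P.n → ZMod P.q) =>
      transformA P i j md p.1.1 p.2 := (measurable_of_countable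
        fun p : (Fin P.n → ZMod P.q) × (Fin P.n → ZMod P.q) => transformA P i j md p.1 p.2).comp
        ((measurable_fst.comp measurable_fst).prodMk measurable_snd)
    refine hd.prodMk (Measurable.add ((measurable_of_countable
        fun p : (Fin P.n → ZMod P.q) × (Fin P.n → ZMod P.q) => embT P (combV P
          (transformW P i (guess P g md) t p.1 p.2))).comp (hd.prodMk measurable_snd))
      (hA.comp (measurable_snd.comp measurable_fst)))
  have hr : Measurable fun p : ((Fin P.n → ZMod P.q) × (Fin P.n → ZMod P.q)) ×
      (Fin P.n → UnitAddCircle) => ((p.1.1, p.2), p.1.2) := by fun_prop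
  have h3 : (lweCoord P s).prod (unifV P) = (((unifV P).prod (unifV P)).prod (gaussT P)).map
      (Prod.map (lweFun P s) id ∘ fun p => ((p.1.1, p.2), p.1.2)) := by
    rw [← Measure.map_map ((measurable_lweFun P s).prodMap measurable_id) hr, map_prod_rotate,
      ← Measure.map_prod_map _ _ (measurable_lweFun P s) measurable_id, Measure.map_id, lweCoord]
  rw [h3, Measure.map_map hT (((measurable_lweFun P s).prodMap measurable_id).comp hr), hybrid]
  conv_rhs => rw [← h2]
  rw [Measure.map_map (measurable_hybridFun P _ _) ((measurable_of_countable _).prodMap hA)]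
  congr 1
  funext p
  simp only [Function.comp_apply, Prod.map_apply, Φ, lweFun, hybridFun, id]
  rw [transform_eq P hmod]
  refine Prod.ext rfl ?_
  simp only
  congr 3
  funext b
  congr 1
  rw [← hμ]
  by_cases h0 : μ = 0
  · simp [h0]
  · rcases lt_trichotomy b i with hb | hb | hb
    · have : (b : ℕ) < i := hb
      simp [h0, hb, hb.ne, this.trans (Nat.lt_succ_self _)]
    · simp [h0, hb]
    · have : ¬ (b : ℕ) < i + 1 := by
        have : (i : ℕ) < b := hb
        omega
      simp [h0, hb.not_gt, hb.ne', this]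

end MRLWE

end

/-! ### Independence of oracle calls and concentration of the scores. -/

noncomputable section

namespace MRLWE

/-! ### Independence -/

theorem map_infinitePi_comp {X ι : Type} [MeasurableSpace X] [Fintype ι] (μ : Measure X)
    [IsProbabilityMeasure μ] {e : ι → ℕ} (he : Function.Injective e) :
    (Measure.infinitePi fun _ : ℕ => μ).map (fun ω i => ω (e i)) = Measure.pi fun _ : ι => μ := by
  classical
  refine (Measure.pi_eq fun s hs => ?_).symm
  have hm : Measurable fun (ω : ℕ → X) i => ω (e i) := by fun_prop
  let t (k : ℕ) : Set X := if h : ∃ i, e i = k then s h.choose else Set.univ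
  have ht (i : ι) : t (e i) = s i := by
    have h : ∃ i', e i' = e i := ⟨i, rfl⟩
    simp only [t, dif_pos h]
    rw [he h.choose_spec]
  have h1 : (fun (ω : ℕ → X) i => ω (e i)) ⁻¹' (Set.pi Set.univ s) =
      Set.pi (Finset.univ.image e : Finset ℕ) t := by
    ext ω
    simp [Set.mem_pi, ht]
  rw [Measure.map_apply hm (MeasurableSet.univ_pi hs), h1, Measure.infinitePi_pi]
  · rw [Finset.prod_image fun i _ i' _ h => he h]
    simp only [ht]
  · intro k hk
    obtain ⟨i, -, rfl⟩ := Finset.mem_image.1 hk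
    rw [ht]
    exact hs i

theorem map_pi_curry {X ι κ : Type} [MeasurableSpace X] [Fintype ι] [Fintype κ] (μ : Measure X)
    [IsProbabilityMeasure μ] :
    (Measure.pi fun _ : ι × κ => μ).map (fun x i k => x (i, k)) =
      Measure.pi fun _ : ι => Measure.pi fun _ : κ => μ := by
  have h := Measure.infinitePi_map_curry fun (_ : ι) (_ : κ) => μ
  simp only [Measure.infinitePi_eq_pi] at h
  exact h

theorem map_prod_pi_zip {X Y ι : Type} [MeasurableSpace X] [MeasurableSpace Y] [Fintype ι]
    (μ : Measure X) (ν : Measure Y) [IsProbabilityMeasure μ] [IsProbabilityMeasure ν] :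
    ((Measure.pi fun _ : ι => μ).prod (Measure.pi fun _ : ι => ν)).map
      (fun p i => (p.1 i, p.2 i)) = Measure.pi fun _ : ι => μ.prod ν :=
  (measurePreserving_arrowProdEquivProdArrow X Y ι (fun _ => μ) fun _ => ν).symm.map_eq

theorem map_pi_sum {X ι κ : Type} [MeasurableSpace X] [Fintype ι] [Fintype κ] (μ : Measure X)
    [IsProbabilityMeasure μ] :
    (Measure.pi fun _ : ι ⊕ κ => μ).map (fun x => (fun i => x (.inl i), fun k => x (.inr k))) =
      (Measure.pi fun _ : ι => μ).prod (Measure.pi fun _ : κ => μ) :=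
  (measurePreserving_sumPiEquivProdPi fun _ : ι ⊕ κ => μ).map_eq

theorem map_pi_unit {X : Type} [MeasurableSpace X] (μ : Measure X) [IsProbabilityMeasure μ] :
    (Measure.pi fun _ : Unit => μ).map (fun x => x ()) = μ :=
  (measurePreserving_eval (fun _ : Unit => μ) ()).map_eq

/-- Hoeffding's inequality for independent copies of a variable with values in `[0, 1]`. -/
theorem hoeffding_pi {Ω : Type} [MeasurableSpace Ω] (ν : Measure Ω) [IsProbabilityMeasure ν]
    {G : Ω → ℝ} (hG : Measurable G) (h01 : ∀ x, G x ∈ Set.Icc (0 : ℝ) 1) (N : ℕ) {δ : ℝ}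
    (hδ : 0 ≤ δ) :
    (Measure.pi fun _ : Fin N => ν).real {x | N * δ ≤ |∑ r, G (x r) - N * ∫ y, G y ∂ν|} ≤
      2 * Real.exp (-(2 * N * δ ^ 2)) := by
  set μ := Measure.pi fun _ : Fin N => ν with hμ
  -- The one-sided bound with a free left end `a` of the unit interval: it serves both for `G` and
  -- for `-G`, whose values lie in `[-1, 0]`.
  have hone (F : Ω → ℝ) (hF : Measurable F) (a : ℝ) (hFa : ∀ x, F x ∈ Set.Icc a (a + 1)) :
      μ.real {x | N * δ ≤ ∑ r, F (x r) - N * ∫ y, F y ∂ν} ≤ Real.exp (-(2 * N * δ ^ 2)) := by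
    have hmean (r : Fin N) : ∫ x, F (x r) ∂μ = ∫ y, F y ∂ν := by
      have h := (measurePreserving_eval (fun _ : Fin N => ν) r).map_eq
      conv_rhs => rw [← h]
      rw [integral_map (measurable_pi_apply r).aemeasurable hF.aestronglyMeasurable]
    have hind : iIndepFun (fun (r : Fin N) (x : Fin N → Ω) => F (x r) - ∫ x, F (x r) ∂μ) μ :=
      iIndepFun_pi (X := fun r y => F y - ∫ x, F (x r) ∂μ) fun r => (hF.sub_const _).aemeasurable
    have hsub (r : Fin N) : HasSubgaussianMGF (fun x : Fin N → Ω => F (x r) - ∫ x, F (x r) ∂μ)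
        ((‖a + 1 - a‖₊ / 2) ^ 2) μ :=
      hasSubgaussianMGF_of_mem_Icc (hF.comp (measurable_pi_apply r)).aemeasurable
        (Filter.Eventually.of_forall fun x => hFa (x r))
    have h := HasSubgaussianMGF.measure_sum_ge_le_of_iIndepFun hind (s := Finset.univ)
      (fun r _ => hsub r) (ε := N * δ) (by positivity)
    simp only [hmean, Finset.sum_sub_distrib, Finset.sum_const, Finset.card_univ, Fintype.card_fin,
      nsmul_eq_mul] at h
    refine h.trans (Real.exp_le_exp.2 (le_of_eq ?_))
    push_cast
    rw [show a + 1 - a = (1 : ℝ) by ring]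
    simp only [norm_one]
    rcases Nat.eq_zero_or_pos N with h0 | h0
    · subst h0
      simp
    · have : (N : ℝ) ≠ 0 := by positivity
      field_simp
  have h1 := hone G hG 0 (by simpa using h01)
  have h2 := hone (fun y => -G y) hG.neg (-1) fun x => by
    have := h01 x
    constructor <;> linarith [this.1, this.2]
  rw [integral_neg] at h2
  simp only [Finset.sum_neg_distrib] at h2
  calc _ ≤ μ.real ({x | N * δ ≤ ∑ r, G (x r) - N * ∫ y, G y ∂ν} ∪
        {x | N * δ ≤ -∑ r, G (x r) - N * -∫ y, G y ∂ν}) := by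
        refine measureReal_mono (fun x hx => ?_)
        rcases le_abs.1 (show (N : ℝ) * δ ≤ |_| from hx) with h | h
        · exact Or.inl h
        · refine Or.inr (show (N : ℝ) * δ ≤ _ - _ from ?_)
          linarith
    _ ≤ _ := measureReal_union_le _ _
    _ ≤ _ := by
      rw [two_mul]
      exact add_le_add h1 h2

end MRLWE

end

noncomputable section

namespace MRLWE

/-! ### Acceptance probabilities -/

variable {P : Params} {L : ℕ} (D : Distinguisher P L)

/-- The acceptance probability on independent samples whose coordinates have law `ν`. -/
def acceptLaw (ν : Measure (Sample P)) : ℝ :=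
  ∫ x, (D.accept x : ℝ) ∂(Measure.pi fun _ : Fin L => ν)

theorem measurable_accept_coe : Measurable fun x => (D.accept x : ℝ) :=
  measurable_subtype_coe.comp D.measurable_accept

theorem integrable_accept (μ : Measure (Fin L → Sample P)) [IsFiniteMeasure μ] :
    Integrable (fun x => (D.accept x : ℝ)) μ :=
  Integrable.of_bound (measurable_accept_coe D).aestronglyMeasurable 1
    (Filter.Eventually.of_forall fun x => by
      rw [Real.norm_eq_abs, abs_of_nonneg (D.accept x).2.1]
      exact (D.accept x).2.2)

theorem integral_accept_comp {X : Type} [MeasurableSpace X] (μ : Measure X) [IsProbabilityMeasure μ]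
    {f : X → Sample P} (hf : Measurable f) :
    ∫ x, (D.accept fun y => f (x y) : ℝ) ∂(Measure.pi fun _ : Fin L => μ) =
      acceptLaw D (μ.map f) := by
  have : IsProbabilityMeasure (μ.map f) := Measure.isProbabilityMeasure_map hf.aemeasurable
  rw [acceptLaw, ← Measure.pi_map_pi fun _ => hf.aemeasurable,
    integral_map (Measurable.aemeasurable (by fun_prop))
      (measurable_accept_coe D).aestronglyMeasurable]

instance : IsProbabilityMeasure (unifLaw P) := by
  have : IsProbabilityMeasure (uniformOn (Set.univ : Set (Rq P))) :=
    isProbabilityMeasure_uniformOn Set.finite_univ Set.univ_nonempty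
  rw [unifLaw]
  infer_instance

theorem acceptProb_eq (μ : Measure (Rq P × Torus P)) [IsProbabilityMeasure μ] :
    D.acceptProb μ = acceptLaw D (μ.map (coord P)) :=
  integral_accept_comp D μ (measurable_coord P)

/-- The average acceptance probability on hybrid samples. -/
def hybridProb (m : ℕ) : ℝ := ∫ t, acceptLaw D (hybrid P m t) ∂(unifV P)

theorem integral_acceptProb_lweLaw [Fact P.q.Prime] (hmod : ∀ i, P.q ≡ 1 [MOD P.m i]) :
    ∫ s, D.acceptProb (lweLaw P s) ∂(uniformOn (Set.univ : Set (RqDual P))) = hybridProb D 0 := by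
  have : Finite (RqDual P) := Finite.of_equiv _ (secretEquiv P hmod).symm
  rw [hybridProb, unifV, ← map_uniformOn_of_bijective (secretEquiv P hmod).bijective,
    integral_map (measurable_of_countable _).aemeasurable
      (measurable_of_countable _).aestronglyMeasurable]
  simp only [acceptProb_eq, map_coord_lweLaw P hmod, hybrid_zero]

/-- Domination of measures is one-sided, but applying it to both `accept` and `1 - accept` bounds
the difference on both sides. -/
theorem abs_acceptLaw_sub_le {ν μ : Measure (Sample P)} [IsProbabilityMeasure ν]
    [IsProbabilityMeasure μ] {ε : ℝ} (hε : 0 ≤ ε) (h : ν ≤ ENNReal.ofReal (1 + ε) • μ) :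
    |acceptLaw D ν - acceptLaw D μ| ≤ (1 + ε) ^ L - 1 := by
  have hle := pi_le_smul_pi h ENNReal.ofReal_ne_top L
  have hfin : IsFiniteMeasure (ENNReal.ofReal (1 + ε) ^ L • Measure.pi fun _ : Fin L => μ) :=
    Measure.smul_finite _ (ENNReal.pow_ne_top ENNReal.ofReal_ne_top)
  have hc : (ENNReal.ofReal (1 + ε) ^ L).toReal = (1 + ε) ^ L := by
    rw [ENNReal.toReal_pow, ENNReal.toReal_ofReal (by linarith)]
  have h1 : 1 ≤ (1 + ε) ^ L := one_le_pow₀ (by linarith)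
  have hone (f : (Fin L → Sample P) → ℝ) (hf0 : ∀ x, 0 ≤ f x)
      (hf : ∀ (κ : Measure (Fin L → Sample P)) [IsFiniteMeasure κ], Integrable f κ) :
      ∫ x, f x ∂(Measure.pi fun _ : Fin L => ν) ≤
        (1 + ε) ^ L * ∫ x, f x ∂(Measure.pi fun _ : Fin L => μ) := by
    have h2 := integral_mono_measure hle (Filter.Eventually.of_forall hf0) (hf _)
    rwa [integral_smul_measure, hc, smul_eq_mul] at h2
  have hA := hone (fun x => (D.accept x : ℝ)) (fun x => (D.accept x).2.1)
    fun κ _ => integrable_accept D κ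
  have hB := hone (fun x => 1 - (D.accept x : ℝ)) (fun x => sub_nonneg.2 (D.accept x).2.2)
    fun κ _ => (integrable_const _).sub (integrable_accept D κ)
  have hsub (κ : Measure (Sample P)) [IsProbabilityMeasure κ] :
      ∫ x, (1 - (D.accept x : ℝ)) ∂(Measure.pi fun _ : Fin L => κ) = 1 - acceptLaw D κ := by
    rw [integral_sub (integrable_const _) (integrable_accept D _)]
    simp [acceptLaw]
  rw [hsub, hsub] at hB
  change acceptLaw D ν ≤ (1 + ε) ^ L * acceptLaw D μ at hA
  have h0 : 0 ≤ acceptLaw D μ := integral_nonneg fun x => (D.accept x).2.1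
  have h3 : 0 ≤ 1 - acceptLaw D μ := by
    rw [← hsub]
    exact integral_nonneg fun x => sub_nonneg.2 (D.accept x).2.2
  rw [abs_le]
  constructor <;> nlinarith

theorem abs_hybridProb_sub_le [Fact P.q.Prime] (hmod : ∀ i, P.q ≡ 1 [MOD P.m i]) {ε : ℝ} (hε : 0 < ε)
    (h : smoothingDual P ε ≤ P.α * P.q) :
    |hybridProb D P.n - D.acceptProb (unifLaw P)| ≤ (1 + ε) ^ L - 1 := by
  -- The full hybrid no longer depends on the secret, so the average may be evaluated at the secret
  -- `0`.
  have h1 : hybridProb D P.n = acceptLaw D (hybrid P P.n 0) := by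
    rw [hybridProb]
    simp only [hybrid_top P hmod]
    simp
  rw [h1, acceptProb_eq, map_coord_unifLaw]
  exact abs_acceptLaw_sub_le D hε.le (hybrid_top_le P hmod hε h 0)

/-- If the distinguisher has an advantage, then it distinguishes two neighbouring hybrids. -/
theorem exists_hybrid_gap [Fact P.q.Prime] (hmod : ∀ i, P.q ≡ 1 [MOD P.m i]) {ε : ℝ} (hε : 0 < ε)
    (h : smoothingDual P ε ≤ P.α * P.q) {k : ℕ} (hk : 1 ≤ (k : ℝ) * D.advantage)
    (hL : (1 + ε) ^ L - 1 ≤ 1 / (2 * k)) :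
    ∃ i : Fin P.n, 1 / (2 * k * P.n : ℝ) ≤ |hybridProb D i - hybridProb D (i + 1)| := by
  have hk0 : (0 : ℝ) < k := by
    rcases Nat.eq_zero_or_pos k with h0 | h0
    · subst h0
      norm_num at hk
    · exact_mod_cast h0
  have hadv : 1 / (k : ℝ) ≤ |hybridProb D 0 - D.acceptProb (unifLaw P)| := by
    rw [div_le_iff₀ hk0, mul_comm]
    rw [Distinguisher.advantage, integral_acceptProb_lweLaw D hmod] at hk
    exact hk
  have h1 := abs_hybridProb_sub_le D hmod hε h
  -- Half of the advantage pays for the passage from the last hybrid to the uniform law.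
  have h2 : 1 / (2 * k : ℝ) ≤ |hybridProb D 0 - hybridProb D P.n| := by
    have h3 := abs_sub_le (hybridProb D 0) (hybridProb D P.n) (D.acceptProb (unifLaw P))
    have h4 : 1 / (k : ℝ) = 1 / (2 * k) + 1 / (2 * k) := by
      field_simp
      norm_num
    linarith
  by_contra! hcon
  have h5 : |hybridProb D 0 - hybridProb D P.n| ≤
      ∑ i ∈ Finset.range P.n, |hybridProb D i - hybridProb D (i + 1)| := by
    have h6 := Finset.sum_range_sub' (fun i => hybridProb D i) P.n
    rw [← h6]
    exact Finset.abs_sum_le_sum_abs _ _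
  have hn : 0 < P.n := Finset.prod_pos fun i _ => Nat.totient_pos.2 (P.m_pos i)
  have hn' : (0 : ℝ) < P.n := by exact_mod_cast hn
  have h7 : ∑ i ∈ Finset.range P.n, |hybridProb D i - hybridProb D (i + 1)| <
      ∑ i ∈ Finset.range P.n, 1 / (2 * k * P.n : ℝ) :=
    Finset.sum_lt_sum_of_nonempty ⟨0, Finset.mem_range.2 hn⟩ fun i hi =>
      hcon ⟨i, Finset.mem_range.1 hi⟩
  rw [Finset.sum_const, Finset.card_range, nsmul_eq_mul] at h7
  have h8 : (P.n : ℝ) * (1 / (2 * k * P.n)) = 1 / (2 * k) := by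
    field_simp
  linarith

/-! ### The law of the replies -/

/-- The samples that are used in one oracle call. -/
abbrev Block (P : Params) (L : ℕ) : Type :=
  (Rq P × Torus P) × (Fin L → (Rq P × Torus P) × (Rq P × Torus P))

/-- The samples that are used in the `Q`-th oracle call. -/
def block (L : ℕ) (ω : ℕ → Rq P × Torus P) (Q : ℕ) : Block P L :=
  (ω (Q * (1 + 2 * L)), fun y => (ω (Q * (1 + 2 * L) + 1 + 2 * y), ω (Q * (1 + 2 * L) + 2 + 2 * y)))

/-- The law of a block. -/
def blockLaw (L : ℕ) (s : RqDual P) : Measure (Block P L) :=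
  (lweLaw P s).prod (Measure.pi fun _ : Fin L => (lweLaw P s).prod (lweLaw P s))

instance (s : RqDual P) : IsProbabilityMeasure (blockLaw L s) := by
  rw [blockLaw]
  infer_instance

/-- The reply to an oracle call as a function of the block and of the number that decides. -/
def replyFun (i j : Fin P.n) (g : ZMod P.q) (md : ℕ) (p : Block P L × unitInterval) : ℝ :=
  if p.2 < D.accept (fun y : Fin L => transform P i j g md (coord P p.1.1).1
      (coord P (p.1.2 y).1) (coord P (p.1.2 y).2).1) then 1 else 0

theorem reply_eq_replyFun (ω : Randomness P) (i j : Fin P.n) (g : ZMod P.q) (md Q : ℕ) :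
    (reply D ω i j g md Q : ℝ) = replyFun D i j g md (block L ω.1 Q, ω.2.2 Q) := by
  rw [reply, replyFun]
  push_cast
  rfl

theorem measurable_transform (i j : Fin P.n) (g : ZMod P.q) (md : ℕ) :
    Measurable fun p : (Fin P.n → ZMod P.q) × Sample P × (Fin P.n → ZMod P.q) =>
      transform P i j g md p.1 p.2.1 p.2.2 := by
  have hd : Measurable fun p : (Fin P.n → ZMod P.q) × Sample P × (Fin P.n → ZMod P.q) =>
      transformA P i j md p.2.1.1 p.2.2 := (measurable_of_countable
        fun p : (Fin P.n → ZMod P.q) × (Fin P.n → ZMod P.q) => transformA P i j md p.1 p.2).comp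
        ((measurable_fst.comp (measurable_fst.comp measurable_snd)).prodMk
          (measurable_snd.comp measurable_snd))
  refine hd.prodMk (Measurable.add ((measurable_of_countable
      fun p : (Fin P.n → ZMod P.q) × (Fin P.n → ZMod P.q) × (Fin P.n → ZMod P.q) => embT P (combV P
        (transformW P i (guess P g md) p.1 p.2.1 p.2.2))).comp
      (measurable_fst.prodMk (hd.prodMk (measurable_snd.comp measurable_snd))))
    ((continuous_autTorus P j i).measurable.comp
      (measurable_snd.comp (measurable_fst.comp measurable_snd))))

theorem measurable_query (i j : Fin P.n) (g : ZMod P.q) (md : ℕ) :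
    Measurable fun p : Block P L => (fun y : Fin L => transform P i j g md (coord P p.1).1
      (coord P (p.2 y).1) (coord P (p.2 y).2).1) := by
  refine measurable_pi_lambda _ fun y => ?_
  have hc := measurable_coord P
  have hy : Measurable fun p : Block P L => p.2 y := (measurable_pi_apply y).comp measurable_snd
  have h1 : Measurable fun p : Block P L => (coord P p.1).1 :=
    measurable_fst.comp (hc.comp measurable_fst)
  have h2 : Measurable fun p : Block P L => coord P (p.2 y).1 := hc.comp (measurable_fst.comp hy)
  have h3 : Measurable fun p : Block P L => (coord P (p.2 y).2).1 :=
    measurable_fst.comp (hc.comp (measurable_snd.comp hy))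
  exact (measurable_transform i j g md).comp (h1.prodMk (h2.prodMk h3))

theorem measurable_replyFun (i j : Fin P.n) (g : ZMod P.q) (md : ℕ) :
    Measurable (replyFun D i j g md) :=
  Measurable.ite (measurableSet_lt measurable_snd
    (D.measurable_accept.comp ((measurable_query i j g md).comp measurable_fst)))
    measurable_const measurable_const

theorem replyFun_mem_Icc (i j : Fin P.n) (g : ZMod P.q) (md : ℕ) (p : Block P L × unitInterval) :
    replyFun D i j g md p ∈ Set.Icc (0 : ℝ) 1 := by
  rw [replyFun]
  split_ifs <;> simp

theorem integral_ite_lt (c : unitInterval) :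
    ∫ u : unitInterval, (if u < c then (1 : ℝ) else 0) = c := by
  have h : (fun u : unitInterval => if u < c then (1 : ℝ) else 0) =
      Set.indicator (Set.Iio c) 1 := by
    funext u
    simp [Set.indicator_apply]
  rw [h, integral_indicator_one measurableSet_Iio, measureReal_def, unitInterval.volume_Iio,
    ENNReal.toReal_ofReal c.2.1]

/-- Given the shift `t`, the `L` transformed samples are independent with a hybrid law for the
permuted secret plus `t`. Averaging over the uniform `t` removes all dependence on `s` except
through the correctness of the guess; this is the passage from the worst case to the average case.
-/
theorem integral_replyFun [Fact P.q.Prime] (hmod : ∀ i, P.q ≡ 1 [MOD P.m i]) (s : RqDual P)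
    (i j : Fin P.n) (g : ZMod P.q) (md : ℕ) :
    ∫ p, replyFun D i j g md p ∂((blockLaw L s).prod (volume : Measure unitInterval)) =
      hybridProb D (if maskCoeff P g (secretEquiv P hmod s j) md = 0 then i else i + 1) := by
  have hintegr : Integrable (replyFun D i j g md)
      ((blockLaw L s).prod (volume : Measure unitInterval)) :=
    Integrable.of_mem_Icc 0 1 (measurable_replyFun D i j g md).aemeasurable
      (Filter.Eventually.of_forall (replyFun_mem_Icc D i j g md))
  rw [integral_prod _ hintegr]
  simp only [replyFun, integral_ite_lt]
  have hintegr₂ : Integrable (fun p : Block P L => (D.accept fun y : Fin L =>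
      transform P i j g md (coord P p.1).1 (coord P (p.2 y).1) (coord P (p.2 y).2).1 : ℝ))
      (blockLaw L s) :=
    Integrable.of_mem_Icc 0 1 ((measurable_accept_coe D).comp (measurable_query i j g md)).aemeasurable
      (Filter.Eventually.of_forall fun p => (D.accept _).2)
  rw [blockLaw, integral_prod _ (by rwa [blockLaw] at hintegr₂)]
  set m := if maskCoeff P g (secretEquiv P hmod s j) md = 0 then (i : ℕ) else i + 1 with hm
  have hc := measurable_coord P
  have hfst : (lweCoord P (secretEquiv P hmod s)).map Prod.fst = unifV P := by
    rw [lweCoord, Measure.map_map measurable_fst (measurable_lweFun P _)]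
    exact Measure.map_fst_prod.trans (by simp)
  have hpair : ((lweLaw P s).prod (lweLaw P s)).map (fun p => (coord P p.1, (coord P p.2).1)) =
      (lweCoord P (secretEquiv P hmod s)).prod (unifV P) := by
    rw [← hfst, ← map_coord_lweLaw P hmod, Measure.map_map measurable_fst hc,
      Measure.map_prod_map _ _ hc (measurable_fst.comp hc)]
    rfl
  have hinner (x : Rq P × Torus P) :
      ∫ f, (D.accept fun y : Fin L => transform P i j g md (coord P x).1 (coord P (f y).1)
        (coord P (f y).2).1 : ℝ) ∂(Measure.pi fun _ : Fin L => (lweLaw P s).prod (lweLaw P s)) =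
      acceptLaw D (hybrid P m fun b => secretEquiv P hmod s (crtPerm P i j b) + (coord P x).1 b) := by
    have hT : Measurable fun p : Sample P × (Fin P.n → ZMod P.q) =>
        transform P i j g md (coord P x).1 p.1 p.2 :=
      (measurable_transform i j g md).comp (measurable_const.prodMk measurable_id)
    have hq : Measurable fun p : (Rq P × Torus P) × (Rq P × Torus P) =>
        (coord P p.1, (coord P p.2).1) :=
      (hc.comp measurable_fst).prodMk ((measurable_fst.comp hc).comp measurable_snd)
    rw [← map_transform P hmod i j g md, ← hpair, Measure.map_map hT hq]
    exact integral_accept_comp D ((lweLaw P s).prod (lweLaw P s)) (hT.comp hq)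
  simp only [hinner]
  have h1 : ∫ x, acceptLaw D (hybrid P m fun b => secretEquiv P hmod s (crtPerm P i j b) +
      (coord P x).1 b) ∂(lweLaw P s) = ∫ t, acceptLaw D (hybrid P m
        fun b => secretEquiv P hmod s (crtPerm P i j b) + t b) ∂(unifV P) := by
    rw [← hfst, ← map_coord_lweLaw P hmod, Measure.map_map measurable_fst hc,
      integral_map (measurable_fst.comp hc).aemeasurable
        (measurable_of_countable _).aestronglyMeasurable]
    rfl
  rw [h1, hybridProb]
  conv_rhs => rw [unifV, ← map_uniformOn_of_bijective (Equiv.addLeft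
    fun b => secretEquiv P hmod s (crtPerm P i j b)).bijective]
  rw [integral_map (measurable_of_countable _).aemeasurable
    (measurable_of_countable _).aestronglyMeasurable]
  rfl

end MRLWE

end

noncomputable section

namespace MRLWE

variable {P : Params} {L : ℕ}

/-! ### Concentration of the scores -/

/-- The position of a sample within a block. -/
def blockPos (L : ℕ) : Unit ⊕ (Fin L ⊕ Fin L) → ℕ
  | .inl _ => 0
  | .inr (.inl y) => 1 + 2 * y
  | .inr (.inr y) => 2 + 2 * y

theorem blockPos_lt (b : Unit ⊕ (Fin L ⊕ Fin L)) : blockPos L b < 1 + 2 * L := by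
  rcases b with _ | y | y
  · simp [blockPos]
  · have := y.2
    simp only [blockPos]
    omega
  · have := y.2
    simp only [blockPos]
    omega

theorem blockPos_injective : Function.Injective (blockPos L) := by
  rintro (_ | y | y) (_ | y' | y') h <;> simp only [blockPos] at h
  · rfl
  · omega
  · omega
  · omega
  · exact congrArg _ (congrArg _ (Fin.ext (by omega)))
  · omega
  · omega
  · omega
  · exact congrArg _ (congrArg _ (Fin.ext (by omega)))

theorem map_pi_block (s : RqDual P) :
    (Measure.pi fun _ : Unit ⊕ (Fin L ⊕ Fin L) => lweLaw P s).map
      (fun x => ((x (.inl ()), fun y => (x (.inr (.inl y)), x (.inr (.inr y)))) : Block P L)) =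
      blockLaw L s := by
  have h1 := map_pi_sum (ι := Unit) (κ := Fin L ⊕ Fin L) (lweLaw P s)
  have h2 := map_pi_sum (ι := Fin L) (κ := Fin L) (lweLaw P s)
  have h3 := map_prod_pi_zip (ι := Fin L) (lweLaw P s) (lweLaw P s)
  have hm : Measurable fun x : (Fin L ⊕ Fin L) → Rq P × Torus P =>
      (fun y : Fin L => (x (.inl y), x (.inr y))) := by fun_prop
  rw [← h2, Measure.map_map (by fun_prop) (by fun_prop)] at h3
  have h4 : (Measure.pi fun _ : Fin L ⊕ Fin L => lweLaw P s).map
      (fun x (y : Fin L) => (x (.inl y), x (.inr y))) = _ := h3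
  have h5 := Measure.map_prod_map (Measure.pi fun _ : Unit => lweLaw P s)
    (Measure.pi fun _ : Fin L ⊕ Fin L => lweLaw P s) (measurable_pi_apply ()) hm
  rw [map_pi_unit, h4] at h5
  rw [blockLaw, h5, ← h1, Measure.map_map (by fun_prop) (by fun_prop)]
  rfl

/-- Different calls read disjoint intervals of `1 + 2 * L` samples and different deciding numbers,
so distinct call numbers give independent inputs. -/
theorem map_runLaw_block (s : RqDual P) {N : ℕ} {Q : Fin N → ℕ} (hQ : Function.Injective Q) :
    (runLaw P s).map (fun ω r => (block L ω.1 (Q r), ω.2.2 (Q r))) =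
      Measure.pi fun _ : Fin N => (blockLaw L s).prod (volume : Measure unitInterval) := by
  let e (p : Fin N × (Unit ⊕ (Fin L ⊕ Fin L))) : ℕ := Q p.1 * (1 + 2 * L) + blockPos L p.2
  have he : Function.Injective e := by
    rintro ⟨r, b⟩ ⟨r', b'⟩ h
    have hb := blockPos_lt b
    have hb' := blockPos_lt b'
    simp only [e] at h
    have h1 : blockPos L b = blockPos L b' := by
      rw [Nat.add_comm, Nat.add_comm (Q r' * _)] at h
      have := congrArg (· % (1 + 2 * L)) h
      simpa only [Nat.add_mul_mod_self_right, Nat.mod_eq_of_lt hb, Nat.mod_eq_of_lt hb'] using this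
    rw [h1] at h
    have h2 : Q r = Q r' := Nat.eq_of_mul_eq_mul_right (by omega) (Nat.add_right_cancel h)
    rw [hQ h2, blockPos_injective h1]
  let Ψ (x : Unit ⊕ (Fin L ⊕ Fin L) → Rq P × Torus P) : Block P L :=
    (x (.inl ()), fun y => (x (.inr (.inl y)), x (.inr (.inr y))))
  have hΨ : Measurable Ψ := by fun_prop
  have h1 : (Measure.infinitePi fun _ : ℕ => lweLaw P s).map
      (fun ω (r : Fin N) => block L ω (Q r)) = Measure.pi fun _ : Fin N => blockLaw L s := by
    have h2 := Measure.pi_map_pi (μ := fun _ : Fin N => Measure.pi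
      fun _ : Unit ⊕ (Fin L ⊕ Fin L) => lweLaw P s) (f := fun _ => Ψ) fun _ => hΨ.aemeasurable
    simp only [Ψ, map_pi_block] at h2
    rw [← h2, ← map_pi_curry, ← map_infinitePi_comp (lweLaw P s) he,
      Measure.map_map (by fun_prop) (by fun_prop), Measure.map_map (by fun_prop) (by fun_prop)]
    congr 1
    funext ω r
    simp [block, e, blockPos, Nat.add_assoc]
  have h3 := map_infinitePi_comp (volume : Measure unitInterval) hQ
  have hblk : Measurable fun (ω : ℕ → Rq P × Torus P) (r : Fin N) => block L ω (Q r) := by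
    unfold block
    fun_prop
  rw [← map_prod_pi_zip, ← h1, ← h3, Measure.map_prod_map _ _ hblk (by fun_prop)]
  have h4 : (Measure.infinitePi fun _ : ℕ => (volume : Measure unitInterval)) =
      ((Measure.infinitePi fun _ : ℕ => (PMF.uniformOfFintype Bool).toMeasure).prod
        (Measure.infinitePi fun _ : ℕ => (volume : Measure unitInterval))).map Prod.snd := by
    rw [Measure.map_snd_prod, measure_univ, one_smul]
  have h5 : (Measure.infinitePi fun _ : ℕ => lweLaw P s).prod
      (Measure.infinitePi fun _ : ℕ => (volume : Measure unitInterval)) =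
      (runLaw P s).map (Prod.map id Prod.snd) := by
    conv_lhs => rw [h4, ← Measure.map_id (μ := Measure.infinitePi fun _ : ℕ => lweLaw P s)]
    rw [Measure.map_prod_map _ _ measurable_id measurable_snd]
    rfl
  rw [h5, Measure.map_map (hblk.prodMap (by fun_prop)) (measurable_id.prodMap measurable_snd),
    Measure.map_map (by fun_prop) ((hblk.prodMap (by fun_prop)).comp
      (measurable_id.prodMap measurable_snd))]
  rfl

variable (D : Distinguisher P L)

theorem runLaw_deviation_le [Fact P.q.Prime] (hmod : ∀ i, P.q ≡ 1 [MOD P.m i]) (s : RqDual P)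
    (i j : Fin P.n) (g : ZMod P.q) (md : ℕ) {N : ℕ} {Q : Fin N → ℕ} (hQ : Function.Injective Q)
    {δ : ℝ} (hδ : 0 ≤ δ) :
    runLaw P s {ω | N * δ ≤ |∑ r, (reply D ω i j g md (Q r) : ℝ) -
      N * hybridProb D (if maskCoeff P g (secretEquiv P hmod s j) md = 0 then i else i + 1)|} ≤
      ENNReal.ofReal (2 * Real.exp (-(2 * N * δ ^ 2))) := by
  have h := hoeffding_pi ((blockLaw L s).prod (volume : Measure unitInterval))
    (measurable_replyFun D i j g md) (replyFun_mem_Icc D i j g md) N hδ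
  rw [integral_replyFun D hmod] at h
  have hblk : Measurable fun (ω : Randomness P) (r : Fin N) => (block L ω.1 (Q r), ω.2.2 (Q r)) := by
    unfold block
    fun_prop
  have hP : IsProbabilityMeasure (runLaw P s) := by
    rw [runLaw]
    infer_instance
  have h2 := ENNReal.ofReal_le_ofReal h
  rw [ofReal_measureReal, ← map_runLaw_block s hQ] at h2
  -- The inequality for image measures holds for arbitrary sets, so the event need not be shown
  -- measurable.
  refine le_trans ?_ ((Measure.le_map_apply hblk.aemeasurable _).trans h2)
  refine measure_mono fun ω hω => ?_
  simp only [Set.mem_ofPred_eq, reply_eq_replyFun] at hω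
  exact hω

theorem maskCoeff_one (g sj : ZMod P.q) : maskCoeff P g sj 1 = 1 := by
  simp [maskCoeff, guess]

/-- The coefficient is `C (g - s_j)` with `C` invertible modulo `q`. -/
theorem maskCoeff_zero_eq_zero_iff [Fact P.q.Prime] (hmod : ∀ i, P.q ≡ 1 [MOD P.m i])
    (g sj : ZMod P.q) : maskCoeff P g sj 0 = 0 ↔ g = sj := by
  have h : maskCoeff P g sj 0 = crtC P * (g - sj) := by
    simp only [maskCoeff, guess, Nat.cast_zero]
    ring
  rw [h, mul_eq_zero, or_iff_right (crtC_ne_zero P hmod), sub_eq_zero]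

/-- The event that some number of positive replies is far from its mean. -/
def badEvent [Fact P.q.Prime] (hmod : ∀ i, P.q ≡ 1 [MOD P.m i]) (s : RqDual P) (N : ℕ) (δ : ℝ) :
    Set (Randomness P) :=
  ⋃ x : (Fin P.n × Fin P.n) × (Fin P.q × Fin 2),
    {ω | N * δ ≤ |∑ r : Fin N, (reply D ω x.1.1 x.1.2 ((x.2.1 : ℕ) : ZMod P.q) x.2.2
        (callIndex P N x.1.2 x.1.1 x.2.1 r x.2.2) : ℝ) - N * hybridProb D
      (if maskCoeff P ((x.2.1 : ℕ) : ZMod P.q) (secretEquiv P hmod s x.1.2) x.2.2 = 0 then x.1.1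
        else x.1.1 + 1)|}

/-- A union bound over `2 n² q` events of probability at most `2 exp(-2 N δ²)`. Independence is used
among the rounds of one event only. -/
theorem runLaw_badEvent_le [Fact P.q.Prime] (hmod : ∀ i, P.q ≡ 1 [MOD P.m i]) (s : RqDual P) (N : ℕ)
    {δ : ℝ} (hδ : 0 ≤ δ) :
    runLaw P s (badEvent D hmod s N δ) ≤
      ENNReal.ofReal (4 * (P.n : ℝ) ^ 2 * P.q * Real.exp (-(2 * N * δ ^ 2))) := by
  refine (measure_iUnion_fintype_le _ _).trans ((Finset.sum_le_sum fun x _ =>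
    runLaw_deviation_le D hmod s x.1.1 x.1.2 ((x.2.1 : ℕ) : ZMod P.q) x.2.2 ?_ hδ).trans ?_)
  -- Different rounds have different call numbers.
  · intro r r' h
    simp only [callIndex] at h
    exact Fin.ext (by omega)
  · rw [Finset.sum_const, nsmul_eq_mul, ← ENNReal.ofReal_natCast,
      ← ENNReal.ofReal_mul (Nat.cast_nonneg _)]
    refine ENNReal.ofReal_le_ofReal (le_of_eq ?_)
    simp only [Finset.card_univ, Fintype.card_prod, Fintype.card_fin]
    push_cast [-Nat.cast_prod]
    ring

/-- Outside of the bad event the best guess is right. -/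
theorem guess_eq_of_not_mem_badEvent [Fact P.q.Prime] (hmod : ∀ i, P.q ≡ 1 [MOD P.m i]) (s : RqDual P)
    {N : ℕ} {δ : ℝ} {ω : Randomness P} (hω : ω ∉ badEvent D hmod s N δ) {i₀ : Fin P.n}
    (hgap : 4 * δ ≤ |hybridProb D i₀ - hybridProb D (i₀ + 1)|) {i j : Fin P.n} {b : ℕ} (hb : b < P.q)
    (hmax : ∀ i' g', g' < P.q → score D ω N j i' g' ^ 2 ≤ score D ω N j i b ^ 2) :
    (b : ZMod P.q) = secretEquiv P hmod s j := by
  by_contra hne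
  have hdev (i : Fin P.n) (g : ℕ) (hg : g < P.q) (md : Fin 2) :
      |∑ r : Fin N, (reply D ω i j (g : ZMod P.q) md (callIndex P N j i g r md) : ℝ) -
        N * hybridProb D (if maskCoeff P (g : ZMod P.q) (secretEquiv P hmod s j) md = 0 then i
          else i + 1)| < N * δ := by
    by_contra! hcon
    exact hω (Set.mem_iUnion.2 ⟨((i, j), (⟨g, hg⟩, md)), hcon⟩)
  have hscore (i : Fin P.n) (g : ℕ) : (score D ω N j i g : ℝ) =
      ∑ r : Fin N, (reply D ω i j (g : ZMod P.q) 0 (callIndex P N j i g r 0) : ℝ) -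
        ∑ r : Fin N, (reply D ω i j (g : ZMod P.q) 1 (callIndex P N j i g r 1) : ℝ) := by
    rw [score]
    push_cast
    rw [Finset.sum_sub_distrib, Finset.sum_range, Finset.sum_range]
  have hwrong : |(score D ω N j i b : ℝ)| < 2 * (N * δ) := by
    have h0 := hdev i b hb 0
    have h1 := hdev i b hb 1
    simp only [Fin.val_zero, Fin.val_one] at h0 h1
    rw [if_neg ((maskCoeff_one _ _).trans_ne one_ne_zero)] at h1
    rw [if_neg (mt (maskCoeff_zero_eq_zero_iff hmod _ _).1 hne)] at h0
    rw [hscore, abs_lt]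
    rw [abs_lt] at h0 h1
    constructor <;> linarith [h0.1, h0.2, h1.1, h1.2]
  set g := (secretEquiv P hmod s j).val with hg
  have hgq : g < P.q := ZMod.val_lt _
  have hgs : (g : ZMod P.q) = secretEquiv P hmod s j := ZMod.natCast_zmod_val _
  -- For the right guess at `i₀` the means differ by at least `4 N δ`, and the deviations take away
  -- at most half of it.
  have hright : 2 * (N * δ) ≤ |(score D ω N j i₀ g : ℝ)| := by
    have h0 := hdev i₀ g hgq 0
    have h1 := hdev i₀ g hgq 1
    simp only [Fin.val_zero, Fin.val_one] at h0 h1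
    rw [if_neg ((maskCoeff_one _ _).trans_ne one_ne_zero)] at h1
    rw [if_pos ((maskCoeff_zero_eq_zero_iff hmod _ _).2 hgs)] at h0
    have h2 : N * (4 * δ) ≤ |N * hybridProb D i₀ - N * hybridProb D (i₀ + 1)| := by
      rw [← mul_sub, abs_mul, Nat.abs_cast]
      gcongr
    rw [hscore]
    rw [abs_lt] at h0 h1
    rcases le_abs.1 h2 with h | h
    · exact le_abs.2 (Or.inl (by linarith [h0.1, h0.2, h1.1, h1.2]))
    · exact le_abs.2 (Or.inr (by linarith [h0.1, h0.2, h1.1, h1.2]))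
  have h3 : (score D ω N j i₀ g : ℝ) ^ 2 ≤ (score D ω N j i b : ℝ) ^ 2 := by
    exact_mod_cast hmax i₀ g hgq
  rw [sq_le_sq] at h3
  linarith

end MRLWE

end

/-! ### Choice of constants, negligible bounds, and conclusion. -/

noncomputable section

namespace MRLWE

/-! ### The reduction -/

section Instance

variable {P : Params} {L : ℕ} (D : Distinguisher P L)

theorem sized_of_modEq [Fact P.q.Prime] (hmod : ∀ i, P.q ≡ 1 [MOD P.m i]) {Z : ℕ} (h : 100 ≤ Z)
    (hl : P.l ≤ Z) (hq : P.q ≤ Z) (hn : P.n ≤ Z) : Sized P Z := by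
  have hN (a : ℕ) : P.q ≡ 1 [MOD P.mN a] := by
    unfold Params.mN
    split_ifs
    · exact hmod _
    · exact Nat.modEq_one
  refine ⟨h, hl, hq, hn, fun a => ?_, fun a => (isPrimitiveRoot_rootMod (hN a)).pow_eq_one⟩
  have h2 := P.two_le_q
  have h3 : P.mN a ∣ P.q - 1 := (Nat.modEq_iff_dvd' (by omega)).1 (hN a).symm
  have := Nat.le_of_dvd (by omega) h3
  omega

theorem failProb_le [Fact P.q.Prime] (hmod : ∀ i, P.q ≡ 1 [MOD P.m i]) {ε : ℝ} (hε : 0 < ε)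
    (h : smoothingDual P ε ≤ P.α * P.q) {k : ℕ} (hk : 1 ≤ (k : ℝ) * D.advantage)
    (hL : (1 + ε) ^ L - 1 ≤ 1 / (2 * k)) (s : RqDual P) :
    failProb progReduction k D s ≤
      ENNReal.ofReal (4 * (P.n : ℝ) ^ 2 * P.q * Real.exp (-(P.n / 2 : ℝ))) := by
  obtain ⟨i₀, hi₀⟩ := exists_hybrid_gap D hmod hε h hk hL
  have hk0 : k ≠ 0 := by
    rintro rfl
    norm_num at hk
  have hn : (P.n : ℝ) ≠ 0 := by
    have : 0 < P.n := Finset.prod_pos fun i _ => Nat.totient_pos.2 (P.m_pos i)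
    exact_mod_cast this.ne'
  have hk' : (k : ℝ) ≠ 0 := by exact_mod_cast hk0
  -- A quarter of the guaranteed gap `1 / (2 k n)`.
  set δ : ℝ := 1 / (8 * k * P.n) with hδ
  have hbad := runLaw_badEvent_le D hmod s (rounds P k) (δ := δ) (by positivity)
  -- The number of rounds contains `n³` and not just `n²` in order to leave an exponent linear in
  -- `n`.
  have hexp : 2 * (rounds P k : ℝ) * δ ^ 2 = (P.n : ℝ) / 2 := by
    rw [rounds, hδ]
    push_cast [-Nat.cast_prod]
    field_simp
    norm_num
    ring
  rw [hexp] at hbad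
  refine le_trans (measure_mono fun ω hω => ?_) hbad
  by_contra hgood
  refine hω ?_
  set Z := 100 + P.l + P.q + P.n + L + k with hZ
  obtain ⟨t, st, hexec, -, bg, hbg, hout⟩ := progReduction_spec (D := D) (ω := ω) (k := k)
    (sized_of_modEq hmod (Z := Z) (by omega) (by omega) (by omega) (by omega)) (by omega) (by omega)
  refine ⟨t, st, hexec, represents_of_secret P hmod fun k' => ?_⟩
  rw [hout]
  congr 1
  refine Finset.sum_congr rfl fun j _ => ?_
  obtain ⟨hlt, i, hmax⟩ := hbg j
  rw [guess_eq_of_not_mem_badEvent D hmod s hgood (i₀ := i₀) ?_ hlt hmax]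
  refine le_trans (le_of_eq ?_) hi₀
  rw [hδ]
  field_simp
  norm_num

end Instance

theorem polynomial_eval_mono (p : Polynomial ℕ) {a b : ℕ} (h : a ≤ b) : p.eval a ≤ p.eval b := by
  rw [Polynomial.eval_eq_sum_range, Polynomial.eval_eq_sum_range]
  exact Finset.sum_le_sum fun i _ => Nat.mul_le_mul_left _ (Nat.pow_le_pow_left h i)

/-- For `n ≥ 2` the constant `p(1)` is absorbed by `p(1) ≤ 2 ^ p(1) ≤ n ^ p(1)`. -/
theorem polynomial_eval_le_pow (p : Polynomial ℕ) : ∃ c : ℕ, ∀ n, 2 ≤ n → p.eval n ≤ n ^ c := by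
  refine ⟨p.eval 1 + p.natDegree, fun n hn => ?_⟩
  calc p.eval n ≤ p.eval 1 * n ^ p.natDegree := by
        rw [Polynomial.eval_eq_sum_range, Polynomial.eval_eq_sum_range, Finset.sum_mul]
        refine Finset.sum_le_sum fun i hi => ?_
        rw [one_pow, mul_one]
        exact Nat.mul_le_mul_left _ (Nat.pow_le_pow_right (by omega)
          (Nat.lt_succ_iff.1 (Finset.mem_range.1 hi)))
    _ ≤ n ^ p.eval 1 * n ^ p.natDegree :=
        Nat.mul_le_mul_right _ ((Nat.lt_two_pow_self).le.trans (Nat.pow_le_pow_left hn _))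
    _ = _ := (pow_add _ _ _).symm

theorem PolyBounded.eventually_le_pow {F : ℕ → Params} {f : ℕ → ℕ} (h : PolyBounded F f)
    (hdim : Filter.Tendsto (fun κ => (F κ).n) Filter.atTop Filter.atTop) :
    ∃ c : ℕ, ∀ᶠ κ in Filter.atTop, f κ ≤ (F κ).n ^ c := by
  obtain ⟨p, hp⟩ := h
  obtain ⟨c, hc⟩ := polynomial_eval_le_pow p
  exact ⟨c, (hdim.eventually_ge_atTop 2).mono fun κ hκ => (hp κ).trans (hc _ hκ)⟩

theorem runsInPolyTime_progReduction {F : ℕ → Params} (hprime : ∀ κ, (F κ).q.Prime)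
    (hmod : ∀ κ i, (F κ).q ≡ 1 [MOD (F κ).m i]) (hpoly : PolyBounded F fun κ => (F κ).q) :
    RunsInPolyTime F progReduction := by
  obtain ⟨p, hp⟩ := hpoly
  -- The base is the size parameter `Z`, with `q` replaced by its polynomial bound; `80` is the
  -- exponent of `progReduction_spec`.
  refine ⟨(Polynomial.X + p + Polynomial.C 100) ^ 80, fun κ k L D ω => ?_⟩
  have : Fact (F κ).q.Prime := ⟨hprime κ⟩
  set T := (F κ).n + (F κ).l + k + L with hT
  have hq : (F κ).q ≤ p.eval T := (hp κ).trans (polynomial_eval_mono p (by omega))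
  obtain ⟨t, st, hexec, ht, -⟩ := progReduction_spec (D := D) (ω := ω) (k := k)
    (sized_of_modEq (hmod κ) (Z := T + p.eval T + 100) (by omega) (by omega) (by omega) (by omega))
    (by omega) (by omega)
  refine ⟨t, st, hexec, ht.trans (le_of_eq ?_)⟩
  simp

/-- The estimate is `(1 + ε)^L ≤ exp(L ε) ≤ 1 + 2 L ε`, where a negligible `ε` beats the polynomial
bounds on `k` and `L`. The case `k = 0` is set apart because `1 / (2 * 0) = 0`; no advantage can
satisfy the promise there. -/
theorem eventually_smoothing_small {F : ℕ → Params}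
    (hdim : Filter.Tendsto (fun κ => (F κ).n) Filter.atTop Filter.atTop) {ε : ℕ → ℝ}
    (hε_pos : ∀ κ, 0 < ε κ) (hε : Negligible F ε) {k L : ℕ → ℕ} (hk : PolyBounded F k)
    (hL : PolyBounded F L) :
    ∀ᶠ κ in Filter.atTop, k κ = 0 ∨ (1 + ε κ) ^ L κ - 1 ≤ 1 / (2 * (k κ : ℝ)) := by
  obtain ⟨a, ha⟩ := hk.eventually_le_pow hdim
  obtain ⟨b, hb⟩ := hL.eventually_le_pow hdim
  filter_upwards [ha, hb, hε (2 + a + b), hdim.eventually_ge_atTop 2] with κ hka hLb hκ hn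
  refine or_iff_not_imp_left.2 fun hk0 => ?_
  have hk1 : (1 : ℝ) ≤ k κ := by exact_mod_cast Nat.one_le_iff_ne_zero.2 hk0
  set n : ℝ := ((F κ).n : ℝ) with hn_def
  have hn2 : (2 : ℝ) ≤ n := by rw [hn_def]; exact Nat.ofNat_le_cast.2 hn
  have hka' : (k κ : ℝ) ≤ n ^ a := by rw [hn_def, ← Nat.cast_pow]; exact Nat.cast_le.2 hka
  have hLb' : (L κ : ℝ) ≤ n ^ b := by rw [hn_def, ← Nat.cast_pow]; exact Nat.cast_le.2 hLb
  rw [abs_of_pos (hε_pos κ)] at hκ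
  have h1 : 4 * (k κ : ℝ) * (L κ * ε κ) ≤ 1 := by
    have h4 : (4 : ℝ) ≤ n ^ 2 := by nlinarith
    have e0 := (hε_pos κ).le
    calc 4 * (k κ : ℝ) * (L κ * ε κ) ≤ n ^ 2 * n ^ a * (n ^ b * ε κ) := by gcongr
      _ = ε κ * n ^ (2 + a + b) := by rw [pow_add, pow_add]; ring
      _ ≤ 1 := hκ
  set x : ℝ := L κ * ε κ with hx
  have hx0 : 0 ≤ x := mul_nonneg (Nat.cast_nonneg _) (hε_pos κ).le
  have hx1 : x ≤ 1 := by nlinarith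
  have h2 : (1 + ε κ) ^ L κ ≤ Real.exp x := by
    rw [hx, Real.exp_nat_mul]
    exact pow_le_pow_left₀ (by linarith [hε_pos κ]) (by linarith [Real.add_one_le_exp (ε κ)]) _
  have h3 : Real.exp x - 1 ≤ 2 * x := by
    have := Real.abs_exp_sub_one_le (x := x) (by rwa [abs_of_nonneg hx0])
    rw [abs_of_nonneg hx0] at this
    exact (le_abs_self _).trans this
  rw [le_div_iff₀ (by positivity)]
  nlinarith

theorem negligible_failBound {F : ℕ → Params}
    (hdim : Filter.Tendsto (fun κ => (F κ).n) Filter.atTop Filter.atTop)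
    (hpoly : PolyBounded F fun κ => (F κ).q) (c : ℕ) :
    ∀ᶠ κ in Filter.atTop, 4 * ((F κ).n : ℝ) ^ 2 * (F κ).q * Real.exp (-((F κ).n / 2 : ℝ)) *
      ((F κ).n : ℝ) ^ c ≤ 1 := by
  obtain ⟨a, ha⟩ := hpoly.eventually_le_pow hdim
  have hreal : Filter.Tendsto (fun κ => ((F κ).n : ℝ) / 2) Filter.atTop Filter.atTop :=
    (tendsto_natCast_atTop_atTop.comp hdim).atTop_div_const (by norm_num)
  -- The limit is taken in the variable `n / 2`; the power of two compensates for this.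
  have h1 := ((Real.tendsto_pow_mul_exp_neg_atTop_nhds_zero (2 + a + c)).comp hreal).const_mul
    (4 * (2 : ℝ) ^ (2 + a + c))
  rw [mul_zero] at h1
  filter_upwards [ha, h1.eventually (ge_mem_nhds one_pos)] with κ hq hκ
  refine le_trans ?_ hκ
  have hq' : ((F κ).q : ℝ) ≤ ((F κ).n : ℝ) ^ a := by exact_mod_cast hq
  simp only [Function.comp_apply]
  have h2 : (2 : ℝ) ^ (2 + a + c) * (((F κ).n : ℝ) / 2) ^ (2 + a + c) =
      ((F κ).n : ℝ) ^ (2 + a + c) := by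
    rw [← mul_pow, mul_div_cancel₀ _ (two_ne_zero' ℝ)]
  rw [← mul_assoc, mul_assoc 4 (_ ^ (2 + a + c)), h2]
  calc _ ≤ 4 * ((F κ).n : ℝ) ^ 2 * ((F κ).n : ℝ) ^ a * Real.exp (-((F κ).n / 2 : ℝ)) *
        ((F κ).n : ℝ) ^ c := by gcongr
    _ = _ := by
      rw [pow_add, pow_add]
      ring

end MRLWE

end

theorem mainTheorem5 (F : ℕ → MRLWE.Params)
    (hdim : Filter.Tendsto (fun κ => (F κ).n) Filter.atTop Filter.atTop)
    (hprime : ∀ κ, (F κ).q.Prime)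
    (hmod : ∀ κ i, (F κ).q ≡ 1 [MOD (F κ).m i])
    (hpoly : MRLWE.PolyBounded F fun κ => (F κ).q)
    (ε : ℕ → ℝ) (hε_pos : ∀ κ, 0 < ε κ) (hε : MRLWE.Negligible F ε)
    (hα : ∀ κ, MRLWE.smoothingDual (F κ) (ε κ) ≤ (F κ).α * (F κ).q) :
    ∃ M : MRLWE.Prog, MRLWE.IsSearchToDecisionReduction F M := by
  classical
  refine ⟨MRLWE.progReduction, MRLWE.runsInPolyTime_progReduction hprime hmod hpoly,
    fun k L hk hL => ?_⟩
  -- At the finitely many indices where the smoothing loss still exceeds half of the advantage, the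
  -- trivial bound `1` is used; this keeps the bound negligible and valid at every index.
  refine ⟨fun κ => if k κ = 0 ∨ (1 + ε κ) ^ L κ - 1 ≤ 1 / (2 * (k κ : ℝ)) then
    4 * ((F κ).n : ℝ) ^ 2 * (F κ).q * Real.exp (-((F κ).n / 2 : ℝ)) else 1, fun c => ?_,
    fun κ D hD s => ?_⟩
  · filter_upwards [MRLWE.eventually_smoothing_small hdim hε_pos hε hk hL,
      MRLWE.negligible_failBound hdim hpoly c] with κ h1 h2
    rw [if_pos h1, abs_of_nonneg (by positivity)]
    exact h2
  · have : Fact (F κ).q.Prime := ⟨hprime κ⟩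
    simp only
    split_ifs with h
    · rcases h with h | h
      · rw [h] at hD
        norm_num at hD
      · exact MRLWE.failProb_le D (hmod κ) (hε_pos κ) (hα κ) hD h s
    · have hP : MeasureTheory.IsProbabilityMeasure (MRLWE.runLaw (F κ) s) := by
        rw [MRLWE.runLaw]
        infer_instance
      rw [ENNReal.ofReal_one]
      exact MeasureTheory.prob_le_one
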